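/- Let $a_{jk}, V\in C^\infty(\mathbb{R}^n;\mathbb{R})$, where $(a_{jk}(x))_{j,k}$ is symmetric and positive definite for every $x$, and suppose that for some $\mu>0$ and all multi-indices $\alpha$ there are constants $C_\alpha$ with $$|\partial_x^\alpha(a_{jk}(x)-\delta_{jk})|\le C_\alpha\langle x\rangle^{-\mu-|\alpha|},\qquad |\partial_x^\alpha V(x)|\le C_\alpha\langle x\rangle^{2-\mu-|\alpha|},\qquad \langle x\rangle=(1+|x|^2)^{1/2}.$$ Let $k(x,\xi)=\frac12\sum_{j,k}a_{jk}(x)\xi_j\xi_k$ and $p=k+V$, and let $(\tilde y,\tilde\eta)(t;x,\xi)=\exp tH_k(x,\xi)$ and $(y,\eta)(t;x,\xi)=\exp tH_p(x,\xi)$ be the Hamilton flows. A point $(x_0,\xi_0)$ is called backward nontrapping if $|\tilde y(t;x_0,\xi_0)|\to\infty$ as $t\to-\infty$. Construction of $W$. Fix $T>0$, $R>0$, $c_0,c_4>0$, and put $\Lambda(t,\zeta)=\eta(t;-R\zeta/|\zeta|,\zeta)$. Suppose that for every $t\in[-T,0]$ the map $\Lambda(t,\cdot)$ is injective on $\{|\zeta|\ge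 c_0R\}$ and that the image of this set contains $\{|\xi|\ge c_4R\}$; let $\zeta(t,\cdot)$ be the inverse. For $|\xi|\ge c_4R$ put $$W_1(t,\xi)=\int_0^t\bigl(p(y(s),\eta(s))+y(s)\cdot\partial_s\eta(s)\bigr)\,ds-R|\zeta(t,\xi)|,$$ where $(y(s),\eta(s))=\exp sH_p(-R\zeta/|\zeta|,\zeta)$ with $\zeta=\zeta(t,\xi)$. Given a smooth $\chi:\mathbb{R}^n\to[0,1]$ with $\chi=0$ for $|\xi|\le c_4R$ and $\chi=1$ for $|\xi|\ge c_4R+1$, put $W=\chi W_1+(1-\chi)\,(-R|\xi|+t|\xi|^2/2)$. Proposition. There are maps $\xi_-$ and $z_-=z_-^{(R)}$ (depending on $R$, but on none of $T,c_0,c_4,\chi,t_0$) such that the following holds. For every $T>0$ there are $R_0,c_0,c_4>0$ such that for every $R\ge R_0$ the construction above is possible, and, for every $\chi$ as above with the resulting $W$, every backward nontrapping $(x_0,\xi_0)$ has an open neighborhood $U\subset\mathbb{R}^{2n}$ such that: (i) for every $t_0\in[-T,0)$ and every $(x,\xi)\in U$, $$\xi_-(x,\xi)=\lim_{\lambda\to+\infty}\lambda^{-1}\eta(t_0;x,\lambda\xi),\qquad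 z_-(x,\xi)=\lim_{\lambda\to+\infty}\bigl[y(t_0;x,\lambda\xi)-\partial_\xi W(t_0,\eta(t_0;x,\lambda\xi))\bigr]$$ exist; in particular they are independent of $t_0$; (ii) for each such $t_0$, the limits are $C^\infty$ on $U$, the functions under the limits are $C^\infty$ on $U$ for all sufficiently large $\lambda$, and the convergence is uniform on $U$ together with all derivatives in $(x,\xi)$; (iii) $\xi_-(x,\xi)=\lim_{t\to-\infty}\tilde\eta(t;x,\xi)$ for $(x,\xi)\in U$; (iv) $S_-:(x,\xi)\mapsto(z_-(x,\xi),\xi_-(x,\xi))$ is a $C^\infty$ local diffeomorphism on $U$. -/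

import Mathlib

open Set Filter Topology
open scoped ContDiff Manifold

noncomputable section

namespace LongRangeFlow

/-- The Euclidean space `ℝⁿ`; phase space is `Eucl n × Eucl n`, with points `(x, ξ)`. -/
abbrev Eucl (n : ℕ) : Type := EuclideanSpace ℝ (Fin n)

/-- The bracket `⟨x⟩ = (1 + |x|²)^{1/2}`. -/
def bracket {n : ℕ} (x : Eucl n) : ℝ := Real.sqrt (1 + ‖x‖ ^ 2)

/-- The standing assumption on the coefficients, with decay rate `μ`: the matrices
`(a_{jk}(x))` are symmetric and positive definite, all `a_{jk}` and `V` are real valued and `C^∞`,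
and every derivative of order `m` of `a_{jk} - δ_{jk}` (of `V`) is
`O(⟨x⟩^{-μ-m})` (is `O(⟨x⟩^{2-μ-m})`).
The operator norm of the `m`-th iterated derivative is comparable, with constants
depending only on `n` and `m`, to the maximum of `|∂^α f|` over the multi-indices `|α| = m`. -/
structure IsLongRange {n : ℕ} (a : Eucl n → Matrix (Fin n) (Fin n) ℝ) (V : Eucl n → ℝ)
    (μ : ℝ) : Prop where
  mu_pos : 0 < μ
  posDef : ∀ x, (a x).PosDef
  smooth_a : ∀ j k, ContDiff ℝ ∞ (fun x => a x j k)
  smooth_V : ContDiff ℝ ∞ V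
  bound_a : ∀ m : ℕ, ∃ C : ℝ, ∀ j k x,
    ‖iteratedFDeriv ℝ m (fun x => a x j k - (1 : Matrix (Fin n) (Fin n) ℝ) j k) x‖
      ≤ C * bracket x ^ (-μ - (m : ℝ))
  bound_V : ∀ m : ℕ, ∃ C : ℝ, ∀ x,
    ‖iteratedFDeriv ℝ m V x‖ ≤ C * bracket x ^ (2 - μ - (m : ℝ))

/-- The kinetic energy `k(x,ξ) = ½ ∑ a_{jk}(x) ξ_j ξ_k`. -/
def kinetic {n : ℕ} (a : Eucl n → Matrix (Fin n) (Fin n) ℝ) (x ξ : Eucl n) : ℝ :=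
  (1 / 2 : ℝ) * ∑ j, ∑ k, a x j k * ξ j * ξ k

/-- The full Hamiltonian `p(x,ξ) = k(x,ξ) + V(x)`. -/
def energy {n : ℕ} (a : Eucl n → Matrix (Fin n) (Fin n) ℝ) (V : Eucl n → ℝ)
    (x ξ : Eucl n) : ℝ :=
  kinetic a x ξ + V x

/-- The Hamilton vector field `(∂p/∂ξ, -∂p/∂x)` of a function `p` on phase space. -/
def hamiltonField {n : ℕ} (p : Eucl n → Eucl n → ℝ) (q : Eucl n × Eucl n) :
    Eucl n × Eucl n :=
  (gradient (fun ξ => p q.1 ξ) q.2, -gradient (fun x => p x q.2) q.1)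

/-- `γ` solves Hamilton's equations for `p` on the whole time axis, with `γ 0 = q`. -/
def IsTrajectory {n : ℕ} (p : Eucl n → Eucl n → ℝ) (q : Eucl n × Eucl n)
    (γ : ℝ → Eucl n × Eucl n) : Prop :=
  γ 0 = q ∧ ∀ t, HasDerivAt γ (hamiltonField p (γ t)) t

/-- The Hamilton flow `exp tH_p`: the time-`t` point of the trajectory issued from `q`. Under the
standing assumption, that trajectory exists for all times and is unique, both for the kinetic
energy and for the full Hamiltonian. -/
def flow {n : ℕ} (p : Eucl n → Eucl n → ℝ) (t : ℝ) (q : Eucl n × Eucl n) : Eucl n × Eucl n :=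
  Classical.epsilon (IsTrajectory p q) t

/-- If a global trajectory exists, the flow is a global trajectory. -/
theorem isTrajectory_flow {n : ℕ} {p : Eucl n → Eucl n → ℝ} {q : Eucl n × Eucl n}
    (h : ∃ γ, IsTrajectory p q γ) : IsTrajectory p q (fun t => flow p t q) :=
  Classical.epsilon_spec h

/-- Backward nontrapping: `|ỹ(t)| → ∞` as `t → -∞`, where `(ỹ(t), η̃(t)) = exp tH_k (x, ξ)`. -/
def BackwardNontrapping {n : ℕ} (a : Eucl n → Matrix (Fin n) (Fin n) ℝ)
    (q : Eucl n × Eucl n) : Prop :=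
  Tendsto (fun t : ℝ => ‖(flow (kinetic a) t q).1‖) atBot atTop

/-- The position component `y(t; x, ξ)` of `exp tH_p (x, ξ)`. -/
def yFlow {n : ℕ} (a : Eucl n → Matrix (Fin n) (Fin n) ℝ) (V : Eucl n → ℝ)
    (t : ℝ) (x ξ : Eucl n) : Eucl n :=
  (flow (energy a V) t (x, ξ)).1

/-- The momentum component `η(t; x, ξ)` of `exp tH_p (x, ξ)`. -/
def etaFlow {n : ℕ} (a : Eucl n → Matrix (Fin n) (Fin n) ℝ) (V : Eucl n → ℝ)
    (t : ℝ) (x ξ : Eucl n) : Eucl n :=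
  (flow (energy a V) t (x, ξ)).2

/-- The incoming starting point `-R ζ/|ζ|`. -/
def incoming {n : ℕ} (R : ℝ) (ζ : Eucl n) : Eucl n := -((R / ‖ζ‖) • ζ)

/-- The map `Λ(t, ·) : ζ ↦ η(t; -R ζ/|ζ|, ζ)`. -/
def Lam {n : ℕ} (a : Eucl n → Matrix (Fin n) (Fin n) ℝ) (V : Eucl n → ℝ)
    (R t : ℝ) (ζ : Eucl n) : Eucl n :=
  etaFlow a V t (incoming R ζ) ζ

/-- The inverse `ζ(t, ·)` of the restriction of `Λ(t, ·)` to `{|ζ| ≥ c₀ R}`. -/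
def zetaInv {n : ℕ} (a : Eucl n → Matrix (Fin n) (Fin n) ℝ) (V : Eucl n → ℝ)
    (c₀ R t : ℝ) (ξ : Eucl n) : Eucl n :=
  Function.invFunOn (Lam a V R t) {ζ | c₀ * R ≤ ‖ζ‖} ξ

/-- The solution of the momentum space Hamilton-Jacobi equation at high momenta,
`W₁(t,ξ) = ∫₀ᵗ (p(y(s),η(s)) + y(s)·∂ₛη(s)) ds - R|ζ(t,ξ)|`, where `(y(s), η(s))` is the trajectory
issued from `(-Rζ/|ζ|, ζ)` with `ζ = ζ(t,ξ)`, which has momentum `ξ` at time `t`. -/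
def W₁ {n : ℕ} (a : Eucl n → Matrix (Fin n) (Fin n) ℝ) (V : Eucl n → ℝ)
    (c₀ R t : ℝ) (ξ : Eucl n) : ℝ :=
  let ζ := zetaInv a V c₀ R t ξ
  let y : ℝ → Eucl n := fun s => yFlow a V s (incoming R ζ) ζ
  let η : ℝ → Eucl n := fun s => etaFlow a V s (incoming R ζ) ζ
  (∫ s in (0 : ℝ)..t, (energy a V (y s) (η s) + inner ℝ (y s) (deriv η s))) - R * ‖ζ‖

/-- A smooth cutoff equal to `0` for `|ξ| ≤ r` and to `1` for `|ξ| ≥ r + 1`. -/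
structure IsCutoff {n : ℕ} (r : ℝ) (χ : Eucl n → ℝ) : Prop where
  smooth : ContDiff ℝ ∞ χ
  mem_Icc : ∀ ξ, χ ξ ∈ Icc (0 : ℝ) 1
  eq_zero : ∀ ξ, ‖ξ‖ ≤ r → χ ξ = 0
  eq_one : ∀ ξ, r + 1 ≤ ‖ξ‖ → χ ξ = 1

/-- The phase `W(t,ξ)`: with `χ` a cutoff at `r = c₄ R`, it is `W₁(t,ξ)` for `|ξ| ≥ c₄ R + 1` and
`-R|ξ| + t|ξ|²/2` for `|ξ| ≤ c₄ R`, glued by the partition of unity `χ + (1 - χ) = 1`. -/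
def W {n : ℕ} (a : Eucl n → Matrix (Fin n) (Fin n) ℝ) (V : Eucl n → ℝ)
    (c₀ R : ℝ) (χ : Eucl n → ℝ) (t : ℝ) (ξ : Eucl n) : ℝ :=
  χ ξ * W₁ a V c₀ R t ξ + (1 - χ ξ) * (-R * ‖ξ‖ + t * ‖ξ‖ ^ 2 / 2)

/-- The rescaled momentum `(x, ξ) ↦ λ⁻¹ η(t; x, λξ)`. -/
def etaScaled {n : ℕ} (a : Eucl n → Matrix (Fin n) (Fin n) ℝ) (V : Eucl n → ℝ)
    (t lam : ℝ) (q : Eucl n × Eucl n) : Eucl n :=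
  lam⁻¹ • etaFlow a V t q.1 (lam • q.2)

/-- The modified position `(x, ξ) ↦ y(t; x, λξ) - ∂_ξ W(t, η(t; x, λξ))`. -/
def zScaled {n : ℕ} (a : Eucl n → Matrix (Fin n) (Fin n) ℝ) (V : Eucl n → ℝ)
    (c₀ R : ℝ) (χ : Eucl n → ℝ) (t lam : ℝ) (q : Eucl n × Eucl n) : Eucl n :=
  yFlow a V t q.1 (lam • q.2) -
    gradient (W a V c₀ R χ t) (etaFlow a V t q.1 (lam • q.2))

/-- `F λ → f` as `λ → +∞`, uniformly on `U` together with all derivatives: `f` is smooth on `U`,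
`F λ` is smooth on `U` for all large `λ`, and derivatives of every order (including order `0`)
converge uniformly on `U`. It is used for open `U` only. -/
def TendstoWithDerivs {G G' : Type*} [NormedAddCommGroup G] [NormedSpace ℝ G]
    [NormedAddCommGroup G'] [NormedSpace ℝ G'] (F : ℝ → G → G') (f : G → G') (U : Set G) : Prop :=
  ContDiffOn ℝ ∞ f U ∧ (∀ᶠ lam in atTop, ContDiffOn ℝ ∞ (F lam) U) ∧
    ∀ m : ℕ, TendstoUniformlyOn (fun lam q => iteratedFDeriv ℝ m (F lam) q)
      (fun q => iteratedFDeriv ℝ m f q) atTop U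

end LongRangeFlow

end

/-! Multiplying the momentum by `lam` and dividing time by `lam` turns exp t₀H_p(x, λξ) into the
flow of k + κV with κ = λ⁻² at time λt₀ (`flow_energy_smul`). The high-energy limit at a fixed time
is therefore the limit κ → 0, t → -∞ with κt² = t₀² fixed. Along escaping trajectories |y| is
comparable to |t|, so the force κ∇V = O(κ|y|^{1-μ}) is O(|y|^{-1-μ}), the same size as the force
coming from the metric. It is integrable in time uniformly in κ and disappears at every fixed time
as κ → 0; hence the limiting momentum is that of the geodesic flow.

Positions diverge. Now ∂_ξ W(t, ξ) is the position at time t of the reference trajectory that starts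
at -Rζ/|ζ| and has momentum ξ at time t: the variation of the action is a boundary term, and -R|ζ|
removes its contribution at time 0 (`hasGradientAt_W₁`). So z is the difference of the positions of
two trajectories having the same momentum at the same time. By variation of constants a trajectory
is written as a reference trajectory with a drifting parameter, chosen to reproduce the momentum,
plus a displacement in position (`flow_of_deep_equation`). Both unknowns are driven by differences
of velocities and forces between nearby points. Differencing gains a power of |y|, so their
derivatives are O(|s|^{-1-μ}), and displacement and momentum are Cauchy at rate |s|^{-μ}, uniformly
in κ. Combined with continuity in κ at fixed time (`Chart.tendsto_rel`),
`exists_limit_of_interchange` gives the limits and identifies them with limits along the geodesic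
flow κ = 0, which involve R and nothing else of the construction.

Uniformity in all derivatives is obtained without differentiating the equations. Trajectories for
all radii, couplings, directions and times together form one point of a space of bounded functions
on a discrete index set times ℝ. Dyadically rescaled symbols act there as smooth superposition
operators (`IsSym.unifSmooth`, `nem_contDiffOn`), the time integrals are small Volterra operators,
and `exists_smooth_fixedPoint` solves the integral equations smoothly in the data. Smallness comes
from large R for the reference trajectories (`exists_refFam`) and from large starting depth for the
relative ones (`exists_deepFam`). A backward nontrapped geodesic satisfies y - tη = o(t), so far
enough back its displacement from the reference geodesic is small relative to the depth
(`BackwardNontrapping.exists_depth`). Derivative bounds for a single smooth map on a compact set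
then hold for all evaluations (`Chart.exists_bound_comp`), and bounded derivatives with pointwise
convergence give convergence of all derivatives (`BddConv.tendstoWithDerivs`).

Finally, the map from relative data to displacement and momentum is close to the identity, and
relative data control the initial point. This gives a lower Lipschitz bound that survives the limit,
and `isLocalDiffeomorphOn_of_lower_bound` yields the local diffeomorphism. -/

noncomputable section

namespace LongRangeFlow

open scoped BoundedContinuousFunction
open BoundedContinuousFunction

/-! ### Calculus on spaces of bounded continuous functions -/

section BCF

variable {T : Type} [TopologicalSpace T]
variable {E F G : Type} [NormedAddCommGroup E] [NormedSpace ℝ E] [NormedAddCommGroup F]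
  [NormedSpace ℝ F] [NormedAddCommGroup G] [NormedSpace ℝ G]

/-- The pointwise application of a continuous bilinear map. -/
def bcfBilin (B : E →L[ℝ] F →L[ℝ] G) : (T →ᵇ E) →L[ℝ] (T →ᵇ F) →L[ℝ] (T →ᵇ G) :=
  LinearMap.mkContinuous₂
    (LinearMap.mk₂ ℝ (fun u v => ofNormedAddCommGroup (fun t => B (u t) (v t))
        ((B.continuous.comp u.continuous).clm_apply v.continuous) (‖B‖ * ‖u‖ * ‖v‖)
        (fun t => (B.le_opNorm₂ _ _).trans (by
          gcongr
          · exact u.norm_coe_le_norm t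
          · exact v.norm_coe_le_norm t)))
      (fun _ _ _ => by ext; simp) (fun _ _ _ => by ext; simp)
      (fun _ _ _ => by ext; simp) (fun _ _ _ => by ext; simp))
    ‖B‖ (fun u v => by
      refine (norm_le (by positivity)).2 fun t => ?_
      exact (B.le_opNorm₂ _ _).trans (by
          gcongr
          · exact u.norm_coe_le_norm t
          · exact v.norm_coe_le_norm t))

@[simp] theorem bcfBilin_apply (B : E →L[ℝ] F →L[ℝ] G) (u : T →ᵇ E) (v : T →ᵇ F) (t : T) :
    bcfBilin B u v t = B (u t) (v t) := rfl

/-- The pullback by a continuous map, as a continuous linear map. -/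
def bcfPull {T' : Type} [TopologicalSpace T'] (c : C(T', T)) : (T →ᵇ E) →L[ℝ] (T' →ᵇ E) :=
  LinearMap.mkContinuous
    { toFun := fun u => u.compContinuous c
      map_add' := fun _ _ => by ext; simp
      map_smul' := fun _ _ => by ext; simp } 1 (fun u => by
      rw [one_mul]
      exact (norm_le (norm_nonneg _)).2 fun t => u.norm_coe_le_norm _)

/-- Constants, as a continuous linear map. -/
def bcfConst : E →L[ℝ] (T →ᵇ E) :=
  LinearMap.mkContinuous
    { toFun := fun x => const T x
      map_add' := fun _ _ => by ext; simp
      map_smul' := fun _ _ => by ext; simp } 1 (fun u => by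
      rw [one_mul]
      exact (norm_le (norm_nonneg _)).2 fun t => le_rfl)

@[simp] theorem bcfConst_apply (x : E) (t : T) : (bcfConst x : T →ᵇ E) t = x := rfl

/-! ### Nemytskii maps -/

/-- All derivatives in `x`, up to order `N`, of the family `f t x` exist on `Ω`, are continuous
there in both variables, and are bounded. -/
def UnifSmooth (Ω : Set (T × E)) : ℕ → ∀ {G : Type} [NormedAddCommGroup G] [NormedSpace ℝ G],
    (T → E → G) → Prop
  | 0, _, _, _, f => ContinuousOn (fun q : T × E => f q.1 q.2) Ω ∧ ∃ C, ∀ q ∈ Ω, ‖f q.1 q.2‖ ≤ C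
  | N + 1, G, _, _, f =>
      (ContinuousOn (fun q : T × E => f q.1 q.2) Ω ∧ ∃ C, ∀ q ∈ Ω, ‖f q.1 q.2‖ ≤ C) ∧
      ∃ f' : T → E → (E →L[ℝ] G), (∀ q ∈ Ω, HasFDerivAt (f q.1) (f' q.1 q.2) q.2) ∧
        UnifSmooth Ω N f'

theorem UnifSmooth.zero {Ω : Set (T × E)} {N : ℕ} {f : T → E → G} (h : UnifSmooth Ω N f) :
    ContinuousOn (fun q : T × E => f q.1 q.2) Ω ∧ ∃ C, ∀ q ∈ Ω, ‖f q.1 q.2‖ ≤ C := by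
  cases N with
  | zero => exact h
  | succ N => exact h.1

/-- The superposition operator `u ↦ (t ↦ f t (u t))`. -/
def nem (f : T → E → G) (u : T →ᵇ E) : T →ᵇ G :=
  -- The default value `0` is never seen below: `UnifSmooth` on a set containing the graph of `u`
  -- ensures both conditions.
  open Classical in
  if h : Continuous (fun t => f t (u t)) ∧ ∃ C, ∀ t, ‖f t (u t)‖ ≤ C then
    ofNormedAddCommGroup _ h.1 h.2.choose h.2.choose_spec else 0

theorem nem_apply {Ω : Set (T × E)} {N : ℕ} {f : T → E → G} (hf : UnifSmooth Ω N f) {u : T →ᵇ E}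
    (hu : ∀ t, (t, u t) ∈ Ω) (t : T) : nem f u t = f t (u t) := by
  obtain ⟨h1, C, hC⟩ := hf.zero
  have h : Continuous (fun t => f t (u t)) ∧ ∃ C, ∀ t, ‖f t (u t)‖ ≤ C :=
    ⟨h1.comp_continuous (continuous_id.prodMk u.continuous) hu, C, fun t => hC _ (hu t)⟩
  rw [nem, dif_pos h]
  rfl

/-- A bound on the second derivative that is uniform in `t` gives a Taylor remainder quadratic in
the sup norm of the increment. Only the segments from `u t` to `u t + h t` have to lie in `Ω`, and
they do because `U` is open; `Ω` itself need not be open. -/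
theorem nem_hasFDerivAt {Ω : Set (T × E)} {f : T → E → G} {f' : T → E → (E →L[ℝ] G)}
    (hf : UnifSmooth Ω 0 f) (hf' : UnifSmooth Ω 1 f')
    (hd : ∀ q ∈ Ω, HasFDerivAt (f q.1) (f' q.1 q.2) q.2)
    {U : Set (T →ᵇ E)} (hU : IsOpen U) (hΩ : ∀ u ∈ U, ∀ t, (t, u t) ∈ Ω) {u : T →ᵇ E} (hu : u ∈ U) :
    HasFDerivAt (nem f) (bcfBilin (ContinuousLinearMap.id ℝ (E →L[ℝ] G)) (nem f' u)) u := by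
  obtain ⟨hf'0, f'', hd', hf''⟩ := hf'
  obtain ⟨C, hC⟩ := hf''.zero.2
  obtain ⟨ρ, hρ, hball⟩ := Metric.isOpen_iff.1 hU u hu
  have hC0 : 0 ≤ |C| := abs_nonneg C
  rw [hasFDerivAt_iff_isLittleO_nhds_zero, Asymptotics.isLittleO_iff]
  intro c hc
  -- The bound `ρ` keeps the segment inside `U`; the second bound turns the remainder `|C| * ‖h‖ ^
  -- 2` into at most `c * ‖h‖`.
  have hev : ∀ᶠ h : T →ᵇ E in 𝓝 0, ‖h‖ < min ρ (c / (|C| + 1)) := by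
    have : Tendsto (fun h : T →ᵇ E => ‖h‖) (𝓝 0) (𝓝 0) := by
      simpa using (continuous_norm (E := T →ᵇ E)).tendsto 0
    exact this.eventually_lt_const (by positivity)
  filter_upwards [hev] with h hh
  have hseg : ∀ t, ∀ x ∈ segment ℝ (u t) (u t + h t), (t, x) ∈ Ω := by
    intro t x hx
    rw [segment_eq_image'] at hx
    obtain ⟨τ, hτ, rfl⟩ := hx
    have hm : u + τ • h ∈ U := by
      apply hball
      rw [Metric.mem_ball, dist_eq_norm, add_sub_cancel_left, norm_smul, Real.norm_eq_abs,
        abs_of_nonneg hτ.1]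
      calc τ * ‖h‖ ≤ 1 * ‖h‖ := by gcongr; exact hτ.2
        _ < ρ := by rw [one_mul]; exact hh.trans_le (min_le_left _ _)
    have := hΩ _ hm t
    simpa using this
  have huh : ∀ t, (t, (u + h) t) ∈ Ω := fun t => hseg t _ (right_mem_segment ℝ _ _)
  refine (norm_le (by positivity)).2 fun t => ?_
  have e1 : (nem f (u + h) - nem f u - bcfBilin (ContinuousLinearMap.id ℝ (E →L[ℝ] G)) (nem f' u) h) t
      = f t (u t + h t) - f t (u t) - f' t (u t) (h t) := by
    have a1 := nem_apply hf huh t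
    have a2 := nem_apply hf (hΩ u hu) t
    have a3 := nem_apply (N := 0) (f := f') hf'0 (hΩ u hu) t
    simp only [BoundedContinuousFunction.coe_sub, Pi.sub_apply, bcfBilin_apply, a1, a2, a3]
    rfl
  rw [e1]
  have hht : ‖h t‖ ≤ ‖h‖ := h.norm_coe_le_norm t
  have hlip : ∀ x ∈ segment ℝ (u t) (u t + h t), ‖f' t x - f' t (u t)‖ ≤ |C| * ‖h‖ := by
    intro x hx
    have := (convex_segment (u t) (u t + h t)).norm_image_sub_le_of_norm_hasFDerivWithin_le
      (f := f' t) (f' := f'' t) (C := |C|)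
      (fun y hy => (hd' _ (hseg t y hy)).hasFDerivWithinAt)
      (fun y hy => (hC _ (hseg t y hy)).trans (le_abs_self C)) (left_mem_segment ℝ _ _) hx
    refine this.trans ?_
    gcongr
    refine le_trans ?_ hht
    rw [segment_eq_image'] at hx
    obtain ⟨τ, hτ, rfl⟩ := hx
    rw [add_sub_cancel_left, add_sub_cancel_left, norm_smul, Real.norm_eq_abs, abs_of_nonneg hτ.1]
    exact mul_le_of_le_one_left (norm_nonneg _) hτ.2
  have key := (convex_segment (u t) (u t + h t)).norm_image_sub_le_of_norm_hasFDerivWithin_le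
      (f := fun x => f t x - f' t (u t) x) (f' := fun x => f' t x - f' t (u t)) (C := |C| * ‖h‖)
      (fun y hy => ((hd _ (hseg t y hy)).sub (f' t (u t)).hasFDerivAt).hasFDerivWithinAt)
      hlip (left_mem_segment ℝ _ _) (right_mem_segment ℝ _ _)
  have e2 : f t (u t + h t) - f t (u t) - f' t (u t) (h t)
      = f t (u t + h t) - f' t (u t) (u t + h t) - (f t (u t) - f' t (u t) (u t)) := by
    rw [map_add]; abel
  rw [e2]
  refine key.trans ?_
  rw [add_sub_cancel_left]
  calc |C| * ‖h‖ * ‖h t‖ ≤ (|C| * (c / (|C| + 1))) * ‖h‖ := by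
        gcongr
        exact (hh.trans_le (min_le_right _ _)).le
    _ ≤ c * ‖h‖ := by
        gcongr
        rw [mul_div_assoc', div_le_iff₀ (by positivity)]
        nlinarith

/-- The derivative of a superposition operator is the superposition operator of the derivative
followed by a fixed continuous linear map, so induction applies. Two orders are lost: the
differentiability estimate needs a bounded second derivative. -/
theorem nem_contDiffOn_nat {Ω : Set (T × E)} {U : Set (T →ᵇ E)} (hU : IsOpen U)
    (hΩ : ∀ u ∈ U, ∀ t, (t, u t) ∈ Ω) (N : ℕ) :
    ∀ {G : Type} [NormedAddCommGroup G] [NormedSpace ℝ G] {f : T → E → G},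
      UnifSmooth Ω (N + 2) f → ContDiffOn ℝ N (nem f) U := by
  induction N with
  | zero =>
    intro G _ _ f hf
    obtain ⟨h0, f', hd, hf'⟩ := hf
    rw [Nat.cast_zero, contDiffOn_zero]
    intro u hu
    exact (nem_hasFDerivAt (show UnifSmooth Ω 0 f from h0) hf' hd hU hΩ
      hu).continuousAt.continuousWithinAt
  | succ N ih =>
    intro G _ _ f hf
    obtain ⟨h0, f', hd, hf'⟩ := hf
    have hf1 : UnifSmooth Ω 1 f' := by
      obtain ⟨a, f'', b, c⟩ := hf'
      exact ⟨a, f'', b, c.zero⟩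
    have hD : ∀ u ∈ U, HasFDerivAt (nem f)
        (bcfBilin (ContinuousLinearMap.id ℝ (E →L[ℝ] G)) (nem f' u)) u := fun u hu =>
      nem_hasFDerivAt (show UnifSmooth Ω 0 f from h0) hf1 hd hU hΩ hu
    rw [Nat.cast_add, Nat.cast_one, contDiffOn_succ_iff_fderiv_of_isOpen hU]
    refine ⟨fun u hu => (hD u hu).differentiableAt.differentiableWithinAt, by simp, ?_⟩
    refine ContDiffOn.congr ?_ (fun u hu => (hD u hu).fderiv)
    exact (ContinuousLinearMap.contDiff _).comp_contDiffOn (ih hf')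

theorem nem_contDiffOn {Ω : Set (T × E)} {U : Set (T →ᵇ E)} (hU : IsOpen U)
    (hΩ : ∀ u ∈ U, ∀ t, (t, u t) ∈ Ω) {f : T → E → G} (hf : ∀ N, UnifSmooth Ω N f) :
    ContDiffOn ℝ ∞ (nem f) U :=
  contDiffOn_infty.2 fun N => nem_contDiffOn_nat hU hΩ N (hf _)

/-- A fixed smooth function on a compact set. -/
theorem unifSmooth_fixed {K O : Set E} (hK : IsCompact K) (hO : IsOpen O) (hKO : K ⊆ O) (N : ℕ) :
    ∀ {G : Type} [NormedAddCommGroup G] [NormedSpace ℝ G] {b : E → G}, ContDiffOn ℝ ∞ b O →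
      UnifSmooth (T := T) (univ ×ˢ K) N (fun _ x => b x) := by
  have base : ∀ {G : Type} [NormedAddCommGroup G] [NormedSpace ℝ G] {b : E → G},
      ContDiffOn ℝ ∞ b O →
      ContinuousOn (fun q : T × E => b q.2) (univ ×ˢ K) ∧ ∃ C, ∀ q ∈ (univ : Set T) ×ˢ K, ‖b q.2‖ ≤ C := by
    intro G _ _ b hb
    have hc : ContinuousOn b K := hb.continuousOn.mono hKO
    obtain ⟨C, hC⟩ := hK.exists_bound_of_continuousOn hc
    exact ⟨hc.comp continuousOn_snd fun q hq => hq.2, C, fun q hq => hC _ hq.2⟩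
  induction N with
  | zero => intro G _ _ b hb; exact base hb
  | succ N ih =>
    intro G _ _ b hb
    refine ⟨base hb, fun _ x => fderiv ℝ b x, fun q hq => ?_, ih (hb.fderiv_of_isOpen hO (by simp))⟩
    exact ((hb.contDiffAt (hO.mem_nhds (hKO hq.2))).differentiableAt (by simp)).hasFDerivAt

end BCF

/-! ### Symbols -/

section Symbols

variable {n : ℕ} {G G' : Type} [NormedAddCommGroup G] [NormedSpace ℝ G] [NormedAddCommGroup G']
  [NormedSpace ℝ G']

/-- Smooth functions whose derivatives of order `m` are `O(⟨x⟩^{-ν-m})`. -/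
def IsSym (b : Eucl n → G) (ν : ℝ) : Prop :=
  ContDiff ℝ ∞ b ∧ ∀ m : ℕ, ∃ C : ℝ, ∀ x, ‖iteratedFDeriv ℝ m b x‖ ≤ C * bracket x ^ (-ν - (m : ℝ))

theorem one_le_bracket (x : Eucl n) : 1 ≤ bracket x := by
  rw [bracket, Real.one_le_sqrt]
  nlinarith [norm_nonneg x]

theorem norm_le_bracket (x : Eucl n) : ‖x‖ ≤ bracket x :=
  Real.le_sqrt_of_sq_le (by linarith)

theorem bracket_le (x : Eucl n) : bracket x ≤ 1 + ‖x‖ := by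
  rw [bracket, Real.sqrt_le_left (by positivity)]
  nlinarith [norm_nonneg x]

theorem IsSym.deriv {b : Eucl n → G} {ν : ℝ} (h : IsSym b ν) : IsSym (fderiv ℝ b) (ν + 1) := by
  refine ⟨h.1.fderiv_right (by simp), fun m => ?_⟩
  obtain ⟨C, hC⟩ := h.2 (m + 1)
  refine ⟨C, fun x => ?_⟩
  rw [norm_iteratedFDeriv_fderiv]
  convert hC x using 3
  push_cast; ring

theorem IsSym.mono {b : Eucl n → G} {ν ν' : ℝ} (h : IsSym b ν) (hν : ν' ≤ ν) : IsSym b ν' := by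
  refine ⟨h.1, fun m => ?_⟩
  obtain ⟨C, hC⟩ := h.2 m
  refine ⟨|C|, fun x => (hC x).trans ?_⟩
  have h1 := one_le_bracket x
  gcongr
  exact le_abs_self C

theorem IsSym.clm_comp {b : Eucl n → G} {ν : ℝ} (h : IsSym b ν) (A : G →L[ℝ] G') :
    IsSym (fun x => A (b x)) ν := by
  refine ⟨A.contDiff.comp h.1, fun m => ?_⟩
  obtain ⟨C, hC⟩ := h.2 m
  refine ⟨‖A‖ * C, fun x => ?_⟩
  have h1 : ‖iteratedFDeriv ℝ m (A ∘ b) x‖ ≤ ‖A‖ * ‖iteratedFDeriv ℝ m b x‖ := by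
    rw [A.iteratedFDeriv_comp_left (h.1.contDiffAt (x := x)) (i := m) (by exact_mod_cast le_top)]
    exact A.norm_compContinuousMultilinearMap_le _
  refine (h1.trans (mul_le_mul_of_nonneg_left (hC x) (norm_nonneg _))).trans ?_
  rw [mul_assoc]

theorem IsSym.sum {ι : Type} (s : Finset ι) {b : ι → Eucl n → G} {ν : ℝ}
    (h : ∀ i ∈ s, IsSym (b i) ν) : IsSym (fun x => ∑ i ∈ s, b i x) ν := by
  refine ⟨ContDiff.sum fun i hi => (h i hi).1, fun m => ?_⟩
  have hC : ∀ i, ∃ C : ℝ, i ∈ s → ∀ x, ‖iteratedFDeriv ℝ m (b i) x‖ ≤ C * bracket x ^ (-ν - (m : ℝ)) := by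
    intro i
    by_cases hi : i ∈ s
    · obtain ⟨C, hC⟩ := (h i hi).2 m
      exact ⟨C, fun _ => hC⟩
    · exact ⟨0, fun h => absurd h hi⟩
  choose C hC using hC
  refine ⟨∑ i ∈ s, C i, fun x => ?_⟩
  have e : iteratedFDeriv ℝ m (fun x => ∑ i ∈ s, b i x) x = ∑ i ∈ s, iteratedFDeriv ℝ m (b i) x :=
    iteratedFDeriv_fun_sum_apply
      (fun i hi => ((h i hi).1.of_le (by exact_mod_cast le_top)).contDiffAt)
  rw [e, Finset.sum_mul]
  exact norm_sum_le_of_le _ fun i hi => hC i hi x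

theorem IsSym.bound {b : Eucl n → G} {ν : ℝ} (h : IsSym b ν) :
    ∃ C : ℝ, 0 ≤ C ∧ ∀ x, ‖b x‖ ≤ C * bracket x ^ (-ν) := by
  obtain ⟨C, hC⟩ := h.2 0
  refine ⟨|C|, abs_nonneg C, fun x => ?_⟩
  have := hC x
  rw [norm_iteratedFDeriv_zero] at this
  simp only [Nat.cast_zero, sub_zero] at this
  have hb := one_le_bracket x
  refine this.trans ?_
  gcongr
  exact le_abs_self C

/-- The dyadic rescalings of a symbol, away from the origin. -/
theorem IsSym.unifSmooth {T : Type} [TopologicalSpace T] {ℓ : T → ℝ} (hℓ : Continuous ℓ)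
    (h1 : ∀ t, 1 ≤ ℓ t) (N : ℕ) :
    ∀ {G : Type} [NormedAddCommGroup G] [NormedSpace ℝ G] {b : Eucl n → G} {ν : ℝ}, IsSym b ν →
      UnifSmooth {q : T × Eucl n | 1 / 2 ≤ ‖q.2‖ ∧ ‖q.2‖ ≤ 2} N
        (fun t x => ℓ t ^ ν • b (ℓ t • x)) := by
  have base : ∀ {G : Type} [NormedAddCommGroup G] [NormedSpace ℝ G] {b : Eucl n → G} {ν : ℝ},
      IsSym b ν →
      ContinuousOn (fun q : T × Eucl n => ℓ q.1 ^ ν • b (ℓ q.1 • q.2))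
        {q : T × Eucl n | 1 / 2 ≤ ‖q.2‖ ∧ ‖q.2‖ ≤ 2} ∧
      ∃ C, ∀ q ∈ {q : T × Eucl n | 1 / 2 ≤ ‖q.2‖ ∧ ‖q.2‖ ≤ 2}, ‖ℓ q.1 ^ ν • b (ℓ q.1 • q.2)‖ ≤ C := by
    intro G _ _ b ν hb
    constructor
    · have hbc := hb.1.continuous
      have : Continuous fun q : T × Eucl n => ℓ q.1 ^ ν • b (ℓ q.1 • q.2) :=
        ((hℓ.comp continuous_fst).rpow_const (fun q => Or.inl (by have := h1 q.1; simp; linarith))).smul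
          (by fun_prop)
      exact this.continuousOn
    · obtain ⟨C, hC0, hC⟩ := hb.bound
      -- On the annulus the ratio of `bracket (ℓ t • x)` to `ℓ t` lies between 1/3 and 3, so this
      -- constant serves both signs of `ν`.
      refine ⟨C * 3 ^ |ν|, ?_⟩
      rintro ⟨t, x⟩ ⟨hx1, hx2⟩
      simp only at hx1 hx2 ⊢
      have hl : 0 < ℓ t := by linarith [h1 t]
      have hb0 : 0 < bracket (ℓ t • x) := by linarith [one_le_bracket (ℓ t • x)]
      rw [norm_smul, Real.norm_eq_abs, abs_of_pos (Real.rpow_pos_of_pos hl _)]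
      calc ℓ t ^ ν * ‖b (ℓ t • x)‖ ≤ ℓ t ^ ν * (C * bracket (ℓ t • x) ^ (-ν)) := by
            gcongr; exact hC _
        _ = C * (bracket (ℓ t • x) / ℓ t) ^ (-ν) := by
            rw [Real.div_rpow hb0.le hl.le, Real.rpow_neg hl.le]
            field_simp
        _ ≤ C * 3 ^ |ν| := by
            gcongr
            have hnx : ‖ℓ t • x‖ = ℓ t * ‖x‖ := by
              rw [norm_smul, Real.norm_eq_abs, abs_of_pos hl]
            have hlow : 1 / 3 ≤ bracket (ℓ t • x) / ℓ t := by
              rw [le_div_iff₀ hl]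
              have := norm_le_bracket (ℓ t • x)
              nlinarith
            have hup : bracket (ℓ t • x) / ℓ t ≤ 3 := by
              rw [div_le_iff₀ hl]
              have := bracket_le (ℓ t • x)
              have := h1 t
              nlinarith
            rcases le_total 0 ν with hν | hν
            · rw [abs_of_nonneg hν, Real.rpow_neg (by positivity), ← Real.inv_rpow (by positivity)]
              apply Real.rpow_le_rpow (by positivity) _ hν
              rw [inv_le_comm₀ (by positivity) (by norm_num)]
              linarith
            · rw [abs_of_nonpos hν]
              exact Real.rpow_le_rpow (by positivity) hup (by linarith)
  induction N with
  | zero => intro G _ _ b ν hb; exact base hb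
  | succ N ih =>
    intro G _ _ b ν hb
    -- The chain rule produces one factor `ℓ t`, which is exactly the decay gained by
    -- differentiating a symbol; the family keeps its shape with `ν + 1`.
    refine ⟨base hb, fun t x => ℓ t ^ (ν + 1) • fderiv ℝ b (ℓ t • x), fun q _ => ?_, ih hb.deriv⟩
    have hl : 0 < ℓ q.1 := by linarith [h1 q.1]
    have hd : HasFDerivAt b (fderiv ℝ b (ℓ q.1 • q.2)) (ℓ q.1 • q.2) :=
      (hb.1.differentiable (by simp) _).hasFDerivAt
    have := (hd.comp q.2 ((hasFDerivAt_id q.2).const_smul (ℓ q.1))).const_smul (ℓ q.1 ^ ν)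
    refine this.congr_fderiv ?_
    ext v
    simp [Real.rpow_add hl, mul_smul]

end Symbols

end LongRangeFlow

end

/-! ### Volterra operators with weights on bounded functions of an index and time. -/

noncomputable section

namespace LongRangeFlow

open scoped BoundedContinuousFunction
open BoundedContinuousFunction

section BCFIntegral

variable {Z : Type} [TopologicalSpace Z] {E : Type} [NormedAddCommGroup E] [NormedSpace ℝ E]

theorem norm_smul_integral_le {k e : Z × ℝ → ℝ} {b : Z → ℝ} {φ : ℝ → ℝ} (hφ : Continuous φ) {C : ℝ}
    (hC : ∀ t, |k t| * |∫ r in b t.1..e t, abs (φ r)| ≤ C) (v : Z × ℝ →ᵇ E) (t : Z × ℝ) :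
    ‖k t • ∫ r in b t.1..e t, φ r • v (t.1, r)‖ ≤ C * ‖v‖ := by
  have h1 : ‖∫ r in b t.1..e t, φ r • v (t.1, r)‖ ≤ |∫ r in b t.1..e t, abs (φ r) * ‖v‖| := by
    refine intervalIntegral.norm_integral_le_abs_of_norm_le
      (Eventually.of_forall fun r => ?_) ((hφ.abs.mul continuous_const).intervalIntegrable _ _)
    rw [norm_smul, Real.norm_eq_abs]
    gcongr
    exact v.norm_coe_le_norm _
  rw [intervalIntegral.integral_mul_const, abs_mul, abs_norm] at h1
  rw [norm_smul, Real.norm_eq_abs]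
  calc |k t| * ‖∫ r in b t.1..e t, φ r • v (t.1, r)‖
      ≤ |k t| * (|∫ r in b t.1..e t, abs (φ r)| * ‖v‖) := by gcongr
    _ = (|k t| * |∫ r in b t.1..e t, abs (φ r)|) * ‖v‖ := by ring
    _ ≤ C * ‖v‖ := by gcongr; exact hC t

/-- The Volterra operator `v ↦ k(z,s) ∫_{b(z)}^{e(z,s)} φ(r) v(z,r) dr`. -/
def bcfInt (k e : Z × ℝ → ℝ) (b : Z → ℝ) (φ : ℝ → ℝ) (hk : Continuous k) (he : Continuous e)
    (hb : Continuous b) (hφ : Continuous φ) (C : ℝ)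
    (hC : ∀ t, |k t| * |∫ r in b t.1..e t, abs (φ r)| ≤ C) : (Z × ℝ →ᵇ E) →L[ℝ] (Z × ℝ →ᵇ E) :=
  have hint : ∀ (v : Z × ℝ →ᵇ E) (z : Z) (p q : ℝ),
      IntervalIntegrable (fun r => φ r • v (z, r)) MeasureTheory.volume p q := fun v z p q =>
    (hφ.smul (v.continuous.comp (by fun_prop))).intervalIntegrable p q
  have hbd := norm_smul_integral_le (E := E) hφ hC
  LinearMap.mkContinuous
    { toFun := fun v => ofNormedAddCommGroup
        (fun t => k t • ∫ r in b t.1..e t, φ r • v (t.1, r))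
        (by
          refine hk.smul ?_
          have hc : Continuous (Function.uncurry fun (t : Z × ℝ) (r : ℝ) => φ r • v (t.1, r)) := by
            have hv := v.continuous
            exact (hφ.comp continuous_snd).smul (hv.comp (by fun_prop))
          -- Both endpoints move with the parameter, so the integral is split at the fixed point 0.
          have e1 := intervalIntegral.continuous_parametric_intervalIntegral_of_continuous
            (μ := MeasureTheory.volume) (a₀ := 0) hc he
          have e2 := intervalIntegral.continuous_parametric_intervalIntegral_of_continuous
            (μ := MeasureTheory.volume) (a₀ := 0) hc (hb.comp continuous_fst)
          refine (e1.sub e2).congr fun t => ?_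
          exact intervalIntegral.integral_interval_sub_left (hint v t.1 _ _) (hint v t.1 _ _))
        (C * ‖v‖) (hbd v)
      map_add' := fun u v => by
        ext t
        simp only [coe_ofNormedAddCommGroup, BoundedContinuousFunction.coe_add, Pi.add_apply,
          smul_add]
        rw [intervalIntegral.integral_add (hint u t.1 _ _) (hint v t.1 _ _), smul_add]
      map_smul' := fun c u => by
        ext t
        simp only [coe_ofNormedAddCommGroup, BoundedContinuousFunction.coe_smul, RingHom.id_apply]
        simp_rw [smul_comm _ c]
        rw [intervalIntegral.integral_smul, smul_comm] }
    (max C 0) (fun v => by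
      refine (norm_le (by positivity)).2 fun t => (hbd v t).trans ?_
      gcongr
      exact le_max_left _ _)

theorem bcfInt_apply {k e : Z × ℝ → ℝ} {b : Z → ℝ} {φ : ℝ → ℝ} {hk : Continuous k}
    {he : Continuous e} {hb : Continuous b} {hφ : Continuous φ} {C : ℝ}
    {hC : ∀ t, |k t| * |∫ r in b t.1..e t, abs (φ r)| ≤ C} (v : Z × ℝ →ᵇ E) (t : Z × ℝ) :
    bcfInt k e b φ hk he hb hφ C hC v t = k t • ∫ r in b t.1..e t, φ r • v (t.1, r) := rfl

theorem norm_bcfInt_le {k e : Z × ℝ → ℝ} {b : Z → ℝ} {φ : ℝ → ℝ} {hk : Continuous k}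
    {he : Continuous e} {hb : Continuous b} {hφ : Continuous φ} {C : ℝ} (hC0 : 0 ≤ C)
    {hC : ∀ t, |k t| * |∫ r in b t.1..e t, abs (φ r)| ≤ C} :
    ‖(bcfInt k e b φ hk he hb hφ C hC : (Z × ℝ →ᵇ E) →L[ℝ] (Z × ℝ →ᵇ E))‖ ≤ C := by
  refine ContinuousLinearMap.opNorm_le_bound _ hC0 fun v => ?_
  exact (norm_le (by positivity)).2 fun t => norm_smul_integral_le hφ hC v t

end BCFIntegral

/-! ### A fixed point problem with smooth dependence on the inhomogeneity -/

section FixedPoint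

open scoped NNReal

variable {X : Type} [NormedAddCommGroup X] [NormedSpace ℝ X] [CompleteSpace X]

/-- The map `x ↦ x - J (N x)` is a Lipschitz perturbation of the identity, hence a homeomorphism
onto its image; its derivative is the identity minus an operator of norm below 1, invertible by the
Neumann series, so the inverse is smooth. In the applications a point of `X` is an entire family of
trajectories, which makes smooth dependence on `p` automatically uniform over the family. -/
theorem exists_smooth_fixedPoint {N : X → X} {x₀ : X} {r : ℝ} (hr : 0 < r)
    (hN : ContDiffOn ℝ ∞ N (Metric.ball x₀ r)) {J : X →L[ℝ] X} {δ : ℝ≥0} (hδ : δ ≤ 1 / 2)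
    (hL : LipschitzOnWith δ (fun x => J (N x)) (Metric.ball x₀ r)) (h0 : ‖J (N x₀)‖ ≤ r / 8) :
    ∃ x : X → X, ContDiffOn ℝ ∞ x (Metric.ball x₀ (r / 8)) ∧
      (∀ p ∈ Metric.ball x₀ (r / 8), x p ∈ Metric.ball x₀ r ∧ x p = p + J (N (x p))) ∧
      LipschitzOnWith (2 * δ) (fun p => x p - p) (Metric.ball x₀ (r / 8)) := by
  rcases subsingleton_or_nontrivial X with hX | hX
  · refine ⟨id, contDiffOn_id, fun p _ => ⟨?_, Subsingleton.elim _ _⟩, ?_⟩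
    · rw [Subsingleton.elim (id p) x₀]; exact Metric.mem_ball_self hr
    · simp only [id, sub_self]
      exact (LipschitzWith.const' (0 : X)).lipschitzOnWith.weaken (by positivity)
  set ψ : X → X := fun x => x - J (N x) with hψ
  have happ : ApproximatesLinearOn ψ ((ContinuousLinearEquiv.refl ℝ X : X ≃L[ℝ] X) : X →L[ℝ] X)
      (Metric.ball x₀ r) δ := by
    intro x hx y hy
    have := hL.dist_le_mul x hx y hy
    rw [dist_eq_norm, dist_eq_norm] at this
    have e : ψ x - ψ y - ((ContinuousLinearEquiv.refl ℝ X : X ≃L[ℝ] X) : X →L[ℝ] X) (x - y)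
        = -(J (N x) - J (N y)) := by
      simp only [hψ, ContinuousLinearEquiv.coe_refl, ContinuousLinearMap.coe_id', id_eq]; abel
    rw [e, norm_neg]; exact this
  have hnorm : ‖(((ContinuousLinearEquiv.refl ℝ X).symm : X ≃L[ℝ] X) : X →L[ℝ] X)‖₊⁻¹ = 1 := by
    have : (((ContinuousLinearEquiv.refl ℝ X).symm : X ≃L[ℝ] X) : X →L[ℝ] X)
      = ContinuousLinearMap.id ℝ X := rfl
    rw [this, ContinuousLinearMap.nnnorm_id, inv_one]
  have hδ1 : δ < 1 := lt_of_le_of_lt hδ (by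
    rw [← NNReal.coe_lt_coe]; norm_num)
  have hδr : (δ : ℝ) ≤ 1 / 2 := by exact_mod_cast hδ
  have hc : Subsingleton X ∨ δ < ‖(((ContinuousLinearEquiv.refl ℝ X).symm : X ≃L[ℝ] X) : X →L[ℝ] X)‖₊⁻¹ :=
    Or.inr (by rw [hnorm]; exact hδ1)
  set e := happ.toOpenPartialHomeomorph ψ (Metric.ball x₀ r) hc Metric.isOpen_ball with he
  have htar : ∀ p ∈ Metric.ball x₀ (r / 8), p ∈ e.target := by
    intro p hp
    -- The image contains the closed ball of radius `(1 - δ) * (r / 2) ≥ r / 4` about `ψ x₀`, while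
    -- `p` and `ψ x₀` are each within `r / 8` of `x₀`.
    refine happ.closedBall_subset_target hc Metric.isOpen_ball (ε := r / 2) (b := x₀) (by positivity)
      (Metric.closedBall_subset_ball (by linarith)) ?_
    rw [hnorm, Metric.mem_closedBall, dist_eq_norm]
    rw [Metric.mem_ball, dist_eq_norm] at hp
    calc ‖p - ψ x₀‖ = ‖(p - x₀) + J (N x₀)‖ := by simp only [hψ]; congr 1; abel
      _ ≤ ‖p - x₀‖ + ‖J (N x₀)‖ := norm_add_le _ _
      _ ≤ r / 4 := by linarith
      _ ≤ (((1 : ℝ≥0) : ℝ) - δ) * (r / 2) := by push_cast; nlinarith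
  have hsrc : e.source = Metric.ball x₀ r := rfl
  have hin : ∀ p ∈ Metric.ball x₀ (r / 8), e.symm p ∈ Metric.ball x₀ r := fun p hp => by
    rw [← hsrc]; exact e.map_target (htar p hp)
  have hfix : ∀ p ∈ Metric.ball x₀ (r / 8), e.symm p = p + J (N (e.symm p)) := fun p hp => by
    have : ψ (e.symm p) = p := e.right_inv (htar p hp)
    nth_rewrite 2 [← this]
    simp [hψ]
  refine ⟨e.symm, fun p hp => ?_, fun p hp => ⟨hin p hp, hfix p hp⟩, ?_⟩
  · have hx := hin p hp
    have hNx : ContDiffAt ℝ ∞ N (e.symm p) := hN.contDiffAt (Metric.isOpen_ball.mem_nhds hx)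
    have hJN : ContDiffAt ℝ ∞ (fun x => J (N x)) (e.symm p) := J.contDiff.contDiffAt.comp _ hNx
    set D := fderiv ℝ (fun x => J (N x)) (e.symm p) with hD
    have hDd : HasFDerivAt (fun x => J (N x)) D (e.symm p) :=
      (hJN.differentiableAt (by simp)).hasFDerivAt
    have hDn : ‖D‖ < 1 :=
      (hDd.le_of_lipschitzOn (Metric.isOpen_ball.mem_nhds hx) hL).trans_lt (by exact_mod_cast hδ1)
    set Φ : X ≃L[ℝ] X := ContinuousLinearEquiv.unitsEquiv ℝ X (Units.oneSub D hDn) with hΦ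
    have hder : HasFDerivAt ψ (Φ : X →L[ℝ] X) (e.symm p) := by
      refine ((hasFDerivAt_id _).sub hDd).congr_fderiv ?_
      ext v
      simp [hΦ, Units.oneSub]
    exact (e.contDiffAt_symm (htar p hp) hder (contDiffAt_id.sub hJN)).contDiffWithinAt
  · refine LipschitzOnWith.of_dist_le_mul fun p hp q hq => ?_
    have h1 := hL.dist_le_mul _ (hin p hp) _ (hin q hq)
    have ep : e.symm p - p = J (N (e.symm p)) := by rw [sub_eq_iff_eq_add']; exact hfix p hp
    have eq' : e.symm q - q = J (N (e.symm q)) := by rw [sub_eq_iff_eq_add']; exact hfix q hq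
    rw [ep, eq']
    have h2 : dist (e.symm p) (e.symm q) ≤ dist p q + δ * dist (e.symm p) (e.symm q) := by
      calc dist (e.symm p) (e.symm q) = ‖(p - q) + (J (N (e.symm p)) - J (N (e.symm q)))‖ := by
            rw [dist_eq_norm, ← ep, ← eq']; congr 1; abel
        _ ≤ ‖p - q‖ + ‖J (N (e.symm p)) - J (N (e.symm q))‖ := norm_add_le _ _
        _ ≤ _ := by rw [← dist_eq_norm, ← dist_eq_norm]; gcongr
    have h3 : dist (e.symm p) (e.symm q) ≤ 2 * dist p q := by
      have := dist_nonneg (x := e.symm p) (y := e.symm q)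
      nlinarith
    refine h1.trans ?_
    push_cast
    nlinarith [NNReal.coe_nonneg δ]

end FixedPoint

/-! ### Pointwise limits of functions with locally bounded derivatives -/

section Limits

variable {G : Type} [NormedAddCommGroup G] [NormedSpace ℝ G] [FiniteDimensional ℝ G]

/-- Bounded first derivatives lie in a compact ball of a finite-dimensional space, so they converge
along the ultrafilter. The second-order Taylor estimate, uniform in the index, passes to the limit
and shows that the limit is the derivative of `f`. -/
theorem hasFDerivAt_ultrafilter_limit {ι G' : Type} [NormedAddCommGroup G'] [NormedSpace ℝ G']
    [FiniteDimensional ℝ G'] {F : ι → G → G'} {f : G → G'} {U : Set G} (hU : IsOpen U)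
    (hUc : Convex ℝ U) {l : Ultrafilter ι}
    (hsm : ∀ᶠ i in (l : Filter ι), ContDiffOn ℝ ∞ (F i) U) {C₁ C₂ : ℝ}
    (hb1 : ∀ᶠ i in (l : Filter ι), ∀ q ∈ U, ‖fderiv ℝ (F i) q‖ ≤ C₁)
    (hb2 : ∀ᶠ i in (l : Filter ι), ∀ q ∈ U, ‖fderiv ℝ (fderiv ℝ (F i)) q‖ ≤ C₂)
    (hpt : ∀ q ∈ U, Tendsto (fun i => F i q) l (𝓝 (f q))) {q : G} (hq : q ∈ U) :
    ∃ A : G →L[ℝ] G', Tendsto (fun i => fderiv ℝ (F i) q) l (𝓝 A) ∧ HasFDerivAt f A q := by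
  have : ProperSpace (G →L[ℝ] G') := FiniteDimensional.proper ℝ _
  obtain ⟨A, _, hA⟩ := (isCompact_closedBall (0 : G →L[ℝ] G') C₁).ultrafilter_le_nhds
    (l.map fun i => fderiv ℝ (F i) q) (by
      rw [le_principal_iff]
      have : ∀ᶠ i in (l : Filter ι), fderiv ℝ (F i) q ∈ Metric.closedBall 0 C₁ := by
        filter_upwards [hb1] with i hi
        simpa using hi q hq
      exact this)
  have hA' : Tendsto (fun i => fderiv ℝ (F i) q) l (𝓝 A) := hA
  refine ⟨A, hA', ?_⟩
  have hest : ∀ x ∈ U, ‖f x - f q - A (x - q)‖ ≤ C₂ * ‖x - q‖ * ‖x - q‖ := by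
    intro x hx
    have hlim : Tendsto (fun i => ‖F i x - F i q - fderiv ℝ (F i) q (x - q)‖) l
        (𝓝 ‖f x - f q - A (x - q)‖) :=
      (((hpt x hx).sub (hpt q hq)).sub
        (((ContinuousLinearMap.apply ℝ G' (x - q)).continuous.tendsto A).comp hA')).norm
    refine le_of_tendsto hlim ?_
    filter_upwards [hsm, hb2] with i hi hi2
    have hseg : segment ℝ q x ⊆ U := hUc.segment_subset hq hx
    have hD2 : ∀ y ∈ U, HasFDerivAt (fderiv ℝ (F i)) (fderiv ℝ (fderiv ℝ (F i)) y) y := fun y hy =>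
      (((hi.fderiv_of_isOpen (m := ∞) hU (by simp)).contDiffAt (hU.mem_nhds hy)).differentiableAt
        (by simp)).hasFDerivAt
    have hD1 : ∀ y ∈ U, HasFDerivAt (F i) (fderiv ℝ (F i) y) y := fun y hy =>
      ((hi.contDiffAt (hU.mem_nhds hy)).differentiableAt (by simp)).hasFDerivAt
    have h0 : 0 ≤ C₂ := (norm_nonneg (fderiv ℝ (fderiv ℝ (F i)) q)).trans (hi2 q hq)
    have hlip : ∀ y ∈ segment ℝ q x, ‖fderiv ℝ (F i) y - fderiv ℝ (F i) q‖ ≤ C₂ * ‖x - q‖ := by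
      intro y hy
      refine ((convex_segment q x).norm_image_sub_le_of_norm_hasFDerivWithin_le
        (fun z hz => (hD2 z (hseg hz)).hasFDerivWithinAt) (fun z hz => hi2 z (hseg hz))
        (left_mem_segment ℝ _ _) hy).trans ?_
      gcongr
      rw [segment_eq_image'] at hy
      obtain ⟨τ, hτ, rfl⟩ := hy
      rw [add_sub_cancel_left, norm_smul, Real.norm_eq_abs, abs_of_nonneg hτ.1]
      exact mul_le_of_le_one_left (norm_nonneg _) hτ.2
    have := (convex_segment q x).norm_image_sub_le_of_norm_hasFDerivWithin_le
      (f := fun y => F i y - fderiv ℝ (F i) q y)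
      (fun z hz => ((hD1 z (hseg hz)).sub (fderiv ℝ (F i) q).hasFDerivAt).hasFDerivWithinAt)
      hlip (left_mem_segment ℝ _ _) (right_mem_segment ℝ _ _)
    refine le_trans (le_of_eq ?_) this
    rw [map_sub]; congr 1; abel
  rw [hasFDerivAt_iff_isLittleO, Asymptotics.isLittleO_iff]
  intro c hc
  have h1 : ∀ᶠ x in 𝓝 q, ‖x - q‖ < c / (|C₂| + 1) := by
    have : Tendsto (fun x => ‖x - q‖) (𝓝 q) (𝓝 0) := by
      have : Continuous fun x : G => ‖x - q‖ := by fun_prop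
      simpa using this.tendsto q
    exact this.eventually_lt_const (by positivity)
  filter_upwards [h1, hU.mem_nhds hq] with x hx hxU
  refine (hest x hxU).trans ?_
  gcongr
  calc C₂ * ‖x - q‖ ≤ |C₂| * (c / (|C₂| + 1)) := by
        gcongr
        exact le_abs_self _
    _ ≤ c := by
        rw [mul_div_assoc', div_le_iff₀ (by positivity)]
        nlinarith [abs_nonneg C₂]

/-- Hypotheses of the limit theorem: smoothness, bounds of all derivatives and pointwise
convergence. -/
structure BddConv {G' : Type} [NormedAddCommGroup G'] [NormedSpace ℝ G'] (F : ℝ → G → G')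
    (f : G → G') (U : Set G) : Prop where
  smooth : ∀ᶠ i in atTop, ContDiffOn ℝ ∞ (F i) U
  bound : ∀ m : ℕ, ∃ C, ∀ᶠ i in atTop, ∀ q ∈ U, ‖iteratedFDeriv ℝ m (F i) q‖ ≤ C
  tendsto : ∀ q ∈ U, Tendsto (fun i => F i q) atTop (𝓝 (f q))

variable {U : Set G}

/-- Along every ultrafilter finer than `atTop` the derivatives converge, and the limit must be
`fderiv ℝ f q`; hence they converge along `atTop`. The class `BddConv` is thus stable under
differentiation, which drives all the inductions below. -/
theorem BddConv.fderiv_conv (hU : IsOpen U) (hUc : Convex ℝ U) {G' : Type} [NormedAddCommGroup G'] [NormedSpace ℝ G']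
    [FiniteDimensional ℝ G'] {F : ℝ → G → G'} {f : G → G'} (h : BddConv F f U) :
    (∀ q ∈ U, DifferentiableAt ℝ f q) ∧ BddConv (fun i => fderiv ℝ (F i)) (fderiv ℝ f) U := by
  obtain ⟨C₁, hC₁⟩ := h.bound 1
  obtain ⟨C₂, hC₂⟩ := h.bound 2
  have key : ∀ q ∈ U, ∀ l : Ultrafilter ℝ, (l : Filter ℝ) ≤ atTop →
      ∃ A : G →L[ℝ] G', Tendsto (fun i => fderiv ℝ (F i) q) l (𝓝 A) ∧ HasFDerivAt f A q := by
    intro q hq l hl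
    refine hasFDerivAt_ultrafilter_limit hU hUc (hl h.smooth) (C₁ := C₁) (C₂ := C₂) ?_ ?_
      (fun x hx => (h.tendsto x hx).mono_left hl) hq
    · filter_upwards [hl hC₁] with i hi x hx
      have := hi x hx
      rwa [← zero_add 1, ← norm_iteratedFDeriv_fderiv, norm_iteratedFDeriv_zero] at this
    · filter_upwards [hl hC₂] with i hi x hx
      have := hi x hx
      rwa [show 2 = 0 + 1 + 1 by rfl, ← norm_iteratedFDeriv_fderiv, ← norm_iteratedFDeriv_fderiv,
        norm_iteratedFDeriv_zero] at this
  refine ⟨fun q hq => ?_, ?_, fun m => ?_, fun q hq => ?_⟩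
  · obtain ⟨A, _, hA⟩ := key q hq (Ultrafilter.of atTop) (Ultrafilter.of_le _)
    exact hA.differentiableAt
  · filter_upwards [h.smooth] with i hi
    exact hi.fderiv_of_isOpen hU (by simp)
  · obtain ⟨C, hC⟩ := h.bound (m + 1)
    refine ⟨C, hC.mono fun i hi q hq => ?_⟩
    rw [norm_iteratedFDeriv_fderiv]
    exact hi q hq
  · rw [tendsto_iff_ultrafilter]
    intro l hl
    obtain ⟨A, h1, h2⟩ := key q hq l hl
    rw [h2.fderiv]
    exact h1

theorem BddConv.contDiffOn_nat (hU : IsOpen U) (hUc : Convex ℝ U) (N : ℕ) : ∀ {G' : Type} [NormedAddCommGroup G'] [NormedSpace ℝ G']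
    [FiniteDimensional ℝ G'] {F : ℝ → G → G'} {f : G → G'}, BddConv F f U →
    ContDiffOn ℝ N f U := by
  induction N with
  | zero =>
    intro G' _ _ _ F f h
    rw [Nat.cast_zero, contDiffOn_zero]
    exact fun q hq => ((h.fderiv_conv hU hUc).1 q hq).continuousAt.continuousWithinAt
  | succ N ih =>
    intro G' _ _ _ F f h
    have := h.fderiv_conv hU hUc
    rw [Nat.cast_add, Nat.cast_one, contDiffOn_succ_iff_fderiv_of_isOpen hU]
    exact ⟨fun q hq => (this.1 q hq).differentiableWithinAt, by simp, ih this.2⟩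

/-- Convexity and the bound on first derivatives make the family equi-Lipschitz, and on a totally
bounded set pointwise convergence of an equi-Lipschitz family is uniform: a finite net suffices. -/
theorem BddConv.tendstoUniformlyOn (hU : IsOpen U) (hUc : Convex ℝ U) (hUb : Bornology.IsBounded U) {G' : Type} [NormedAddCommGroup G']
    [NormedSpace ℝ G'] [FiniteDimensional ℝ G'] {F : ℝ → G → G'} {f : G → G'}
    (h : BddConv F f U) : TendstoUniformlyOn F f atTop U := by
  have : ProperSpace G := FiniteDimensional.proper ℝ G
  obtain ⟨C, hC⟩ := h.bound 1
  set K := |C| + 1 with hK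
  have hK0 : 0 < K := by positivity
  have hlip : ∀ᶠ i in atTop, ∀ x ∈ U, ∀ y ∈ U, ‖F i y - F i x‖ ≤ K * ‖y - x‖ := by
    filter_upwards [hC, h.smooth] with i hi hs x hx y hy
    refine hUc.norm_image_sub_le_of_norm_hasFDerivWithin_le (f' := fderiv ℝ (F i))
      (fun z hz => ((hs.contDiffAt (hU.mem_nhds hz)).differentiableAt
        (by simp)).hasFDerivAt.hasFDerivWithinAt) (fun z hz => ?_) hx hy
    have := hi z hz
    rw [← zero_add 1, ← norm_iteratedFDeriv_fderiv, norm_iteratedFDeriv_zero] at this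
    linarith [le_abs_self C]
  have hlipf : ∀ x ∈ U, ∀ y ∈ U, ‖f y - f x‖ ≤ K * ‖y - x‖ := by
    intro x hx y hy
    refine le_of_tendsto ((h.tendsto y hy).sub (h.tendsto x hx)).norm ?_
    filter_upwards [hlip] with i hi
    exact hi x hx y hy
  rw [Metric.tendstoUniformlyOn_iff]
  intro ε hε
  have htb : TotallyBounded U := hUb.isCompact_closure.totallyBounded.subset subset_closure
  obtain ⟨s, hsU, hsf, hcov⟩ := Metric.finite_approx_of_totallyBounded htb (ε / (3 * K)) (by positivity)
  have hfin : ∀ᶠ i in atTop, ∀ x ∈ s, dist (f x) (F i x) < ε / 3 := by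
    rw [eventually_all_finite hsf]
    intro x hx
    have := (h.tendsto x (hsU hx)).eventually (Metric.ball_mem_nhds (f x) (by positivity : 0 < ε / 3))
    filter_upwards [this] with i hi
    rw [dist_comm]; exact hi
  filter_upwards [hfin, hlip] with i hi hl q hq
  obtain ⟨x, hx, hqx⟩ := mem_iUnion₂.1 (hcov hq)
  rw [Metric.mem_ball, dist_eq_norm] at hqx
  have e1 := hlipf x (hsU hx) q hq
  have e2 := hl x (hsU hx) q hq
  have e3 := hi x hx
  have hlt : K * ‖q - x‖ < ε / 3 := by
    calc K * ‖q - x‖ < K * (ε / (3 * K)) := by gcongr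
      _ = ε / 3 := by field_simp
  rw [dist_eq_norm] at e3 ⊢
  calc ‖f q - F i q‖ = ‖(f q - f x) + (f x - F i x) - (F i q - F i x)‖ := by congr 1; abel
    _ ≤ ‖f q - f x‖ + ‖f x - F i x‖ + ‖F i q - F i x‖ :=
      (norm_sub_le _ _).trans (by gcongr; exact norm_add_le _ _)
    _ < ε := by linarith

theorem BddConv.tendstoUniformlyOn_iteratedFDeriv (hU : IsOpen U) (hUc : Convex ℝ U)
    (hUb : Bornology.IsBounded U) (m : ℕ) :
    ∀ {G' : Type} [NormedAddCommGroup G'] [NormedSpace ℝ G'] [FiniteDimensional ℝ G']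
    {F : ℝ → G → G'} {f : G → G'}, BddConv F f U →
    TendstoUniformlyOn (fun i q => iteratedFDeriv ℝ m (F i) q) (fun q => iteratedFDeriv ℝ m f q)
      atTop U := by
  induction m with
  | zero =>
    intro G' _ _ _ F f h
    have h1 := h.tendstoUniformlyOn hU hUc hUb
    rw [Metric.tendstoUniformlyOn_iff] at h1 ⊢
    intro ε hε
    filter_upwards [h1 ε hε] with i hi q hq
    simp only [iteratedFDeriv_zero_eq_comp, Function.comp_apply, LinearIsometryEquiv.dist_map]
    exact hi q hq
  | succ m ih =>
    intro G' _ _ _ F f h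
    have h1 := ih (h.fderiv_conv hU hUc).2
    rw [Metric.tendstoUniformlyOn_iff] at h1 ⊢
    intro ε hε
    filter_upwards [h1 ε hε] with i hi q hq
    simp only [iteratedFDeriv_succ_eq_comp_right, Function.comp_apply, LinearIsometryEquiv.dist_map]
    exact hi q hq

theorem BddConv.tendstoWithDerivs (hU : IsOpen U) (hUc : Convex ℝ U) (hUb : Bornology.IsBounded U) {G' : Type} [NormedAddCommGroup G']
    [NormedSpace ℝ G'] [FiniteDimensional ℝ G'] {F : ℝ → G → G'} {f : G → G'}
    (h : BddConv F f U) : TendstoWithDerivs F f U :=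
  ⟨contDiffOn_infty.2 fun N => h.contDiffOn_nat hU hUc N, h.smooth,
    fun m => h.tendstoUniformlyOn_iteratedFDeriv hU hUc hUb m⟩

end Limits

end LongRangeFlow

end

noncomputable section

namespace LongRangeFlow

open scoped BoundedContinuousFunction NNReal
open BoundedContinuousFunction

/-! ### Ordinary differential equations -/

section ODE

variable {F : Type} [NormedAddCommGroup F] [NormedSpace ℝ F] [FiniteDimensional ℝ F] {X : F → F}

theorem exists_lipschitzOnWith_closedBall (hX : ContDiff ℝ ∞ X) (R : ℝ) :
    ∃ K : ℝ≥0, LipschitzOnWith K X (Metric.closedBall 0 R) := by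
  have : ProperSpace F := FiniteDimensional.proper ℝ F
  obtain ⟨C, hC⟩ := (isCompact_closedBall (0 : F) R).exists_bound_of_continuousOn
    (hX.continuous_fderiv (by simp)).continuousOn
  refine ⟨C.toNNReal, (convex_closedBall 0 R).lipschitzOnWith_of_nnnorm_fderiv_le
    (fun x _ => hX.differentiable (by simp) x) fun x hx => ?_⟩
  rw [← NNReal.coe_le_coe, coe_nnnorm]
  exact (hC x hx).trans (Real.le_coe_toNNReal C)

theorem ode_unique (hX : ContDiff ℝ ∞ X) {f g : ℝ → F} {a b t₀ : ℝ} (ht₀ : t₀ ∈ Icc a b)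
    (hf : ∀ t ∈ Icc a b, HasDerivAt f (X (f t)) t) (hg : ∀ t ∈ Icc a b, HasDerivAt g (X (g t)) t)
    (h : f t₀ = g t₀) : EqOn f g (Icc a b) := by
  have hfc : ContinuousOn f (Icc a b) := fun t ht => (hf t ht).continuousAt.continuousWithinAt
  have hgc : ContinuousOn g (Icc a b) := fun t ht => (hg t ht).continuousAt.continuousWithinAt
  obtain ⟨C₁, hC₁⟩ := isCompact_Icc.exists_bound_of_continuousOn hfc
  obtain ⟨C₂, hC₂⟩ := isCompact_Icc.exists_bound_of_continuousOn hgc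
  obtain ⟨K, hK⟩ := exists_lipschitzOnWith_closedBall hX (max C₁ C₂)
  have hfs : ∀ t ∈ Icc a b, f t ∈ Metric.closedBall (0 : F) (max C₁ C₂) := fun t ht => by
    simpa using Or.inl (hC₁ t ht)
  have hgs : ∀ t ∈ Icc a b, g t ∈ Metric.closedBall (0 : F) (max C₁ C₂) := fun t ht => by
    simpa using Or.inr (hC₂ t ht)
  have hl : Icc a t₀ ⊆ Icc a b := Icc_subset_Icc_right ht₀.2
  have hr : Icc t₀ b ⊆ Icc a b := Icc_subset_Icc_left ht₀.1
  intro t ht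
  rcases le_total t t₀ with h1 | h1
  · exact ODE_solution_unique_of_mem_Icc_left (v := fun _ => X)
      (s := fun _ => Metric.closedBall (0 : F) (max C₁ C₂)) (fun _ _ => hK) (hfc.mono hl)
      (fun s hs => (hf s (hl (Ioc_subset_Icc_self hs))).hasDerivWithinAt)
      (fun s hs => hfs s (hl (Ioc_subset_Icc_self hs))) (hgc.mono hl)
      (fun s hs => (hg s (hl (Ioc_subset_Icc_self hs))).hasDerivWithinAt)
      (fun s hs => hgs s (hl (Ioc_subset_Icc_self hs))) h ⟨ht.1, h1⟩
  · exact ODE_solution_unique_of_mem_Icc_right (v := fun _ => X)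
      (s := fun _ => Metric.closedBall (0 : F) (max C₁ C₂)) (fun _ _ => hK) (hfc.mono hr)
      (fun s hs => (hf s (hr (Ico_subset_Icc_self hs))).hasDerivWithinAt)
      (fun s hs => hfs s (hr (Ico_subset_Icc_self hs))) (hgc.mono hr)
      (fun s hs => (hg s (hr (Ico_subset_Icc_self hs))).hasDerivWithinAt)
      (fun s hs => hgs s (hr (Ico_subset_Icc_self hs))) h ⟨h1, ht.2⟩

/-- The field is cut off outside a large ball, which makes it bounded and globally Lipschitz.
Grönwall's inequality for the proper function `V` then confines the solution to the region where the
cutoff equals 1, so it solves the original equation. -/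
theorem exists_local_of_growth (hX : ContDiff ℝ ∞ X) {V : F → ℝ} (hV : ContDiff ℝ 1 V) {C : ℝ}
    (hgrow : ∀ q, |fderiv ℝ V q (X q)| ≤ C * V q) (hC : 0 ≤ C)
    (hprop : ∀ q, ‖q‖ ≤ V q) (q : F) {a : ℝ} (ha : 0 < a) :
    ∃ γ : ℝ → F, γ 0 = q ∧ ∀ t ∈ Ioo (-a) a, HasDerivAt γ (X (γ t)) t := by
  have : ProperSpace F := FiniteDimensional.proper ℝ F
  set M : ℝ := V q * Real.exp (C * a) + 1 with hM
  have hVnn : ∀ q, 0 ≤ V q := fun q => (norm_nonneg q).trans (hprop q)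
  have hM0 : 0 < M := by have := hVnn q; positivity
  let ψ : ContDiffBump (0 : F) := ⟨M, M + 1, hM0, by linarith⟩
  set Y : F → F := fun x => ψ x • X x with hY
  have hYs : ContDiff ℝ ∞ Y := ψ.contDiff.smul hX
  have hYc : HasCompactSupport Y := ψ.hasCompactSupport.smul_right
  obtain ⟨K, hK⟩ := hYs.lipschitzWith_of_hasCompactSupport hYc (by simp)
  obtain ⟨L, hL⟩ := hYc.exists_bound_of_continuous hYs.continuous
  have hL0 : 0 ≤ L := (norm_nonneg _).trans (hL 0)
  -- The cut-off field is bounded by `L` everywhere, so the radius `L * a` lets Picard-Lindelöf run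
  -- over the whole interval at once.
  have hPL : IsPicardLindelof (fun _ : ℝ => Y) (tmin := -a) (tmax := a) ⟨0, by constructor <;> linarith⟩ q
      ⟨L * a, by positivity⟩ 0 ⟨L, hL0⟩ K :=
    { lipschitzOnWith := fun _ _ => hK.lipschitzOnWith
      continuousOn := fun _ _ => continuousOn_const
      norm_le := fun _ _ x _ => hL x
      mul_max_le := by
        simp only [sub_zero, zero_sub, neg_neg, max_self, NNReal.coe_zero]
        exact le_rfl }
  obtain ⟨γ, h0, hγ⟩ := hPL.exists_eq_forall_mem_Icc_hasDerivWithinAt₀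
  have hder : ∀ t ∈ Ioo (-a) a, HasDerivAt γ (Y (γ t)) t := fun t ht =>
    (hγ t (Ioo_subset_Icc_self ht)).hasDerivAt (Icc_mem_nhds ht.1 ht.2)
  have hγc : ContinuousOn γ (Icc (-a) a) := fun t ht => (hγ t ht).continuousWithinAt
  have hder2 : ∀ t ∈ Ioo (-a) a, HasDerivAt (fun t => V (γ t)) (ψ (γ t) * fderiv ℝ V (γ t) (X (γ t))) t := by
    intro t ht
    have := ((hV.differentiable (by simp) (γ t)).hasFDerivAt).comp_hasDerivAt t (hder t ht)
    refine this.congr_deriv ?_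
    simp [hY]
  have hbd : ∀ t, |ψ (γ t) * fderiv ℝ V (γ t) (X (γ t))| ≤ C * V (γ t) := by
    intro t
    rw [abs_mul, abs_of_nonneg ψ.nonneg]
    calc ψ (γ t) * |fderiv ℝ V (γ t) (X (γ t))| ≤ 1 * (C * V (γ t)) := by
          gcongr
          · exact ψ.le_one
          · exact hgrow _
      _ = _ := one_mul _
  have hcont : ContinuousOn (fun t => V (γ t)) (Icc (-a) a) := hV.continuous.comp_continuousOn hγc
  have hexp : ∀ (c t : ℝ), HasDerivAt (fun t => Real.exp (c * t)) (Real.exp (c * t) * c) t := fun c t => by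
    have := ((hasDerivAt_id t).const_mul c).exp
    simpa using this
  -- Forward in time `V` times the decaying exponential is antitone; backward in time `V` times the
  -- growing one is monotone.
  have hVb : ∀ t ∈ Icc (-a) a, V (γ t) ≤ V q * Real.exp (C * a) := by
    intro t ht
    rcases le_total 0 t with h | h
    · have hanti : AntitoneOn (fun t => V (γ t) * Real.exp (-C * t)) (Icc (-a) a) := by
        refine antitoneOn_of_hasDerivWithinAt_nonpos (convex_Icc _ _)
          (f' := fun t => ψ (γ t) * fderiv ℝ V (γ t) (X (γ t)) * Real.exp (-C * t)
            + V (γ t) * (Real.exp (-C * t) * -C))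
          (hcont.mul (by fun_prop)) (fun s hs => ?_) (fun s hs => ?_)
        · rw [interior_Icc] at hs
          exact ((hder2 s hs).mul (hexp (-C) s)).hasDerivWithinAt
        · have := (abs_le.1 (hbd s)).2
          nlinarith [Real.exp_pos (-C * s)]
      have := hanti (a := 0) (b := t) ⟨by linarith, by linarith⟩ ht h
      simp only [h0, mul_zero, Real.exp_zero, mul_one] at this
      have e : V (γ t) = V (γ t) * Real.exp (-C * t) * Real.exp (C * t) := by
        rw [mul_assoc, ← Real.exp_add]; simp
      rw [e]
      have := hVnn q
      gcongr
      exact ht.2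
    · have hmono : MonotoneOn (fun t => V (γ t) * Real.exp (C * t)) (Icc (-a) a) := by
        refine monotoneOn_of_hasDerivWithinAt_nonneg (convex_Icc _ _)
          (f' := fun t => ψ (γ t) * fderiv ℝ V (γ t) (X (γ t)) * Real.exp (C * t)
            + V (γ t) * (Real.exp (C * t) * C))
          (hcont.mul (by fun_prop)) (fun s hs => ?_) (fun s hs => ?_)
        · rw [interior_Icc] at hs
          exact ((hder2 s hs).mul (hexp C s)).hasDerivWithinAt
        · have := (abs_le.1 (hbd s)).1
          nlinarith [Real.exp_pos (C * s)]
      have := hmono (a := t) (b := 0) ht ⟨by linarith, by linarith⟩ h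
      simp only [h0, mul_zero, Real.exp_zero, mul_one] at this
      have e : V (γ t) = V (γ t) * Real.exp (C * t) * Real.exp (C * -t) := by
        rw [mul_assoc, ← Real.exp_add]; simp
      rw [e]
      have := hVnn q
      gcongr
      linarith [ht.1]
  refine ⟨γ, h0, fun t ht => ?_⟩
  have h1 : ψ (γ t) = 1 := by
    apply ψ.one_of_mem_closedBall
    rw [mem_closedBall_zero_iff]
    have := hVb t (Ioo_subset_Icc_self ht)
    have := hprop (γ t)
    show _ ≤ M
    linarith
  have := hder t ht
  simpa [hY, h1] using this

theorem exists_global_of_growth (hX : ContDiff ℝ ∞ X) {V : F → ℝ} (hV : ContDiff ℝ 1 V) {C : ℝ}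
    (hgrow : ∀ q, |fderiv ℝ V q (X q)| ≤ C * V q) (hC : 0 ≤ C)
    (hprop : ∀ q, ‖q‖ ≤ V q) (q : F) :
    ∃ γ : ℝ → F, γ 0 = q ∧ ∀ t, HasDerivAt γ (X (γ t)) t := by
  have h := fun a : {a : ℝ // 0 < a} => exists_local_of_growth hX hV hgrow hC hprop q a.2
  choose α hα0 hα using h
  have huniq : ∀ (a b : {a : ℝ // 0 < a}) (t : ℝ), |t| < a.1 → |t| < b.1 → α a t = α b t := by
    intro a b t ha hb
    have hab := abs_lt.1 ha
    have hbb := abs_lt.1 hb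
    refine ode_unique hX (a := -|t|) (b := |t|) (t₀ := 0) (by constructor <;> simp)
      (fun s hs => hα a s ⟨by linarith [hs.1], by linarith [hs.2]⟩)
      (fun s hs => hα b s ⟨by linarith [hs.1], by linarith [hs.2]⟩) (by rw [hα0, hα0])
      ⟨neg_abs_le t, le_abs_self t⟩
  refine ⟨fun t => α ⟨|t| + 1, by positivity⟩ t, hα0 _, fun t => ?_⟩
  have h1 := hα ⟨|t| + 2, by positivity⟩ t
    ⟨by simp only; linarith [neg_abs_le t], by simp only; linarith [le_abs_self t]⟩
  rw [huniq ⟨|t| + 2, by positivity⟩ ⟨|t| + 1, by positivity⟩ t (by simp) (by simp)] at h1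
  refine h1.congr_of_eventuallyEq ?_
  have : ∀ᶠ s in 𝓝 t, |s| < |t| + 1 := (continuous_abs.tendsto t).eventually_lt_const (by simp)
  filter_upwards [this] with s hs
  exact huniq _ _ s (by simp) (by simp only; linarith)

variable {φ : ℝ → F → F} 

theorem flow_add (hX : ContDiff ℝ ∞ X) (h0 : ∀ q, φ 0 q = q)
    (hφ : ∀ q t, HasDerivAt (fun t => φ t q) (X (φ t q)) t) (t s : ℝ) (q : F) :
    φ (t + s) q = φ s (φ t q) := by
  have := ode_unique hX (f := fun s => φ (t + s) q) (g := fun s => φ s (φ t q))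
    (a := -|s|) (b := |s|) (t₀ := 0) (by constructor <;> simp)
    (fun r _ => by simpa using (hφ q (t + r)).comp_const_add t r)
    (fun r _ => hφ _ r) (by simp [h0])
  exact this ⟨neg_abs_le s, le_abs_self s⟩

/-- Elapsed time is made a parameter of the initial data by letting it act as a constant speed, so
joint smoothness in time and initial point becomes smooth dependence of a fixed point on its
inhomogeneity. -/
theorem flow_contDiffAt_zero (hX : ContDiff ℝ ∞ X) (h0 : ∀ q, φ 0 q = q)
    (hφ : ∀ q t, HasDerivAt (fun t => φ t q) (X (φ t q)) t) (q₀ : F) :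
    ContDiffAt ℝ ∞ (fun p : ℝ × F => φ p.1 p.2) (0, q₀) := by
  have : ProperSpace F := FiniteDimensional.proper ℝ F
  -- The second component is the speed at which `X` is followed; it stays constant, and at the base
  -- point it is 0, so the unperturbed curve is constant.
  set b : F × ℝ → F × ℝ := fun x => (x.2 • X x.1, 0) with hb
  have hbs : ContDiff ℝ ∞ b := (contDiff_snd.smul (hX.comp contDiff_fst)).prodMk contDiff_const
  set x₀ : Unit × ℝ →ᵇ F × ℝ := bcfConst (q₀, (0 : ℝ)) with hx₀
  set Ω : Set ((Unit × ℝ) × (F × ℝ)) := univ ×ˢ Metric.closedBall (q₀, (0 : ℝ)) 1 with hΩ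
  have hus : ∀ N, UnifSmooth Ω N (fun (_ : Unit × ℝ) x => b x) := fun N =>
    unifSmooth_fixed (isCompact_closedBall _ _) isOpen_univ (subset_univ _) N hbs.contDiffOn
  have hmem : ∀ u ∈ Metric.ball x₀ 1, ∀ t, (t, u t) ∈ Ω := fun u hu t => by
    refine ⟨mem_univ _, ?_⟩
    rw [Metric.mem_closedBall]
    exact (BoundedContinuousFunction.dist_coe_le_dist (f := u) (g := x₀) t).trans
      (Metric.mem_ball.1 hu).le
  set N : (Unit × ℝ →ᵇ F × ℝ) → (Unit × ℝ →ᵇ F × ℝ) := nem (fun _ x => b x) with hN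
  have hNs : ContDiffOn ℝ ∞ N (Metric.ball x₀ 1) := nem_contDiffOn Metric.isOpen_ball hmem hus
  have hNa : ∀ u ∈ Metric.ball x₀ 1, ∀ t, N u t = b (u t) := fun u hu t =>
    nem_apply (hus 0) (hmem u hu) t
  have hN0 : N x₀ = 0 := by
    ext1 t
    rw [hNa _ (Metric.mem_ball_self one_pos)]
    simp [hb, hx₀]
  obtain ⟨K, s, hs, hKs⟩ := ((hNs.contDiffAt (Metric.ball_mem_nhds x₀ one_pos)).of_le
    (by simp : (1 : WithTop ℕ∞) ≤ ∞)).exists_lipschitzOnWith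
  obtain ⟨r', hr', hrs⟩ := Metric.mem_nhds_iff.1 hs
  set r := min r' 1 with hr
  have hr0 : 0 < r := by positivity
  -- This factor makes `J ∘ N` a contraction with constant 1/2. Speed `τ` over unit scaled time then
  -- means flowing for the time `δ * τ`.
  set δ : ℝ≥0 := 1 / (2 * (K + 1)) with hδ
  have hδ0 : 0 < δ := by positivity
  set e : Unit × ℝ → ℝ := fun t => max (min t.2 1) (-1) with he
  have hec : Continuous e := by fun_prop
  have hJC : ∀ t : Unit × ℝ, |(δ : ℝ)| * |∫ r in (0 : ℝ)..e t, abs (1 : ℝ)| ≤ δ := by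
    intro t
    have : |e t| ≤ 1 := abs_le.2 ⟨le_max_right _ _, max_le (min_le_right _ _) (by norm_num)⟩
    simp only [NNReal.abs_eq, abs_one, intervalIntegral.integral_const, sub_zero, smul_eq_mul, mul_one]
    exact mul_le_of_le_one_right δ.2 this
  set J : (Unit × ℝ →ᵇ F × ℝ) →L[ℝ] (Unit × ℝ →ᵇ F × ℝ) :=
    bcfInt (fun _ => (δ : ℝ)) e (fun _ => 0) (fun _ => 1) continuous_const hec continuous_const
      continuous_const δ hJC with hJ
  have hJn : ‖J‖ ≤ δ := norm_bcfInt_le δ.2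
  have hlip : LipschitzOnWith (1 / 2) (fun x => J (N x)) (Metric.ball x₀ r) := by
    refine LipschitzOnWith.of_dist_le_mul fun x hx y hy => ?_
    have h1 := hKs.dist_le_mul x (hrs (Metric.ball_subset_ball (min_le_left _ _) hx)) y
      (hrs (Metric.ball_subset_ball (min_le_left _ _) hy))
    rw [dist_eq_norm, ← map_sub]
    refine (J.le_opNorm _).trans ?_
    rw [← dist_eq_norm]
    calc ‖J‖ * dist (N x) (N y) ≤ δ * (K * dist x y) := by gcongr
      _ = (K / (K + 1)) * (1 / 2) * dist x y := by rw [hδ]; push_cast; field_simp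
      _ ≤ 1 * (1 / 2) * dist x y := by
          gcongr
          rw [div_le_one (by positivity)]
          linarith
      _ = _ := by push_cast; ring
  obtain ⟨x, hxs, hxf, -⟩ := exists_smooth_fixedPoint hr0
    (hNs.mono (Metric.ball_subset_ball (min_le_right _ _))) le_rfl hlip (by
      rw [hN0, map_zero, norm_zero]; positivity)
  have hkey : ∀ q τ, bcfConst (q, τ) ∈ Metric.ball x₀ (r / 8) →
      φ (δ * τ) q = (x (bcfConst (q, τ)) ((), 1)).1 := by
    intro q τ hp
    obtain ⟨hx1, hx2⟩ := hxf _ hp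
    set u := x (bcfConst (q, τ)) with hu
    have hu1 : u ∈ Metric.ball x₀ 1 := Metric.ball_subset_ball (min_le_right _ _) hx1
    set c : ℝ → F × ℝ := fun s => (q, τ) + (δ : ℝ) • ∫ r in (0 : ℝ)..s, b (u ((), r)) with hc
    have hcu : ∀ s ∈ Icc (0 : ℝ) 1, u ((), s) = c s := by
      intro s hs
      have h1 := DFunLike.congr_fun hx2 ((), s)
      rw [BoundedContinuousFunction.coe_add, Pi.add_apply, hJ, bcfInt_apply] at h1
      have h2 : e ((), s) = s := by
        simp only [he]; rw [min_eq_left hs.2, max_eq_left (by linarith [hs.1])]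
      rw [h1, h2]
      simp only [hc, bcfConst_apply, one_smul, hNa u hu1]
    have hbu : Continuous fun r => b (u ((), r)) :=
      hbs.continuous.comp (u.continuous.comp (by fun_prop))
    have hcd : ∀ s ∈ Icc (0 : ℝ) 1, HasDerivAt c ((δ : ℝ) • b (c s)) s := by
      intro s hs
      rw [← hcu s hs]
      exact ((intervalIntegral.integral_hasDerivAt_right (hbu.intervalIntegrable _ _)
        (hbu.stronglyMeasurableAtFilter _ _) hbu.continuousAt).const_smul (δ : ℝ)).const_add _
    have hgd : ∀ s ∈ Icc (0 : ℝ) 1, HasDerivAt (fun s => (φ (δ * τ * s) q, τ))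
        ((δ : ℝ) • b (φ (δ * τ * s) q, τ)) s := by
      intro s _
      have h1 := (hφ q (δ * τ * s)).scomp s ((hasDerivAt_id s).const_mul (δ * τ : ℝ))
      refine (h1.prodMk (hasDerivAt_const s τ)).congr_deriv ?_
      simp [hb, mul_smul]
    have := ode_unique (X := fun x => (δ : ℝ) • b x) (hbs.const_smul (δ : ℝ)) (a := 0) (b := 1)
      (t₀ := 0) (by simp) hgd hcd (by simp [hc, h0]) (x := 1) (by simp)
    rw [← hcu 1 (by simp)] at this
    simpa using congrArg Prod.fst this
  have hmap : ContDiff ℝ ∞ (fun p : ℝ × F => (bcfConst (p.2, (δ : ℝ)⁻¹ * p.1) : Unit × ℝ →ᵇ F × ℝ)) :=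
    (bcfConst (T := Unit × ℝ) (E := F × ℝ)).contDiff.comp
      (contDiff_snd.prodMk (contDiff_const.mul contDiff_fst))
  have hb0 : (bcfConst ((0, q₀).2, (δ : ℝ)⁻¹ * ((0 : ℝ), q₀).1) : Unit × ℝ →ᵇ F × ℝ) = x₀ := by
    simp [hx₀]
  have hnh : Metric.ball x₀ (r / 8) ∈ 𝓝 (bcfConst ((0, q₀).2, (δ : ℝ)⁻¹ * ((0 : ℝ), q₀).1) :
      Unit × ℝ →ᵇ F × ℝ) := by
    rw [hb0]; exact Metric.ball_mem_nhds _ (by positivity)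
  have hcomp : ContDiffAt ℝ ∞ (fun p : ℝ × F => (x (bcfConst (p.2, (δ : ℝ)⁻¹ * p.1)) ((), 1)).1) (0, q₀) := by
    have h1 : ContDiffAt ℝ ∞ (fun p : ℝ × F => x (bcfConst (p.2, (δ : ℝ)⁻¹ * p.1))) (0, q₀) :=
      ContDiffAt.comp (0, q₀) (hxs.contDiffAt hnh) hmap.contDiffAt
    exact ((ContinuousLinearMap.fst ℝ F ℝ).comp
      (BoundedContinuousFunction.evalCLM ℝ ((), (1 : ℝ)))).contDiff.contDiffAt.comp _ h1
  refine hcomp.congr_of_eventuallyEq ?_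
  filter_upwards [hmap.continuous.continuousAt.preimage_mem_nhds hnh] with p hp
  rw [← hkey _ _ hp]
  congr 1
  field_simp

/-- For a fixed initial point the set of times of smoothness is open, closed (compose with the flow
for a short remaining time, by the group law), and contains 0. -/
theorem flow_contDiff (hX : ContDiff ℝ ∞ X) (h0 : ∀ q, φ 0 q = q)
    (hφ : ∀ q t, HasDerivAt (fun t => φ t q) (X (φ t q)) t) :
    ContDiff ℝ ∞ (fun p : ℝ × F => φ p.1 p.2) := by
  rw [contDiff_infty]
  intro N
  rw [contDiff_iff_contDiffAt]
  rintro ⟨t, q₀⟩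
  set A : Set ℝ := {t | ContDiffAt ℝ N (fun p : ℝ × F => φ p.1 p.2) (t, q₀)} with hA
  have hcl : IsClopen A := by
    constructor
    · refine isClosed_of_closure_subset fun t' ht' => ?_
      have hz := ((flow_contDiffAt_zero hX h0 hφ (φ t' q₀)).of_le
        (by exact_mod_cast le_top : (N : WithTop ℕ∞) ≤ ∞)).eventually (by simp)
      have hcont : Tendsto (fun t => (t' - t, φ t q₀)) (𝓝 t') (𝓝 (0, φ t' q₀)) := by
        have : ContinuousAt (fun t => (t' - t, φ t q₀)) t' :=
          (continuousAt_const.sub continuousAt_id).prodMk (hφ q₀ t').continuousAt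
        simpa [ContinuousAt] using this
      obtain ⟨t, ht, htA⟩ := (mem_closure_iff_frequently.1 ht').and_eventually (hcont.eventually hz)
        |>.exists
      have hq : ContDiffAt ℝ N (fun p : ℝ × F => (p.1 - t, φ t p.2)) (t', q₀) := by
        refine (contDiffAt_fst.sub contDiffAt_const).prodMk ?_
        exact ContDiffAt.comp (t', q₀) (g := fun p : ℝ × F => φ p.1 p.2)
          (f := fun p : ℝ × F => (t, p.2)) ht (contDiffAt_const.prodMk contDiffAt_snd)
      have := ContDiffAt.comp (t', q₀) (g := fun p : ℝ × F => φ p.1 p.2)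
          (f := fun p : ℝ × F => (p.1 - t, φ t p.2)) htA hq
      refine this.congr_of_eventuallyEq (Eventually.of_forall fun p => ?_)
      simp only [Function.comp_apply]
      rw [← flow_add hX h0 hφ]
      congr 1; ring
    · rw [isOpen_iff_mem_nhds]
      intro t ht
      have := ContDiffAt.eventually (show ContDiffAt ℝ N (fun p : ℝ × F => φ p.1 p.2) (t, q₀) from ht) (by simp)
      exact (Continuous.tendsto (f := fun t : ℝ => (t, q₀)) (by fun_prop) t).eventually this
  have hne : A.Nonempty := ⟨0, (flow_contDiffAt_zero hX h0 hφ q₀).of_le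
    (by exact_mod_cast le_top : (N : WithTop ℕ∞) ≤ ∞)⟩
  have := hcl.eq_univ hne
  have ht : t ∈ A := by rw [this]; exact mem_univ t
  exact ht

end ODE

end LongRangeFlow

end

noncomputable section

namespace LongRangeFlow

/-! ### The Hamilton fields of a long-range system -/

variable {n : ℕ}

/-- The field `(A(y)η, -B(y)(η,η) - κ g(y))`. -/
def fieldX (A : Eucl n → Eucl n →L[ℝ] Eucl n) (B : Eucl n → Eucl n →L[ℝ] Eucl n →L[ℝ] Eucl n)
    (g : Eucl n → Eucl n) (κ : ℝ) (q : Eucl n × Eucl n) : Eucl n × Eucl n :=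
  (A q.1 q.2, -(B q.1 q.2 q.2) - κ • g q.1)

/-- A family of complete long-range fields with coupling constant `κ`, together with its flow. -/
structure LRSys (n : ℕ) where
  A : Eucl n → Eucl n →L[ℝ] Eucl n
  B : Eucl n → Eucl n →L[ℝ] Eucl n →L[ℝ] Eucl n
  g : Eucl n → Eucl n
  μ : ℝ
  μ_pos : 0 < μ
  μ_lt : μ < 1
  symA : IsSym (fun x => A x - 1) μ
  symB : IsSym B (μ + 1)
  symg : IsSym g (μ - 1)
  φ : ℝ → ℝ → Eucl n × Eucl n → Eucl n × Eucl n
  φ_zero : ∀ κ q, φ κ 0 q = q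
  φ_deriv : ∀ κ q t, HasDerivAt (fun t => φ κ t q) (fieldX A B g κ (φ κ t q)) t
  φ_smooth : ContDiff ℝ ∞ (fun p : ℝ × ℝ × (Eucl n × Eucl n) => φ p.1 p.2.1 p.2.2)

theorem contDiff_fieldX_uncurry {A : Eucl n → Eucl n →L[ℝ] Eucl n}
    {B : Eucl n → Eucl n →L[ℝ] Eucl n →L[ℝ] Eucl n} {g : Eucl n → Eucl n} (hA : ContDiff ℝ ∞ A)
    (hB : ContDiff ℝ ∞ B) (hg : ContDiff ℝ ∞ g) :
    ContDiff ℝ ∞ (fun p : ℝ × (Eucl n × Eucl n) => fieldX A B g p.1 p.2) := by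
  unfold fieldX
  fun_prop

theorem LRSys.contDiff_A (S : LRSys n) : ContDiff ℝ ∞ S.A := by
  have := S.symA.1.add (contDiff_const (c := (1 : Eucl n →L[ℝ] Eucl n)))
  simpa using this

/-- The Hamilton field of the system. -/
def LRSys.X (S : LRSys n) (κ : ℝ) (q : Eucl n × Eucl n) : Eucl n × Eucl n :=
  fieldX S.A S.B S.g κ q

theorem LRSys.contDiff_X (S : LRSys n) (κ : ℝ) : ContDiff ℝ ∞ (S.X κ) :=
  (contDiff_fieldX_uncurry S.contDiff_A S.symB.1 S.symg.1).comp
    (contDiff_const.prodMk contDiff_id)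

theorem LRSys.φ_unique (S : LRSys n) {κ : ℝ} {γ : ℝ → Eucl n × Eucl n} {a b t₀ t₁ : ℝ} {q}
    (h0 : t₀ ∈ Icc a b) (hγ : ∀ t ∈ Icc a b, HasDerivAt γ (S.X κ (γ t)) t)
    (h : γ t₀ = S.φ κ t₁ q) {t : ℝ} (ht : t ∈ Icc a b) : γ t = S.φ κ (t₁ + (t - t₀)) q := by
  refine ode_unique (S.contDiff_X κ) h0 hγ
    (g := fun t => S.φ κ (t₁ + (t - t₀)) q) (fun s _ => ?_) (by simp [h]) ht
  have h1 : HasDerivAt (fun s => t₁ + (s - t₀)) 1 s := ((hasDerivAt_id s).sub_const t₀).const_add t₁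
  exact ((S.φ_deriv κ q (t₁ + (s - t₀))).scomp s h1).congr_deriv (one_smul _ _)

theorem LRSys.φ_add (S : LRSys n) (κ t s : ℝ) (q : Eucl n × Eucl n) :
    S.φ κ (t + s) q = S.φ κ s (S.φ κ t q) :=
  flow_add (S.contDiff_X κ) (S.φ_zero κ) (S.φ_deriv κ) t s q

/-- Scaling of the momenta. -/
theorem LRSys.φ_scale (S : LRSys n) {lam : ℝ} (hl : lam ≠ 0) (κ s : ℝ) (y η : Eucl n) :
    S.φ (lam ^ 2 * κ) (lam⁻¹ * s) (y, lam • η) =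
      ((S.φ κ s (y, η)).1, lam • (S.φ κ s (y, η)).2) := by
  -- Velocities scale like `lam` and the quadratic kinetic force like `lam ^ 2`, as does
  -- accelerating the momentum `lam • η` in time shortened by `lam`; the potential force must be
  -- multiplied by `lam ^ 2` to match.
  set γ : ℝ → Eucl n × Eucl n := fun t =>
    ((S.φ κ (lam * t) (y, η)).1, lam • (S.φ κ (lam * t) (y, η)).2) with hγ
  have hd : ∀ t, HasDerivAt γ (S.X (lam ^ 2 * κ) (γ t)) t := by
    intro t
    have h1 := (S.φ_deriv κ (y, η) (lam * t)).scomp t ((hasDerivAt_id t).const_mul lam)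
    have h2 := (hasFDerivAt_fst.comp_hasDerivAt t h1).prodMk
      ((hasFDerivAt_snd.comp_hasDerivAt t h1).const_smul lam)
    refine h2.congr_deriv ?_
    simp only [LRSys.X, fieldX, hγ]
    ext1
    · simp
    · simp only [mul_one, Prod.smul_mk, ContinuousLinearMap.coe_snd', map_smul,
        ContinuousLinearMap.smul_apply, smul_sub, smul_neg, smul_smul]
      ring_nf
  have := ode_unique (S.contDiff_X (lam ^ 2 * κ)) (f := γ)
    (g := fun t => S.φ (lam ^ 2 * κ) t (y, lam • η)) (a := -|lam⁻¹ * s|) (b := |lam⁻¹ * s|)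
    (t₀ := 0) ⟨neg_nonpos.2 (abs_nonneg _), abs_nonneg _⟩ (fun t _ => hd t)
    (fun t _ => S.φ_deriv _ _ t) (by simp [hγ, S.φ_zero]) (x := lam⁻¹ * s)
    ⟨neg_abs_le _, le_abs_self _⟩
  refine this.symm.trans ?_
  simp [hγ, mul_inv_cancel_left₀ hl]

/-! ### The system attached to a long-range Hamiltonian -/

/-- The matrix of the kinetic energy, as an operator. -/
def opA (a : Eucl n → Matrix (Fin n) (Fin n) ℝ) (x : Eucl n) : Eucl n →L[ℝ] Eucl n :=
  Matrix.toEuclideanCLM (𝕜 := ℝ) (a x)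

/-- The real-linear adjoint map. -/
def adjR (E : Type) [NormedAddCommGroup E] [InnerProductSpace ℝ E] [CompleteSpace E] :
    (E →L[ℝ] E) →L[ℝ] (E →L[ℝ] E) :=
  LinearMap.mkContinuous
    { toFun := fun M => ContinuousLinearMap.adjoint M
      map_add' := fun M N => map_add _ M N
      map_smul' := fun c M => by simp } 1 (fun M => by simp)

theorem inner_adjR {E : Type} [NormedAddCommGroup E] [InnerProductSpace ℝ E] [CompleteSpace E]
    (M : E →L[ℝ] E) (x y : E) : inner ℝ (adjR E M x) y = inner ℝ x (M y) :=
  ContinuousLinearMap.adjoint_inner_left M y x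

/-- The linear map producing the kinetic force from the derivative of the operator. -/
def forceMap (E : Type) [NormedAddCommGroup E] [InnerProductSpace ℝ E] [CompleteSpace E] :
    (E →L[ℝ] E →L[ℝ] E) →L[ℝ] (E →L[ℝ] E →L[ℝ] E) :=
  (1 / 2 : ℝ) • (ContinuousLinearMap.compL ℝ E (E →L[ℝ] E) (E →L[ℝ] E) (adjR E)).comp
    ((ContinuousLinearMap.flipₗᵢ ℝ E E E).toContinuousLinearEquiv :
      (E →L[ℝ] E →L[ℝ] E) →L[ℝ] (E →L[ℝ] E →L[ℝ] E))

/-- When `M` is the derivative of the coefficient operator, the right side with `ξ = η` is the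
derivative of the kinetic energy in the position direction `v`; so `forceMap` produces its gradient.
-/
theorem inner_forceMap {E : Type} [NormedAddCommGroup E] [InnerProductSpace ℝ E] [CompleteSpace E]
    (M : E →L[ℝ] E →L[ℝ] E) (ξ η v : E) :
    inner ℝ (forceMap E M ξ η) v = 1 / 2 * inner ℝ (M v ξ) η := by
  have : forceMap E M ξ η = (1 / 2 : ℝ) • adjR E (M.flip ξ) η := rfl
  rw [this, real_inner_smul_left, inner_adjR, ContinuousLinearMap.flip_apply, real_inner_comm]

/-- The real-linear Riesz map. -/
def rieszR (E : Type) [NormedAddCommGroup E] [InnerProductSpace ℝ E] [CompleteSpace E] :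
    StrongDual ℝ E →L[ℝ] E :=
  LinearMap.mkContinuous
    { toFun := fun M => (InnerProductSpace.toDual ℝ E).symm M
      map_add' := fun M N => map_add _ M N
      map_smul' := fun c M => by simp } 1 (fun M => by simp)

variable {a : Eucl n → Matrix (Fin n) (Fin n) ℝ} {V : Eucl n → ℝ} {μ : ℝ}

theorem isSym_opA (h : IsLongRange a V μ) : IsSym (fun x => opA a x - 1) μ := by
  have hjk : ∀ j k, IsSym (fun x => a x j k - (1 : Matrix (Fin n) (Fin n) ℝ) j k) μ := fun j k =>
    ⟨(h.smooth_a j k).sub contDiff_const, fun m => by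
      obtain ⟨C, hC⟩ := h.bound_a m
      exact ⟨C, hC j k⟩⟩
  have hs : IsSym (fun x => ∑ j, ∑ k, (ContinuousLinearMap.toSpanSingleton ℝ
      (Matrix.toEuclideanCLM (𝕜 := ℝ) (Matrix.single j k (1 : ℝ)) : Eucl n →L[ℝ] Eucl n))
      (a x j k - (1 : Matrix (Fin n) (Fin n) ℝ) j k)) μ :=
    IsSym.sum _ fun j _ => IsSym.sum _ fun k _ => (hjk j k).clm_comp _
  convert hs using 2 with x
  have e : a x - 1 = ∑ j, ∑ k, (a x j k - (1 : Matrix (Fin n) (Fin n) ℝ) j k) •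
      Matrix.single j k (1 : ℝ) := by
    conv_lhs => rw [Matrix.matrix_eq_sum_single (a x - 1)]
    simp [Matrix.smul_single]
  have e2 : opA a x - 1 = Matrix.toEuclideanCLM (𝕜 := ℝ) (a x - 1) := by
    rw [map_sub, map_one]; rfl
  rw [e2, e]
  simp only [map_sum, map_smul, ContinuousLinearMap.toSpanSingleton_apply]

theorem contDiff_opA (h : IsLongRange a V μ) : ContDiff ℝ ∞ (opA a) := by
  have := (isSym_opA h).1.add (contDiff_const (c := (1 : Eucl n →L[ℝ] Eucl n)))
  simpa using this

/-- The bilinear kinetic force. -/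
def opB (a : Eucl n → Matrix (Fin n) (Fin n) ℝ) (x : Eucl n) : Eucl n →L[ℝ] Eucl n →L[ℝ] Eucl n :=
  forceMap (Eucl n) (fderiv ℝ (opA a) x)

theorem isSym_opB (h : IsLongRange a V μ) : IsSym (opB a) (μ + 1) := by
  have h1 := IsSym.clm_comp (G := Eucl n →L[ℝ] Eucl n →L[ℝ] Eucl n)
    (G' := Eucl n →L[ℝ] Eucl n →L[ℝ] Eucl n) ((isSym_opA h).deriv) (forceMap (Eucl n))
  convert h1 using 2 with x
  rw [fderiv_sub_const]; rfl

theorem isSym_gradient (h : IsLongRange a V μ) : IsSym (gradient V) (μ - 1) := by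
  have hV : IsSym V (μ - 2) := ⟨h.smooth_V, fun m => by
    obtain ⟨C, hC⟩ := h.bound_V m
    refine ⟨C, fun x => (hC x).trans (le_of_eq ?_)⟩
    congr 2; ring⟩
  have h1 := (hV.deriv).clm_comp (rieszR (Eucl n))
  rw [show μ - 2 + 1 = μ - 1 by ring] at h1
  exact h1

theorem kinetic_eq (x ξ : Eucl n) : kinetic a x ξ = 1 / 2 * inner ℝ (opA a x ξ) ξ := by
  rw [kinetic, opA, PiLp.inner_apply]
  congr 1
  refine Finset.sum_congr rfl fun j _ => ?_
  have : (Matrix.toEuclideanCLM (𝕜 := ℝ) (a x) ξ) j = ∑ k, a x j k * ξ k := by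
    simp [Matrix.ofLp_toEuclideanCLM, Matrix.mulVec, dotProduct]
  rw [this]
  simp only [RCLike.inner_apply, conj_trivial, Finset.mul_sum]
  exact Finset.sum_congr rfl fun k _ => by ring

theorem inner_opA_comm (h : IsLongRange a V μ) (x ξ η : Eucl n) :
    inner ℝ (opA a x ξ) η = inner ℝ ξ (opA a x η) := by
  have hs : (a x).IsHermitian := (h.posDef x).isHermitian
  have e : ∀ u v : Eucl n, inner ℝ (opA a x u) v = ∑ j, ∑ k, a x j k * u k * v j := by
    intro u v
    rw [opA, PiLp.inner_apply]
    refine Finset.sum_congr rfl fun j _ => ?_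
    have : (Matrix.toEuclideanCLM (𝕜 := ℝ) (a x) u) j = ∑ k, a x j k * u k := by
      simp [Matrix.ofLp_toEuclideanCLM, Matrix.mulVec, dotProduct]
    rw [this]
    simp only [RCLike.inner_apply, conj_trivial, Finset.mul_sum]
    exact Finset.sum_congr rfl fun k _ => by ring
  rw [real_inner_comm (opA a x η) ξ, e, e, Finset.sum_comm]
  refine Finset.sum_congr rfl fun j _ => Finset.sum_congr rfl fun k _ => ?_
  have : a x k j = a x j k := by
    have := hs.apply k j
    simpa using this.symm
  rw [this]; ring

theorem opA_pos (h : IsLongRange a V μ) (x : Eucl n) {ξ : Eucl n} (hξ : ξ ≠ 0) :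
    0 < inner ℝ (opA a x ξ) ξ := by
  have h1 := (h.posDef x).dotProduct_mulVec_pos (x := (fun i => ξ i)) (by
    intro h0; apply hξ; ext i; exact congrFun h0 i)
  rw [opA, PiLp.inner_apply]
  refine lt_of_lt_of_eq h1 ?_
  simp [Matrix.ofLp_toEuclideanCLM, dotProduct]

/-- Far out the matrix is within 1/2 of the identity; over the remaining compact set of positions
and unit momenta a positive continuous function has a positive lower bound. -/
theorem exists_elliptic (h : IsLongRange a V μ) :
    ∃ c : ℝ, 0 < c ∧ ∀ x ξ : Eucl n, c * ‖ξ‖ ^ 2 ≤ inner ℝ (opA a x ξ) ξ := by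
  obtain ⟨C, hC0, hC⟩ := (isSym_opA h).bound
  have hcoc : ∃ r : ℝ, ∀ x : Eucl n, r ≤ ‖x‖ → ‖opA a x - 1‖ ≤ 1 / 2 := by
    have ht : Tendsto (fun s : ℝ => C * s ^ (-μ)) atTop (𝓝 (C * 0)) :=
      (tendsto_rpow_neg_atTop h.mu_pos).const_mul C
    rw [mul_zero] at ht
    obtain ⟨r, hr⟩ := (ht.eventually_lt_const (by norm_num : (0 : ℝ) < 1 / 2)).exists_forall_of_atTop
    exact ⟨r, fun x hx => (hC x).trans (hr _ (hx.trans (norm_le_bracket x))).le⟩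
  obtain ⟨r, hr⟩ := hcoc
  have hcomp : IsCompact (Metric.closedBall (0 : Eucl n) r ×ˢ Metric.sphere (0 : Eucl n) 1) :=
    (isCompact_closedBall _ _).prod (isCompact_sphere _ _)
  have hA := (contDiff_opA h).continuous
  obtain ⟨c, hc0, hc⟩ := hcomp.exists_forall_le' (f := fun q : Eucl n × Eucl n =>
    inner ℝ (opA a q.1 q.2) q.2) (by fun_prop) (a := 0) (fun q hq => opA_pos h q.1 (by
      rintro h0
      have := hq.2
      simp [h0] at this))
  refine ⟨min c (1 / 2), by positivity, fun x ξ => ?_⟩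
  rcases eq_or_ne ξ 0 with rfl | hξ
  · simp
  have hξ0 : 0 < ‖ξ‖ := norm_pos_iff.2 hξ
  rcases le_or_gt r ‖x‖ with hx | hx
  · have h1 : inner ℝ (opA a x ξ) ξ = ‖ξ‖ ^ 2 + inner ℝ ((opA a x - 1) ξ) ξ := by
      simp [inner_sub_left]
    have h2 : |inner ℝ ((opA a x - 1) ξ) ξ| ≤ 1 / 2 * ‖ξ‖ * ‖ξ‖ := by
      refine (abs_real_inner_le_norm _ _).trans ?_
      gcongr
      exact ((opA a x - 1).le_opNorm ξ).trans (by gcongr; exact hr x hx)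
    rw [h1]
    have := (abs_le.1 h2).1
    have h3 : min c (1 / 2) * ‖ξ‖ ^ 2 ≤ 1 / 2 * ‖ξ‖ ^ 2 := by gcongr; exact min_le_right _ _
    nlinarith
  · have := hc (x, ‖ξ‖⁻¹ • ξ) ⟨by simpa using hx.le, by simp [norm_smul, hξ0.ne']⟩
    simp only [map_smul, real_inner_smul_left, real_inner_smul_right] at this
    calc min c (1 / 2) * ‖ξ‖ ^ 2 ≤ c * ‖ξ‖ ^ 2 := by gcongr; exact min_le_left _ _
      _ ≤ (‖ξ‖⁻¹ * (‖ξ‖⁻¹ * inner ℝ (opA a x ξ) ξ)) * ‖ξ‖ ^ 2 := by gcongr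
      _ = _ := by field_simp

theorem hasFDerivAt_kinetic (h : IsLongRange a V μ) (x ξ : Eucl n) :
    ∃ L : Eucl n × Eucl n →L[ℝ] ℝ, HasFDerivAt (fun q : Eucl n × Eucl n => kinetic a q.1 q.2) L (x, ξ) ∧
      ∀ v w, L (v, w) = inner ℝ (opB a x ξ ξ) v + inner ℝ (opA a x ξ) w := by
  have hd : HasFDerivAt (fun q : Eucl n × Eucl n => opA a q.1)
      ((fderiv ℝ (opA a) x).comp (ContinuousLinearMap.fst ℝ (Eucl n) (Eucl n))) (x, ξ) :=
    HasFDerivAt.comp (x, ξ) (f := Prod.fst) (g := opA a)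
      ((contDiff_opA h).differentiable (by simp) x).hasFDerivAt hasFDerivAt_fst
  have h1 := ((hd.clm_apply (hasFDerivAt_snd (p := (x, ξ)))).inner ℝ
    (hasFDerivAt_snd (p := (x, ξ)))).const_mul (1 / 2 : ℝ)
  refine ⟨_, h1.congr_of_eventuallyEq (Eventually.of_forall fun q => kinetic_eq q.1 q.2), ?_⟩
  intro v w
  have e1 := inner_forceMap (fderiv ℝ (opA a) x) ξ ξ v
  have e2 := inner_opA_comm h x ξ w
  simp only [opB, e1]
  simp [inner_add_left]
  rw [real_inner_comm ξ, ← e2]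
  ring

theorem hamiltonField_energy (h : IsLongRange a V μ) (κ : ℝ) (q : Eucl n × Eucl n) :
    hamiltonField (energy a (fun x => κ * V x)) q = fieldX (opA a) (opB a) (gradient V) κ q := by
  obtain ⟨x, ξ⟩ := q
  obtain ⟨L, hL, hLv⟩ := hasFDerivAt_kinetic h x ξ
  have hξ : HasFDerivAt (fun ξ' => energy a (fun x => κ * V x) x ξ')
      (L.comp (ContinuousLinearMap.inr ℝ (Eucl n) (Eucl n))) ξ := by
    have := (HasFDerivAt.comp ξ (f := fun ξ' => (x, ξ')) (g := fun q : Eucl n × Eucl n =>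
      kinetic a q.1 q.2) hL (hasFDerivAt_prodMk_right x ξ)).add_const (κ * V x)
    exact this
  have hx : HasFDerivAt (fun x' => energy a (fun x => κ * V x) x' ξ)
      (L.comp (ContinuousLinearMap.inl ℝ (Eucl n) (Eucl n)) + κ • fderiv ℝ V x) x := by
    have h1 := (HasFDerivAt.comp x (f := fun x' => (x', ξ)) (g := fun q : Eucl n × Eucl n =>
      kinetic a q.1 q.2) hL (hasFDerivAt_prodMk_left x ξ))
    exact h1.add (((h.smooth_V.differentiable (by simp) x).hasFDerivAt).const_mul κ)
  have gξ : HasGradientAt (fun ξ' => energy a (fun x => κ * V x) x ξ') (opA a x ξ) ξ := by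
    rw [hasGradientAt_iff_hasFDerivAt]
    refine hξ.congr_fderiv ?_
    ext v
    simp [hLv]
  have gx : HasGradientAt (fun x' => energy a (fun x => κ * V x) x' ξ)
      (opB a x ξ ξ + κ • gradient V x) x := by
    rw [hasGradientAt_iff_hasFDerivAt]
    refine hx.congr_fderiv ?_
    ext v
    simp [hLv, gradient]
  simp only [hamiltonField, fieldX]
  rw [gξ.gradient, gx.gradient, neg_add, sub_eq_add_neg]

/-- Along the flow the kinetic energy changes only by the work of `κ • gradient V`, and this
gradient grows at most linearly. Hence a multiple of 1 + |x|² + 2k grows at most exponentially, and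
by ellipticity it controls the phase point. -/
theorem exists_trajectory (h : IsLongRange a V μ) (κ : ℝ) (q : Eucl n × Eucl n) :
    ∃ γ : ℝ → Eucl n × Eucl n, γ 0 = q ∧
      ∀ t, HasDerivAt γ (fieldX (opA a) (opB a) (gradient V) κ (γ t)) t := by
  obtain ⟨c, hc0, hc⟩ := exists_elliptic h
  obtain ⟨CA, hCA0, hCA⟩ := (isSym_opA h).bound
  obtain ⟨Cg, hCg0, hCg⟩ := (isSym_gradient h).bound
  have hA : ∀ x, ‖opA a x‖ ≤ CA + 1 := fun x => by
    have h1 : ‖opA a x - 1‖ ≤ CA := (hCA x).trans (mul_le_of_le_one_right hCA0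
      (Real.rpow_le_one_of_one_le_of_nonpos (one_le_bracket x) (by linarith [h.mu_pos])))
    calc ‖opA a x‖ = ‖(opA a x - 1) + 1‖ := by simp
      _ ≤ CA + 1 := (norm_add_le _ _).trans (by
        gcongr; exact ContinuousLinearMap.norm_id_le)
  have hg : ∀ x, ‖gradient V x‖ ≤ Cg * (1 + ‖x‖) := fun x => by
    refine (hCg x).trans ?_
    gcongr
    calc bracket x ^ (-(μ - 1)) ≤ bracket x ^ (1 : ℝ) :=
          Real.rpow_le_rpow_of_exponent_le (one_le_bracket x) (by linarith [h.mu_pos])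
      _ ≤ 1 + ‖x‖ := by rw [Real.rpow_one]; exact bracket_le x
  -- Chosen so that both `1 ≤ M` and `1 ≤ M * c`; then `W` dominates 1 + |x|² + |ξ|².
  set M : ℝ := 1 + 1 / c with hM
  have hM0 : 0 < M := by positivity
  set W : Eucl n × Eucl n → ℝ := fun q => M * (1 + ‖q.1‖ ^ 2 + 2 * kinetic a q.1 q.2) with hW
  have hks : ContDiff ℝ ∞ (fun q : Eucl n × Eucl n => kinetic a q.1 q.2) := by
    have := contDiff_opA h
    simp only [kinetic_eq]
    exact contDiff_const.mul (ContDiff.inner ℝ (by fun_prop) contDiff_snd)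
  have hWs : ContDiff ℝ 1 W := by
    have h1 : ContDiff ℝ 1 (fun q : Eucl n × Eucl n => ‖q.1‖ ^ 2) := contDiff_fst.norm_sq ℝ
    have h2 : ContDiff ℝ 1 (fun q : Eucl n × Eucl n => kinetic a q.1 q.2) := hks.of_le (by simp)
    exact contDiff_const.mul ((contDiff_const.add h1).add (contDiff_const.mul h2))
  have hWlow : ∀ q : Eucl n × Eucl n, M * (1 + ‖q.1‖ ^ 2) + M * c * ‖q.2‖ ^ 2 ≤ W q := fun q => by
    have := hc q.1 q.2
    simp only [hW, kinetic_eq]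
    nlinarith
  have hMc : 1 ≤ M * c := by rw [hM, add_mul, one_div, inv_mul_cancel₀ hc0.ne']; linarith
  have hM1 : 1 ≤ M := by rw [hM]; linarith [one_div_pos.2 hc0]
  have hWlow' : ∀ q : Eucl n × Eucl n, 1 + ‖q.1‖ ^ 2 + ‖q.2‖ ^ 2 ≤ W q := fun q => by
    refine le_trans ?_ (hWlow q)
    nlinarith [sq_nonneg ‖q.1‖, sq_nonneg ‖q.2‖]
  refine exists_global_of_growth (V := W) (C := M * ((CA + 1) * 2 + 2 * |κ| * (CA + 1) * Cg * 2))
    ((contDiff_fieldX_uncurry (contDiff_opA h) (isSym_opB h).1 (isSym_gradient h).1).comp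
      (contDiff_const.prodMk contDiff_id)) hWs ?_ (by positivity) ?_ q
  · rintro ⟨x, ξ⟩
    obtain ⟨L, hL, hLv⟩ := hasFDerivAt_kinetic h x ξ
    have hder := (((hasFDerivAt_fst (𝕜 := ℝ) (p := (x, ξ))).norm_sq.const_add 1).add
      (hL.const_mul 2)).const_mul M
    have e0 : fderiv ℝ W (x, ξ) (fieldX (opA a) (opB a) (gradient V) κ (x, ξ)) =
        M * (2 * inner ℝ x (opA a x ξ) - 2 * κ * inner ℝ (opA a x ξ) (gradient V x)) := by
      rw [HasFDerivAt.fderiv (f := W) hder]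
      have : L (fieldX (opA a) (opB a) (gradient V) κ (x, ξ)) =
          - κ * inner ℝ (opA a x ξ) (gradient V x) := by
        rw [fieldX, hLv, inner_sub_right, inner_neg_right, real_inner_smul_right]
        rw [real_inner_comm (opA a x ξ)]
        ring
      have e1 : (fieldX (opA a) (opB a) (gradient V) κ (x, ξ)).1 = opA a x ξ := rfl
      generalize fieldX (opA a) (opB a) (gradient V) κ (x, ξ) = Z at this e1 ⊢
      simp [this, e1]
      ring
    show |fderiv ℝ W (x, ξ) (fieldX (opA a) (opB a) (gradient V) κ (x, ξ))| ≤ _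
    rw [e0, abs_mul, abs_of_pos hM0]
    have hAx : ‖opA a x ξ‖ ≤ (CA + 1) * ‖ξ‖ := ((opA a x).le_opNorm ξ).trans (by gcongr; exact hA x)
    have t1 : |inner ℝ x (opA a x ξ)| ≤ ‖x‖ * ((CA + 1) * ‖ξ‖) :=
      (abs_real_inner_le_norm _ _).trans (by gcongr)
    have t2 : |inner ℝ (opA a x ξ) (gradient V x)| ≤ ((CA + 1) * ‖ξ‖) * (Cg * (1 + ‖x‖)) :=
      (abs_real_inner_le_norm _ _).trans (by gcongr; exact hg x)
    have hwl := hWlow' (x, ξ)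
    simp only at hwl
    have q1 : ‖x‖ * ‖ξ‖ ≤ W (x, ξ) := by nlinarith [sq_nonneg (‖x‖ - ‖ξ‖)]
    have q2 : ‖ξ‖ * (1 + ‖x‖) ≤ 2 * W (x, ξ) := by
      nlinarith [sq_nonneg (‖x‖ - ‖ξ‖), sq_nonneg (‖ξ‖ - 1)]
    rw [mul_assoc M]
    refine mul_le_mul_of_nonneg_left ?_ hM0.le
    calc |2 * inner ℝ x (opA a x ξ) - 2 * κ * inner ℝ (opA a x ξ) (gradient V x)|
        ≤ |2 * inner ℝ x (opA a x ξ)| + |2 * κ * inner ℝ (opA a x ξ) (gradient V x)| := abs_sub _ _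
      _ = 2 * |inner ℝ x (opA a x ξ)| + 2 * |κ| * |inner ℝ (opA a x ξ) (gradient V x)| := by
          simp [abs_mul]
      _ ≤ 2 * (‖x‖ * ((CA + 1) * ‖ξ‖)) + 2 * |κ| * (((CA + 1) * ‖ξ‖) * (Cg * (1 + ‖x‖))) := by
          gcongr
      _ = (CA + 1) * 2 * (‖x‖ * ‖ξ‖) + 2 * |κ| * (CA + 1) * Cg * (‖ξ‖ * (1 + ‖x‖)) := by ring
      _ ≤ (CA + 1) * 2 * W (x, ξ) + 2 * |κ| * (CA + 1) * Cg * (2 * W (x, ξ)) := by gcongr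
      _ = _ := by ring
  · rintro ⟨x, ξ⟩
    have hwl := hWlow' (x, ξ)
    simp only at hwl
    rw [Prod.norm_mk, max_le_iff]
    constructor
    · nlinarith [sq_nonneg (‖x‖ - 1), sq_nonneg ‖ξ‖]
    · nlinarith [sq_nonneg (‖ξ‖ - 1), sq_nonneg ‖x‖]

/-- The long-range system of a Hamiltonian. -/
def sysOf (h : IsLongRange a V μ) : LRSys n where
  A := opA a
  B := opB a
  g := gradient V
  -- Lowering the rate only weakens the hypotheses. With a rate below 1, the integral of `(1 + |r|)
  -- ^ (-μ)` grows like the power `1 - μ`, without a logarithmic case.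
  μ := min μ (1 / 2)
  μ_pos := lt_min h.mu_pos (by norm_num)
  μ_lt := (min_le_right _ _).trans_lt (by norm_num)
  symA := (isSym_opA h).mono (min_le_left _ _)
  symB := (isSym_opB h).mono (by gcongr; exact min_le_left _ _)
  symg := (isSym_gradient h).mono (by gcongr; exact min_le_left _ _)
  φ κ t q := flow (energy a (fun x => κ * V x)) t q
  φ_zero κ q := (isTrajectory_flow (by
    obtain ⟨γ, h0, hγ⟩ := exists_trajectory h κ q
    exact ⟨γ, h0, fun t => by rw [hamiltonField_energy h]; exact hγ t⟩)).1
  φ_deriv κ q t := by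
    have := (isTrajectory_flow (p := energy a (fun x => κ * V x)) (q := q) (by
      obtain ⟨γ, h0, hγ⟩ := exists_trajectory h κ q
      exact ⟨γ, h0, fun t => by rw [hamiltonField_energy h]; exact hγ t⟩)).2 t
    rwa [hamiltonField_energy h] at this
  φ_smooth := by
    have htr : ∀ κ q, IsTrajectory (energy a (fun x => κ * V x)) q
        (fun t => flow (energy a (fun x => κ * V x)) t q) := fun κ q => isTrajectory_flow (by
      obtain ⟨γ, h0, hγ⟩ := exists_trajectory h κ q
      exact ⟨γ, h0, fun t => by rw [hamiltonField_energy h]; exact hγ t⟩)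
    have hfs := contDiff_fieldX_uncurry (contDiff_opA h) (isSym_opB h).1 (isSym_gradient h).1
    -- The coupling constant is adjoined to phase space as a frozen coordinate, so smoothness in it
    -- comes from smoothness in the initial point.
    have := flow_contDiff (F := (Eucl n × Eucl n) × ℝ)
      (X := fun p => (fieldX (opA a) (opB a) (gradient V) p.2 p.1, 0))
      (φ := fun t p => (flow (energy a (fun x => p.2 * V x)) t p.1, p.2))
      ((hfs.comp (contDiff_snd.prodMk contDiff_fst)).prodMk contDiff_const)
      (fun p => Prod.ext (htr p.2 p.1).1 rfl)
      (fun p t => by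
        have := (htr p.2 p.1).2 t
        rw [hamiltonField_energy h] at this
        exact this.prodMk (hasDerivAt_const t p.2))
    exact (contDiff_fst.comp this).comp
      (f := fun p : ℝ × ℝ × (Eucl n × Eucl n) => (p.2.1, (p.2.2, p.1))) (by fun_prop)

theorem sysOf_φ_one (h : IsLongRange a V μ) (t : ℝ) (q : Eucl n × Eucl n) :
    (sysOf h).φ 1 t q = flow (energy a V) t q := by
  show flow (energy a fun x => 1 * V x) t q = _
  simp only [one_mul]

theorem sysOf_φ_zero (h : IsLongRange a V μ) (t : ℝ) (q : Eucl n × Eucl n) :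
    (sysOf h).φ 0 t q = flow (kinetic a) t q := by
  have : energy a (fun x => 0 * V x) = kinetic a := by
    funext x ξ; simp [energy]
  show flow (energy a fun x => 0 * V x) t q = _
  rw [this]

end LongRangeFlow

end

noncomputable section

namespace LongRangeFlow

/-! ### Scaled symbols, index spaces and weights -/

open BoundedContinuousFunction

section Scaled

variable {n : ℕ} {T : Type} [TopologicalSpace T] {G : Type} [NormedAddCommGroup G] [NormedSpace ℝ G]

/-- The superposition operator `u ↦ ℓ^ν b(ℓ u)`. -/
def scl (ℓ : T → ℝ) (ν : ℝ) (b : Eucl n → G) (u : T →ᵇ Eucl n) : T →ᵇ G :=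
  nem (fun t x => ℓ t ^ ν • b (ℓ t • x)) u

theorem mem_annulus {om : T →ᵇ Eucl n} (hom : ∀ t, ‖om t‖ = 1) {u : T →ᵇ Eucl n}
    (hu : u ∈ Metric.ball (-om) (1 / 2)) (t : T) :
    (t, u t) ∈ {q : T × Eucl n | 1 / 2 ≤ ‖q.2‖ ∧ ‖q.2‖ ≤ 2} := by
  have h1 : ‖u t + om t‖ < 1 / 2 := by
    rw [Metric.mem_ball, dist_eq_norm, sub_neg_eq_add] at hu
    exact ((u + om).norm_coe_le_norm t).trans_lt hu
  have h2 : ‖om t‖ ≤ ‖u t + om t‖ + ‖u t‖ := by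
    calc ‖om t‖ = ‖(u t + om t) - u t‖ := by congr 1; abel
      _ ≤ _ := norm_sub_le _ _
  have h3 : ‖u t‖ ≤ ‖u t + om t‖ + ‖om t‖ := by
    calc ‖u t‖ = ‖(u t + om t) - om t‖ := by congr 1; abel
      _ ≤ _ := norm_sub_le _ _
  rw [hom] at h2 h3
  exact ⟨by simp only; linarith, by simp only; linarith⟩

theorem scl_contDiffOn {ℓ : T → ℝ} (hℓ : Continuous ℓ) (h1 : ∀ t, 1 ≤ ℓ t) {om : T →ᵇ Eucl n}
    (hom : ∀ t, ‖om t‖ = 1) {b : Eucl n → G} {ν : ℝ} (hb : IsSym b ν) :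
    ContDiffOn ℝ ∞ (scl ℓ ν b) (Metric.ball (-om) (1 / 2)) :=
  nem_contDiffOn Metric.isOpen_ball (fun _ hu t => mem_annulus hom hu t)
    fun N => hb.unifSmooth hℓ h1 N

theorem scl_apply {ℓ : T → ℝ} (hℓ : Continuous ℓ) (h1 : ∀ t, 1 ≤ ℓ t) {om : T →ᵇ Eucl n}
    (hom : ∀ t, ‖om t‖ = 1) {b : Eucl n → G} {ν : ℝ} (hb : IsSym b ν) {u : T →ᵇ Eucl n}
    (hu : u ∈ Metric.ball (-om) (1 / 2)) (t : T) :
    scl ℓ ν b u t = ℓ t ^ ν • b (ℓ t • u t) :=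
  nem_apply (hb.unifSmooth hℓ h1 0) (fun t => mem_annulus hom hu t) t

/-- Multiplication of a bounded function by a bounded scalar function. -/
def bcfMul : (T →ᵇ ℝ) →L[ℝ] (T →ᵇ G) →L[ℝ] (T →ᵇ G) := bcfBilin (ContinuousLinearMap.lsmul ℝ ℝ)

@[simp] theorem bcfMul_apply (c : T →ᵇ ℝ) (u : T →ᵇ G) (t : T) : bcfMul c u t = c t • u t := rfl

/-- Pointwise application. -/
def bcfApp {G' : Type} [NormedAddCommGroup G'] [NormedSpace ℝ G'] :
    (T →ᵇ (G →L[ℝ] G')) →L[ℝ] (T →ᵇ G) →L[ℝ] (T →ᵇ G') :=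
  bcfBilin (ContinuousLinearMap.id ℝ (G →L[ℝ] G'))

@[simp] theorem bcfApp_apply {G' : Type} [NormedAddCommGroup G'] [NormedSpace ℝ G']
    (M : T →ᵇ (G →L[ℝ] G')) (u : T →ᵇ G) (t : T) : bcfApp M u t = M t (u t) := rfl

theorem norm_bcfMul_le {c : T →ᵇ ℝ} {C : ℝ} (hC : 0 ≤ C) (hc : ∀ t, |c t| ≤ C) (u : T →ᵇ G) :
    ‖bcfMul c u‖ ≤ C * ‖u‖ := by
  refine (norm_le (by positivity)).2 fun t => ?_
  rw [bcfMul_apply, norm_smul, Real.norm_eq_abs]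
  exact mul_le_mul (hc t) (u.norm_coe_le_norm t) (norm_nonneg _) hC

end Scaled

section Curves

variable {E G T : Type} [NormedAddCommGroup E] [NormedSpace ℝ E] [FiniteDimensional ℝ E]
  [NormedAddCommGroup G] [NormedSpace ℝ G] [TopologicalSpace T]

/-- Exchange a linear map into bounded functions for a bounded family of linear maps. -/
def bcfSwap : (E →L[ℝ] (T →ᵇ G)) →L[ℝ] (T →ᵇ (E →L[ℝ] G)) := by
  have key : ∀ (L : E →L[ℝ] (T →ᵇ G)) (t : T), ‖(evalCLM ℝ t).comp L‖ ≤ ‖L‖ := fun L t =>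
    ContinuousLinearMap.opNorm_le_bound _ (norm_nonneg _) fun x =>
      ((L x).norm_coe_le_norm t).trans (L.le_opNorm x)
  refine LinearMap.mkContinuous
    { toFun := fun L => BoundedContinuousFunction.ofNormedAddCommGroup
        (fun t => (evalCLM ℝ t).comp L) ?_ ‖L‖ (key L)
      map_add' := fun L L' => by ext t x; rfl
      map_smul' := fun c L => by ext t x; rfl } 1 fun L => ?_
  · rw [continuous_clm_apply]
    intro x
    exact (L x).continuous
  · rw [one_mul]
    exact (BoundedContinuousFunction.norm_le (norm_nonneg _)).2 (key L)

theorem contDiff_bcfSwap : ContDiff ℝ ∞ (fun L : E →L[ℝ] (T →ᵇ G) => bcfSwap L) := by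
  fun_prop

theorem hasFDerivAt_eval {𝒳 : E → (T →ᵇ G)} {x : E} (h : DifferentiableAt ℝ 𝒳 x) (t : T) :
    HasFDerivAt (fun x => 𝒳 x t) (bcfSwap (fderiv ℝ 𝒳 x) t) x :=
  ((evalCLM ℝ (β := G) t).hasFDerivAt.comp x h.hasFDerivAt)

/-- Evaluation of a smooth map into bounded functions gives a uniformly smooth family. -/
theorem unifSmooth_eval {ρ r : ℝ} (hr : r < ρ) (N : ℕ) :
    ∀ {G : Type} [NormedAddCommGroup G] [NormedSpace ℝ G] {𝒳 : E → (T →ᵇ G)},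
      ContDiffOn ℝ ∞ 𝒳 (Metric.ball 0 ρ) →
      UnifSmooth {q : T × E | ‖q.2‖ < r} N (fun t x => 𝒳 x t) := by
  have hb : ∀ {q : T × E}, q ∈ {q : T × E | ‖q.2‖ < r} → q.2 ∈ Metric.ball (0 : E) ρ := by
    intro q hq
    rw [mem_ball_zero_iff]
    exact lt_trans hq hr
  have base : ∀ {G : Type} [NormedAddCommGroup G] [NormedSpace ℝ G] {𝒳 : E → (T →ᵇ G)},
      ContDiffOn ℝ ∞ 𝒳 (Metric.ball 0 ρ) →
      ContinuousOn (fun q : T × E => 𝒳 q.2 q.1) {q : T × E | ‖q.2‖ < r} ∧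
        ∃ C, ∀ q ∈ {q : T × E | ‖q.2‖ < r}, ‖𝒳 q.2 q.1‖ ≤ C := by
    intro G _ _ 𝒳 h
    constructor
    · have h1 : ContinuousOn (fun q : T × E => (𝒳 q.2, q.1)) {q : T × E | ‖q.2‖ < r} :=
        (h.continuousOn.comp continuousOn_snd fun q hq => hb hq).prodMk continuousOn_fst
      exact (continuous_eval (F := T →ᵇ G)).comp_continuousOn h1
    · obtain ⟨C, hC⟩ := (isCompact_closedBall (0 : E) r).exists_bound_of_continuousOn
        (f := 𝒳) (h.continuousOn.mono (Metric.closedBall_subset_ball hr))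
      refine ⟨C, fun q hq => ((𝒳 q.2).norm_coe_le_norm q.1).trans (hC q.2 ?_)⟩
      rw [mem_closedBall_zero_iff]
      exact le_of_lt hq
  induction N with
  | zero => intro G _ _ 𝒳 h; exact base h
  | succ N ih =>
    intro G _ _ 𝒳 h
    refine ⟨base h, fun t x => bcfSwap (fderiv ℝ 𝒳 x) t, fun q hq => ?_, ?_⟩
    · exact hasFDerivAt_eval ((h.differentiableOn (by simp)).differentiableAt
        (Metric.isOpen_ball.mem_nhds (hb hq))) q.1
    · exact ih (𝒳 := fun x => bcfSwap (fderiv ℝ 𝒳 x))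
        (contDiff_bcfSwap.comp_contDiffOn
          (h.fderiv_of_isOpen (m := ∞) Metric.isOpen_ball (by simp)))

end Curves

/-! ### Indices -/

/-- Scaled data of a trajectory: radius, coupling, final scaled time, scaled starting depth and
direction. -/
structure Idx (n : ℕ) (K : ℝ) where
  R : ℝ
  κ : ℝ
  σ : ℝ
  L : ℝ
  dir : Eucl n
  one_le_R : 1 ≤ R
  κ_nonneg : 0 ≤ κ
  -- This and the next inequality keep `κ * R ^ 2 * (1 + |s|) ^ 2` bounded for `s` between `σ` and
  -- 0. Since the position has size R(1 + |s|), the force κ∇V is then of the same order as the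
  -- metric force.
  κR : κ * R ^ 2 ≤ 1
  κRσ : κ * R ^ 2 * σ ^ 2 ≤ K
  one_le_L : 1 ≤ L
  σ_le : σ ≤ -L
  norm_dir : ‖dir‖ = 1

/-- With the discrete topology every function of the index is continuous. A bounded continuous
function on `Idx n K × ℝ` is thus an arbitrary family of continuous curves with a common bound, and
all estimates become uniform in the index. -/
instance (n : ℕ) (K : ℝ) : TopologicalSpace (Idx n K) := ⊥
instance (n : ℕ) (K : ℝ) : DiscreteTopology (Idx n K) := ⟨rfl⟩

variable {n : ℕ} {K : ℝ}

/-- Index and scaled time. -/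
abbrev IT (n : ℕ) (K : ℝ) : Type := Idx n K × ℝ

theorem continuous_idx {X : Type} [TopologicalSpace X] (f : Idx n K → X) :
    Continuous (fun t : IT n K => f t.1) :=
  continuous_of_discreteTopology.comp continuous_fst

/-- Scaled time clamped to `[σ, 0]`. -/
def cl (t : IT n K) : ℝ := max t.1.σ (min t.2 0)

theorem Idx.σ_nonpos (i : Idx n K) : i.σ ≤ -1 := i.σ_le.trans (by linarith [i.one_le_L])

theorem continuous_cl : Continuous (cl : IT n K → ℝ) :=
  (continuous_idx Idx.σ).max (continuous_snd.min continuous_const)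

theorem cl_mem (t : IT n K) : cl t ∈ Icc t.1.σ 0 :=
  ⟨le_max_left _ _, max_le (t.1.σ_nonpos.trans (by norm_num)) (min_le_right _ _)⟩

theorem cl_eq {i : Idx n K} {s : ℝ} (hs : s ∈ Icc i.σ 0) : cl (i, s) = s := by
  simp [cl, hs.1, hs.2]

/-- The weight `1 + |s|`. -/
def wt (t : IT n K) : ℝ := 1 - cl t

theorem one_le_wt (t : IT n K) : 1 ≤ wt t := by
  have := (cl_mem t).2
  simp only [wt]; linarith

theorem wt_pos (t : IT n K) : 0 < wt t := zero_lt_one.trans_le (one_le_wt t)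

theorem wt_eq {i : Idx n K} {s : ℝ} (hs : s ∈ Icc i.σ 0) : wt (i, s) = 1 - s := by
  rw [wt, cl_eq hs]

theorem continuous_wt : Continuous (wt : IT n K → ℝ) := continuous_const.sub continuous_cl

/-- The true distance scale. -/
def ell (t : IT n K) : ℝ := t.1.R * wt t

theorem continuous_ell : Continuous (ell : IT n K → ℝ) := (continuous_idx Idx.R).mul continuous_wt

theorem one_le_ell (t : IT n K) : 1 ≤ ell t :=
  one_le_mul_of_one_le_of_one_le t.1.one_le_R (one_le_wt t)

/-- The direction, as a bounded function. -/
def om : IT n K →ᵇ Eucl n :=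
  BoundedContinuousFunction.ofNormedAddCommGroup (fun t => t.1.dir) (continuous_idx Idx.dir) 1
    fun t => t.1.norm_dir.le

@[simp] theorem om_apply (t : IT n K) : (om t : Eucl n) = t.1.dir := rfl

theorem norm_om (t : IT n K) : ‖(om t : Eucl n)‖ = 1 := t.1.norm_dir

/-- The inverse weight. -/
def iw : IT n K →ᵇ ℝ :=
  BoundedContinuousFunction.ofNormedAddCommGroup (fun t => (wt t)⁻¹)
    (continuous_wt.inv₀ fun t => (wt_pos t).ne') 1 fun t => by
      rw [Real.norm_eq_abs, abs_of_pos (inv_pos.2 (wt_pos t))]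
      exact inv_le_one_of_one_le₀ (one_le_wt t)

/-- The quotient of clamped time and weight. -/
def cw : IT n K →ᵇ ℝ :=
  BoundedContinuousFunction.ofNormedAddCommGroup (fun t => cl t / wt t)
    (continuous_cl.div continuous_wt fun t => (wt_pos t).ne') 1 fun t => by
      rw [Real.norm_eq_abs, abs_div, abs_of_pos (wt_pos t), div_le_one (wt_pos t),
        abs_of_nonpos (cl_mem t).2, wt]
      linarith

@[simp] theorem cw_apply (t : IT n K) : cw t = cl t / wt t := rfl

theorem abs_cw_le (t : IT n K) : |cw t| ≤ 1 := by
  rw [cw_apply, abs_div, abs_of_pos (wt_pos t), div_le_one (wt_pos t),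
    abs_of_nonpos (cl_mem t).2, wt]
  linarith

/-- The scaled coupling. -/
def rh : IT n K →ᵇ ℝ :=
  BoundedContinuousFunction.ofNormedAddCommGroup (fun t => t.1.κ * t.1.R ^ 2 * wt t ^ 2)
    ((continuous_idx fun i => i.κ * i.R ^ 2).mul (continuous_wt.pow 2)) (2 + 2 * K) fun t => by
      have h0 : 0 ≤ t.1.κ * t.1.R ^ 2 := mul_nonneg t.1.κ_nonneg (sq_nonneg _)
      rw [Real.norm_eq_abs, abs_of_nonneg (by positivity)]
      have h1 : wt t ^ 2 ≤ 2 + 2 * t.1.σ ^ 2 := by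
        have := (cl_mem t).1
        have := (cl_mem t).2
        have h3 : cl t ^ 2 ≤ t.1.σ ^ 2 := by nlinarith
        rw [wt]; nlinarith [sq_nonneg (1 + cl t)]
      have := t.1.κR
      have := t.1.κRσ
      nlinarith

@[simp] theorem rh_apply (t : IT n K) : rh t = t.1.κ * t.1.R ^ 2 * wt t ^ 2 := rfl

theorem integral_weight {p a b : ℝ} (hp : p ≠ 1) (ha : a ≤ b) (hb : b ≤ 0) :
    ∫ r in a..b, (1 + |r|) ^ (-p) = ((1 - a) ^ (1 - p) - (1 - b) ^ (1 - p)) / (1 - p) := by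
  have hp' : 1 - p ≠ 0 := sub_ne_zero.2 hp.symm
  have h1 : ∀ r ∈ uIcc a b, HasDerivAt (fun r => -((1 - r) ^ (1 - p) / (1 - p)))
      ((1 + |r|) ^ (-p)) r := by
    intro r hr
    rw [uIcc_of_le ha] at hr
    have hr0 : r ≤ 0 := hr.2.trans hb
    have h2 : HasDerivAt (fun r : ℝ => 1 - r) (-1) r := (hasDerivAt_id r).const_sub 1
    have h3 := (h2.rpow_const (p := 1 - p) (Or.inl (by linarith))).div_const (1 - p)
    refine h3.neg.congr_deriv ?_
    rw [abs_of_nonpos hr0, show 1 - p - 1 = -p by ring, ← sub_eq_add_neg]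
    field_simp
  rw [intervalIntegral.integral_eq_sub_of_hasDerivAt h1]
  · field_simp; ring
  · apply Continuous.intervalIntegrable
    exact Continuous.rpow_const (by fun_prop) fun r => Or.inl (by positivity)

theorem continuous_weight (p : ℝ) : Continuous (fun r : ℝ => (1 + |r|) ^ (-p)) :=
  Continuous.rpow_const (by fun_prop) fun r => Or.inl (by positivity)

theorem abs_weight (p r : ℝ) : |(1 + |r|) ^ (-p)| = (1 + |r|) ^ (-p) :=
  abs_of_nonneg (by positivity)

end LongRangeFlow

end

noncomputable section

namespace LongRangeFlow

/-! ### The family of incoming reference trajectories -/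

open BoundedContinuousFunction
open scoped NNReal

variable {n : ℕ} {K : ℝ}

/-- Bounded vector fields along indexed scaled time. -/
abbrev BE (n : ℕ) (K : ℝ) : Type := IT n K →ᵇ Eucl n

/-- The rescaled position determined by the rescaled drift and the momentum. -/
def Yhat : BE n K × BE n K →L[ℝ] BE n K :=
  ContinuousLinearMap.fst ℝ (BE n K) (BE n K) +
    (bcfMul cw).comp (ContinuousLinearMap.snd ℝ (BE n K) (BE n K))

theorem Yhat_eq (x : BE n K × BE n K) : Yhat x = x.1 + bcfMul cw x.2 := rfl

theorem norm_Yhat_le (x : BE n K × BE n K) : ‖Yhat x‖ ≤ 2 * ‖x‖ := by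
  rw [Yhat_eq]
  have h1 : ‖bcfMul cw x.2‖ ≤ 1 * ‖x.2‖ := norm_bcfMul_le zero_le_one abs_cw_le x.2
  have h2 := norm_fst_le x
  have h3 := norm_snd_le x
  have := norm_add_le x.1 (bcfMul cw x.2)
  linarith

/-- The rescaled force. -/
def forceN (S : LRSys n) (p : BE n K × BE n K) : BE n K :=
  bcfApp (bcfApp (scl ell (S.μ + 1) S.B p.1) p.2) p.2 + bcfMul rh (scl ell (S.μ - 1) S.g p.1)

theorem contDiffOn_forceN (S : LRSys n) :
    ContDiffOn ℝ ∞ (forceN S : BE n K × BE n K → BE n K)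
      {p | p.1 ∈ Metric.ball (-om) (1 / 2)} := by
  have hB : ContDiffOn ℝ ∞ (fun p : BE n K × BE n K => scl ell (S.μ + 1) S.B p.1)
      {p | p.1 ∈ Metric.ball (-om) (1 / 2)} :=
    (scl_contDiffOn continuous_ell one_le_ell norm_om S.symB).comp contDiffOn_fst fun _ h => h
  have hg : ContDiffOn ℝ ∞ (fun p : BE n K × BE n K => scl ell (S.μ - 1) S.g p.1)
      {p | p.1 ∈ Metric.ball (-om) (1 / 2)} :=
    (scl_contDiffOn continuous_ell one_le_ell norm_om S.symg).comp contDiffOn_fst fun _ h => h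
  unfold forceN
  fun_prop

/-- The nonlinearity of the integral equation for the reference trajectories. -/
def refN (S : LRSys n) (x : BE n K × BE n K) : BE n K × BE n K :=
  -- In scaled time the drift u = y/R - sη satisfies u' = (A - 1)η - sη' with η' = -R(B(η,η) + κg);
  -- `cw` carries the factor s. This drift grows more slowly than s, so the position stays near the
  -- ray s·η.
  (bcfApp (scl ell S.μ (fun x => S.A x - 1) (Yhat x)) x.2 + bcfMul cw (forceN S (Yhat x, x.2)),
    forceN S (Yhat x, x.2))

theorem contDiffOn_refN (S : LRSys n) :
    ContDiffOn ℝ ∞ (refN S : BE n K × BE n K → BE n K × BE n K)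
      {x | Yhat x ∈ Metric.ball (-om) (1 / 2)} := by
  have hA : ContDiffOn ℝ ∞ (fun x : BE n K × BE n K => scl ell S.μ (fun x => S.A x - 1) (Yhat x))
      {x | Yhat x ∈ Metric.ball (-om) (1 / 2)} :=
    (scl_contDiffOn continuous_ell one_le_ell norm_om S.symA).comp
      (Yhat (n := n) (K := K)).contDiff.contDiffOn fun _ h => h
  have hP : ContDiffOn ℝ ∞ (fun x : BE n K × BE n K => forceN S (Yhat x, x.2))
      {x | Yhat x ∈ Metric.ball (-om) (1 / 2)} :=
    (contDiffOn_forceN S).comp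
      (((Yhat (n := n) (K := K)).contDiff.prodMk contDiff_snd).contDiffOn) fun _ h => h
  unfold refN
  fun_prop

/-- The small factor, cut off below the radius `R₀`. -/
def gf (μ R₀ : ℝ) (i : Idx n K) : ℝ := open Classical in if R₀ ≤ i.R then i.R ^ (-μ) else 0

theorem gf_eq {μ R₀ : ℝ} {i : Idx n K} (h : R₀ ≤ i.R) : gf μ R₀ i = i.R ^ (-μ) := if_pos h

theorem abs_gf_le {μ R₀ : ℝ} (hμ : 0 < μ) (hR : 1 ≤ R₀) (i : Idx n K) :
    |gf μ R₀ i| ≤ R₀ ^ (-μ) := by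
  have h0 : 0 < R₀ := by linarith
  rw [gf]
  split_ifs with h
  · rw [abs_of_nonneg (Real.rpow_nonneg (h0.le.trans h) _)]
    exact Real.rpow_le_rpow_of_nonpos h0 h (by linarith)
  · simp only [abs_zero]; positivity

theorem abs_integral_weight_le {μ c : ℝ} (hμ : μ < 1) (hc : c ≤ 0) :
    |(∫ r in (0 : ℝ)..c, |(1 + |r|) ^ (-μ)|)| ≤ (1 - c) ^ (1 - μ) / (1 - μ) := by
  simp only [abs_weight]
  rw [intervalIntegral.integral_symm, abs_neg, integral_weight hμ.ne hc le_rfl]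
  have h1 : (1 : ℝ) ≤ (1 - c) ^ (1 - μ) := Real.one_le_rpow (by linarith) (by linarith)
  rw [sub_zero, Real.one_rpow, abs_of_nonneg (div_nonneg (by linarith) (by linarith))]
  exact div_le_div_of_nonneg_right (by linarith) (by linarith)

theorem abs_integral_weight_le' {μ b c : ℝ} (hμ : 0 < μ) (hb : b ≤ 0) (hc : c ≤ b) :
    |(∫ r in b..c, |(1 + |r|) ^ (-(1 + μ))|)| ≤ (1 - b) ^ (-μ) / μ := by
  simp only [abs_weight]
  rw [intervalIntegral.integral_symm, abs_neg, integral_weight (by linarith) hc hb]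
  have e : ((1 - c) ^ (1 - (1 + μ)) - (1 - b) ^ (1 - (1 + μ))) / (1 - (1 + μ)) =
      ((1 - b) ^ (-μ) - (1 - c) ^ (-μ)) / μ := by
    rw [show 1 - (1 + μ) = -μ by ring, div_neg, ← neg_div]; ring
  have h1 : (1 - c) ^ (-μ) ≤ (1 - b) ^ (-μ) :=
    Real.rpow_le_rpow_of_nonpos (by linarith) (by linarith) (by linarith)
  have h2 : 0 ≤ (1 - c) ^ (-μ) := Real.rpow_nonneg (by linarith) _
  rw [e, abs_of_nonneg (div_nonneg (by linarith) hμ.le)]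
  exact div_le_div_of_nonneg_right (by linarith) hμ.le

theorem continuous_gf_wt (μ R₀ : ℝ) : Continuous (fun t : IT n K => gf μ R₀ t.1 / wt t) :=
  (continuous_idx (gf μ R₀)).div continuous_wt fun t => (wt_pos t).ne'

/-- Division by the weight absorbs the growth of the drift, whose size is the power `1 - μ` of the
weight. The small constant comes from `gf`, which vanishes for radii below `R₀`: one operator is
thereby small on all indices, and the function space does not depend on `R₀`. -/
theorem refJ_bound₁ {μ R₀ : ℝ} (hμ : 0 < μ) (hμ1 : μ < 1) (hR : 1 ≤ R₀) (t : IT n K) :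
    |gf μ R₀ t.1 / wt t| * |(∫ r in (0 : ℝ)..cl t, |(1 + |r|) ^ (-μ)|)| ≤
      R₀ ^ (-μ) * (1 / (1 - μ)) := by
  have hw := wt_pos t
  have h1 := abs_gf_le hμ hR t.1
  have h2 := abs_integral_weight_le hμ1 (cl_mem t).2
  have h3 : (1 - cl t) ^ (1 - μ) ≤ wt t := by
    have := Real.rpow_le_rpow_of_exponent_le (one_le_wt t) (show 1 - μ ≤ 1 by linarith)
    rwa [Real.rpow_one] at this
  have h4 : 0 < 1 - μ := by linarith
  rw [abs_div, abs_of_pos hw]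
  calc |gf μ R₀ t.1| / wt t * |(∫ r in (0 : ℝ)..cl t, |(1 + |r|) ^ (-μ)|)|
      ≤ R₀ ^ (-μ) / wt t * (wt t / (1 - μ)) := by
        gcongr
        exact h2.trans (by gcongr)
    _ = _ := by field_simp

theorem refJ_bound₂ {μ R₀ : ℝ} (hμ : 0 < μ) (hR : 1 ≤ R₀) (t : IT n K) :
    |gf μ R₀ t.1| * |(∫ r in (0 : ℝ)..cl t, |(1 + |r|) ^ (-(1 + μ))|)| ≤ R₀ ^ (-μ) * (1 / μ) := by
  have h1 := abs_gf_le hμ hR t.1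
  have h2 := abs_integral_weight_le' hμ le_rfl (cl_mem t).2
  rw [sub_zero, Real.one_rpow] at h2
  gcongr

/-- The integral operator for the reference trajectories. -/
def refJ {μ R₀ : ℝ} (hμ : 0 < μ) (hμ1 : μ < 1) (hR : 1 ≤ R₀) :
    BE n K × BE n K →L[ℝ] BE n K × BE n K :=
  ((bcfInt (fun t : IT n K => gf μ R₀ t.1 / wt t) cl (fun _ => 0) (fun r => (1 + |r|) ^ (-μ))
      (continuous_gf_wt μ R₀) continuous_cl continuous_const (continuous_weight μ)
      (R₀ ^ (-μ) * (1 / (1 - μ))) (refJ_bound₁ hμ hμ1 hR)).comp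
        (ContinuousLinearMap.fst ℝ (BE n K) (BE n K))).prod
    (-(bcfInt (fun t : IT n K => gf μ R₀ t.1) cl (fun _ => 0) (fun r => (1 + |r|) ^ (-(1 + μ)))
      (continuous_idx (gf μ R₀)) continuous_cl continuous_const (continuous_weight (1 + μ))
      (R₀ ^ (-μ) * (1 / μ)) (refJ_bound₂ hμ hR)).comp
        (ContinuousLinearMap.snd ℝ (BE n K) (BE n K)))

theorem refJ_fst {μ R₀ : ℝ} (hμ : 0 < μ) (hμ1 : μ < 1) (hR : 1 ≤ R₀) (v : BE n K × BE n K)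
    (t : IT n K) : (refJ hμ hμ1 hR v).1 t =
      (gf μ R₀ t.1 / wt t) • ∫ r in (0 : ℝ)..cl t, (1 + |r|) ^ (-μ) • v.1 (t.1, r) := rfl

theorem refJ_snd {μ R₀ : ℝ} (hμ : 0 < μ) (hμ1 : μ < 1) (hR : 1 ≤ R₀) (v : BE n K × BE n K)
    (t : IT n K) : (refJ hμ hμ1 hR v).2 t =
      -(gf μ R₀ t.1 • ∫ r in (0 : ℝ)..cl t, (1 + |r|) ^ (-(1 + μ)) • v.2 (t.1, r)) := rfl

theorem norm_refJ_le {μ R₀ : ℝ} (hμ : 0 < μ) (hμ1 : μ < 1) (hR : 1 ≤ R₀) (v : BE n K × BE n K) :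
    ‖refJ hμ hμ1 hR v‖ ≤ R₀ ^ (-μ) * (1 / (1 - μ) + 1 / μ) * ‖v‖ := by
  have h0 : 0 ≤ R₀ ^ (-μ) := by positivity
  have h1 : 0 < 1 - μ := by linarith
  have a1 := norm_bcfInt_le (E := Eucl n) (C := R₀ ^ (-μ) * (1 / (1 - μ))) (by positivity)
    (hk := continuous_gf_wt (n := n) (K := K) μ R₀) (he := continuous_cl)
    (hb := continuous_const) (hφ := continuous_weight μ) (hC := refJ_bound₁ hμ hμ1 hR)
  have a2 := norm_bcfInt_le (E := Eucl n) (C := R₀ ^ (-μ) * (1 / μ)) (by positivity)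
    (hk := continuous_idx (n := n) (K := K) (gf μ R₀)) (he := continuous_cl)
    (hb := continuous_const) (hφ := continuous_weight (1 + μ)) (hC := refJ_bound₂ hμ hR)
  rw [Prod.norm_def]
  refine max_le ?_ ?_
  · refine (ContinuousLinearMap.le_of_opNorm_le _ a1 v.1).trans ?_
    have := norm_fst_le v
    have h3 : 0 ≤ R₀ ^ (-μ) * (1 / μ) * ‖v‖ := by positivity
    calc R₀ ^ (-μ) * (1 / (1 - μ)) * ‖v.1‖ ≤ R₀ ^ (-μ) * (1 / (1 - μ)) * ‖v‖ := by gcongr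
      _ ≤ _ := by rw [mul_add, add_mul]; linarith
  · refine (norm_neg _).le.trans ((ContinuousLinearMap.le_of_opNorm_le _ a2 v.2).trans ?_)
    have := norm_snd_le v
    have h3 : 0 ≤ R₀ ^ (-μ) * (1 / (1 - μ)) * ‖v‖ := by positivity
    calc R₀ ^ (-μ) * (1 / μ) * ‖v.2‖ ≤ R₀ ^ (-μ) * (1 / μ) * ‖v‖ := by gcongr
      _ ≤ _ := by rw [mul_add, add_mul]; linarith

theorem sub_apply_eq {c : ℝ} {A : Eucl n →L[ℝ] Eucl n} {v w : Eucl n} :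
    c • (A - 1) v + w = c • (A v - v) + w := rfl

/-- A solution of the integral equation is a rescaled trajectory. -/
theorem flow_of_integral_equation (S : LRSys n) {R₀ : ℝ} (hR : 1 ≤ R₀) {x : BE n K × BE n K}
    (hx : Yhat x ∈ Metric.ball (-om) (1 / 2)) {i : Idx n K} (hi : R₀ ≤ i.R) {θ : Eucl n}
    (h1 : ∀ s, x.1 (i, s) = -(((wt (i, s))⁻¹ * ‖θ‖⁻¹) • θ) +
      (refJ S.μ_pos S.μ_lt hR (refN S x)).1 (i, s))
    (h2 : ∀ s, x.2 (i, s) = θ + (refJ S.μ_pos S.μ_lt hR (refN S x)).2 (i, s))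
    {s : ℝ} (hs : s ∈ Icc i.σ 0) :
    S.φ i.κ (i.R * s) (incoming i.R θ, θ) = ((i.R * (1 - s)) • Yhat x (i, s), x.2 (i, s)) := by
  set R := i.R with hRdef
  set μ := S.μ with hμdef
  have hR0 : 0 < R := lt_of_lt_of_le one_pos i.one_le_R
  set N := refN S x with hN
  have hc1 : Continuous (fun r : ℝ => (1 + |r|) ^ (-μ) • N.1 (i, r)) :=
    (continuous_weight μ).smul (N.1.continuous.comp (by fun_prop))
  have hc2 : Continuous (fun r : ℝ => (1 + |r|) ^ (-(1 + μ)) • N.2 (i, r)) :=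
    (continuous_weight (1 + μ)).smul (N.2.continuous.comp (by fun_prop))
  set u : ℝ → Eucl n := fun s => -(‖θ‖⁻¹ • θ) +
    R ^ (-μ) • ∫ r in (0 : ℝ)..s, (1 + |r|) ^ (-μ) • N.1 (i, r) with hu
  set h : ℝ → Eucl n := fun s => θ +
    -(R ^ (-μ) • ∫ r in (0 : ℝ)..s, (1 + |r|) ^ (-(1 + μ)) • N.2 (i, r)) with hh
  have du : ∀ s, HasDerivAt u (R ^ (-μ) • (1 + |s|) ^ (-μ) • N.1 (i, s)) s := fun s =>
    ((hc1.integral_hasStrictDerivAt 0 s).hasDerivAt.const_smul (R ^ (-μ))).const_add _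
  have dh : ∀ s, HasDerivAt h (-(R ^ (-μ) • (1 + |s|) ^ (-(1 + μ)) • N.2 (i, s))) s := fun s =>
    (((hc2.integral_hasStrictDerivAt 0 s).hasDerivAt.const_smul (R ^ (-μ))).neg).const_add _
  have x2 : ∀ s ∈ Icc i.σ 0, x.2 (i, s) = h s := fun s hs => by
    rw [h2, refJ_snd, gf_eq hi, cl_eq hs]
  have x1 : ∀ s ∈ Icc i.σ 0, (1 - s) • x.1 (i, s) = u s := fun s hs => by
    have hw : (0 : ℝ) < 1 - s := by linarith [hs.2]
    rw [h1, refJ_fst, gf_eq hi, cl_eq hs, wt_eq hs, smul_add, smul_neg, smul_smul, smul_smul,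
      mul_inv_cancel_left₀ hw.ne', mul_div_cancel₀ _ hw.ne']
  have hY : ∀ s ∈ Icc i.σ 0, (1 - s) • Yhat x (i, s) = u s + s • h s := fun s hs => by
    have hw : (0 : ℝ) < 1 - s := by linarith [hs.2]
    rw [Yhat_eq, BoundedContinuousFunction.add_apply, smul_add, x1 s hs, bcfMul_apply, cw_apply,
      cl_eq hs, wt_eq hs, x2 s hs, smul_smul, mul_div_cancel₀ _ hw.ne']
  -- The candidate trajectory in physical time `τ = R * s`: position `R * (u + s • h)`, momentum
  -- `h`.
  set γ : ℝ → Eucl n × Eucl n := fun τ =>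
    (R • (u (R⁻¹ * τ) + (R⁻¹ * τ) • h (R⁻¹ * τ)), h (R⁻¹ * τ)) with hγ
  have key : ∀ τ ∈ Icc (R * i.σ) 0, HasDerivAt γ (S.X i.κ (γ τ)) τ := by
    intro τ hτ
    set s := R⁻¹ * τ with hsdef
    have hs : s ∈ Icc i.σ 0 := by
      constructor
      · rw [hsdef, inv_mul_eq_div, le_div_iff₀ hR0, mul_comm]; exact hτ.1
      · rw [hsdef]; exact mul_nonpos_of_nonneg_of_nonpos (inv_pos.2 hR0).le hτ.2
    have hw : (0 : ℝ) < 1 - s := by linarith [hs.2]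
    have d1 : HasDerivAt (fun τ : ℝ => R⁻¹ * τ) R⁻¹ τ := by
      simpa using (hasDerivAt_id τ).const_mul R⁻¹
    have dU : HasDerivAt (fun τ => u (R⁻¹ * τ)) (R⁻¹ • (R ^ (-μ) • (1 + |s|) ^ (-μ) • N.1 (i, s))) τ :=
      HasDerivAt.scomp τ (du s) d1
    have dH : HasDerivAt (fun τ => h (R⁻¹ * τ))
        (R⁻¹ • -(R ^ (-μ) • (1 + |s|) ^ (-(1 + μ)) • N.2 (i, s))) τ :=
      HasDerivAt.scomp τ (dh s) d1
    have dd : HasDerivAt γ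
        (R • (R⁻¹ • (R ^ (-μ) • (1 + |s|) ^ (-μ) • N.1 (i, s)) +
          (s • (R⁻¹ • -(R ^ (-μ) • (1 + |s|) ^ (-(1 + μ)) • N.2 (i, s))) + R⁻¹ • h s)),
          R⁻¹ • -(R ^ (-μ) • (1 + |s|) ^ (-(1 + μ)) • N.2 (i, s))) τ :=
      ((dU.add (d1.smul dH)).const_smul R).prodMk dH
    refine dd.congr_deriv ?_
    have eA : N.1 (i, s) = (R * (1 - s)) ^ μ • (S.A ((R * (1 - s)) • Yhat x (i, s)) - 1) (h s) +
        (s / (1 - s)) • N.2 (i, s) := by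
      rw [hN, refN]
      simp only [BoundedContinuousFunction.add_apply, bcfApp_apply, bcfMul_apply, cw_apply, cl_eq hs, wt_eq hs, x2 s hs]
      rw [scl_apply continuous_ell one_le_ell norm_om S.symA hx]
      simp only [ell, wt_eq hs]
      rfl
    have eP : N.2 (i, s) =
        (R * (1 - s)) ^ (μ + 1) • S.B ((R * (1 - s)) • Yhat x (i, s)) (h s) (h s) +
        (i.κ * R ^ 2 * (1 - s) ^ 2) • (R * (1 - s)) ^ (μ - 1) • S.g ((R * (1 - s)) • Yhat x (i, s)) := by
      rw [hN, refN, forceN]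
      simp only [BoundedContinuousFunction.add_apply, bcfApp_apply, bcfMul_apply, rh_apply, wt_eq hs, x2 s hs]
      rw [scl_apply continuous_ell one_le_ell norm_om S.symB hx,
        scl_apply continuous_ell one_le_ell norm_om S.symg hx]
      simp only [ell, wt_eq hs]
      rfl
    have hYs : R • (u s + s • h s) = (R * (1 - s)) • Yhat x (i, s) := by
      rw [← hY s hs, smul_smul]
    have hRw : 0 < R * (1 - s) := mul_pos hR0 hw
    -- These identities express that the weights pulled out of the integrals cancel the powers of
    -- `ell` put into the rescaled symbols. What remains is linear algebra with opaque vectors.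
    have e1 : R ^ (-μ) * (1 - s) ^ (-μ) * (R * (1 - s)) ^ μ = 1 := by
      rw [← Real.mul_rpow hR0.le hw.le, ← Real.rpow_add hRw]; simp
    have e2 : (R * (1 - s)) ^ (μ + 1) = (R * (1 - s)) ^ μ * (R * (1 - s)) := by
      rw [Real.rpow_add hRw, Real.rpow_one]
    have e3 : (R * (1 - s)) ^ (μ - 1) * (R * (1 - s)) = (R * (1 - s)) ^ μ := by
      rw [Real.rpow_sub hRw, Real.rpow_one]; field_simp
    have e4 : (1 - s) ^ (-(1 + μ)) * (1 - s) = (1 - s) ^ (-μ) := by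
      rw [show -μ = -(1 + μ) + 1 by ring, Real.rpow_add hw, Real.rpow_one]
    have habs : |s| = -s := abs_of_nonpos hs.2
    have hX : S.X i.κ (γ τ) = (S.A ((R * (1 - s)) • Yhat x (i, s)) (h s),
        -(S.B ((R * (1 - s)) • Yhat x (i, s)) (h s) (h s)) -
          i.κ • S.g ((R * (1 - s)) • Yhat x (i, s))) := by
      simp only [LRSys.X, fieldX, hγ, ← hsdef, hYs]
    rw [hX, habs, ← sub_eq_add_neg]
    rw [sub_apply_eq] at eA
    generalize S.B ((R * (1 - s)) • Yhat x (i, s)) (h s) (h s) = b at *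
    generalize S.g ((R * (1 - s)) • Yhat x (i, s)) = g at *
    generalize S.A ((R * (1 - s)) • Yhat x (i, s)) (h s) = a at *
    generalize N.1 (i, s) = N1 at *
    generalize N.2 (i, s) = N2 at *
    generalize R ^ (-μ) = α at *
    generalize (1 - s) ^ (-μ) = β at *
    generalize (1 - s) ^ (-(1 + μ)) = β' at *
    generalize (R * (1 - s)) ^ μ = p at *
    generalize (R * (1 - s)) ^ (μ + 1) = p1 at *
    generalize (R * (1 - s)) ^ (μ - 1) = pm at *
    have e5 : α * β' * p1 = R := by
      rw [e2]; linear_combination R * e1 + α * p * R * e4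
    have e6 : α * β' * ((i.κ * R ^ 2 * (1 - s) ^ 2) * pm) = R * i.κ := by
      linear_combination α * β' * i.κ * R * (1 - s) * e3 + R * i.κ * e1 + α * p * R * i.κ * e4
    have eh : α • β' • N2 = R • (b + i.κ • g) := by
      rw [eP, smul_smul, smul_add, smul_smul, smul_smul (i.κ * R ^ 2 * (1 - s) ^ 2), smul_smul, e5,
        e6, smul_add, smul_smul]
    have eN : α • β • N1 = (a - h s) + s • α • β' • N2 := by
      rw [eA, smul_smul, smul_add, smul_smul, e1, one_smul, smul_smul, smul_smul, smul_smul]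
      congr 2
      rw [← e4]; field_simp
    rw [eN]
    refine Prod.ext ?_ ?_
    · simp only
      generalize α • β' • N2 = X
      match_scalars <;> field_simp <;> ring
    · simp only
      rw [eh]
      match_scalars <;> field_simp
  have h0 : γ 0 = S.φ i.κ 0 (incoming R θ, θ) := by
    rw [S.φ_zero]
    simp [hγ, hu, hh, incoming, smul_smul, div_eq_mul_inv]
  have hRs : R * s ∈ Icc (R * i.σ) 0 :=
    ⟨mul_le_mul_of_nonneg_left hs.1 hR0.le, mul_nonpos_of_nonneg_of_nonpos hR0.le hs.2⟩
  have := S.φ_unique (t₀ := 0) ⟨hRs.1.trans hRs.2, le_rfl⟩ key h0 hRs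
  rw [zero_add, sub_zero] at this
  rw [← this, hγ]
  simp only [inv_mul_cancel_left₀ hR0.ne']
  rw [x2 s hs, mul_smul, hY s hs]

end LongRangeFlow

end

/-! ### Construction of the incoming reference family by a fixed point. -/

noncomputable section

namespace LongRangeFlow

open BoundedContinuousFunction
open scoped NNReal

variable {n : ℕ} {K : ℝ}

/-- The reference trajectories issued from `(-Rθ/|θ|, θ)`, `θ = ω + ϑ`, in rescaled form. -/
structure RefFam (S : LRSys n) (K : ℝ) where
  R₀ : ℝ
  r : ℝ
  one_le_R₀ : 1 ≤ R₀
  r_pos : 0 < r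
  r_le : r ≤ 1 / 8
  Y : Eucl n → BE n K
  H : Eucl n → BE n K
  smooth_Y : ContDiffOn ℝ ∞ Y (Metric.ball 0 (2 * r))
  smooth_H : ContDiffOn ℝ ∞ H (Metric.ball 0 (2 * r))
  flow_eq : ∀ i : Idx n K, R₀ ≤ i.R → ∀ s ∈ Icc i.σ 0, ∀ ϑ ∈ Metric.ball (0 : Eucl n) (2 * r),
    S.φ i.κ (i.R * s) (incoming i.R (i.dir + ϑ), i.dir + ϑ) =
      ((i.R * (1 - s)) • Y ϑ (i, s), H ϑ (i, s))
  near_Y : ∀ ϑ ∈ Metric.ball (0 : Eucl n) (2 * r), ‖Y ϑ + om‖ ≤ 1 / 8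
  -- The momentum at every time is within 1/8, in Lipschitz norm, of the initial momentum.
  -- Injectivity, surjectivity and invertibility of the derivative of the momentum map all rest on
  -- this.
  lip_H : ∀ ϑ ∈ Metric.ball (0 : Eucl n) (2 * r), ∀ ϑ' ∈ Metric.ball (0 : Eucl n) (2 * r),
    ‖(H ϑ - H ϑ') - bcfConst (ϑ - ϑ')‖ ≤ 1 / 8 * ‖ϑ - ϑ'‖
  zero_H : ‖H 0 - om‖ ≤ r / 8
  C' : ℝ
  cauchy_H : ∀ ϑ ∈ Metric.ball (0 : Eucl n) (2 * r), ∀ (i : Idx n K) (s s' : ℝ), i.σ ≤ s' → s' ≤ s →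
    s ≤ 0 → ‖H ϑ (i, s') - H ϑ (i, s)‖ ≤ C' * (1 - s) ^ (-S.μ)
  C : ℝ
  -- Position minus time times momentum is sublinear in the depth. This is what allows a reference
  -- geodesic to be compared with a nontrapped one in `BackwardNontrapping.exists_depth`.
  decay : ∀ t : IT n K, ‖(Y 0 - bcfMul cw (H 0)) t‖ ≤ C * wt t ^ (-S.μ)

/-- Initial data of the reference trajectories. -/
def refP (ϑ : Eucl n) : BE n K × BE n K :=
  (-(bcfMul iw (nem (fun _ x => ‖x‖⁻¹ • x) (om + bcfConst ϑ))), om + bcfConst ϑ)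

theorem contDiffOn_normalize : ContDiffOn ℝ ∞ (fun x : Eucl n => ‖x‖⁻¹ • x) {x | x ≠ 0} := by
  intro x hx
  exact (((contDiffAt_id.norm ℝ hx).inv (norm_ne_zero_iff.2 hx)).smul contDiffAt_id).contDiffWithinAt

theorem unifSmooth_normalize {T : Type} [TopologicalSpace T] (N : ℕ) :
    UnifSmooth (T := T) (univ ×ˢ {x : Eucl n | 1 / 2 ≤ ‖x‖ ∧ ‖x‖ ≤ 2}) N
      (fun _ x => ‖x‖⁻¹ • x) := by
  refine unifSmooth_fixed (O := {x : Eucl n | x ≠ 0}) ?_ isOpen_ne ?_ N contDiffOn_normalize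
  · refine (isCompact_closedBall (0 : Eucl n) 2).of_isClosed_subset ?_ fun x hx => by
      simpa using hx.2
    exact (isClosed_le continuous_const continuous_norm).inter
      (isClosed_le continuous_norm continuous_const)
  · rintro x ⟨hx, -⟩ rfl
    norm_num at hx

theorem norm_bcfConst_le (ϑ : Eucl n) : ‖(bcfConst ϑ : BE n K)‖ ≤ ‖ϑ‖ :=
  (BoundedContinuousFunction.norm_le (norm_nonneg _)).2 fun _ => le_rfl

theorem om_add_mem {u : BE n K} (hu : ‖u‖ < 1 / 2) (t : IT n K) :
    (t, (om + u : BE n K) t) ∈ (univ : Set (IT n K)) ×ˢ {x : Eucl n | 1 / 2 ≤ ‖x‖ ∧ ‖x‖ ≤ 2} := by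
  refine ⟨mem_univ _, ?_⟩
  have h1 : ‖u t‖ < 1 / 2 := (u.norm_coe_le_norm t).trans_lt hu
  have h2 : ‖(om t : Eucl n)‖ = 1 := norm_om t
  have h3 : ‖(om t : Eucl n)‖ ≤ ‖(om + u : BE n K) t‖ + ‖u t‖ := by
    calc ‖(om t : Eucl n)‖ = ‖(om + u : BE n K) t - u t‖ := by simp
      _ ≤ _ := norm_sub_le _ _
  have h4 : ‖(om + u : BE n K) t‖ ≤ ‖(om t : Eucl n)‖ + ‖u t‖ := norm_add_le _ _
  exact ⟨by simp only; linarith, by simp only; linarith⟩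

theorem refP_fst {ϑ : Eucl n} (hϑ : ‖ϑ‖ < 1 / 2) (t : IT n K) :
    (refP ϑ : BE n K × BE n K).1 t = -(((wt t)⁻¹ * ‖t.1.dir + ϑ‖⁻¹) • (t.1.dir + ϑ)) := by
  have h := nem_apply (unifSmooth_normalize (n := n) (T := IT n K) 0)
    (u := (om + bcfConst ϑ : BE n K))
    (fun t => om_add_mem ((norm_bcfConst_le ϑ).trans_lt hϑ) t) t
  have e : (refP ϑ : BE n K × BE n K).1 t = -((wt t)⁻¹ •
    nem (fun _ (x : Eucl n) => ‖x‖⁻¹ • x) (om + bcfConst ϑ : BE n K) t) := rfl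
  rw [e, h, mul_smul]
  rfl

theorem contDiffOn_refP : ContDiffOn ℝ ∞ (refP : Eucl n → BE n K × BE n K)
    (Metric.ball 0 (1 / 2)) := by
  have h1 : ContDiffOn ℝ ∞ (nem (T := IT n K) (fun _ (x : Eucl n) => ‖x‖⁻¹ • x))
      (Metric.ball om (1 / 2)) := by
    refine nem_contDiffOn Metric.isOpen_ball (Ω := univ ×ˢ {x : Eucl n | 1 / 2 ≤ ‖x‖ ∧ ‖x‖ ≤ 2})
      (fun u hu t => ?_) fun N => unifSmooth_normalize N
    rw [mem_ball_iff_norm] at hu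
    have := om_add_mem hu t
    simpa using this
  have h2 : ContDiff ℝ ∞ (fun ϑ : Eucl n => (om + bcfConst ϑ : BE n K)) :=
    contDiff_const.add (bcfConst (T := IT n K) (E := Eucl n)).contDiff
  have h3 : ContDiffOn ℝ ∞ (fun ϑ : Eucl n => nem (T := IT n K) (fun _ (x : Eucl n) => ‖x‖⁻¹ • x)
      (om + bcfConst ϑ)) (Metric.ball 0 (1 / 2)) := by
    refine h1.comp h2.contDiffOn fun ϑ hϑ => ?_
    rw [mem_ball_iff_norm, add_sub_cancel_left]
    rw [mem_ball_zero_iff] at hϑ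
    exact (norm_bcfConst_le ϑ).trans_lt hϑ
  exact (((bcfMul (T := IT n K) (G := Eucl n) iw).contDiff.comp_contDiffOn h3).neg).prodMk
    h2.contDiffOn

/-- The free incoming trajectory is at R(s - 1) times the direction, so after division by the depth
R(1 - s) it sits constantly at minus the direction, the centre of the region where the rescaled
symbols are smooth. -/
theorem Yhat_refP_zero : Yhat (refP 0 : BE n K × BE n K) = -om := by
  ext1 t
  have hw := wt_pos t
  rw [Yhat_eq, BoundedContinuousFunction.add_apply, refP_fst (by norm_num) t]
  simp only [refP, map_zero, add_zero, t.1.norm_dir, bcfMul_apply, cw_apply, om_apply, inv_one,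
    mul_one, BoundedContinuousFunction.neg_apply]
  rw [← neg_smul, ← add_smul]
  have : -(wt t)⁻¹ + cl t / wt t = -1 := by
    rw [wt] at hw ⊢; field_simp; ring
  rw [this, neg_one_smul]

/-- A perturbation of the free incoming motion: the nonlinearity is smooth near the free solution,
and the Volterra operator has norm O(R₀^{-μ}). The Cauchy and decay estimates are read off from the
integral equations, whose integrands are bounded times explicit weights. -/
theorem exists_refFam (S : LRSys n) (K : ℝ) : Nonempty (RefFam S K) := by
  set x₀ : BE n K × BE n K := refP 0 with hx₀
  have hU : ∀ x ∈ Metric.ball x₀ (1 / 4), Yhat x ∈ Metric.ball (-om : BE n K) (1 / 2) := by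
    intro x hx
    rw [mem_ball_iff_norm] at hx ⊢
    rw [← Yhat_refP_zero, ← map_sub]
    have := norm_Yhat_le (x - x₀)
    linarith
  have hN : ContDiffOn ℝ ∞ (refN S) (Metric.ball x₀ (1 / 4)) := (contDiffOn_refN S).mono hU
  have hNat : ContDiffAt ℝ 1 (refN S) x₀ :=
    ((hN.contDiffAt (Metric.ball_mem_nhds _ (by norm_num))).of_le (by simp))
  obtain ⟨KN, t, ht, hKN⟩ := hNat.exists_lipschitzOnWith
  obtain ⟨ε, hε, hεt⟩ := Metric.mem_nhds_iff.1 ht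
  set r' := min ε (1 / 16) with hr'
  have hr'0 : 0 < r' := lt_min hε (by norm_num)
  have hr'16 : r' ≤ 1 / 16 := min_le_right _ _
  have hKN' : LipschitzOnWith KN (refN S) (Metric.ball x₀ r') :=
    hKN.mono ((Metric.ball_subset_ball (min_le_left _ _)).trans hεt)
  set MN := ‖refN S x₀‖ + KN * r' with hMN
  have hMNb : ∀ x ∈ Metric.ball x₀ r', ‖refN S x‖ ≤ MN := by
    intro x hx
    have h1 := hKN'.dist_le_mul x hx x₀ (Metric.mem_ball_self hr'0)
    rw [dist_eq_norm] at h1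
    have h2 : (KN : ℝ) * dist x x₀ ≤ KN * r' := by gcongr; exact (Metric.mem_ball.1 hx).le
    have h3 : ‖refN S x‖ ≤ ‖refN S x - refN S x₀‖ + ‖refN S x₀‖ := by
      simpa using norm_add_le (refN S x - refN S x₀) (refN S x₀)
    linarith
  have hMN0 : 0 ≤ MN := by positivity
  have hPat : ContDiffAt ℝ 1 (refP : Eucl n → BE n K × BE n K) 0 :=
    ((contDiffOn_refP.contDiffAt (Metric.ball_mem_nhds _ (by norm_num))).of_le (by simp))
  obtain ⟨KP, tP, htP, hKP⟩ := hPat.exists_lipschitzOnWith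
  obtain ⟨εP, hεP, hεtP⟩ := Metric.mem_nhds_iff.1 htP
  obtain ⟨ε', hε', hεt'⟩ := Metric.mem_nhds_iff.1
    (hPat.continuousAt (Metric.ball_mem_nhds x₀ (show 0 < r' / 8 by positivity)))
  set r := min (min (εP / 2) (ε' / 2)) (1 / 8) with hr
  have hr0 : 0 < r := by positivity
  have hr2 : 2 * r ≤ εP ∧ 2 * r ≤ ε' ∧ 2 * r ≤ 1 / 4 := by
    have h1 : r ≤ εP / 2 := (min_le_left _ _).trans (min_le_left _ _)
    have h2 : r ≤ ε' / 2 := (min_le_left _ _).trans (min_le_right _ _)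
    have h3 : r ≤ 1 / 8 := min_le_right _ _
    exact ⟨by linarith, by linarith, by linarith⟩
  have hPball : ∀ ϑ ∈ Metric.ball (0 : Eucl n) (2 * r), refP ϑ ∈ Metric.ball x₀ (r' / 8) :=
    fun ϑ hϑ => hεt' (Metric.ball_subset_ball hr2.2.1 hϑ)
  have hPlip : LipschitzOnWith KP (refP : Eucl n → BE n K × BE n K) (Metric.ball 0 (2 * r)) :=
    hKP.mono ((Metric.ball_subset_ball hr2.1).trans hεtP)
  have hμ := S.μ_pos
  have hμ1 : 0 < 1 - S.μ := by linarith [S.μ_lt]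
  -- The fixed point differs from its inhomogeneity by a map with constant `2 * δ`, and the
  -- inhomogeneity `refP` has constant `KP`; this choice leaves at most 1/8 in `lip_H`.
  set δ : ℝ≥0 := 1 / (16 * (1 + KP)) with hδ
  have hδ0 : 0 < δ := by positivity
  have hδ2 : δ ≤ 1 / 2 := by
    rw [hδ]
    apply one_div_le_one_div_of_le (by norm_num)
    have h0 : (0 : ℝ≥0) ≤ KP := zero_le
    have h1 : (0 : ℝ) ≤ KP := KP.2
    rw [← NNReal.coe_le_coe]; push_cast; linarith
  -- A large radius makes the operator contracting with constant `δ` and its values small enough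
  -- both for the fixed point and for `zero_H`.
  have hsmall : ∃ R₀ : ℝ, 1 ≤ R₀ ∧ R₀ ^ (-S.μ) * (1 / (1 - S.μ) + 1 / S.μ) * KN ≤ δ ∧
      R₀ ^ (-S.μ) * (1 / (1 - S.μ) + 1 / S.μ) * MN ≤ min (r' / 8) (r / 8) := by
    have h0 := tendsto_rpow_neg_atTop hμ
    have h1 := (h0.mul_const (1 / (1 - S.μ) + 1 / S.μ)).mul_const (KN : ℝ)
    have h2 := (h0.mul_const (1 / (1 - S.μ) + 1 / S.μ)).mul_const MN
    rw [zero_mul, zero_mul] at h1 h2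
    have e1 := h1.eventually_le_const (show (0 : ℝ) < δ from hδ0)
    have e2 := h2.eventually_le_const (show (0 : ℝ) < min (r' / 8) (r / 8) by positivity)
    obtain ⟨R₀, ha, hb, hc⟩ := ((eventually_ge_atTop 1).and (e1.and e2)).exists
    exact ⟨R₀, ha, hb, hc⟩
  obtain ⟨R₀, hR₀, hJ1, hJ2⟩ := hsmall
  set J := refJ (n := n) (K := K) S.μ_pos S.μ_lt hR₀ with hJ
  have hJn : ∀ v, ‖J v‖ ≤ R₀ ^ (-S.μ) * (1 / (1 - S.μ) + 1 / S.μ) * ‖v‖ :=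
    norm_refJ_le S.μ_pos S.μ_lt hR₀
  have hcJ : 0 ≤ R₀ ^ (-S.μ) * (1 / (1 - S.μ) + 1 / S.μ) := by positivity
  have hJN : ∀ x ∈ Metric.ball x₀ r', ‖J (refN S x)‖ ≤ min (r' / 8) (r / 8) := fun x hx =>
    (hJn _).trans ((mul_le_mul_of_nonneg_left (hMNb x hx) hcJ).trans hJ2)
  have hLip : LipschitzOnWith δ (fun x => J (refN S x)) (Metric.ball x₀ r') := by
    refine LipschitzOnWith.of_dist_le_mul fun x hx y hy => ?_
    rw [dist_eq_norm, ← map_sub]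
    refine (hJn _).trans ?_
    have := hKN'.dist_le_mul x hx y hy
    rw [dist_eq_norm] at this
    calc _ ≤ R₀ ^ (-S.μ) * (1 / (1 - S.μ) + 1 / S.μ) * (KN * dist x y) := by gcongr
      _ = R₀ ^ (-S.μ) * (1 / (1 - S.μ) + 1 / S.μ) * KN * dist x y := by ring
      _ ≤ _ := by gcongr
  obtain ⟨x, hxs, hxm, hxL⟩ := exists_smooth_fixedPoint hr'0
    (hN.mono (Metric.ball_subset_ball (by linarith))) hδ2 hLip
    ((hJN x₀ (Metric.mem_ball_self hr'0)).trans (min_le_left _ _))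
  have hXs : ContDiffOn ℝ ∞ (fun ϑ : Eucl n => x (refP ϑ)) (Metric.ball 0 (2 * r)) :=
    hxs.comp (contDiffOn_refP.mono (Metric.ball_subset_ball (by linarith))) hPball
  have h0r : (0 : Eucl n) ∈ Metric.ball (0 : Eucl n) (2 * r) := Metric.mem_ball_self (by positivity)
  have hnorm : ∀ {ϑ : Eucl n}, ϑ ∈ Metric.ball (0 : Eucl n) (2 * r) → ‖ϑ‖ < 1 / 2 := fun h => by
    rw [mem_ball_zero_iff] at h; linarith
  have hsub : Metric.ball x₀ r' ⊆ Metric.ball x₀ (1 / 4) := Metric.ball_subset_ball (by linarith)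
  exact ⟨{
    R₀ := R₀
    r := r
    one_le_R₀ := hR₀
    r_pos := hr0
    r_le := min_le_right _ _
    Y := fun ϑ => Yhat (x (refP ϑ))
    H := fun ϑ => (x (refP ϑ)).2
    smooth_Y := (Yhat (n := n) (K := K)).contDiff.comp_contDiffOn hXs
    smooth_H := contDiff_snd.comp_contDiffOn hXs
    flow_eq := by
      intro i hi s hs ϑ hϑ
      obtain ⟨hb, he⟩ := hxm _ (hPball ϑ hϑ)
      refine flow_of_integral_equation S hR₀ (hU _ (hsub hb)) hi ?_ ?_ hs
      · intro s
        have := congrArg (fun z : BE n K × BE n K => z.1 (i, s)) he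
        simp only [Prod.fst_add, BoundedContinuousFunction.add_apply] at this
        rw [refP_fst (hnorm hϑ)] at this
        exact this
      · intro s
        exact congrArg (fun z : BE n K × BE n K => z.2 (i, s)) he
    near_Y := by
      intro ϑ hϑ
      have hb := (hxm _ (hPball ϑ hϑ)).1
      rw [mem_ball_iff_norm] at hb
      rw [← sub_neg_eq_add, ← Yhat_refP_zero, ← map_sub]
      have := norm_Yhat_le (x (refP ϑ) - x₀)
      linarith
    lip_H := by
      intro ϑ hϑ ϑ' hϑ'
      have h1 := hxL.dist_le_mul _ (hPball ϑ hϑ) _ (hPball ϑ' hϑ')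
      have h2 := hPlip.dist_le_mul _ hϑ _ hϑ'
      rw [dist_eq_norm] at h1 h2
      have e : (x (refP ϑ)).2 - (x (refP ϑ')).2 - bcfConst (ϑ - ϑ') =
          (x (refP ϑ) - refP ϑ - (x (refP ϑ') - refP ϑ')).2 := by
        simp only [Prod.snd_sub, refP, map_sub]; abel
      rw [e]
      refine (norm_snd_le _).trans (h1.trans ?_)
      rw [dist_eq_norm]
      rw [dist_eq_norm] at h2
      have h3 : (δ : ℝ) * (1 + KP) = 1 / 16 := by
        rw [hδ]; push_cast; field_simp
      have h4 : ((2 * δ : ℝ≥0) : ℝ) = 2 * δ := by push_cast; rfl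
      rw [h4]
      have h5 : (δ : ℝ) * KP ≤ 1 / 16 := by
        have : (0 : ℝ) ≤ δ := δ.2
        linarith
      calc 2 * (δ : ℝ) * ‖refP ϑ - refP ϑ'‖ ≤ 2 * (δ : ℝ) * (KP * ‖ϑ - ϑ'‖) := by gcongr
        _ = 2 * (δ * KP) * ‖ϑ - ϑ'‖ := by ring
        _ ≤ 2 * (1 / 16) * ‖ϑ - ϑ'‖ := by gcongr
        _ = _ := by ring
    zero_H := by
      obtain ⟨hb, he⟩ := hxm _ (hPball 0 h0r)
      have : (x (refP 0)).2 - om = (J (refN S (x (refP 0)))).2 := by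
        have h2 := congrArg Prod.snd he
        rw [Prod.snd_add] at h2
        rw [h2]
        simp [refP]
      rw [this]
      exact (norm_snd_le _).trans ((hJN _ hb).trans (min_le_right _ _))
    C' := MN / S.μ
    cauchy_H := by
      intro ϑ hϑ i s s' h1 h2 h3
      obtain ⟨hb, he⟩ := hxm _ (hPball ϑ hϑ)
      have e2 : ∀ s, (x (refP ϑ)).2 (i, s) = i.dir + ϑ + -(gf S.μ R₀ i •
          ∫ r in (0 : ℝ)..cl (i, s), (1 + |r|) ^ (-(1 + S.μ)) • (refN S (x (refP ϑ))).2 (i, r)) :=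
        fun s => congrArg (fun z : BE n K × BE n K => z.2 (i, s)) he
      have hcc : Continuous fun r : ℝ =>
          (1 + |r|) ^ (-(1 + S.μ)) • (refN S (x (refP ϑ))).2 (i, r) :=
        (continuous_weight (1 + S.μ)).smul
          ((refN S (x (refP ϑ))).2.continuous.comp (by fun_prop))
      have e3 : (x (refP ϑ)).2 (i, s') - (x (refP ϑ)).2 (i, s) = -(gf S.μ R₀ i •
          ∫ r in s..s', (1 + |r|) ^ (-(1 + S.μ)) • (refN S (x (refP ϑ))).2 (i, r)) := by
        rw [e2, e2, cl_eq ⟨h1, h2.trans h3⟩, cl_eq ⟨h1.trans h2, h3⟩,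
          ← intervalIntegral.integral_add_adjacent_intervals (hcc.intervalIntegrable 0 s)
            (hcc.intervalIntegrable s s'), smul_add]
        abel
      have i2 : ‖∫ r in s..s', (1 + |r|) ^ (-(1 + S.μ)) • (refN S (x (refP ϑ))).2 (i, r)‖ ≤
          (1 - s) ^ (-S.μ) / S.μ * MN := by
        have hc : Continuous fun r : ℝ => |(1 + |r|) ^ (-(1 + S.μ))| * MN :=
          (continuous_weight (1 + S.μ)).abs.mul continuous_const
        refine (intervalIntegral.norm_integral_le_abs_of_norm_le (μ := MeasureTheory.volume)
          (g := fun r => |(1 + |r|) ^ (-(1 + S.μ))| * MN) ?_ (hc.intervalIntegrable _ _)).trans ?_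
        · refine Eventually.of_forall fun r => ?_
          rw [norm_smul, Real.norm_eq_abs]
          gcongr
          exact ((refN S (x (refP ϑ))).2.norm_coe_le_norm _).trans
            ((norm_snd_le _).trans (hMNb _ hb))
        · rw [intervalIntegral.integral_mul_const, abs_mul, abs_of_nonneg hMN0]
          gcongr
          exact abs_integral_weight_le' hμ h3 h2
      have i3 : |gf S.μ R₀ i| ≤ 1 := (abs_gf_le hμ hR₀ i).trans
        (Real.rpow_le_one_of_one_le_of_nonpos hR₀ (by linarith))
      show ‖(x (refP ϑ)).2 (i, s') - (x (refP ϑ)).2 (i, s)‖ ≤ _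
      rw [e3, norm_neg, norm_smul, Real.norm_eq_abs]
      calc _ ≤ 1 * ((1 - s) ^ (-S.μ) / S.μ * MN) := by gcongr
        _ = _ := by ring
    C := 1 + MN / (1 - S.μ)
    decay := by
      intro t
      obtain ⟨hb, he⟩ := hxm _ (hPball 0 h0r)
      have hw := wt_pos t
      have e1 : (Yhat (x (refP 0)) - bcfMul cw (x (refP 0)).2 : BE n K) t = (x (refP 0)).1 t := by
        rw [Yhat_eq, add_sub_cancel_right]
      have e2 : (x (refP 0)).1 t = -((wt t)⁻¹ • t.1.dir) + (gf S.μ R₀ t.1 / wt t) •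
          ∫ r in (0 : ℝ)..cl t, (1 + |r|) ^ (-S.μ) • (refN S (x (refP 0))).1 (t.1, r) := by
        have h2 := congrArg (fun z : BE n K × BE n K => z.1 t) he
        simp only [Prod.fst_add, BoundedContinuousFunction.add_apply] at h2
        rw [refP_fst (by norm_num)] at h2
        simp only [add_zero, t.1.norm_dir, inv_one, mul_one] at h2
        exact h2
      rw [e1, e2]
      have i1 : ‖-((wt t)⁻¹ • t.1.dir)‖ ≤ wt t ^ (-S.μ) := by
        rw [norm_neg, norm_smul, t.1.norm_dir, mul_one, Real.norm_eq_abs, abs_of_pos (inv_pos.2 hw),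
          ← Real.rpow_neg_one]
        exact Real.rpow_le_rpow_of_exponent_le (one_le_wt t) (by linarith [S.μ_lt])
      have i2 : ‖∫ r in (0 : ℝ)..cl t, (1 + |r|) ^ (-S.μ) • (refN S (x (refP 0))).1 (t.1, r)‖ ≤
          wt t ^ (1 - S.μ) / (1 - S.μ) * MN := by
        have hc : Continuous fun r : ℝ => |(1 + |r|) ^ (-S.μ)| * MN :=
          (continuous_weight S.μ).abs.mul continuous_const
        refine (intervalIntegral.norm_integral_le_abs_of_norm_le (μ := MeasureTheory.volume)
          (g := fun r => |(1 + |r|) ^ (-S.μ)| * MN) ?_ (hc.intervalIntegrable _ _)).trans ?_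
        · refine Eventually.of_forall fun r => ?_
          rw [norm_smul, Real.norm_eq_abs]
          gcongr
          exact ((refN S (x (refP 0))).1.norm_coe_le_norm _).trans
            ((norm_fst_le _).trans (hMNb _ hb))
        · rw [intervalIntegral.integral_mul_const, abs_mul, abs_of_nonneg hMN0]
          gcongr
          exact abs_integral_weight_le S.μ_lt (cl_mem t).2
      have i3 : |gf S.μ R₀ t.1| ≤ 1 := (abs_gf_le hμ hR₀ t.1).trans
        (Real.rpow_le_one_of_one_le_of_nonpos hR₀ (by linarith))
      have i4 : wt t ^ (1 - S.μ) / wt t = wt t ^ (-S.μ) := by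
        rw [show 1 - S.μ = -S.μ + 1 by ring, Real.rpow_add hw, Real.rpow_one]
        field_simp
      refine (norm_add_le _ _).trans ?_
      rw [norm_smul, Real.norm_eq_abs, abs_div, abs_of_pos hw]
      calc _ ≤ wt t ^ (-S.μ) + 1 / wt t * (wt t ^ (1 - S.μ) / (1 - S.μ) * MN) := by gcongr
        _ = wt t ^ (-S.μ) + (wt t ^ (1 - S.μ) / wt t) * (MN / (1 - S.μ)) := by ring
        _ = _ := by rw [i4]; ring }⟩

end LongRangeFlow

end

noncomputable section

namespace LongRangeFlow

open BoundedContinuousFunction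
open scoped NNReal

variable {n : ℕ} {K : ℝ}

/-! ### The momentum map of the incoming trajectories -/

theorem incoming_smul {R m : ℝ} (hm : 0 < m) (θ : Eucl n) : incoming R (m • θ) = incoming R θ := by
  simp only [incoming, norm_smul, Real.norm_eq_abs, abs_of_pos hm, smul_smul]
  congr 2
  rcases eq_or_ne ‖θ‖ 0 with h | h
  · simp [h]
  · field_simp

/-- Momenta admissible at coupling `κ` and radius `R`. -/
def admissible (κ R : ℝ) : Set (Eucl n) := {ζ | ζ ≠ 0 ∧ κ * R ^ 2 ≤ ‖ζ‖ ^ 2}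

/-- The momentum at time `t` of the trajectory issued from `(-Rζ/|ζ|, ζ)`. -/
def LRSys.mom (S : LRSys n) (R κ t : ℝ) (ζ : Eucl n) : Eucl n := (S.φ κ t (incoming R ζ, ζ)).2

/-- The index of an admissible momentum. -/
def idxOf {R κ t : ℝ} {ζ : Eucl n} (hR : 1 ≤ R) (hκ : 0 ≤ κ) (hζ : ζ ∈ admissible κ R)
    (htK : κ * t ^ 2 + 1 ≤ K) : Idx n K where
  R := R
  κ := κ / ‖ζ‖ ^ 2
  -- An index requires `σ ≤ -1`, whereas the scaled time may be shorter. Extending to -1 costs at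
  -- most 1 in the bound on `κ * R ^ 2 * σ ^ 2`, which is the summand 1 in `κ * t ^ 2 + 1 ≤ K`.
  σ := min (t * ‖ζ‖ / R) (-1)
  L := 1
  dir := ‖ζ‖⁻¹ • ζ
  one_le_R := hR
  κ_nonneg := by positivity
  κR := by
    have : 0 < ‖ζ‖ := norm_pos_iff.2 hζ.1
    rw [div_mul_eq_mul_div, div_le_one (by positivity)]
    exact hζ.2
  κRσ := by
    have h0 : 0 < ‖ζ‖ := norm_pos_iff.2 hζ.1
    have hR0 : 0 < R := by linarith
    have h1 : κ / ‖ζ‖ ^ 2 * R ^ 2 ≤ 1 := by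
      rw [div_mul_eq_mul_div, div_le_one (by positivity)]
      exact hζ.2
    have h2 : κ / ‖ζ‖ ^ 2 * R ^ 2 * (t * ‖ζ‖ / R) ^ 2 = κ * t ^ 2 := by field_simp
    rcases min_choice (t * ‖ζ‖ / R) (-1) with h | h <;> rw [h]
    · linarith
    · have : 0 ≤ κ * t ^ 2 := by positivity
      linarith
  one_le_L := le_rfl
  σ_le := min_le_right _ _
  norm_dir := by
    have : ‖ζ‖ ≠ 0 := norm_ne_zero_iff.2 hζ.1
    simp [norm_smul, this]

/-- Trajectories near an admissible incoming one. -/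
theorem RefFam.flow_near {S : LRSys n} (F : RefFam S K) {R κ t : ℝ} {ζ : Eucl n} (hR : F.R₀ ≤ R)
    (hκ : 0 ≤ κ) (hζ : ζ ∈ admissible κ R) (ht : t ≤ 0) (htK : κ * t ^ 2 + 1 ≤ K) {ζ' : Eucl n}
    (hζ' : ‖ζ' - ζ‖ < 2 * F.r * ‖ζ‖) :
    ‖‖ζ‖⁻¹ • (ζ' - ζ)‖ < 2 * F.r ∧
    S.mom R κ t ζ' = ‖ζ‖ • F.H (‖ζ‖⁻¹ • (ζ' - ζ))
      (idxOf (F.one_le_R₀.trans hR) hκ hζ htK, t * ‖ζ‖ / R) := by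
  have hm : 0 < ‖ζ‖ := norm_pos_iff.2 hζ.1
  have hR0 : 0 < R := by linarith [F.one_le_R₀]
  set i := idxOf (K := K) (F.one_le_R₀.trans hR) hκ hζ htK with hi
  set ϑ := ‖ζ‖⁻¹ • (ζ' - ζ) with hϑ
  have hϑn : ‖ϑ‖ < 2 * F.r := by
    rw [hϑ, norm_smul, norm_inv, norm_norm, inv_mul_lt_iff₀ hm]
    linarith
  refine ⟨hϑn, ?_⟩
  have hs : t * ‖ζ‖ / R ∈ Icc i.σ 0 :=
    ⟨min_le_left _ _, div_nonpos_of_nonpos_of_nonneg (mul_nonpos_of_nonpos_of_nonneg ht hm.le) hR0.le⟩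
  have h1 := F.flow_eq i hR _ hs ϑ (by rwa [mem_ball_zero_iff])
  have hz : ζ' = ‖ζ‖ • (i.dir + ϑ) := by
    have : i.dir = ‖ζ‖⁻¹ • ζ := rfl
    rw [this, hϑ, ← smul_add, smul_smul, mul_inv_cancel₀ hm.ne', one_smul]
    abel
  have h2 := S.φ_scale hm.ne' i.κ (R * (t * ‖ζ‖ / R)) (incoming R (i.dir + ϑ)) (i.dir + ϑ)
  have e1 : ‖ζ‖ ^ 2 * i.κ = κ := by
    have : i.κ = κ / ‖ζ‖ ^ 2 := rfl
    rw [this]; field_simp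
  have e2 : ‖ζ‖⁻¹ * (R * (t * ‖ζ‖ / R)) = t := by field_simp
  rw [e1, e2, ← hz, ← incoming_smul hm, ← hz] at h2
  have hinc : incoming i.R (i.dir + ϑ) = incoming R ζ' := by rw [hz, incoming_smul hm]; rfl
  rw [hinc] at h1
  rw [LRSys.mom, h2]
  exact congrArg (fun z : Eucl n × Eucl n => ‖ζ‖ • z.2) h1

/-- Rescaling by `‖ζ‖` reduces to a unit direction and `lip_H`. The resulting ball of validity has
radius proportional to `‖ζ‖`, with a factor independent of `R`, `κ` and `t`. -/
theorem RefFam.mom_sub {S : LRSys n} (F : RefFam S K) {R κ t : ℝ} {ζ : Eucl n} (hR : F.R₀ ≤ R)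
    (hκ : 0 ≤ κ) (hζ : ζ ∈ admissible κ R) (ht : t ≤ 0) (htK : κ * t ^ 2 + 1 ≤ K) {ζ₁ ζ₂ : Eucl n}
    (h₁ : ‖ζ₁ - ζ‖ < 2 * F.r * ‖ζ‖) (h₂ : ‖ζ₂ - ζ‖ < 2 * F.r * ‖ζ‖) :
    ‖(S.mom R κ t ζ₁ - S.mom R κ t ζ₂) - (ζ₁ - ζ₂)‖ ≤ 1 / 8 * ‖ζ₁ - ζ₂‖ := by
  have hm : 0 < ‖ζ‖ := norm_pos_iff.2 hζ.1
  obtain ⟨b1, e1⟩ := F.flow_near hR hκ hζ ht htK h₁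
  obtain ⟨b2, e2⟩ := F.flow_near hR hκ hζ ht htK h₂
  rw [e1, e2]
  set ϑ₁ := ‖ζ‖⁻¹ • (ζ₁ - ζ)
  set ϑ₂ := ‖ζ‖⁻¹ • (ζ₂ - ζ)
  set i : IT n K := (idxOf (F.one_le_R₀.trans hR) hκ hζ htK, t * ‖ζ‖ / R)
  have hd : ζ₁ - ζ₂ = ‖ζ‖ • (ϑ₁ - ϑ₂) := by
    simp only [ϑ₁, ϑ₂, ← smul_sub, smul_smul, mul_inv_cancel₀ hm.ne', one_smul]; abel
  have h1 := F.lip_H ϑ₁ (by rwa [mem_ball_zero_iff]) ϑ₂ (by rwa [mem_ball_zero_iff])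
  have h2 := ((F.H ϑ₁ - F.H ϑ₂ - bcfConst (ϑ₁ - ϑ₂)).norm_coe_le_norm i).trans h1
  have e3 : (F.H ϑ₁ - F.H ϑ₂ - bcfConst (ϑ₁ - ϑ₂) : BE n K) i = F.H ϑ₁ i - F.H ϑ₂ i - (ϑ₁ - ϑ₂) := rfl
  rw [e3] at h2
  rw [hd, ← smul_sub, ← smul_sub, norm_smul, norm_smul, norm_norm]
  calc _ ≤ ‖ζ‖ * (1 / 8 * ‖ϑ₁ - ϑ₂‖) := by gcongr
    _ = _ := by ring

theorem RefFam.norm_mom_sub_self_le {S : LRSys n} (F : RefFam S K) {R κ t : ℝ} {ζ : Eucl n}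
    (hR : F.R₀ ≤ R) (hκ : 0 ≤ κ) (hζ : ζ ∈ admissible κ R) (ht : t ≤ 0) (htK : κ * t ^ 2 + 1 ≤ K) :
    ‖S.mom R κ t ζ - ζ‖ ≤ F.r / 8 * ‖ζ‖ := by
  have hm : 0 < ‖ζ‖ := norm_pos_iff.2 hζ.1
  have hr := F.r_pos
  obtain ⟨-, e1⟩ := F.flow_near hR hκ hζ ht htK (ζ' := ζ) (by simp; positivity)
  rw [e1, sub_self, smul_zero]
  set i : IT n K := (idxOf (F.one_le_R₀.trans hR) hκ hζ htK, t * ‖ζ‖ / R)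
  have h2 := ((F.H 0 - om).norm_coe_le_norm i).trans F.zero_H
  have e3 : (F.H 0 - om : BE n K) i = F.H 0 i - ‖ζ‖⁻¹ • ζ := rfl
  rw [e3] at h2
  have e4 : ‖ζ‖ • F.H 0 i - ζ = ‖ζ‖ • (F.H 0 i - ‖ζ‖⁻¹ • ζ) := by
    rw [smul_sub, smul_smul, mul_inv_cancel₀ hm.ne', one_smul]
  rw [e4, norm_smul, norm_norm]
  nlinarith

/-- Each momentum differs from its image by a small fraction of its norm, so two momenta with a
common image lie in one ball on which the map is a small Lipschitz perturbation of the identity. -/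
theorem RefFam.mom_injOn {S : LRSys n} (F : RefFam S K) {R κ t : ℝ} (hR : F.R₀ ≤ R) (hκ : 0 ≤ κ)
    (ht : t ≤ 0) (htK : κ * t ^ 2 + 1 ≤ K) : InjOn (S.mom R κ t) (admissible κ R) := by
  have key : ∀ ζ₁ ∈ admissible (n := n) κ R, ∀ ζ₂ ∈ admissible κ R, ‖ζ₂‖ ≤ ‖ζ₁‖ →
      S.mom R κ t ζ₁ = S.mom R κ t ζ₂ → ζ₁ = ζ₂ := by
    intro ζ₁ h₁ ζ₂ h₂ hle he
    have hm : 0 < ‖ζ₁‖ := norm_pos_iff.2 h₁.1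
    have hr := F.r_pos
    have a1 := F.norm_mom_sub_self_le hR hκ h₁ ht htK
    have a2 := F.norm_mom_sub_self_le hR hκ h₂ ht htK
    have a3 : ‖ζ₂ - ζ₁‖ ≤ ‖S.mom R κ t ζ₁ - ζ₁‖ + ‖S.mom R κ t ζ₂ - ζ₂‖ := by
      rw [he]
      calc ‖ζ₂ - ζ₁‖ = ‖(S.mom R κ t ζ₂ - ζ₁) - (S.mom R κ t ζ₂ - ζ₂)‖ := by congr 1; abel
        _ ≤ _ := norm_sub_le _ _
    have a4 : ‖ζ₂ - ζ₁‖ < 2 * F.r * ‖ζ₁‖ := by nlinarith [mul_pos hr hm]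
    have a5 := F.mom_sub hR hκ h₁ ht htK (ζ₁ := ζ₁) (ζ₂ := ζ₂) (by simp; positivity) a4
    rw [he, sub_self, zero_sub, norm_neg] at a5
    have : ‖ζ₁ - ζ₂‖ = 0 := le_antisymm (by linarith) (norm_nonneg _)
    exact sub_eq_zero.1 (norm_eq_zero.1 this)
  intro ζ₁ h₁ ζ₂ h₂ he
  rcases le_total ‖ζ₂‖ ‖ζ₁‖ with h | h
  · exact key _ h₁ _ h₂ h he
  · exact (key _ h₂ _ h₁ h he.symm).symm

/-- Contraction principle for `ζ ↦ ζ - S.mom R κ t ζ + ξ` on a ball around `ξ`. The factor 4 in the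
hypothesis leaves room for the solution, of norm at least half that of `ξ`, to be admissible. -/
theorem RefFam.exists_mom_eq {S : LRSys n} (F : RefFam S K) {R κ t : ℝ} (hR : F.R₀ ≤ R) (hκ : 0 ≤ κ)
    (ht : t ≤ 0) (htK : κ * t ^ 2 + 1 ≤ K) {ξ : Eucl n} (hξ : ξ ≠ 0)
    (hξR : 4 * (κ * R ^ 2) ≤ ‖ξ‖ ^ 2) :
    ∃ ζ, ζ ∈ admissible κ R ∧ S.mom R κ t ζ = ξ ∧ ‖ζ - ξ‖ ≤ 1 / 4 * ‖ξ‖ := by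
  have hm : 0 < ‖ξ‖ := norm_pos_iff.2 hξ
  have hr := F.r_pos
  have hr8 := F.r_le
  have hκR : 0 ≤ κ * R ^ 2 := by positivity
  have hadm : ξ ∈ admissible κ R := ⟨hξ, by linarith⟩
  set B := Metric.closedBall ξ (F.r / 2 * ‖ξ‖) with hB
  have hsub : ∀ ζ ∈ B, ‖ζ - ξ‖ < 2 * F.r * ‖ξ‖ := fun ζ hζ => by
    rw [hB, mem_closedBall_iff_norm] at hζ
    nlinarith [mul_pos hr hm]
  set f : Eucl n → Eucl n := fun ζ => ζ - S.mom R κ t ζ + ξ with hf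
  have hξB : ξ ∈ B := Metric.mem_closedBall_self (by positivity)
  have hlip : ∀ ζ₁ ∈ B, ∀ ζ₂ ∈ B, ‖f ζ₁ - f ζ₂‖ ≤ 1 / 8 * ‖ζ₁ - ζ₂‖ := fun ζ₁ h₁ ζ₂ h₂ => by
    have := F.mom_sub hR hκ hadm ht htK (hsub ζ₁ h₁) (hsub ζ₂ h₂)
    have e : f ζ₁ - f ζ₂ = -((S.mom R κ t ζ₁ - S.mom R κ t ζ₂) - (ζ₁ - ζ₂)) := by
      show ζ₁ - S.mom R κ t ζ₁ + ξ - (ζ₂ - S.mom R κ t ζ₂ + ξ) = _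
      abel
    rw [e, norm_neg]
    exact this
  have hmaps : MapsTo f B B := fun ζ hζ => by
    have h1 := hlip ζ hζ ξ hξB
    have h2 := F.norm_mom_sub_self_le hR hκ hadm ht htK
    have h3 : ‖f ξ - ξ‖ ≤ F.r / 8 * ‖ξ‖ := by
      have e : f ξ - ξ = -(S.mom R κ t ξ - ξ) := by
        show ξ - S.mom R κ t ξ + ξ - ξ = _
        abel
      rw [e, norm_neg]
      exact h2
    have h4 : ‖f ζ - ξ‖ ≤ ‖f ζ - f ξ‖ + ‖f ξ - ξ‖ := norm_sub_le_norm_sub_add_norm_sub _ _ _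
    rw [hB, mem_closedBall_iff_norm] at hζ ⊢
    nlinarith [mul_pos hr hm]
  have hc : ContractingWith (1 / 8) (hmaps.restrict f B B) := by
    refine ⟨by rw [← NNReal.coe_lt_coe]; norm_num, LipschitzWith.of_dist_le_mul fun x y => ?_⟩
    have := hlip x x.2 y y.2
    rw [Subtype.dist_eq, Subtype.dist_eq, dist_eq_norm, dist_eq_norm]
    simpa using this
  obtain ⟨ζ, hζB, hζf, -⟩ := ContractingWith.exists_fixedPoint' (f := f)
    Metric.isClosed_closedBall.isComplete hmaps hc hξB (by simp [edist_ne_top])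
  have hζn : ‖ζ - ξ‖ ≤ 1 / 4 * ‖ξ‖ := by
    rw [mem_closedBall_iff_norm] at hζB
    nlinarith
  have hfix : S.mom R κ t ζ = ξ := by
    have : ζ - S.mom R κ t ζ + ξ = ζ := hζf
    have h2 : ξ - S.mom R κ t ζ = 0 := by
      have := congrArg (fun z => z - ζ) this
      simp only [sub_self] at this
      rw [← this]; abel
    exact (sub_eq_zero.1 h2).symm
  have hn : ‖ξ‖ ≤ ‖ζ‖ + 1 / 4 * ‖ξ‖ := by
    have : ‖ξ‖ ≤ ‖ζ‖ + ‖ζ - ξ‖ := by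
      calc ‖ξ‖ = ‖ζ - (ζ - ξ)‖ := by congr 1; abel
        _ ≤ _ := norm_sub_le _ _
    linarith
  have hn' : 1 / 2 * ‖ξ‖ ≤ ‖ζ‖ := by linarith
  refine ⟨ζ, ⟨norm_pos_iff.1 (by linarith), ?_⟩, hfix, hζn⟩
  nlinarith [mul_self_le_mul_self (by positivity) hn']

theorem contDiffAt_incoming (R : ℝ) {ζ : Eucl n} (hζ : ζ ≠ 0) :
    ContDiffAt ℝ ∞ (incoming R : Eucl n → Eucl n) ζ := by
  unfold incoming
  exact ((contDiffAt_const.div (contDiffAt_id.norm ℝ hζ) (norm_ne_zero_iff.2 hζ)).smul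
    contDiffAt_id).neg

theorem LRSys.contDiffAt_incoming_flow (S : LRSys n) (R κ t : ℝ) {ζ : Eucl n} (hζ : ζ ≠ 0) :
    ContDiffAt ℝ ∞ (fun p : ℝ × ℝ × Eucl n => S.φ p.1 p.2.1 (incoming R p.2.2, p.2.2)) (κ, t, ζ) := by
  have h1 : ContDiffAt ℝ ∞ (fun p : ℝ × ℝ × Eucl n => incoming R p.2.2) (κ, t, ζ) :=
    ContDiffAt.comp (κ, t, ζ) (f := fun p : ℝ × ℝ × Eucl n => p.2.2) (g := incoming R)
      (contDiffAt_incoming R hζ) (by fun_prop)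
  have h2 : ContDiffAt ℝ ∞ (fun p : ℝ × ℝ × Eucl n => (p.1, p.2.1, (incoming R p.2.2, p.2.2)))
      (κ, t, ζ) :=
    contDiffAt_fst.prodMk ((contDiffAt_fst.comp _ contDiffAt_snd).prodMk
      (h1.prodMk (contDiffAt_snd.comp _ contDiffAt_snd)))
  exact S.φ_smooth.contDiffAt.comp (κ, t, ζ) h2

theorem LRSys.contDiffAt_mom (S : LRSys n) (R κ t : ℝ) {ζ : Eucl n} (hζ : ζ ≠ 0) :
    ContDiffAt ℝ ∞ (S.mom R κ t) ζ :=
  contDiffAt_snd.comp ζ ((S.contDiffAt_incoming_flow R κ t hζ).comp ζ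
    (f := fun ζ' => (κ, t, ζ')) (contDiffAt_const.prodMk (contDiffAt_const.prodMk contDiffAt_id)))

/-- A linear map close to the identity is invertible. -/
theorem exists_equiv_of_norm_sub_le {E : Type} [NormedAddCommGroup E] [NormedSpace ℝ E]
    [FiniteDimensional ℝ E] (D : E →L[ℝ] E) {c : ℝ} (hc : c < 1) (h : ∀ v, ‖D v - v‖ ≤ c * ‖v‖) :
    ∃ e : E ≃L[ℝ] E, (e : E →L[ℝ] E) = D := by
  have hinj : Function.Injective (D : E →ₗ[ℝ] E) := by
    rw [injective_iff_map_eq_zero]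
    intro v hv
    have h1 := h v
    have hv' : D v = 0 := hv
    rw [hv', zero_sub, norm_neg] at h1
    have : ‖v‖ = 0 := by nlinarith [norm_nonneg v]
    exact norm_eq_zero.1 this
  refine ⟨(LinearEquiv.ofInjectiveEndo (D : E →ₗ[ℝ] E) hinj).toContinuousLinearEquiv, ?_⟩
  ext v
  rfl

theorem norm_fderiv_sub_le_of_lip {E : Type} [NormedAddCommGroup E] [NormedSpace ℝ E]
    {f : E → E} {x : E} {D : E →L[ℝ] E} (hf : HasFDerivAt f D x) {U : Set E} (hU : U ∈ 𝓝 x) {c : ℝ}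
    (hc : 0 ≤ c) (h : ∀ y ∈ U, ‖(f y - f x) - (y - x)‖ ≤ c * ‖y - x‖) (v : E) :
    ‖D v - v‖ ≤ c * ‖v‖ := by
  have h1 : HasFDerivAt (fun y => f y - y) (D - ContinuousLinearMap.id ℝ E) x :=
    hf.sub (hasFDerivAt_id x)
  have h2 : ‖D - ContinuousLinearMap.id ℝ E‖ ≤ c := by
    refine h1.le_of_lip' hc ?_
    filter_upwards [hU] with y hy
    refine le_of_eq_of_le ?_ (h y hy)
    congr 1; abel
  exact (D - ContinuousLinearMap.id ℝ E).le_of_opNorm_le h2 v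

theorem RefFam.hasStrictFDerivAt_mom {S : LRSys n} (F : RefFam S K) {R κ t : ℝ} {ζ : Eucl n}
    (hR : F.R₀ ≤ R) (hκ : 0 ≤ κ) (hζ : ζ ∈ admissible κ R) (ht : t ≤ 0)
    (htK : κ * t ^ 2 + 1 ≤ K) :
    ∃ e : Eucl n ≃L[ℝ] Eucl n, HasStrictFDerivAt (S.mom R κ t) (e : Eucl n →L[ℝ] Eucl n) ζ := by
  have hm : 0 < ‖ζ‖ := norm_pos_iff.2 hζ.1
  have hr := F.r_pos
  have h1 := (S.contDiffAt_mom R κ t hζ.1).hasStrictFDerivAt (by simp)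
  obtain ⟨e, he⟩ := exists_equiv_of_norm_sub_le (fderiv ℝ (S.mom R κ t) ζ)
    (c := 1 / 8) (by norm_num) (norm_fderiv_sub_le_of_lip h1.hasFDerivAt
      (Metric.ball_mem_nhds ζ (show 0 < 2 * F.r * ‖ζ‖ by positivity)) (by norm_num) fun y hy =>
        F.mom_sub hR hκ hζ ht htK (mem_ball_iff_norm.1 hy) (by simp; positivity))
  exact ⟨e, he ▸ h1⟩

end LongRangeFlow

end

noncomputable section

namespace LongRangeFlow

/-! ### The gradient of the phase -/

section Action

variable {E : Type} [NormedAddCommGroup E] [InnerProductSpace ℝ E] [FiniteDimensional ℝ E]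

theorem hasFDerivAt_parametric_integral {O : Set E} (hO : IsOpen O) {f : ℝ × E → ℝ}
    (hf : ContDiffOn ℝ 1 f (univ ×ˢ O)) {x₀ : E} (hx : x₀ ∈ O) (t : ℝ) :
    HasFDerivAt (fun x => ∫ s in (0 : ℝ)..t, f (s, x))
      (∫ s in (0 : ℝ)..t, (fderiv ℝ f (s, x₀)).comp (ContinuousLinearMap.inr ℝ ℝ E)) x₀ := by
  have hop : IsOpen ((univ : Set ℝ) ×ˢ O) := isOpen_univ.prod hO
  obtain ⟨ε, hε, hεO⟩ := Metric.nhds_basis_closedBall.mem_iff.1 (hO.mem_nhds hx)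
  have hcf : ContinuousOn (fderiv ℝ f) (univ ×ˢ O) := hf.continuousOn_fderiv_of_isOpen hop le_rfl
  have hcomp : IsCompact (uIcc 0 t ×ˢ Metric.closedBall x₀ ε) :=
    isCompact_uIcc.prod (isCompact_closedBall _ _)
  have hsub : uIcc 0 t ×ˢ Metric.closedBall x₀ ε ⊆ univ ×ˢ O := prod_mono (subset_univ _) hεO
  obtain ⟨C, hC⟩ : ∃ C, ∀ p ∈ uIcc 0 t ×ˢ Metric.closedBall x₀ ε, ‖fderiv ℝ f p‖ ≤ C := by
    have hn : ContinuousOn (fun p => ‖fderiv ℝ f p‖) (uIcc 0 t ×ˢ Metric.closedBall x₀ ε) := by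
      refine ContinuousOn.norm (E := ℝ × E →L[ℝ] ℝ) ?_
      exact hcf.mono hsub
    obtain ⟨C, hC⟩ := hcomp.exists_bound_of_continuousOn hn
    exact ⟨C, fun p hp => le_trans (le_abs_self _) (hC p hp)⟩
  have hsl : ∀ x ∈ O, Continuous (fun s : ℝ => f (s, x)) := fun x hx' =>
    hf.continuousOn.comp_continuous (by fun_prop) fun s => ⟨mem_univ _, hx'⟩
  have hsl' : Continuous (fun s : ℝ => (fderiv ℝ f (s, x₀)).comp (ContinuousLinearMap.inr ℝ ℝ E)) := by
    have : Continuous (fun s : ℝ => fderiv ℝ f (s, x₀)) :=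
      hcf.comp_continuous (by fun_prop) fun s => ⟨mem_univ _, hx⟩
    exact this.clm_comp continuous_const
  refine intervalIntegral.hasFDerivAt_integral_of_dominated_of_fderiv_le
    (μ := MeasureTheory.volume) (F := fun x s => f (s, x))
    (F' := fun x s => (fderiv ℝ f (s, x)).comp (ContinuousLinearMap.inr ℝ ℝ E))
    (bound := fun _ => C * 1) (Metric.closedBall_mem_nhds x₀ hε) ?_ ?_ ?_ ?_ ?_ ?_
  · filter_upwards [hO.mem_nhds hx] with x hx'
    exact (hsl x hx').aestronglyMeasurable
  · exact (hsl x₀ hx).intervalIntegrable _ _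
  · exact hsl'.aestronglyMeasurable
  · refine Eventually.of_forall fun s hs x hx' => ?_
    have h1 : ‖fderiv ℝ f (s, x)‖ ≤ C := hC (s, x) ⟨uIoc_subset_uIcc hs, hx'⟩
    refine (ContinuousLinearMap.opNorm_comp_le _ _).trans ?_
    gcongr
    · exact le_trans (norm_nonneg (fderiv ℝ f (s, x))) h1
    · exact ContinuousLinearMap.norm_inr_le_one ℝ ℝ E
  · exact intervalIntegrable_const
  · refine Eventually.of_forall fun s _ x hx' => ?_
    have h1 : HasFDerivAt f (fderiv ℝ f (s, x)) (s, x) :=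
      ((hf.differentiableOn (by simp)).differentiableAt
        (hop.mem_nhds ⟨mem_univ _, hεO hx'⟩)).hasFDerivAt
    exact HasFDerivAt.comp x (f := fun x => (s, x)) h1 (hasFDerivAt_prodMk_right s x)

/-- The variational equation, obtained from the symmetry of the second derivative of `Φ` in time and
parameter. -/
theorem hasDerivAt_fderiv_flow {E F : Type} [NormedAddCommGroup E] [InnerProductSpace ℝ E] [NormedAddCommGroup F] [NormedSpace ℝ F] {O : Set E}
    (hO : IsOpen O) {Φ G : ℝ × E → F} (hΦ : ContDiffOn ℝ ∞ Φ (univ ×ˢ O))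
    (hd : ∀ s, ∀ x ∈ O, HasDerivAt (fun s => Φ (s, x)) (G (s, x)) s) {x : E} (hx : x ∈ O) (s : ℝ)
    (v : E) :
    HasDerivAt (fun s => fderiv ℝ Φ (s, x) (0, v)) (fderiv ℝ G (s, x) (0, v)) s := by
  have hop : IsOpen ((univ : Set ℝ) ×ˢ O) := isOpen_univ.prod hO
  have hmem : (s, x) ∈ (univ : Set ℝ) ×ˢ O := ⟨mem_univ _, hx⟩
  have h1 : ∀ q ∈ (univ : Set ℝ) ×ˢ O, fderiv ℝ Φ q (1, 0) = G q := by
    rintro ⟨s', x'⟩ ⟨-, hx'⟩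
    have h2 : HasFDerivAt Φ (fderiv ℝ Φ (s', x')) (s', x') :=
      ((hΦ.differentiableOn (by simp)).differentiableAt
        (hop.mem_nhds ⟨mem_univ _, hx'⟩)).hasFDerivAt
    have h3 : HasDerivAt (fun s => (s, x')) ((1 : ℝ), (0 : E)) s' :=
      (hasDerivAt_id s').prodMk (hasDerivAt_const s' x')
    exact (HasFDerivAt.comp_hasDerivAt s' (f := fun s => (s, x')) h2 h3).unique (hd s' x' hx')
  have hat : ContDiffAt ℝ ∞ Φ (s, x) := hΦ.contDiffAt (hop.mem_nhds hmem)
  have hsym : IsSymmSndFDerivAt ℝ Φ (s, x) := hat.isSymmSndFDerivAt (by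
    simp only [minSmoothness_of_isRCLikeNormedField]
    exact WithTop.coe_le_coe.2 (le_top : (2 : ℕ∞) ≤ ⊤))
  have hdd : DifferentiableAt ℝ (fderiv ℝ Φ) (s, x) :=
    (hat.fderiv_right (m := ∞) (by simp)).differentiableAt (by simp)
  have h4 : fderiv ℝ G (s, x) (0, v) = fderiv ℝ (fderiv ℝ Φ) (s, x) (0, v) (1, 0) := by
    have e : (fun q => fderiv ℝ Φ q (1, 0)) =ᶠ[𝓝 (s, x)] G := by
      filter_upwards [hop.mem_nhds hmem] with q hq using h1 q hq
    rw [← e.fderiv_eq]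
    rw [fderiv_clm_apply hdd (differentiableAt_const _)]
    simp
  rw [h4, hsym.eq]
  have h3 : HasDerivAt (fun s => (s, x)) ((1 : ℝ), (0 : E)) s :=
    (hasDerivAt_id s).prodMk (hasDerivAt_const s x)
  have h5 : HasDerivAt (fun s => fderiv ℝ Φ (s, x)) (fderiv ℝ (fderiv ℝ Φ) (s, x) (1, 0)) s := by
    refine HasFDerivAt.comp_hasDerivAt s (f := fun s => (s, x)) (l := fderiv ℝ Φ) ?_ h3
    exact hdd.hasFDerivAt
  exact (h5.clm_apply (hasDerivAt_const s ((0 : ℝ), v))).congr_deriv (by simp)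

/-- The derivative of the action along a family of Hamiltonian trajectories. -/
theorem exists_hasFDerivAt_action {O : Set E} (hO : IsOpen O) {Φ : ℝ × E → E × E}
    {𝓔 : E × E → ℝ} {Xf : E × E → E × E} (hΦ : ContDiffOn ℝ ∞ Φ (univ ×ˢ O))
    (h𝓔 : ContDiff ℝ ∞ 𝓔) (hXf : ContDiff ℝ ∞ Xf)
    (hX : ∀ q v w, fderiv ℝ 𝓔 q (v, w) = -inner ℝ (Xf q).2 v + inner ℝ (Xf q).1 w)
    (hd : ∀ s, ∀ x ∈ O, HasDerivAt (fun s => Φ (s, x)) (Xf (Φ (s, x))) s) {x : E} (hx : x ∈ O)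
    (t : ℝ) :
    ∃ L : E →L[ℝ] ℝ, HasFDerivAt (fun x => ∫ s in (0 : ℝ)..t,
      (𝓔 (Φ (s, x)) + inner ℝ (Φ (s, x)).1 (Xf (Φ (s, x))).2)) L x ∧
      ∀ v, L v = inner ℝ (Φ (t, x)).1 (fderiv ℝ Φ (t, x) (0, v)).2 -
        inner ℝ (Φ (0, x)).1 (fderiv ℝ Φ (0, x) (0, v)).2 := by
  have hop : IsOpen ((univ : Set ℝ) ×ˢ O) := isOpen_univ.prod hO
  set I : ℝ × E → ℝ := fun p => 𝓔 (Φ p) + inner ℝ (Φ p).1 (Xf (Φ p)).2 with hI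
  have hXΦ : ContDiffOn ℝ ∞ (fun p => Xf (Φ p)) (univ ×ˢ O) := hXf.comp_contDiffOn hΦ
  have hIs : ContDiffOn ℝ ∞ I (univ ×ˢ O) :=
    (h𝓔.comp_contDiffOn hΦ).add ((contDiff_fst.comp_contDiffOn hΦ).inner ℝ
      (contDiff_snd.comp_contDiffOn hXΦ))
  have h1 := hasFDerivAt_parametric_integral hO (hIs.of_le (by simp)) hx t
  refine ⟨_, h1, fun v => ?_⟩
  have hcont : Continuous (fun s : ℝ => (fderiv ℝ I (s, x)).comp (ContinuousLinearMap.inr ℝ ℝ E)) := by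
    have : Continuous (fun s : ℝ => fderiv ℝ I (s, x)) :=
      (hIs.continuousOn_fderiv_of_isOpen hop (by simp)).comp_continuous (by fun_prop)
        fun s => ⟨mem_univ _, hx⟩
    exact this.clm_comp continuous_const
  rw [ContinuousLinearMap.intervalIntegral_apply (hcont.intervalIntegrable _ _)]
  -- By Hamilton's equations the variation of the integrand is -⟨η',δy⟩ + ⟨y',δη⟩ + ⟨δy,η'⟩ +
  -- ⟨y,δη'⟩, which is the time derivative of ⟨y,δη⟩.
  refine intervalIntegral.integral_eq_sub_of_hasDerivAt
    (f := fun s => inner ℝ (Φ (s, x)).1 (fderiv ℝ Φ (s, x) (0, v)).2) (fun s _ => ?_) ?_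
  · have hdΦ := hd s x hx
    have hmem : (s, x) ∈ (univ : Set ℝ) ×ˢ O := ⟨mem_univ _, hx⟩
    have hv := hasDerivAt_fderiv_flow hO hΦ (G := fun p => Xf (Φ p)) hd hx s v
    have hDΦ : HasFDerivAt Φ (fderiv ℝ Φ (s, x)) (s, x) :=
      ((hΦ.differentiableOn (by simp)).differentiableAt (hop.mem_nhds hmem)).hasFDerivAt
    have hDX : HasFDerivAt (fun p => Xf (Φ p)) (fderiv ℝ (fun p => Xf (Φ p)) (s, x)) (s, x) :=
      ((hXΦ.differentiableOn (by simp)).differentiableAt (hop.mem_nhds hmem)).hasFDerivAt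
    have hDI : HasFDerivAt I _ (s, x) :=
      (((h𝓔.differentiable (by simp) (Φ (s, x))).hasFDerivAt.comp (s, x) hDΦ).add
        ((hasFDerivAt_fst.comp (s, x) hDΦ).inner ℝ (hasFDerivAt_snd.comp (s, x) hDX)))
    have e1 := (hasFDerivAt_fst.comp_hasDerivAt s hdΦ).inner ℝ (hasFDerivAt_snd.comp_hasDerivAt s hv)
    refine e1.congr_deriv ?_
    rw [ContinuousLinearMap.comp_apply, hDI.fderiv]
    set D := fderiv ℝ Φ (s, x) (0, v) with hD
    have hE := hX (Φ (s, x)) D.1 D.2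
    simp only [ContinuousLinearMap.add_apply, ContinuousLinearMap.comp_apply,
      ContinuousLinearMap.inr_apply, ContinuousLinearMap.prod_apply, fderivInnerCLM_apply,
      ContinuousLinearMap.coe_fst', ContinuousLinearMap.coe_snd', Function.comp]
    rw [← hD, show fderiv ℝ 𝓔 (Φ (s, x)) D = _ from hE]
    rw [real_inner_comm D.1]
    ring
  · exact (hcont.clm_apply continuous_const).intervalIntegrable _ _

end Action

variable {n : ℕ} {a : Eucl n → Matrix (Fin n) (Fin n) ℝ} {V : Eucl n → ℝ} {μ K : ℝ}

theorem contDiff_energy (h : IsLongRange a V μ) :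
    ContDiff ℝ ∞ (fun q : Eucl n × Eucl n => energy a V q.1 q.2) := by
  have := contDiff_opA h
  have hV := h.smooth_V
  simp only [energy, kinetic_eq]
  exact (contDiff_const.mul (ContDiff.inner ℝ (by fun_prop) contDiff_snd)).add (by fun_prop)

theorem fderiv_energy (h : IsLongRange a V μ) (q : Eucl n × Eucl n) (v w : Eucl n) :
    fderiv ℝ (fun q : Eucl n × Eucl n => energy a V q.1 q.2) q (v, w) =
      -inner ℝ ((sysOf h).X 1 q).2 v + inner ℝ ((sysOf h).X 1 q).1 w := by
  obtain ⟨x, ξ⟩ := q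
  obtain ⟨L, hL, hLv⟩ := hasFDerivAt_kinetic h x ξ
  have hV : HasFDerivAt (fun q : Eucl n × Eucl n => V q.1)
      ((fderiv ℝ V x).comp (ContinuousLinearMap.fst ℝ (Eucl n) (Eucl n))) (x, ξ) :=
    HasFDerivAt.comp (x, ξ) (f := Prod.fst) (g := V)
      ((h.smooth_V.differentiable (by simp) x).hasFDerivAt) hasFDerivAt_fst
  have h2 : HasFDerivAt (fun q : Eucl n × Eucl n => energy a V q.1 q.2) _ (x, ξ) := hL.add hV
  have e1 : ((sysOf h).X 1 (x, ξ)).1 = opA a x ξ := rfl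
  have e2 : ((sysOf h).X 1 (x, ξ)).2 = -(opB a x ξ ξ) - (1 : ℝ) • gradient V x := rfl
  have e3 : fderiv ℝ V x v = inner ℝ (gradient V x) v := by simp [gradient]
  rw [h2.fderiv, e1, e2, ContinuousLinearMap.add_apply, hLv, ContinuousLinearMap.comp_apply,
    ContinuousLinearMap.coe_fst', e3, one_smul, inner_sub_left, inner_neg_left]
  ring

theorem Lam_eq_mom (h : IsLongRange a V μ) (R t : ℝ) : Lam a V R t = (sysOf h).mom R 1 t := by
  funext ζ
  rw [LRSys.mom, sysOf_φ_one]; rfl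

/-- At coupling 1 admissibility is the bound |ζ| ≥ R, which is where the choice `c₀ = 1` comes from.
-/
theorem setOf_le_norm_eq {R : ℝ} (hR : 0 < R) : {ζ : Eucl n | 1 * R ≤ ‖ζ‖} = admissible 1 R := by
  ext ζ
  simp only [mem_setOf_eq, admissible, one_mul]
  constructor
  · intro h
    exact ⟨norm_pos_iff.1 (hR.trans_le h), by gcongr⟩
  · rintro ⟨-, h⟩
    exact le_of_sq_le_sq h (norm_nonneg _)

/-- The inverse momentum map is a right inverse at high momenta. -/
theorem zetaInv_spec (h : IsLongRange a V μ) (F : RefFam (sysOf h) K) {R t : ℝ} (hR : F.R₀ ≤ R)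
    (ht : t ≤ 0) (htK : t ^ 2 + 1 ≤ K) {ξ : Eucl n} (hξ : 2 * R ≤ ‖ξ‖) :
    zetaInv a V 1 R t ξ ∈ admissible 1 R ∧ (sysOf h).mom R 1 t (zetaInv a V 1 R t ξ) = ξ := by
  have hR0 : 0 < R := by linarith [F.one_le_R₀]
  have hex : ∃ ζ ∈ {ζ : Eucl n | 1 * R ≤ ‖ζ‖}, Lam a V R t ζ = ξ := by
    obtain ⟨ζ, h1, h2, -⟩ := F.exists_mom_eq hR zero_le_one ht (by linarith) (ξ := ξ)
      (norm_pos_iff.1 (by linarith)) (by nlinarith)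
    exact ⟨ζ, by rw [setOf_le_norm_eq hR0]; exact h1, by rw [Lam_eq_mom h]; exact h2⟩
  have h1 := Function.invFunOn_mem hex
  have h2 := Function.invFunOn_eq hex
  rw [setOf_le_norm_eq hR0] at h1
  rw [Lam_eq_mom h] at h2
  refine ⟨?_, ?_⟩
  · rw [zetaInv, setOf_le_norm_eq hR0, Lam_eq_mom h]
    rw [Lam_eq_mom h] at h1
    exact h1
  · rw [zetaInv, Lam_eq_mom h]
    exact h2

theorem zetaInv_unique (h : IsLongRange a V μ) (F : RefFam (sysOf h) K) {R t : ℝ} (hR : F.R₀ ≤ R)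
    (ht : t ≤ 0) (htK : t ^ 2 + 1 ≤ K) {ζ : Eucl n} (hζ : ζ ∈ admissible 1 R)
    (hξ : 2 * R ≤ ‖(sysOf h).mom R 1 t ζ‖) : zetaInv a V 1 R t ((sysOf h).mom R 1 t ζ) = ζ := by
  obtain ⟨h1, h2⟩ := zetaInv_spec h F hR ht htK hξ
  exact F.mom_injOn hR zero_le_one ht (by linarith) h1 hζ h2

/-- The gradient of `W₁` is the position of the incoming trajectory. -/
theorem hasGradientAt_W₁ (h : IsLongRange a V μ) (F : RefFam (sysOf h) K) {R t : ℝ} (hR : F.R₀ ≤ R)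
    (ht : t ≤ 0) (htK : t ^ 2 + 1 ≤ K) {ξ : Eucl n} (hξ : 2 * R < ‖ξ‖) :
    HasGradientAt (W₁ a V 1 R t)
      ((sysOf h).φ 1 t (incoming R (zetaInv a V 1 R t ξ), zetaInv a V 1 R t ξ)).1 ξ := by
  have hR0 : 0 < R := by linarith [F.one_le_R₀]
  obtain ⟨hadm, hmom⟩ := zetaInv_spec h F hR ht htK hξ.le
  set ζ := zetaInv a V 1 R t ξ with hζ
  have hζ0 : ζ ≠ 0 := hadm.1
  -- strict lower bound
  have hlt : R < ‖ζ‖ := by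
    have h1 := F.norm_mom_sub_self_le hR zero_le_one hadm ht (by linarith)
    rw [hmom] at h1
    have h2 : ‖ξ‖ ≤ ‖ξ - ζ‖ + ‖ζ‖ := by simpa using norm_add_le (ξ - ζ) ζ
    have h3 := F.r_le
    have h4 := norm_nonneg ζ
    nlinarith
  set Φ : ℝ × Eucl n → Eucl n × Eucl n := fun p => (sysOf h).φ 1 p.1 (incoming R p.2, p.2) with hΦ
  have hO : IsOpen {ζ : Eucl n | ζ ≠ 0} := isOpen_ne
  have hΦs : ContDiffOn ℝ ∞ Φ (univ ×ˢ {ζ : Eucl n | ζ ≠ 0}) := by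
    rintro ⟨s, x⟩ ⟨-, hx⟩
    exact (((sysOf h).contDiffAt_incoming_flow R 1 s hx).comp (s, x)
      (f := fun p : ℝ × Eucl n => ((1 : ℝ), p.1, p.2))
      (contDiffAt_const.prodMk (contDiffAt_fst.prodMk contDiffAt_snd))).contDiffWithinAt
  have hd : ∀ s, ∀ x ∈ {ζ : Eucl n | ζ ≠ 0}, HasDerivAt (fun s => Φ (s, x)) ((sysOf h).X 1 (Φ (s, x))) s :=
    fun s x _ => (sysOf h).φ_deriv 1 (incoming R x, x) s
  obtain ⟨L, hL, hLv⟩ := exists_hasFDerivAt_action hO hΦs (contDiff_energy h) ((sysOf h).contDiff_X 1)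
    (fderiv_energy h) hd hζ0 t
  have hN : HasFDerivAt (fun x : Eucl n => R * ‖x‖) (R • (‖ζ‖⁻¹ • innerSL ℝ ζ)) ζ := by
    have h1 : HasFDerivAt (fun x : Eucl n => Real.sqrt (‖x‖ ^ 2))
        ((1 / (2 * Real.sqrt (‖ζ‖ ^ 2))) • (2 • innerSL ℝ ζ)) ζ :=
      (hasStrictFDerivAt_norm_sq ζ).hasFDerivAt.sqrt (by simpa using hζ0)
    simp only [Real.sqrt_sq (norm_nonneg _)] at h1
    refine (h1.const_mul R).congr_fderiv ?_
    ext v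
    simp [hR0.ne']
    ring
  have h𝒲 := hL.sub hN
  -- the momentum map and its inverse
  obtain ⟨e, he⟩ := F.hasStrictFDerivAt_mom hR zero_le_one hadm ht (by linarith)
  have hloc : ∀ᶠ x in 𝓝 ξ, zetaInv a V 1 R t x = he.localInverse _ e ζ x := by
    have hc : ContinuousAt (he.localInverse _ e ζ) ξ := by
      have := he.localInverse_continuousAt
      rwa [hmom] at this
    have hz : he.localInverse _ e ζ ξ = ζ := by
      have := he.localInverse_apply_image
      rwa [hmom] at this
    have h1 : ∀ᶠ x in 𝓝 ξ, R < ‖he.localInverse _ e ζ x‖ :=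
      (hc.norm).eventually (lt_mem_nhds (by
        show R < ‖he.localInverse _ e ζ ξ‖
        rw [hz]; exact hlt))
    have h2 : ∀ᶠ x in 𝓝 ξ, (sysOf h).mom R 1 t (he.localInverse _ e ζ x) = x := by
      have := he.eventually_right_inverse
      rwa [hmom] at this
    have h3 : ∀ᶠ x in 𝓝 ξ, 2 * R < ‖x‖ := continuous_norm.continuousAt.eventually (lt_mem_nhds hξ)
    filter_upwards [h1, h2, h3] with x a1 a2 a3
    have hx : he.localInverse _ e ζ x ∈ admissible 1 R := by
      rw [← setOf_le_norm_eq hR0, mem_setOf_eq, one_mul]; exact a1.le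
    have := zetaInv_unique h F hR ht htK hx (by rw [a2]; exact a3.le)
    rwa [a2] at this
  have hinv : HasFDerivAt (zetaInv a V 1 R t) (e.symm : Eucl n →L[ℝ] Eucl n) ξ := by
    have := he.to_localInverse.hasFDerivAt
    rw [hmom] at this
    exact this.congr_of_eventuallyEq hloc
  have hW : HasFDerivAt (W₁ a V 1 R t) ((L - R • (‖ζ‖⁻¹ • innerSL ℝ ζ)).comp
      (e.symm : Eucl n →L[ℝ] Eucl n)) ξ := by
    have h1 := HasFDerivAt.comp ξ (f := zetaInv a V 1 R t) h𝒲 hinv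
    refine h1.congr_of_eventuallyEq (Eventually.of_forall fun x => ?_)
    simp only [W₁, Function.comp, Pi.sub_apply]
    congr 1
    refine intervalIntegral.integral_congr fun s _ => ?_
    have e1 : ∀ s, flow (energy a V) s (incoming R (zetaInv a V 1 R t x), zetaInv a V 1 R t x) =
      (sysOf h).φ 1 s (incoming R (zetaInv a V 1 R t x), zetaInv a V 1 R t x) :=
      fun s => (sysOf_φ_one h s _).symm
    simp only [yFlow, etaFlow, e1, hΦ]
    congr 2
    exact (hasFDerivAt_snd.comp_hasDerivAt s ((sysOf h).φ_deriv 1 (incoming R (zetaInv a V 1 R t x),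
      zetaInv a V 1 R t x) s)).deriv
  rw [hasGradientAt_iff_hasFDerivAt]
  refine hW.congr_fderiv ?_
  ext w
  set v := e.symm w with hv
  have hDmom : (fderiv ℝ Φ (t, ζ) (0, v)).2 = w := by
    have h1 : HasFDerivAt Φ (fderiv ℝ Φ (t, ζ)) (t, ζ) :=
      ((hΦs.differentiableOn (by simp)).differentiableAt
        ((isOpen_univ.prod hO).mem_nhds (mk_mem_prod (mem_univ _) hζ0))).hasFDerivAt
    have h2 := hasFDerivAt_snd.comp ζ (HasFDerivAt.comp ζ (f := fun x => (t, x)) h1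
      (hasFDerivAt_prodMk_right t ζ))
    have h3 := DFunLike.congr_fun (h2.unique he.hasFDerivAt) v
    have h4 : e v = w := by rw [hv]; simp
    rw [← h4]
    exact h3
  have hD0 : (fderiv ℝ Φ (0, ζ) (0, v)).2 = v := by
    have h1 : HasFDerivAt Φ (fderiv ℝ Φ (0, ζ)) (0, ζ) :=
      ((hΦs.differentiableOn (by simp)).differentiableAt
        ((isOpen_univ.prod hO).mem_nhds (mk_mem_prod (mem_univ _) hζ0))).hasFDerivAt
    have h2 := hasFDerivAt_snd.comp ζ (HasFDerivAt.comp ζ (f := fun x => ((0 : ℝ), x)) h1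
      (hasFDerivAt_prodMk_right (0 : ℝ) ζ))
    have h5 : HasFDerivAt (Prod.snd ∘ (Φ ∘ fun x => ((0 : ℝ), x)))
        (ContinuousLinearMap.id ℝ (Eucl n)) ζ := by
      refine (hasFDerivAt_id ζ).congr_of_eventuallyEq (Eventually.of_forall fun x => ?_)
      simp [hΦ, (sysOf h).φ_zero]
    exact DFunLike.congr_fun (h2.unique h5) v
  have hΦ0 : (Φ (0, ζ)).1 = -((R / ‖ζ‖) • ζ) := by simp [hΦ, (sysOf h).φ_zero, incoming]
  -- The boundary term of the action at time 0 pairs the starting point -Rζ/|ζ| with `v`; it cancels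
  -- the derivative of R|ζ|. Only the pairing of the final position with the variation `w` of the
  -- final momentum is left.
  show L v - R * (‖ζ‖⁻¹ * inner ℝ ζ v) = _
  rw [hLv, hDmom, hD0, hΦ0, inner_neg_left, real_inner_smul_left]
  simp only [InnerProductSpace.toDual_apply_apply, hΦ]
  ring

theorem gradient_W (h : IsLongRange a V μ) (F : RefFam (sysOf h) K) {R t : ℝ} (hR : F.R₀ ≤ R)
    (ht : t ≤ 0) (htK : t ^ 2 + 1 ≤ K) {χ : Eucl n → ℝ} (hχ : IsCutoff (2 * R) χ) {ξ : Eucl n}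
    (hξ : 2 * R + 1 < ‖ξ‖) :
    gradient (W a V 1 R χ t) ξ =
      ((sysOf h).φ 1 t (incoming R (zetaInv a V 1 R t ξ), zetaInv a V 1 R t ξ)).1 := by
  have h1 := hasGradientAt_W₁ h F hR ht htK (ξ := ξ) (by linarith)
  refine HasGradientAt.gradient (HasGradientAt.congr_of_eventuallyEq h1 ?_)
  filter_upwards [continuous_norm.continuousAt.eventually (lt_mem_nhds hξ)] with x hx
  rw [W, hχ.eq_one x hx.le]
  ring

end LongRangeFlow

end

noncomputable section

namespace LongRangeFlow

/-! ### Difference quotients of scaled symbols -/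

open BoundedContinuousFunction
open scoped NNReal

section Quotient

variable {n : ℕ} {T : Type} [TopologicalSpace T] {G : Type} [NormedAddCommGroup G] [NormedSpace ℝ G]

/-- Restriction of the first variable. -/
def bcfFst : (T →ᵇ G) →L[ℝ] (T × ℝ →ᵇ G) := bcfPull ⟨Prod.fst, continuous_fst⟩

/-- Integration over the second variable in `[0,1]`. -/
def bcfAvg : (T × ℝ →ᵇ G) →L[ℝ] (T →ᵇ G) :=
  (bcfPull ⟨fun t : T => (t, (0 : ℝ)), by fun_prop⟩).comp
    (bcfInt (fun _ => 1) (fun _ => 1) (fun _ => 0) (fun _ => 1) continuous_const continuous_const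
      continuous_const continuous_const 1 (fun _ => by simp))

theorem bcfAvg_apply (u : T × ℝ →ᵇ G) (t : T) : bcfAvg u t = ∫ τ in (0 : ℝ)..1, u (t, τ) := by
  show (1 : ℝ) • ∫ τ in (0 : ℝ)..1, (1 : ℝ) • u (t, τ) = _
  simp

/-- The second variable clamped to `[0,1]`. -/
def unitClamp : T × ℝ →ᵇ ℝ :=
  BoundedContinuousFunction.ofNormedAddCommGroup (fun p => max 0 (min p.2 1)) (by fun_prop) 1
    fun p => by
      rw [Real.norm_eq_abs, abs_of_nonneg (le_max_left _ _)]
      exact max_le zero_le_one (min_le_right _ _)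

theorem unitClamp_apply {p : T × ℝ} (h : p.2 ∈ Icc (0 : ℝ) 1) : unitClamp p = p.2 := by
  show max 0 (min p.2 1) = p.2
  rw [min_eq_left h.2, max_eq_right h.1]

theorem abs_unitClamp_le (p : T × ℝ) : |(unitClamp p : ℝ)| ≤ 1 := by
  show |max 0 (min p.2 1)| ≤ 1
  rw [abs_of_nonneg (le_max_left _ _)]
  exact max_le zero_le_one (min_le_right _ _)

/-- The segment from `y` to `y + k z`. -/
def segm (k : T →ᵇ ℝ) : (T →ᵇ Eucl n) × (T →ᵇ Eucl n) →L[ℝ] (T × ℝ →ᵇ Eucl n) :=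
  bcfFst.comp (ContinuousLinearMap.fst ℝ _ _) +
    (bcfMul unitClamp).comp ((bcfFst.comp (bcfMul k)).comp (ContinuousLinearMap.snd ℝ _ _))

theorem segm_apply (k : T →ᵇ ℝ) (p : (T →ᵇ Eucl n) × (T →ᵇ Eucl n)) (t : T) (τ : ℝ) :
    segm k p (t, τ) = p.1 t + (unitClamp (t, τ) : ℝ) • k t • p.2 t := rfl

/-- The integrated derivative of a scaled symbol along a segment. -/
def dq (ℓ : T → ℝ) (k : T →ᵇ ℝ) (ν : ℝ) (b : Eucl n → G)
    (p : (T →ᵇ Eucl n) × (T →ᵇ Eucl n)) : T →ᵇ G :=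
  bcfAvg (bcfApp (scl (fun q : T × ℝ => ℓ q.1) (ν + 1) (fderiv ℝ b) (segm k p)) (bcfFst p.2))

/-- Pairs close to `(-ω, 0)`. -/
def nearPair (om : T →ᵇ Eucl n) : Set ((T →ᵇ Eucl n) × (T →ᵇ Eucl n)) :=
  {p | ‖p.1 + om‖ < 1 / 4 ∧ ‖p.2‖ < 1 / 4}

theorem segm_mem {k : T →ᵇ ℝ} (hk : ∀ t, |k t| ≤ 1) {om : T →ᵇ Eucl n}
    {p : (T →ᵇ Eucl n) × (T →ᵇ Eucl n)} (hp : p ∈ nearPair om) :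
    segm k p ∈ Metric.ball (-(bcfFst om)) (1 / 2) := by
  rw [mem_ball_iff_norm, sub_neg_eq_add]
  refine lt_of_le_of_lt ((BoundedContinuousFunction.norm_le (C := ‖p.1 + om‖ + ‖p.2‖)
    (by positivity)).2 ?_) (by linarith [hp.1, hp.2])
  rintro ⟨t, τ⟩
  have e : (segm k p + bcfFst om : T × ℝ →ᵇ Eucl n) (t, τ) =
      (p.1 + om) t + (unitClamp (t, τ) : ℝ) • k t • p.2 t := by
    show p.1 t + (unitClamp (t, τ) : ℝ) • k t • p.2 t + om t =
      (p.1 t + om t) + (unitClamp (t, τ) : ℝ) • k t • p.2 t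
    abel
  rw [e]
  refine (norm_add_le _ _).trans ?_
  rw [norm_smul, norm_smul, Real.norm_eq_abs, Real.norm_eq_abs]
  gcongr
  · exact (p.1 + om).norm_coe_le_norm t
  · have h1 := abs_unitClamp_le (t, τ)
    have h2 := hk t
    have h3 := p.2.norm_coe_le_norm t
    calc |(unitClamp (t, τ) : ℝ)| * (|k t| * ‖p.2 t‖) ≤ 1 * (1 * ‖p.2‖) := by gcongr
      _ = _ := by ring

theorem contDiffOn_dq {ℓ : T → ℝ} (hℓ : Continuous ℓ) (h1 : ∀ t, 1 ≤ ℓ t) {k : T →ᵇ ℝ}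
    (hk : ∀ t, |k t| ≤ 1) {om : T →ᵇ Eucl n} (hom : ∀ t, ‖om t‖ = 1) {b : Eucl n → G} {ν : ℝ}
    (hb : IsSym b ν) : ContDiffOn ℝ ∞ (dq ℓ k ν b) (nearPair om) := by
  have h2 : ContDiffOn ℝ ∞ (fun p => scl (fun q : T × ℝ => ℓ q.1) (ν + 1) (fderiv ℝ b) (segm k p))
      (nearPair om) :=
    (scl_contDiffOn (hℓ.comp continuous_fst) (fun q => h1 q.1) (om := bcfFst om)
      (fun q => hom q.1) hb.deriv).comp (segm (n := n) k).contDiff.contDiffOn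
      fun p hp => segm_mem hk hp
  have h3 : ContDiff ℝ ∞ (fun p : (T →ᵇ Eucl n) × (T →ᵇ Eucl n) => bcfFst p.2) :=
    (bcfFst (T := T) (G := Eucl n)).contDiff.comp contDiff_snd
  have h4 : ContDiffOn ℝ ∞ (fun p : (T →ᵇ Eucl n) × (T →ᵇ Eucl n) =>
      bcfApp (scl (fun q : T × ℝ => ℓ q.1) (ν + 1) (fderiv ℝ b) (segm k p)) (bcfFst p.2))
      (nearPair om) := by
    have := h3.contDiffOn (s := nearPair om)
    fun_prop
  exact (bcfAvg (T := T) (G := G)).contDiff.comp_contDiffOn h4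

/-- The integral form of the mean value theorem. The displacement contributes a factor `ℓ t`,
matched by the extra order of decay of the derivative, so the quotient is again a rescaled symbol,
now with exponent `ν + 1`; the factor `k t` is the gain from taking differences. -/
theorem dq_apply [CompleteSpace G] {ℓ : T → ℝ} (hℓ : Continuous ℓ) (h1 : ∀ t, 1 ≤ ℓ t)
    {k : T →ᵇ ℝ} (hk : ∀ t, |k t| ≤ 1) {om : T →ᵇ Eucl n} (hom : ∀ t, ‖om t‖ = 1) {b : Eucl n → G}
    {ν : ℝ} (hb : IsSym b ν) {p : (T →ᵇ Eucl n) × (T →ᵇ Eucl n)} (hp : p ∈ nearPair om) (t : T) :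
    k t • dq ℓ k ν b p t =
      ℓ t ^ ν • (b (ℓ t • (p.1 t + k t • p.2 t)) - b (ℓ t • p.1 t)) := by
  have hℓ0 : 0 < ℓ t := lt_of_lt_of_le one_pos (h1 t)
  have happ : ∀ τ ∈ uIcc (0 : ℝ) 1,
      (bcfApp (scl (fun q : T × ℝ => ℓ q.1) (ν + 1) (fderiv ℝ b) (segm k p)) (bcfFst p.2)) (t, τ) =
        ℓ t ^ (ν + 1) • fderiv ℝ b (ℓ t • (p.1 t + τ • k t • p.2 t)) (p.2 t) := by
    intro τ hτ
    rw [uIcc_of_le zero_le_one] at hτ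
    rw [bcfApp_apply, scl_apply (ℓ := fun q : T × ℝ => ℓ q.1) (hℓ.comp continuous_fst) (fun q => h1 q.1) (om := bcfFst om)
      (fun q => hom q.1) hb.deriv (segm_mem hk hp), segm_apply, unitClamp_apply hτ]
    rfl
  have hbd : ContDiff ℝ ∞ (fderiv ℝ b) := hb.deriv.1
  have hcont : Continuous fun τ : ℝ =>
      ℓ t ^ ν • fderiv ℝ b (ℓ t • (p.1 t + τ • k t • p.2 t)) (ℓ t • k t • p.2 t) := by
    have := hbd.continuous
    fun_prop
  have hder : ∀ τ ∈ uIcc (0 : ℝ) 1,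
      HasDerivAt (fun τ : ℝ => ℓ t ^ ν • b (ℓ t • (p.1 t + τ • k t • p.2 t)))
        (ℓ t ^ ν • fderiv ℝ b (ℓ t • (p.1 t + τ • k t • p.2 t)) (ℓ t • k t • p.2 t)) τ := by
    intro τ _
    have h2 : HasDerivAt (fun τ : ℝ => ℓ t • (p.1 t + τ • k t • p.2 t)) (ℓ t • k t • p.2 t) τ := by
      have := ((((hasDerivAt_id τ).smul_const (k t • p.2 t)).const_add (p.1 t)).const_smul (ℓ t))
      exact this.congr_deriv (by simp)
    exact (((hb.1.differentiable (by simp) _).hasFDerivAt).comp_hasDerivAt τ h2).const_smul _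
  have hint := intervalIntegral.integral_eq_sub_of_hasDerivAt hder (hcont.intervalIntegrable _ _)
  rw [dq, bcfAvg_apply, intervalIntegral.integral_congr happ, ← intervalIntegral.integral_smul]
  simp only [one_smul, zero_smul, add_zero] at hint
  rw [smul_sub, ← hint]
  refine intervalIntegral.integral_congr fun τ _ => ?_
  simp only [map_smul, smul_smul]
  congr 1
  rw [Real.rpow_add hℓ0, Real.rpow_one]
  ring

end Quotient

section Inverse

variable {T E : Type} [TopologicalSpace T] [NormedAddCommGroup E] [NormedSpace ℝ E]

/-- Operator families close to the identity. -/
def nearOne : Set (T →ᵇ (E →L[ℝ] E)) := {M | ‖M - bcfConst 1‖ < 1 / 4}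

theorem isOpen_norm_sub_lt {V : Type} [NormedAddCommGroup V] (c : V) (r : ℝ) :
    IsOpen {x : V | ‖x - c‖ < r} :=
  isOpen_lt (by fun_prop) continuous_const

theorem isOpen_nearOne : IsOpen (nearOne : Set (T →ᵇ (E →L[ℝ] E))) :=
  isOpen_norm_sub_lt (V := T →ᵇ (E →L[ℝ] E)) _ _

theorem nearOne_mem {M : T →ᵇ (E →L[ℝ] E)} (hM : M ∈ nearOne) (t : T) :
    (t, M t) ∈ (univ : Set T) ×ˢ Metric.closedBall (1 : E →L[ℝ] E) (1 / 4) := by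
  refine ⟨mem_univ _, ?_⟩
  rw [mem_closedBall_iff_norm]
  exact ((M - bcfConst 1).norm_coe_le_norm t).trans (le_of_lt hM)

variable [FiniteDimensional ℝ E]

theorem isUnit_of_norm_sub_one_le {D : E →L[ℝ] E} (h : ‖D - 1‖ ≤ 1 / 2) : IsUnit D := by
  have h1 : ‖(1 : E →L[ℝ] E) - D‖ < 1 := by rw [norm_sub_rev]; linarith
  have := isUnit_one_sub_of_norm_lt_one h1
  rwa [sub_sub_cancel] at this

theorem unifSmooth_inverse (N : ℕ) :
    UnifSmooth (T := T) (univ ×ˢ Metric.closedBall (1 : E →L[ℝ] E) (1 / 4)) N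
      (fun _ D => Ring.inverse D) := by
  have : ProperSpace (E →L[ℝ] E) := FiniteDimensional.proper ℝ _
  refine unifSmooth_fixed (O := Metric.ball (1 : E →L[ℝ] E) (1 / 2)) (isCompact_closedBall _ _)
    Metric.isOpen_ball (Metric.closedBall_subset_ball (by norm_num)) N fun D hD => ?_
  obtain ⟨u, rfl⟩ := isUnit_of_norm_sub_one_le (D := D) (mem_ball_iff_norm.1 hD).le
  have : CompleteSpace E := FiniteDimensional.complete ℝ E
  exact (contDiffAt_ringInverse ℝ u).contDiffWithinAt

/-- Pointwise inversion of a family of operators close to the identity. -/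
def bcfInv (M : T →ᵇ (E →L[ℝ] E)) : T →ᵇ (E →L[ℝ] E) := nem (fun _ D => Ring.inverse D) M

theorem contDiffOn_bcfInv : ContDiffOn ℝ ∞ (bcfInv : (T →ᵇ (E →L[ℝ] E)) → _) nearOne :=
  nem_contDiffOn isOpen_nearOne (fun _ hM t => nearOne_mem hM t) fun N => unifSmooth_inverse N

theorem bcfInv_apply {M : T →ᵇ (E →L[ℝ] E)} (hM : M ∈ nearOne) (t : T) (v : E) :
    M t (bcfInv M t v) = v := by
  have h1 := nem_apply (unifSmooth_inverse (T := T) (E := E) 0)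
    (fun t => nearOne_mem hM t) t (u := M)
  have h2 : IsUnit (M t) := isUnit_of_norm_sub_one_le
    ((mem_closedBall_iff_norm.1 (nearOne_mem hM t).2).trans (by norm_num))
  have h3 := Ring.mul_inverse_cancel _ h2
  rw [bcfInv, h1]
  exact DFunLike.congr_fun h3 v

end Inverse

end LongRangeFlow

end

noncomputable section

namespace LongRangeFlow

/-! ### Trajectories relative to the incoming reference family -/

open BoundedContinuousFunction
open scoped NNReal

variable {n : ℕ} {K : ℝ} {S : LRSys n}

/-- Bounded operator fields along indexed scaled time. -/
abbrev BL (n : ℕ) (K : ℝ) : Type := IT n K →ᵇ (Eucl n →L[ℝ] Eucl n)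

namespace RefFam

variable (F : RefFam S K)

/-- Superposition with a smooth curve of bounded functions. -/
def along {G : Type} [NormedAddCommGroup G] [NormedSpace ℝ G] (f : Eucl n → (IT n K →ᵇ G))
    (ϑ : BE n K) : IT n K →ᵇ G :=
  nem (fun t x => f x t) ϑ

theorem along_mem {ϑ : BE n K} (hϑ : ϑ ∈ Metric.ball (0 : BE n K) F.r) (t : IT n K) :
    (t, ϑ t) ∈ {q : IT n K × Eucl n | ‖q.2‖ < F.r} :=
  (ϑ.norm_coe_le_norm t).trans_lt (mem_ball_zero_iff.1 hϑ)

theorem along_mem' {ϑ : BE n K} (hϑ : ϑ ∈ Metric.ball (0 : BE n K) F.r) (t : IT n K) :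
    ϑ t ∈ Metric.ball (0 : Eucl n) (2 * F.r) := by
  have := F.along_mem hϑ t
  rw [mem_ball_zero_iff]
  exact lt_trans this (by linarith [F.r_pos])

theorem contDiffOn_along {G : Type} [NormedAddCommGroup G] [NormedSpace ℝ G]
    {f : Eucl n → (IT n K →ᵇ G)} (hf : ContDiffOn ℝ ∞ f (Metric.ball 0 (2 * F.r))) :
    ContDiffOn ℝ ∞ (along f) (Metric.ball (0 : BE n K) F.r) :=
  nem_contDiffOn Metric.isOpen_ball (fun _ h t => F.along_mem h t)
    fun N => unifSmooth_eval (by linarith [F.r_pos]) N hf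

theorem along_apply {G : Type} [NormedAddCommGroup G] [NormedSpace ℝ G]
    {f : Eucl n → (IT n K →ᵇ G)} (hf : ContDiffOn ℝ ∞ f (Metric.ball 0 (2 * F.r))) {ϑ : BE n K}
    (hϑ : ϑ ∈ Metric.ball (0 : BE n K) F.r) (t : IT n K) : along f ϑ t = f (ϑ t) t :=
  nem_apply (unifSmooth_eval (ρ := 2 * F.r) (r := F.r) (by linarith [F.r_pos]) 0 hf)
    (fun t => F.along_mem hϑ t) t

/-- The parameter derivative of the rescaled positions. -/
def DY (x : Eucl n) : BL n K := bcfSwap (fderiv ℝ F.Y x)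

/-- The parameter derivative of the momenta. -/
def DH (x : Eucl n) : BL n K := bcfSwap (fderiv ℝ F.H x)

theorem contDiffOn_DY : ContDiffOn ℝ ∞ F.DY (Metric.ball 0 (2 * F.r)) :=
  contDiff_bcfSwap.comp_contDiffOn
    (F.smooth_Y.fderiv_of_isOpen (m := ∞) Metric.isOpen_ball (by simp))

theorem contDiffOn_DH : ContDiffOn ℝ ∞ F.DH (Metric.ball 0 (2 * F.r)) :=
  contDiff_bcfSwap.comp_contDiffOn
    (F.smooth_H.fderiv_of_isOpen (m := ∞) Metric.isOpen_ball (by simp))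

theorem hasFDerivAt_Y {x : Eucl n} (hx : x ∈ Metric.ball (0 : Eucl n) (2 * F.r)) (t : IT n K) :
    HasFDerivAt (fun x => F.Y x t) (F.DY x t) x :=
  hasFDerivAt_eval ((F.smooth_Y.differentiableOn (by simp)).differentiableAt
    (Metric.isOpen_ball.mem_nhds hx)) t

theorem hasFDerivAt_H {x : Eucl n} (hx : x ∈ Metric.ball (0 : Eucl n) (2 * F.r)) (t : IT n K) :
    HasFDerivAt (fun x => F.H x t) (F.DH x t) x :=
  hasFDerivAt_eval ((F.smooth_H.differentiableOn (by simp)).differentiableAt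
    (Metric.isOpen_ball.mem_nhds hx)) t

theorem lip_H_apply {x y : Eucl n} (hx : x ∈ Metric.ball (0 : Eucl n) (2 * F.r))
    (hy : y ∈ Metric.ball (0 : Eucl n) (2 * F.r)) (t : IT n K) :
    ‖(F.H x t - F.H y t) - (x - y)‖ ≤ 1 / 8 * ‖x - y‖ :=
  ((F.H x - F.H y - bcfConst (x - y)).norm_coe_le_norm t).trans (F.lip_H x hx y hy)

theorem norm_DH_sub_le {x : Eucl n} (hx : x ∈ Metric.ball (0 : Eucl n) (2 * F.r)) (t : IT n K) :
    ‖F.DH x t - 1‖ ≤ 1 / 8 := by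
  refine ContinuousLinearMap.opNorm_le_bound _ (by norm_num) fun v => ?_
  exact norm_fderiv_sub_le_of_lip (F.hasFDerivAt_H hx t) (Metric.isOpen_ball.mem_nhds hx)
    (by norm_num) (fun y hy => F.lip_H_apply hy hx t) v

theorem along_DH_mem {ϑ : BE n K} (hϑ : ϑ ∈ Metric.ball (0 : BE n K) F.r) :
    along F.DH ϑ ∈ (nearOne : Set (BL n K)) := by
  refine lt_of_le_of_lt ((BoundedContinuousFunction.norm_le (C := 1 / 8) (by norm_num)).2
    fun t => ?_) (by norm_num)
  have e : (along F.DH ϑ - bcfConst 1 : BL n K) t = F.DH (ϑ t) t - 1 := by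
    rw [BoundedContinuousFunction.sub_apply, F.along_apply F.contDiffOn_DH hϑ]; rfl
  rw [e]
  exact F.norm_DH_sub_le (F.along_mem' hϑ t) t

theorem norm_along_Y_add_le {ϑ : BE n K} (hϑ : ϑ ∈ Metric.ball (0 : BE n K) F.r) :
    ‖along F.Y ϑ + om‖ ≤ 1 / 8 := by
  refine (BoundedContinuousFunction.norm_le (by norm_num)).2 fun t => ?_
  have e : (along F.Y ϑ + om : BE n K) t = (F.Y (ϑ t) + om : BE n K) t := by
    rw [BoundedContinuousFunction.add_apply, F.along_apply F.smooth_Y hϑ]; rfl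
  rw [e]
  exact ((F.Y (ϑ t) + om).norm_coe_le_norm t).trans (F.near_Y _ (F.along_mem' hϑ t))

end RefFam

/-- The ratio of the starting depth to the current depth. -/
def kp : IT n K →ᵇ ℝ :=
  BoundedContinuousFunction.ofNormedAddCommGroup (fun t => min 1 (t.1.L / wt t))
    (continuous_const.min ((continuous_idx Idx.L).div continuous_wt fun t => (wt_pos t).ne')) 1
    fun t => by
      have : 0 ≤ t.1.L / wt t := div_nonneg (by linarith [t.1.one_le_L]) (wt_pos t).le
      rw [Real.norm_eq_abs, abs_of_nonneg (le_min zero_le_one this)]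
      exact min_le_left _ _

theorem abs_kp_le (t : IT n K) : |(kp t : ℝ)| ≤ 1 := by
  have : 0 ≤ t.1.L / wt t := div_nonneg (by linarith [t.1.one_le_L]) (wt_pos t).le
  show |min 1 (t.1.L / wt t)| ≤ 1
  rw [abs_of_nonneg (le_min zero_le_one this)]
  exact min_le_left _ _

theorem kp_eq {i : Idx n K} {s : ℝ} (hs : s ∈ Icc i.σ (-i.L)) : (kp (i, s) : ℝ) = i.L / (1 - s) := by
  have h0 := i.one_le_L
  have h1 : wt (i, s) = 1 - s := wt_eq ⟨hs.1, hs.2.trans (by linarith)⟩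
  show min 1 (i.L / wt (i, s)) = _
  rw [h1, min_eq_right]
  rw [div_le_one (by linarith [hs.2])]
  linarith [hs.2]

variable (F : RefFam S K)

/-- The force difference quotient. -/
def deepQ (p : BE n K × BE n K) : BE n K :=
  bcfApp (bcfApp (dq ell kp (S.μ + 1) S.B (RefFam.along F.Y p.2, p.1)) (RefFam.along F.H p.2))
    (RefFam.along F.H p.2) +
  bcfMul rh (dq ell kp (S.μ - 1) S.g (RefFam.along F.Y p.2, p.1))

/-- The drift of the parameter, up to the factor `kp`. -/
def deepM (p : BE n K × BE n K) : BE n K := bcfApp (bcfInv (RefFam.along F.DH p.2)) (deepQ F p)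

/-- The nonlinearity for the trajectories relative to the reference family. -/
def deepN (p : BE n K × BE n K) : BE n K × BE n K :=
  -- Equality of momenta determines the parameter drift: DH·θ' is minus the force difference, which
  -- carries a factor `kp`. Equality of positions gives R·L·z' as R times the velocity difference
  -- minus R(1-s)·DY·θ'. Since (1-s)·`kp` is L, no factor `kp` remains in the first component.
  (bcfApp (dq ell kp S.μ (fun x => S.A x - 1) (RefFam.along F.Y p.2, p.1)) (RefFam.along F.H p.2) +
    bcfApp (RefFam.along F.DY p.2) (deepM F p), bcfMul kp (deepM F p))

theorem mem_of_mem_ball {p : BE n K × BE n K} (hp : p ∈ Metric.ball (0 : BE n K × BE n K) F.r) :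
    p.2 ∈ Metric.ball (0 : BE n K) F.r ∧
      (RefFam.along F.Y p.2, p.1) ∈ nearPair (om : BE n K) := by
  rw [mem_ball_zero_iff] at hp
  have h2 : p.2 ∈ Metric.ball (0 : BE n K) F.r := mem_ball_zero_iff.2 ((norm_snd_le p).trans_lt hp)
  refine ⟨h2, ?_, ?_⟩
  · exact lt_of_le_of_lt (F.norm_along_Y_add_le h2) (by norm_num)
  · exact lt_of_le_of_lt (norm_fst_le p) (by linarith [F.r_le])

theorem contDiffOn_deepN : ContDiffOn ℝ ∞ (deepN F) (Metric.ball (0 : BE n K × BE n K) F.r) := by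
  have hsnd : ∀ {G : Type} [NormedAddCommGroup G] [NormedSpace ℝ G] {f : Eucl n → (IT n K →ᵇ G)},
      ContDiffOn ℝ ∞ f (Metric.ball 0 (2 * F.r)) →
      ContDiffOn ℝ ∞ (fun p : BE n K × BE n K => RefFam.along f p.2)
        (Metric.ball (0 : BE n K × BE n K) F.r) := fun hf =>
    (F.contDiffOn_along hf).comp contDiffOn_snd fun p hp => (mem_of_mem_ball F hp).1
  have hY := hsnd F.smooth_Y
  have hH := hsnd F.smooth_H
  have hDY := hsnd F.contDiffOn_DY
  have hDH := hsnd F.contDiffOn_DH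
  have hinv : ContDiffOn ℝ ∞ (fun p : BE n K × BE n K => bcfInv (RefFam.along F.DH p.2))
      (Metric.ball (0 : BE n K × BE n K) F.r) :=
    contDiffOn_bcfInv.comp hDH fun p hp => F.along_DH_mem (mem_of_mem_ball F hp).1
  have hpair : ContDiffOn ℝ ∞ (fun p : BE n K × BE n K => (RefFam.along F.Y p.2, p.1))
      (Metric.ball (0 : BE n K × BE n K) F.r) := hY.prodMk contDiffOn_fst
  have hA := (contDiffOn_dq (continuous_ell (n := n) (K := K)) one_le_ell abs_kp_le norm_om
    S.symA).comp hpair fun p hp => (mem_of_mem_ball F hp).2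
  have hB := (contDiffOn_dq (continuous_ell (n := n) (K := K)) one_le_ell abs_kp_le norm_om
    S.symB).comp hpair fun p hp => (mem_of_mem_ball F hp).2
  have hg := (contDiffOn_dq (continuous_ell (n := n) (K := K)) one_le_ell abs_kp_le norm_om
    S.symg).comp hpair fun p hp => (mem_of_mem_ball F hp).2
  simp only [Function.comp_def] at hA hB hg
  have hQ : ContDiffOn ℝ ∞ (deepQ F) (Metric.ball (0 : BE n K × BE n K) F.r) := by
    unfold deepQ; fun_prop
  have hM : ContDiffOn ℝ ∞ (deepM F) (Metric.ball (0 : BE n K × BE n K) F.r) := by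
    unfold deepM; fun_prop
  unfold deepN
  fun_prop

theorem dq_zero {G : Type} [NormedAddCommGroup G] [NormedSpace ℝ G] (ν : ℝ) (b : Eucl n → G)
    (y : BE n K) : dq ell kp ν b (y, 0) = 0 := by
  simp [dq]

theorem deepQ_snd_zero (θ : BE n K) : deepQ F ((0, θ) : BE n K × BE n K) = 0 := by
  ext1 t
  show (dq ell kp (S.μ + 1) S.B (RefFam.along F.Y θ, 0) t) (RefFam.along F.H θ t)
    (RefFam.along F.H θ t) + rh t • dq ell kp (S.μ - 1) S.g (RefFam.along F.Y θ, 0) t = 0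
  rw [dq_zero, dq_zero]
  show (0 : Eucl n →L[ℝ] Eucl n →L[ℝ] Eucl n) _ _ + rh t • (0 : Eucl n) = 0
  rw [ContinuousLinearMap.zero_apply, ContinuousLinearMap.zero_apply, smul_zero, add_zero]

theorem deepM_snd_zero (θ : BE n K) : deepM F ((0, θ) : BE n K × BE n K) = 0 := by
  rw [deepM, deepQ_snd_zero, ContinuousLinearMap.map_zero]

/-- Without displacement the reference trajectories themselves are solutions, with constant
parameter. The fixed point problem therefore starts from an exact solution at 0. -/
theorem deepN_snd_zero (θ : BE n K) : deepN F ((0, θ) : BE n K × BE n K) = 0 := by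
  have h1 : dq ell kp S.μ (fun x => S.A x - 1) (RefFam.along F.Y θ, 0) = 0 := dq_zero _ _ _
  rw [deepN, deepM_snd_zero, ContinuousLinearMap.map_zero, ContinuousLinearMap.map_zero, add_zero]
  refine Prod.ext ?_ rfl
  ext1 t
  show (dq ell kp S.μ (fun x => S.A x - 1) (RefFam.along F.Y θ, 0) t) (RefFam.along F.H θ t) = 0
  rw [h1]
  show (0 : Eucl n →L[ℝ] Eucl n) _ = 0
  rw [ContinuousLinearMap.zero_apply]

end LongRangeFlow

end

/-! ### The integral equation for the drifting parameter and the displacement. -/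

noncomputable section

namespace LongRangeFlow

open BoundedContinuousFunction
open scoped NNReal

variable {n : ℕ} {K : ℝ} {S : LRSys n}

/-- Scaled time clamped to `[σ, -L]`. -/
def clDeep (t : IT n K) : ℝ := max t.1.σ (min t.2 (-t.1.L))

theorem continuous_clDeep : Continuous (clDeep : IT n K → ℝ) :=
  (continuous_idx Idx.σ).max (continuous_snd.min (continuous_idx fun i => -i.L))

theorem clDeep_mem (t : IT n K) : clDeep t ∈ Icc t.1.σ (-t.1.L) :=
  ⟨le_max_left _ _, max_le t.1.σ_le (min_le_right _ _)⟩

theorem clDeep_eq {i : Idx n K} {s : ℝ} (hs : s ∈ Icc i.σ (-i.L)) : clDeep (i, s) = s := by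
  show max i.σ (min s (-i.L)) = s
  rw [min_eq_left hs.2, max_eq_right hs.1]

/-- The small factor, cut off below the radius `R₀` and the depth `L₀`. -/
def gDeep (μ R₀ L₀ : ℝ) (i : Idx n K) : ℝ :=
  open Classical in if R₀ ≤ i.R ∧ L₀ ≤ i.L then i.R ^ (-μ) else 0

theorem gDeep_eq {μ R₀ L₀ : ℝ} {i : Idx n K} (h : R₀ ≤ i.R) (h' : L₀ ≤ i.L) :
    gDeep μ R₀ L₀ i = i.R ^ (-μ) := if_pos ⟨h, h'⟩

theorem gDeep_abs_le {μ R₀ L₀ : ℝ} (hμ : 0 < μ) (i : Idx n K) : |gDeep μ R₀ L₀ i| ≤ 1 := by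
  rw [gDeep]
  split_ifs with h
  · rw [abs_of_nonneg (Real.rpow_nonneg (zero_le_one.trans i.one_le_R) _)]
    exact Real.rpow_le_one_of_one_le_of_nonpos i.one_le_R (by linarith)
  · simp

/-- The weight is integrable, so integrating from depth L onwards gives O(L^{-μ}). Smallness comes
from the depth alone; of the factor R^{-μ} only the bound by 1 is used, so the radius need not be
enlarged again. -/
theorem deepJ_bound {μ R₀ L₀ : ℝ} (hμ : 0 < μ) (hL : 1 ≤ L₀) (t : IT n K) :
    |gDeep μ R₀ L₀ t.1| * |(∫ r in (-t.1.L)..clDeep t, |(1 + |r|) ^ (-(1 + μ))|)| ≤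
      L₀ ^ (-μ) * (1 / μ) := by
  have h1 := gDeep_abs_le (R₀ := R₀) (L₀ := L₀) hμ t.1
  have h0 := t.1.one_le_L
  have h2 := abs_integral_weight_le' hμ (by linarith) (clDeep_mem t).2
  by_cases h : R₀ ≤ t.1.R ∧ L₀ ≤ t.1.L
  · calc _ ≤ 1 * ((1 - -t.1.L) ^ (-μ) / μ) := by gcongr
      _ = (1 - -t.1.L) ^ (-μ) * (1 / μ) := by ring
      _ ≤ _ := by
        gcongr 1
        exact Real.rpow_le_rpow_of_nonpos (by linarith) (by linarith [h.2]) (by linarith)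
  · rw [gDeep, if_neg h, abs_zero, zero_mul]
    positivity

/-- Integration from the starting depth. -/
def deepInt {μ L₀ : ℝ} (R₀ : ℝ) (hμ : 0 < μ) (hL : 1 ≤ L₀) : BE n K →L[ℝ] BE n K :=
  bcfInt (fun t : IT n K => gDeep μ R₀ L₀ t.1) clDeep (fun i => -i.L)
    (fun r => (1 + |r|) ^ (-(1 + μ))) (continuous_idx (gDeep μ R₀ L₀)) continuous_clDeep
    continuous_of_discreteTopology (continuous_weight (1 + μ)) (L₀ ^ (-μ) * (1 / μ))
    (deepJ_bound hμ hL)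

theorem deepInt_apply {μ R₀ L₀ : ℝ} (hμ : 0 < μ) (hL : 1 ≤ L₀) (v : BE n K) (t : IT n K) :
    deepInt R₀ hμ hL v t =
      gDeep μ R₀ L₀ t.1 • ∫ r in (-t.1.L)..clDeep t, (1 + |r|) ^ (-(1 + μ)) • v (t.1, r) := rfl

theorem norm_deepInt_le {μ R₀ L₀ : ℝ} (hμ : 0 < μ) (hL : 1 ≤ L₀) (v : BE n K) :
    ‖deepInt R₀ hμ hL v‖ ≤ L₀ ^ (-μ) * (1 / μ) * ‖v‖ :=
  ContinuousLinearMap.le_of_opNorm_le _ (norm_bcfInt_le (by positivity)) v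

/-- The integral operator for trajectories relative to the reference family. -/
def deepJ {μ L₀ : ℝ} (R₀ : ℝ) (hμ : 0 < μ) (hL : 1 ≤ L₀) :
    BE n K × BE n K →L[ℝ] BE n K × BE n K :=
  ((deepInt R₀ hμ hL).comp (ContinuousLinearMap.fst ℝ (BE n K) (BE n K))).prod
    (-(deepInt R₀ hμ hL).comp (ContinuousLinearMap.snd ℝ (BE n K) (BE n K)))

theorem norm_deepJ_le {μ R₀ L₀ : ℝ} (hμ : 0 < μ) (hL : 1 ≤ L₀) (v : BE n K × BE n K) :
    ‖deepJ R₀ hμ hL v‖ ≤ L₀ ^ (-μ) * (1 / μ) * ‖v‖ := by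
  rw [Prod.norm_def]
  refine max_le ((norm_deepInt_le hμ hL v.1).trans ?_)
    ((norm_neg _).le.trans ((norm_deepInt_le hμ hL v.2).trans ?_))
  · gcongr; exact norm_fst_le v
  · gcongr; exact norm_snd_le v

variable (F : RefFam S K)

/-- The two partial derivatives needed for variation of constants: in time the family follows the
Hamilton field, in the parameter its derivative is given by `DY` and `DH`. -/
theorem RefFam.hasFDerivAt_family {i : Idx n K} (hi : F.R₀ ≤ i.R) {s : ℝ} (hs : s ∈ Icc i.σ 0)
    {θ : Eucl n} (hθ : θ ∈ Metric.ball (0 : Eucl n) (2 * F.r)) :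
    ∃ D : ℝ × Eucl n →L[ℝ] Eucl n × Eucl n,
      HasFDerivAt (fun p : ℝ × Eucl n =>
        S.φ i.κ (i.R * p.1) (incoming i.R (i.dir + p.2), i.dir + p.2)) D (s, θ) ∧
      ∀ c v, D (c, v) = c • i.R • S.X i.κ ((i.R * (1 - s)) • F.Y θ (i, s), F.H θ (i, s)) +
        ((i.R * (1 - s)) • F.DY θ (i, s) v, F.DH θ (i, s) v) := by
  have hne : i.dir + θ ≠ 0 := by
    intro h0
    have h1 : ‖θ‖ = 1 := by rw [← i.norm_dir, ← norm_neg, ← eq_neg_of_add_eq_zero_left h0]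
    rw [mem_ball_zero_iff, h1] at hθ
    linarith [F.r_le]
  set Ψ : ℝ × Eucl n → Eucl n × Eucl n := fun p =>
    S.φ i.κ (i.R * p.1) (incoming i.R (i.dir + p.2), i.dir + p.2) with hΨ
  have hd : DifferentiableAt ℝ Ψ (s, θ) := by
    have h1 := (S.contDiffAt_incoming_flow i.R i.κ (i.R * s) hne).comp (s, θ)
      (f := fun p : ℝ × Eucl n => (i.κ, i.R * p.1, i.dir + p.2)) (by fun_prop)
    exact h1.differentiableAt (by simp)
  refine ⟨fderiv ℝ Ψ (s, θ), hd.hasFDerivAt, fun c v => ?_⟩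
  have e1 : fderiv ℝ Ψ (s, θ) (1, 0) =
      i.R • S.X i.κ ((i.R * (1 - s)) • F.Y θ (i, s), F.H θ (i, s)) := by
    have h1 : HasDerivAt (fun s : ℝ => (s, θ)) (1, (0 : Eucl n)) s :=
      (hasDerivAt_id s).prodMk (hasDerivAt_const s θ)
    have h2 := hd.hasFDerivAt.comp_hasDerivAt s h1
    have h3 : HasDerivAt (fun s : ℝ => i.R * s) i.R s := by
      simpa using (hasDerivAt_id s).const_mul i.R
    have h4 := HasDerivAt.scomp s
      (S.φ_deriv i.κ (incoming i.R (i.dir + θ), i.dir + θ) (i.R * s)) h3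
    rw [h2.unique h4, F.flow_eq i hi s hs θ hθ]
    rfl
  have e2 : fderiv ℝ Ψ (s, θ) (0, v) =
      ((i.R * (1 - s)) • F.DY θ (i, s) v, F.DH θ (i, s) v) := by
    have h1 : HasFDerivAt (fun θ : Eucl n => (s, θ)) (ContinuousLinearMap.inr ℝ ℝ (Eucl n)) θ :=
      hasFDerivAt_prodMk_right s θ
    have h2 := hd.hasFDerivAt.comp θ h1
    have h3 : HasFDerivAt (fun θ => ((i.R * (1 - s)) • F.Y θ (i, s), F.H θ (i, s)))
        (((i.R * (1 - s)) • F.DY θ (i, s)).prod (F.DH θ (i, s))) θ :=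
      ((F.hasFDerivAt_Y hθ (i, s)).const_smul (i.R * (1 - s))).prodMk (F.hasFDerivAt_H hθ (i, s))
    have h4 : (Ψ ∘ fun θ => (s, θ)) =ᶠ[𝓝 θ]
        fun θ => ((i.R * (1 - s)) • F.Y θ (i, s), F.H θ (i, s)) := by
      filter_upwards [Metric.isOpen_ball.mem_nhds hθ] with θ' hθ'
      exact F.flow_eq i hi s hs θ' hθ'
    have h5 := (h2.congr_of_eventuallyEq h4.symm).unique h3
    exact congrArg (fun D => D v) h5
  have e3 : ((c, v) : ℝ × Eucl n) = c • (1, 0) + (0, v) := by simp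
  rw [e3, map_add, map_smul, e1, e2]

/-- A solution of the relative integral equation is a rescaled trajectory. -/
theorem flow_of_deep_equation {L₀ : ℝ} (hL : 1 ≤ L₀) {x : BE n K × BE n K}
    (hx : x ∈ Metric.ball (0 : BE n K × BE n K) F.r) {i : Idx n K} (hi : F.R₀ ≤ i.R)
    (hiL : L₀ ≤ i.L) {z₀ ϑ₀ : Eucl n}
    (h1 : ∀ s, x.1 (i, s) = z₀ + (deepJ F.R₀ S.μ_pos hL (deepN F x)).1 (i, s))
    (h2 : ∀ s, x.2 (i, s) = ϑ₀ + (deepJ F.R₀ S.μ_pos hL (deepN F x)).2 (i, s))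
    {s : ℝ} (hs : s ∈ Icc i.σ (-i.L)) :
    S.φ i.κ (i.R * (s + i.L)) ((i.R * (1 + i.L)) • F.Y ϑ₀ (i, -i.L) + (i.R * i.L) • z₀,
        F.H ϑ₀ (i, -i.L)) =
      ((i.R * (1 - s)) • F.Y (x.2 (i, s)) (i, s) + (i.R * i.L) • x.1 (i, s),
        F.H (x.2 (i, s)) (i, s)) := by
  obtain ⟨hx2, hpair⟩ := mem_of_mem_ball F hx
  have hL1 := i.one_le_L
  set R := i.R with hRdef
  set μ := S.μ with hμdef
  have hR0 : 0 < R := lt_of_lt_of_le one_pos i.one_le_R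
  set N := deepN F x with hN
  have hc1 : Continuous (fun r : ℝ => (1 + |r|) ^ (-(1 + μ)) • N.1 (i, r)) :=
    (continuous_weight (1 + μ)).smul (N.1.continuous.comp (by fun_prop))
  have hc2 : Continuous (fun r : ℝ => (1 + |r|) ^ (-(1 + μ)) • N.2 (i, r)) :=
    (continuous_weight (1 + μ)).smul (N.2.continuous.comp (by fun_prop))
  set z : ℝ → Eucl n := fun s => z₀ +
    R ^ (-μ) • ∫ r in (-i.L)..s, (1 + |r|) ^ (-(1 + μ)) • N.1 (i, r) with hz
  set θ : ℝ → Eucl n := fun s => ϑ₀ +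
    -(R ^ (-μ) • ∫ r in (-i.L)..s, (1 + |r|) ^ (-(1 + μ)) • N.2 (i, r)) with hθ
  have dz : ∀ s, HasDerivAt z (R ^ (-μ) • (1 + |s|) ^ (-(1 + μ)) • N.1 (i, s)) s := fun s =>
    ((hc1.integral_hasStrictDerivAt _ s).hasDerivAt.const_smul (R ^ (-μ))).const_add _
  have dθ : ∀ s, HasDerivAt θ (-(R ^ (-μ) • (1 + |s|) ^ (-(1 + μ)) • N.2 (i, s))) s := fun s =>
    (((hc2.integral_hasStrictDerivAt _ s).hasDerivAt.const_smul (R ^ (-μ))).neg).const_add _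
  have x1 : ∀ s ∈ Icc i.σ (-i.L), x.1 (i, s) = z s := fun s hs => by
    have : (deepJ F.R₀ S.μ_pos hL N).1 (i, s) = deepInt F.R₀ S.μ_pos hL N.1 (i, s) := rfl
    rw [h1, this, deepInt_apply, gDeep_eq hi hiL, clDeep_eq hs]
  have x2 : ∀ s ∈ Icc i.σ (-i.L), x.2 (i, s) = θ s := fun s hs => by
    have : (deepJ F.R₀ S.μ_pos hL N).2 (i, s) = -(deepInt F.R₀ S.μ_pos hL N.2 (i, s)) := rfl
    rw [h2, this, deepInt_apply, gDeep_eq hi hiL, clDeep_eq hs]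
  have hθb : ∀ s ∈ Icc i.σ (-i.L), θ s ∈ Metric.ball (0 : Eucl n) (2 * F.r) := fun s hs => by
    rw [← x2 s hs]; exact F.along_mem' hx2 _
  have hs0 : ∀ s ∈ Icc i.σ (-i.L), s ∈ Icc i.σ 0 := fun s hs => ⟨hs.1, by linarith [hs.2]⟩
  set Ψ : ℝ × Eucl n → Eucl n × Eucl n := fun p =>
    S.φ i.κ (i.R * p.1) (incoming i.R (i.dir + p.2), i.dir + p.2) with hΨ
  have hΨe : ∀ s ∈ Icc i.σ (-i.L), Ψ (s, θ s) =
      ((R * (1 - s)) • F.Y (x.2 (i, s)) (i, s), F.H (x.2 (i, s)) (i, s)) := fun s hs => by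
    rw [x2 s hs]
    exact F.flow_eq i hi s (hs0 s hs) (θ s) (hθb s hs)
  -- The variation-of-constants ansatz in physical time: the reference trajectory with parameter
  -- `θ`, displaced by `(R * i.L) • z` in position only.
  set γ : ℝ → Eucl n × Eucl n := fun τ =>
    Ψ (R⁻¹ * τ, θ (R⁻¹ * τ)) + ((R * i.L) • z (R⁻¹ * τ), 0) with hγ
  have hγe : ∀ s ∈ Icc i.σ (-i.L), γ (R * s) =
      ((R * (1 - s)) • F.Y (x.2 (i, s)) (i, s) + (R * i.L) • x.1 (i, s),
        F.H (x.2 (i, s)) (i, s)) := fun s hs => by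
    simp only [hγ, inv_mul_cancel_left₀ hR0.ne']
    rw [hΨe s hs, x1 s hs, Prod.mk_add_mk, add_zero]
  have key : ∀ τ ∈ Icc (R * i.σ) (R * -i.L), HasDerivAt γ (S.X i.κ (γ τ)) τ := by
    intro τ hτ
    obtain ⟨s, rfl⟩ : ∃ s, τ = R * s := ⟨R⁻¹ * τ, by rw [mul_inv_cancel_left₀ hR0.ne']⟩
    have hs : s ∈ Icc i.σ (-i.L) :=
      ⟨le_of_mul_le_mul_left hτ.1 hR0, le_of_mul_le_mul_left hτ.2 hR0⟩
    have hw : (0 : ℝ) < 1 - s := by linarith [hs.2]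
    have d1 : HasDerivAt (fun τ : ℝ => R⁻¹ * τ) R⁻¹ (R * s) := by
      simpa using (hasDerivAt_id (R * s)).const_mul R⁻¹
    obtain ⟨D, hD, hDe⟩ := F.hasFDerivAt_family hi (hs0 s hs) (hθb s hs)
    have dΨ : HasDerivAt (fun s => Ψ (s, θ s)) (D (1, -(R ^ (-μ) • (1 + |s|) ^ (-(1 + μ)) •
        N.2 (i, s)))) s :=
      HasFDerivAt.comp_hasDerivAt (f := fun s => (s, θ s)) s hD
        ((hasDerivAt_id s).prodMk (dθ s))
    have dz' : HasDerivAt (fun s => ((R * i.L) • z s, (0 : Eucl n)))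
        ((R * i.L) • R ^ (-μ) • (1 + |s|) ^ (-(1 + μ)) • N.1 (i, s), 0) s :=
      ((dz s).const_smul (R * i.L)).prodMk (hasDerivAt_const s (0 : Eucl n))
    have dd : HasDerivAt γ (R⁻¹ • (D (1, -(R ^ (-μ) • (1 + |s|) ^ (-(1 + μ)) • N.2 (i, s))) +
        ((R * i.L) • R ^ (-μ) • (1 + |s|) ^ (-(1 + μ)) • N.1 (i, s), 0))) (R * s) := by
      have h3 := (dΨ.add dz')
      rw [← inv_mul_cancel_left₀ hR0.ne' s] at h3
      have h4 := HasDerivAt.scomp (R * s) h3 d1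
      rw [inv_mul_cancel_left₀ hR0.ne' s] at h4
      exact h4
    refine dd.congr_deriv ?_
    rw [hγe s hs, hDe, ← x2 s hs, one_smul]
    have habs : |s| = -s := abs_of_nonpos (hs0 s hs).2
    rw [habs, ← sub_eq_add_neg]
    set y := F.Y (x.2 (i, s)) (i, s) with hy
    set η := F.H (x.2 (i, s)) (i, s) with hη
    have eY : RefFam.along F.Y x.2 (i, s) = y := F.along_apply F.smooth_Y hx2 _
    have eH : RefFam.along F.H x.2 (i, s) = η := F.along_apply F.smooth_H hx2 _
    have eDY : RefFam.along F.DY x.2 (i, s) = F.DY (x.2 (i, s)) (i, s) :=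
      F.along_apply F.contDiffOn_DY hx2 _
    have eDH : RefFam.along F.DH x.2 (i, s) = F.DH (x.2 (i, s)) (i, s) :=
      F.along_apply F.contDiffOn_DH hx2 _
    have ewt : wt (i, s) = 1 - s := wt_eq (hs0 s hs)
    have eell : ell (i, s) = R * (1 - s) := by rw [ell, ewt]
    have ekp : (kp (i, s) : ℝ) = i.L / (1 - s) := kp_eq hs
    have hk0 : i.L / (1 - s) ≠ 0 := (div_pos (by linarith) hw).ne'
    set M := deepM F x (i, s) with hM
    have eM : F.DH (x.2 (i, s)) (i, s) M = deepQ F x (i, s) := by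
      rw [← eDH]
      exact bcfInv_apply (F.along_DH_mem hx2) _ _
    have hpos : (R * (1 - s)) • (y + (i.L / (1 - s)) • x.1 (i, s)) =
        (R * (1 - s)) • y + (R * i.L) • x.1 (i, s) := by
      rw [smul_add, smul_smul]; congr 2; field_simp
    have qA := dq_apply continuous_ell one_le_ell abs_kp_le norm_om S.symA hpair (i, s)
    have qB := dq_apply continuous_ell one_le_ell abs_kp_le norm_om S.symB hpair (i, s)
    have qg := dq_apply continuous_ell one_le_ell abs_kp_le norm_om S.symg hpair (i, s)
    simp only [eell, ekp, eY, hpos] at qA qB qg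
    have eN2 : N.2 (i, s) = (i.L / (1 - s)) • M := by
      rw [← ekp]; rfl
    have eN1 : N.1 (i, s) = dq ell kp μ (fun x => S.A x - 1) (RefFam.along F.Y x.2, x.1) (i, s) η +
        F.DY (x.2 (i, s)) (i, s) M := by
      rw [← eDY, ← eH]; rfl
    have eQ : deepQ F x (i, s) =
        dq ell kp (μ + 1) S.B (RefFam.along F.Y x.2, x.1) (i, s) η η +
        (i.κ * R ^ 2 * (1 - s) ^ 2) •
          dq ell kp (μ - 1) S.g (RefFam.along F.Y x.2, x.1) (i, s) := by
      have : (rh (i, s) : ℝ) = i.κ * R ^ 2 * (1 - s) ^ 2 := by rw [rh_apply, ewt]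
      rw [← this, ← eH]; rfl
    have hX : ∀ p, S.X i.κ (p, η) = (S.A p η, -(S.B p η η) - i.κ • S.g p) := fun p => rfl
    rw [hX, hX, eN1, eN2, map_neg, map_neg, map_smul, map_smul, map_smul, map_smul, map_smul,
      map_smul, eM, eQ]
    have qA' := congrArg (fun T : Eucl n →L[ℝ] Eucl n => T η) qA
    have qB' := congrArg (fun T : Eucl n →L[ℝ] Eucl n →L[ℝ] Eucl n => T η η) qB
    simp only [sub_sub_sub_cancel_right] at qA'
    change (i.L / (1 - s)) • dq ell kp μ (fun x => S.A x - 1) (RefFam.along F.Y x.2, x.1) (i, s) η =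
      (R * (1 - s)) ^ μ • (S.A ((R * (1 - s)) • y + (R * i.L) • x.1 (i, s)) η -
        S.A ((R * (1 - s)) • y) η) at qA'
    change (i.L / (1 - s)) • dq ell kp (μ + 1) S.B (RefFam.along F.Y x.2, x.1) (i, s) η η =
      (R * (1 - s)) ^ (μ + 1) • (S.B ((R * (1 - s)) • y + (R * i.L) • x.1 (i, s)) η η -
        S.B ((R * (1 - s)) • y) η η) at qB'
    have hRw : 0 < R * (1 - s) := mul_pos hR0 hw
    -- As for the reference family, the weights of the integrals cancel the powers of `ell`; here
    -- one more factor `1 - s` is balanced by the denominator of `kp`.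
    have e1 : R ^ (-μ) * (1 - s) ^ (-(1 + μ)) * (R * (1 - s)) ^ μ * (1 - s) = 1 := by
      rw [mul_right_comm (R ^ (-μ)), mul_assoc, show (-(1 + μ)) = -μ - 1 by ring,
        Real.rpow_sub hw, Real.rpow_one, div_mul_cancel₀ _ hw.ne', mul_right_comm,
        ← Real.mul_rpow hR0.le hw.le, ← Real.rpow_add hRw]; simp
    have e2 : (R * (1 - s)) ^ (μ + 1) = (R * (1 - s)) ^ μ * (R * (1 - s)) := by
      rw [Real.rpow_add hRw, Real.rpow_one]
    have e3 : (R * (1 - s)) ^ (μ - 1) * (R * (1 - s)) = (R * (1 - s)) ^ μ := by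
      rw [Real.rpow_sub hRw, Real.rpow_one]; field_simp
    clear hX eN1 eN2 eM eQ qA qB hDe dd dz' dΨ hD
    generalize dq ell kp μ (fun x => S.A x - 1) (RefFam.along F.Y x.2, x.1) (i, s) η = QA at *
    generalize dq ell kp (μ + 1) S.B (RefFam.along F.Y x.2, x.1) (i, s) η η = QB at *
    generalize dq ell kp (μ - 1) S.g (RefFam.along F.Y x.2, x.1) (i, s) = Qg at *
    generalize F.DY (x.2 (i, s)) (i, s) M = P at *
    generalize S.A ((R * (1 - s)) • y) η = A₀ at *
    generalize S.B ((R * (1 - s)) • y) η η = B₀ at *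
    generalize S.g ((R * (1 - s)) • y) = g₀ at *
    generalize S.A ((R * (1 - s)) • y + (R * i.L) • x.1 (i, s)) η = A₁ at *
    generalize S.B ((R * (1 - s)) • y + (R * i.L) • x.1 (i, s)) η η = B₁ at *
    generalize S.g ((R * (1 - s)) • y + (R * i.L) • x.1 (i, s)) = g₁ at *
    generalize R ^ (-μ) = α at *
    generalize (1 - s) ^ (-(1 + μ)) = β at *
    generalize (R * (1 - s)) ^ μ = p at *
    generalize (R * (1 - s)) ^ (μ + 1) = p1 at *
    generalize (R * (1 - s)) ^ (μ - 1) = pm at *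
    have hne : (1 - s) ≠ 0 := hw.ne'
    have e5 : α * β * p1 = R := by
      rw [e2]; linear_combination R * e1
    have e6 : α * β * ((i.κ * R ^ 2 * (1 - s) ^ 2) * pm) = R * i.κ := by
      linear_combination α * β * i.κ * R * (1 - s) * e3 + R * i.κ * e1
    have eA : (i.L * α * β) • QA = A₁ - A₀ := by
      have : (i.L * α * β) • QA = (α * β * (1 - s)) • ((i.L / (1 - s)) • QA) := by
        rw [smul_smul]; congr 1; field_simp
      rw [this, qA', smul_smul, show α * β * (1 - s) * p = 1 by linear_combination e1, one_smul]
    have eB : (α * β * (i.L / (1 - s))) • QB = R • (B₁ - B₀) := by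
      rw [mul_smul, qB', smul_smul, e5]
    have eg : (α * β * (i.L / (1 - s))) • ((i.κ * R ^ 2 * (1 - s) ^ 2) • Qg) =
        (R * i.κ) • (g₁ - g₀) := by
      have : (α * β * (i.L / (1 - s))) • ((i.κ * R ^ 2 * (1 - s) ^ 2) • Qg) =
          (α * β * (i.κ * R ^ 2 * (1 - s) ^ 2)) • ((i.L / (1 - s)) • Qg) := by
        rw [smul_smul, smul_smul]; congr 1; ring
      rw [this, qg, smul_smul, ← e6]
      congr 1; ring
    refine Prod.ext ?_ ?_
    -- The term `P` caused by the moving parameter cancels, because `(1 - s) * (i.L / (1 - s)) =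
    -- i.L`; the reference velocity plus the velocity difference remains.
    · show R⁻¹ • ((R • A₀ + (R * (1 - s)) • -(α • β • (i.L / (1 - s)) • P)) +
        (R * i.L) • α • β • (QA + P)) = A₁
      have : A₁ = A₀ + (i.L * α * β) • QA := by rw [eA]; abel
      rw [this]
      match_scalars <;> field_simp <;> ring
    · show R⁻¹ • ((R • (-B₀ - i.κ • g₀) + -(α • β • (i.L / (1 - s)) •
        (QB + (i.κ * R ^ 2 * (1 - s) ^ 2) • Qg))) + 0) = -B₁ - i.κ • g₁
      have : α • β • (i.L / (1 - s)) • (QB + (i.κ * R ^ 2 * (1 - s) ^ 2) • Qg) =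
          R • (B₁ - B₀) + (R * i.κ) • (g₁ - g₀) := by
        rw [← eB, ← eg, ← smul_add, smul_smul, smul_smul, mul_assoc]
      rw [this]
      match_scalars <;> field_simp <;> ring
  have hLm : -i.L ∈ Icc i.σ (-i.L) := ⟨i.σ_le, le_rfl⟩
  have h0 : γ (R * -i.L) = S.φ i.κ 0 ((R * (1 + i.L)) • F.Y ϑ₀ (i, -i.L) + (R * i.L) • z₀,
      F.H ϑ₀ (i, -i.L)) := by
    rw [S.φ_zero, hγe _ hLm, x1 _ hLm, x2 _ hLm]
    simp [hz, hθ]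
  have hRs : R * s ∈ Icc (R * i.σ) (R * -i.L) :=
    ⟨mul_le_mul_of_nonneg_left hs.1 hR0.le, mul_le_mul_of_nonneg_left hs.2 hR0.le⟩
  have := S.φ_unique (t₀ := R * -i.L) ⟨hRs.1.trans hRs.2, le_rfl⟩ key h0 hRs
  rw [zero_add, ← mul_sub, sub_neg_eq_add] at this
  rw [← this, hγe s hs]

end LongRangeFlow

end

/-! ### Trajectories with small data relative to the reference family. -/

noncomputable section

namespace LongRangeFlow

open BoundedContinuousFunction
open scoped NNReal

variable {n : ℕ} {K : ℝ} {S : LRSys n}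

/-- The constant pair of bounded functions. -/
def constPair : Eucl n × Eucl n →L[ℝ] BE n K × BE n K :=
  (bcfConst.comp (ContinuousLinearMap.fst ℝ (Eucl n) (Eucl n))).prod
    (bcfConst.comp (ContinuousLinearMap.snd ℝ (Eucl n) (Eucl n)))

theorem constPair_apply (p : Eucl n × Eucl n) :
    (constPair p : BE n K × BE n K) = (bcfConst p.1, bcfConst p.2) := rfl

theorem norm_constPair_le (p : Eucl n × Eucl n) : ‖(constPair p : BE n K × BE n K)‖ ≤ ‖p‖ := by
  rw [constPair_apply, Prod.norm_def]
  exact max_le ((norm_bcfConst_le _).trans (norm_fst_le p))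
    ((norm_bcfConst_le _).trans (norm_snd_le p))

/-- Trajectories relative to the reference family: the parameter of the reference trajectory
drifts from `ϑ₀`, and the position is displaced from it, starting with `z₀` at the depth `L`. -/
structure DeepFam (F : RefFam S K) where
  L₀ : ℝ
  one_le_L₀ : 1 ≤ L₀
  ρ : ℝ
  ρ_pos : 0 < ρ
  ρ_le : ρ ≤ F.r
  V : Eucl n × Eucl n → BE n K × BE n K
  smooth : ContDiffOn ℝ ∞ V (Metric.ball 0 ρ)
  mem : ∀ p ∈ Metric.ball (0 : Eucl n × Eucl n) ρ, V p ∈ Metric.ball (0 : BE n K × BE n K) F.r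
  lip : ∀ p ∈ Metric.ball (0 : Eucl n × Eucl n) ρ, ∀ p' ∈ Metric.ball (0 : Eucl n × Eucl n) ρ,
    ‖(V p - V p') - constPair (p - p')‖ ≤ 1 / 8 * ‖p - p'‖
  flow_eq : ∀ p ∈ Metric.ball (0 : Eucl n × Eucl n) ρ, ∀ i : Idx n K, F.R₀ ≤ i.R → L₀ ≤ i.L →
    ∀ s ∈ Icc i.σ (-i.L),
    S.φ i.κ (i.R * (s + i.L)) ((i.R * (1 + i.L)) • F.Y p.2 (i, -i.L) + (i.R * i.L) • p.1,
        F.H p.2 (i, -i.L)) =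
      ((i.R * (1 - s)) • F.Y ((V p).2 (i, s)) (i, s) + (i.R * i.L) • (V p).1 (i, s),
        F.H ((V p).2 (i, s)) (i, s))
  C : ℝ
  cauchy : ∀ p ∈ Metric.ball (0 : Eucl n × Eucl n) ρ, ∀ (i : Idx n K) (s s' : ℝ), i.σ ≤ s' →
    s' ≤ s → s ≤ -i.L →
    ‖(V p).1 (i, s') - (V p).1 (i, s)‖ ≤ C * (1 - s) ^ (-S.μ) ∧
    ‖(V p).2 (i, s') - (V p).2 (i, s)‖ ≤ C * (1 - s) ^ (-S.μ)

theorem norm_deepInt_sub_le {μ R₀ L₀ : ℝ} (hμ : 0 < μ) (hL : 1 ≤ L₀) (v : BE n K) (i : Idx n K)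
    {s s' : ℝ} (h1 : i.σ ≤ s') (h2 : s' ≤ s) (h3 : s ≤ -i.L) :
    ‖deepInt R₀ hμ hL v (i, s') - deepInt R₀ hμ hL v (i, s)‖ ≤
      ‖v‖ / μ * (1 - s) ^ (-μ) := by
  have hcc : Continuous fun r : ℝ => (1 + |r|) ^ (-(1 + μ)) • v (i, r) :=
    (continuous_weight (1 + μ)).smul (v.continuous.comp (by fun_prop))
  have hs0 : s ≤ 0 := h3.trans (by linarith [i.one_le_L])
  have e3 : deepInt R₀ hμ hL v (i, s') - deepInt R₀ hμ hL v (i, s) = gDeep μ R₀ L₀ i •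
      ∫ r in s..s', (1 + |r|) ^ (-(1 + μ)) • v (i, r) := by
    rw [deepInt_apply, deepInt_apply, clDeep_eq ⟨h1, h2.trans h3⟩, clDeep_eq ⟨h1.trans h2, h3⟩,
      ← intervalIntegral.integral_add_adjacent_intervals (hcc.intervalIntegrable (-i.L) s)
        (hcc.intervalIntegrable s s'), smul_add]
    abel
  have i2 : ‖∫ r in s..s', (1 + |r|) ^ (-(1 + μ)) • v (i, r)‖ ≤ (1 - s) ^ (-μ) / μ * ‖v‖ := by
    have hc : Continuous fun r : ℝ => |(1 + |r|) ^ (-(1 + μ))| * ‖v‖ :=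
      (continuous_weight (1 + μ)).abs.mul continuous_const
    refine (intervalIntegral.norm_integral_le_abs_of_norm_le (μ := MeasureTheory.volume)
      (g := fun r => |(1 + |r|) ^ (-(1 + μ))| * ‖v‖) ?_ (hc.intervalIntegrable _ _)).trans ?_
    · refine Eventually.of_forall fun r => ?_
      rw [norm_smul, Real.norm_eq_abs]
      gcongr
      exact v.norm_coe_le_norm _
    · rw [intervalIntegral.integral_mul_const, abs_mul, abs_of_nonneg (norm_nonneg v)]
      gcongr
      exact abs_integral_weight_le' hμ hs0 h2
  rw [e3, norm_smul, Real.norm_eq_abs]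
  calc _ ≤ 1 * ((1 - s) ^ (-μ) / μ * ‖v‖) := by gcongr; exact gDeep_abs_le hμ i
    _ = _ := by ring

/-- The depth `L₀` makes the integral operator times the Lipschitz constant of the nonlinearity at
most 1/16, and the fixed point then differs from its data by a map with constant 1/8. The Cauchy
estimate is the tail of the integrable weight. -/
theorem exists_deepFam (F : RefFam S K) : Nonempty (DeepFam F) := by
  have hr0 := F.r_pos
  have hN := contDiffOn_deepN F
  have hNat : ContDiffAt ℝ 1 (deepN F) 0 :=
    ((hN.contDiffAt (Metric.ball_mem_nhds _ hr0)).of_le (by simp))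
  obtain ⟨KN, t, ht, hKN⟩ := hNat.exists_lipschitzOnWith
  obtain ⟨ε, hε, hεt⟩ := Metric.mem_nhds_iff.1 ht
  set r := min ε F.r with hr
  have hrpos : 0 < r := lt_min hε hr0
  have hKN' : LipschitzOnWith KN (deepN F) (Metric.ball 0 r) :=
    hKN.mono ((Metric.ball_subset_ball (min_le_left _ _)).trans hεt)
  have hsub : Metric.ball (0 : BE n K × BE n K) r ⊆ Metric.ball 0 F.r :=
    Metric.ball_subset_ball (min_le_right _ _)
  have h00 : deepN F 0 = 0 := deepN_snd_zero F 0
  have hNb : ∀ x ∈ Metric.ball (0 : BE n K × BE n K) r, ‖deepN F x‖ ≤ KN * r := by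
    intro x hx
    have h1 := hKN'.dist_le_mul x hx 0 (Metric.mem_ball_self hrpos)
    rw [h00, dist_zero_right, dist_zero_right] at h1
    rw [mem_ball_zero_iff] at hx
    exact h1.trans (by gcongr)
  have hμ := S.μ_pos
  have hsmall : ∃ L₀ : ℝ, 1 ≤ L₀ ∧ L₀ ^ (-S.μ) * (1 / S.μ) * KN ≤ 1 / 16 := by
    have h1 := ((tendsto_rpow_neg_atTop hμ).mul_const (1 / S.μ)).mul_const (KN : ℝ)
    rw [zero_mul, zero_mul] at h1
    have e1 := h1.eventually_le_const (show (0 : ℝ) < 1 / 16 by norm_num)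
    obtain ⟨L₀, ha, hb⟩ := ((eventually_ge_atTop 1).and e1).exists
    exact ⟨L₀, ha, hb⟩
  obtain ⟨L₀, hL₀, hJ1⟩ := hsmall
  set J := deepJ (n := n) (K := K) F.R₀ hμ hL₀ with hJ
  have hJn : ∀ v, ‖J v‖ ≤ L₀ ^ (-S.μ) * (1 / S.μ) * ‖v‖ := norm_deepJ_le hμ hL₀
  have hLip : LipschitzOnWith (1 / 16 : ℝ≥0) (fun x => J (deepN F x)) (Metric.ball 0 r) := by
    refine LipschitzOnWith.of_dist_le_mul fun x hx y hy => ?_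
    rw [dist_eq_norm, ← map_sub]
    refine (hJn _).trans ?_
    have := hKN'.dist_le_mul x hx y hy
    rw [dist_eq_norm] at this
    calc _ ≤ L₀ ^ (-S.μ) * (1 / S.μ) * (KN * dist x y) := by gcongr
      _ = L₀ ^ (-S.μ) * (1 / S.μ) * KN * dist x y := by ring
      _ ≤ 1 / 16 * dist x y := by gcongr
      _ = _ := by norm_num
  have hδ : (1 / 16 : ℝ≥0) ≤ 1 / 2 := by
    rw [← NNReal.coe_le_coe]; push_cast; norm_num
  obtain ⟨x, hxs, hxm, hxL⟩ := exists_smooth_fixedPoint hrpos (hN.mono hsub) hδ hLip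
    (by simp only [h00, map_zero, norm_zero]; positivity)
  have hc : ∀ p ∈ Metric.ball (0 : Eucl n × Eucl n) (r / 8),
      (constPair p : BE n K × BE n K) ∈ Metric.ball 0 (r / 8) := fun p hp => by
    rw [mem_ball_zero_iff] at hp ⊢
    exact (norm_constPair_le p).trans_lt hp
  have hcomp1 : ∀ p ∈ Metric.ball (0 : Eucl n × Eucl n) (r / 8), ∀ t : IT n K,
      (x (constPair p)).1 t = p.1 + (J (deepN F (x (constPair p)))).1 t := fun p hp t =>
    congrArg (fun z : BE n K × BE n K => z.1 t) (hxm _ (hc p hp)).2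
  have hcomp2 : ∀ p ∈ Metric.ball (0 : Eucl n × Eucl n) (r / 8), ∀ t : IT n K,
      (x (constPair p)).2 t = p.2 + (J (deepN F (x (constPair p)))).2 t := fun p hp t =>
    congrArg (fun z : BE n K × BE n K => z.2 t) (hxm _ (hc p hp)).2
  exact ⟨{
    L₀ := L₀
    one_le_L₀ := hL₀
    ρ := r / 8
    ρ_pos := by positivity
    ρ_le := by linarith [min_le_right ε F.r]
    V := fun p => x (constPair p)
    smooth := hxs.comp (constPair (n := n) (K := K)).contDiff.contDiffOn hc
    mem := fun p hp => hsub (hxm _ (hc p hp)).1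
    lip := by
      intro p hp p' hp'
      have h1 := hxL.dist_le_mul _ (hc p hp) _ (hc p' hp')
      rw [dist_eq_norm, dist_eq_norm, ← map_sub] at h1
      have e : (x (constPair p) - x (constPair p') - constPair (p - p') : BE n K × BE n K) =
          (x (constPair p) - constPair p) - (x (constPair p') - constPair p') := by
        rw [map_sub]; abel
      rw [e]
      refine h1.trans ?_
      have h2 := norm_constPair_le (K := K) (p - p')
      push_cast
      linarith
    flow_eq := fun p hp i hi hiL s hs => flow_of_deep_equation F hL₀ (hsub (hxm _ (hc p hp)).1)
      hi hiL (fun s => hcomp1 p hp (i, s)) (fun s => hcomp2 p hp (i, s)) hs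
    C := KN * r / S.μ
    cauchy := by
      intro p hp i s s' h1 h2 h3
      have hb := hNb _ (hxm _ (hc p hp)).1
      have hpow : 0 ≤ (1 - s) ^ (-S.μ) :=
        Real.rpow_nonneg (by linarith [i.one_le_L]) _
      rw [hcomp1 p hp, hcomp1 p hp, hcomp2 p hp, hcomp2 p hp, add_sub_add_left_eq_sub,
        add_sub_add_left_eq_sub]
      constructor
      · refine (norm_deepInt_sub_le hμ hL₀ (deepN F (x (constPair p))).1 i h1 h2 h3).trans ?_
        gcongr
        exact (norm_fst_le _).trans hb
      · have e : (J (deepN F (x (constPair p)))).2 (i, s') -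
            (J (deepN F (x (constPair p)))).2 (i, s) =
            -(deepInt F.R₀ hμ hL₀ (deepN F (x (constPair p))).2 (i, s') -
              deepInt F.R₀ hμ hL₀ (deepN F (x (constPair p))).2 (i, s)) := by
          have eJ : ∀ t, (J (deepN F (x (constPair p)))).2 t =
            -(deepInt F.R₀ hμ hL₀ (deepN F (x (constPair p))).2 t) := fun _ => rfl
          rw [eJ, eJ]; abel
        rw [e, norm_neg]
        refine (norm_deepInt_sub_le hμ hL₀ (deepN F (x (constPair p))).2 i h1 h2 h3).trans ?_
        gcongr
        exact (norm_snd_le _).trans hb }⟩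

end LongRangeFlow

end

noncomputable section

namespace LongRangeFlow

/-! ### Nontrapped geodesics -/

variable {n : ℕ} {a : Eucl n → Matrix (Fin n) (Fin n) ℝ} {V : Eucl n → ℝ} {μ : ℝ}

theorem sub_le_of_le_deriv {g g' : ℝ → ℝ} {b t₁ : ℝ} (hg : ∀ t, HasDerivAt g (g' t) t)
    (hb : ∀ t ≤ t₁, b ≤ g' t) {t : ℝ} (ht : t ≤ t₁) : g t ≤ g t₁ - b * (t₁ - t) := by
  have hd : ∀ t, HasDerivAt (fun t => g t - b * t) (g' t - b) t := fun t =>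
    (hg t).sub (by simpa using (hasDerivAt_id t).const_mul b)
  have hm : MonotoneOn (fun t => g t - b * t) (Iic t₁) := by
    refine monotoneOn_of_deriv_nonneg (convex_Iic t₁)
      (fun t _ => (hd t).continuousAt.continuousWithinAt)
      (fun t _ => (hd t).differentiableAt.differentiableWithinAt) fun t ht => ?_
    rw [(hd t).deriv]
    rw [interior_Iic] at ht
    linarith [hb t (le_of_lt ht)]
  have := hm ht (mem_Iic.2 le_rfl) ht
  simp only at this
  linarith

/-- Mean value inequality beyond the time where the derivative is at most ε/2; the fixed initial
part is absorbed into the other half. -/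
theorem sublinear_of_deriv_tendsto_zero {E : Type} [NormedAddCommGroup E] [NormedSpace ℝ E]
    {f f' : ℝ → E} (hf : ∀ t, HasDerivAt f (f' t) t)
    (h : ∀ ε > 0, ∀ᶠ t in atBot, ‖f' t‖ ≤ ε) {ε : ℝ} (hε : 0 < ε) :
    ∀ᶠ t in atBot, ‖f t‖ ≤ ε * |t| := by
  obtain ⟨t₃, ht₃⟩ := eventually_atBot.1 (h (ε / 2) (by positivity))
  have hev : ∀ᶠ t in atBot, ‖f t₃‖ + ε / 2 * |t₃| ≤ ε / 2 * -t :=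
    (tendsto_neg_atBot_atTop.const_mul_atTop (show (0 : ℝ) < ε / 2 by positivity)).eventually_ge_atTop _
  filter_upwards [hev, eventually_le_atBot t₃, eventually_le_atBot 0] with t h1 h2 h3
  have := (convex_Iic t₃).norm_image_sub_le_of_norm_hasDerivWithin_le (f := f) (f' := f')
    (C := ε / 2) (x := t₃) (y := t) (fun s _ => (hf s).hasDerivWithinAt) (fun s hs => ht₃ s hs)
    (mem_Iic.2 le_rfl) h2
  have h4 : ‖f t‖ ≤ ‖f t - f t₃‖ + ‖f t₃‖ := by simpa using norm_add_le (f t - f t₃) (f t₃)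
  have h5 : ‖t - t₃‖ ≤ |t| + |t₃| := abs_sub _ _
  have h6 : ε / 2 * ‖t - t₃‖ ≤ ε / 2 * (|t| + |t₃|) := by gcongr
  rw [abs_of_nonpos h3] at *
  linarith

/-- A backward nontrapped geodesic is asymptotic to a line to leading order. -/
theorem BackwardNontrapping.asymptotics (h : IsLongRange a V μ) {q : Eucl n × Eucl n}
    (hq : BackwardNontrapping a q) :
    ∃ e₀ e₁ : ℝ, 0 < e₀ ∧ (∀ t, e₀ ≤ ‖((sysOf h).φ 0 t q).2‖ ∧ ‖((sysOf h).φ 0 t q).2‖ ≤ e₁) ∧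
      ∀ ε > 0, ∀ᶠ t in atBot,
        ‖((sysOf h).φ 0 t q).1 - t • ((sysOf h).φ 0 t q).2‖ ≤ ε * |t| := by
  set y : ℝ → Eucl n := fun t => ((sysOf h).φ 0 t q).1 with hy
  set η : ℝ → Eucl n := fun t => ((sysOf h).φ 0 t q).2 with hη
  have hμ := h.mu_pos
  have hq' : Tendsto (fun t => ‖y t‖) atBot atTop := by
    have h1 : (fun t => ‖y t‖) = fun t => ‖(flow (kinetic a) t q).1‖ := by
      funext t; simp only [hy, sysOf_φ_zero]
    rw [h1]; exact hq
  have dy : ∀ t, HasDerivAt y (opA a (y t) (η t)) t := fun t =>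
    HasFDerivAt.comp_hasDerivAt (f := fun t => (sysOf h).φ 0 t q) (l := Prod.fst) t
      hasFDerivAt_fst ((sysOf h).φ_deriv 0 q t)
  have dη : ∀ t, HasDerivAt η (-(opB a (y t) (η t) (η t))) t := fun t => by
    have := HasFDerivAt.comp_hasDerivAt (f := fun t => (sysOf h).φ 0 t q) (l := Prod.snd) t
      hasFDerivAt_snd ((sysOf h).φ_deriv 0 q t)
    refine this.congr_deriv ?_
    show -(opB a (y t) (η t) (η t)) - (0 : ℝ) • gradient V (y t) = _
    rw [zero_smul, sub_zero]
  obtain ⟨c, hc0, hc⟩ := exists_elliptic h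
  obtain ⟨CA, hCA0, hCA⟩ := (isSym_opA h).bound
  obtain ⟨CB, hCB0, hCB⟩ := (isSym_opB h).bound
  have hA : ∀ x, ‖opA a x‖ ≤ CA + 1 := fun x => by
    have h1 : ‖opA a x - 1‖ ≤ CA := (hCA x).trans (mul_le_of_le_one_right hCA0
      (Real.rpow_le_one_of_one_le_of_nonpos (one_le_bracket x) (by linarith)))
    calc ‖opA a x‖ = ‖(opA a x - 1) + 1‖ := by simp
      _ ≤ CA + 1 := (norm_add_le _ _).trans (by
        gcongr; exact ContinuousLinearMap.norm_id_le)
  set Q := inner ℝ (opA a (y 0) (η 0)) (η 0) with hQ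
  have hcons : ∀ t, inner ℝ (opA a (y t) (η t)) (η t) = Q := by
    have hd : ∀ t, HasDerivAt (fun t => kinetic a (y t) (η t)) 0 t := fun t => by
      obtain ⟨L, hL, hLv⟩ := hasFDerivAt_kinetic h (y t) (η t)
      have := HasFDerivAt.comp_hasDerivAt (f := fun t => (y t, η t)) t hL ((dy t).prodMk (dη t))
      refine this.congr_deriv ?_
      rw [hLv, inner_neg_right, real_inner_comm (opA a (y t) (η t))]
      ring
    intro t
    have h1 := is_const_of_deriv_eq_zero (fun t => (hd t).differentiableAt)
      (fun t => (hd t).deriv) t 0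
    simp only [kinetic_eq] at h1
    linarith
  have low : ∀ t, c * ‖η t‖ ^ 2 ≤ Q := fun t => by rw [← hcons t]; exact hc _ _
  have upp : ∀ t, Q ≤ (CA + 1) * ‖η t‖ ^ 2 := fun t => by
    rw [← hcons t]
    refine (real_inner_le_norm _ _).trans ?_
    have := ((opA a (y t)).le_opNorm (η t)).trans
      (mul_le_mul_of_nonneg_right (hA (y t)) (norm_nonneg (η t)))
    calc ‖opA a (y t) (η t)‖ * ‖η t‖ ≤ (CA + 1) * ‖η t‖ * ‖η t‖ := by gcongr
      _ = _ := by ring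
  -- Zero energy would mean zero momentum and a constant position, which is trapped.
  have hQ0 : 0 < Q := by
    rcases lt_or_ge 0 Q with h0 | h0
    · exact h0
    exfalso
    have hη0 : ∀ t, η t = 0 := fun t => by
      have h1 : c * ‖η t‖ ^ 2 ≤ 0 := (low t).trans h0
      have h2 : ‖η t‖ ^ 2 ≤ 0 := by
        by_contra hcon
        push Not at hcon
        nlinarith [mul_pos hc0 hcon]
      rw [← norm_eq_zero]
      nlinarith [norm_nonneg (η t)]
    have hyc : ∀ t, y t = y 0 := fun t =>
      is_const_of_deriv_eq_zero (fun t => (dy t).differentiableAt)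
        (fun t => by rw [(dy t).deriv, hη0, map_zero]) t 0
    have h3 := hq'.eventually_gt_atTop ‖y 0‖
    obtain ⟨t, ht⟩ := h3.exists
    exact absurd ht (by rw [hyc t]; exact lt_irrefl _)
  have hM0 : 0 < CA + 1 := by linarith
  set e₁ := Real.sqrt (Q / c) with he₁
  have up1 : ∀ t, ‖η t‖ ≤ e₁ := fun t => by
    apply Real.le_sqrt_of_sq_le
    rw [le_div_iff₀ hc0]
    linarith [low t]
  have he₁0 : 0 < e₁ := Real.sqrt_pos.2 (by positivity)
  have hBy : ∀ t, ‖opB a (y t) (η t) (η t)‖ ≤ CB * e₁ ^ 2 * bracket (y t) ^ (-(μ + 1)) := fun t => by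
    have hbr : 0 ≤ bracket (y t) ^ (-(μ + 1)) :=
      Real.rpow_nonneg (zero_le_one.trans (one_le_bracket _)) _
    calc ‖opB a (y t) (η t) (η t)‖ ≤ ‖opB a (y t)‖ * ‖η t‖ * ‖η t‖ :=
          (opB a (y t)).le_opNorm₂ _ _
      _ ≤ (CB * bracket (y t) ^ (-(μ + 1))) * e₁ * e₁ := by
          gcongr
          · exact hCB _
          · exact up1 t
          · exact up1 t
      _ = _ := by ring
  have hbr0 : ∀ t, 0 < bracket (y t) := fun t => lt_of_lt_of_le one_pos (one_le_bracket _)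
  have hbr : ∀ t, bracket (y t) ^ (-(μ + 1)) * bracket (y t) = bracket (y t) ^ (-μ) := fun t => by
    rw [show -μ = -(μ + 1) + 1 by ring, Real.rpow_add (hbr0 t), Real.rpow_one]
  have hdec : Tendsto (fun t => bracket (y t) ^ (-μ)) atBot (𝓝 0) :=
    (tendsto_rpow_neg_atTop hμ).comp
      (tendsto_atTop_mono (fun t => norm_le_bracket (y t)) hq')
  have hgd : ∀ t, HasDerivAt (fun t => inner ℝ (y t) (η t))
      (inner ℝ (y t) (-(opB a (y t) (η t) (η t))) + inner ℝ (opA a (y t) (η t)) (η t)) t :=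
    fun t => (dy t).inner ℝ (dη t)
  have hev1 : ∀ᶠ t in atBot, CB * e₁ ^ 2 * bracket (y t) ^ (-μ) ≤ Q / 2 := by
    have := hdec.const_mul (CB * e₁ ^ 2)
    rw [mul_zero] at this
    exact this.eventually_le_const (by positivity)
  obtain ⟨t₁, ht₁⟩ := eventually_atBot.1 hev1
  -- The derivative of ⟨y,η⟩ is the conserved Q up to an error O(⟨y⟩^{-μ}), which tends to 0 because
  -- |y| → ∞. So ⟨y,η⟩ decreases at least linearly backward in time, and bounded momentum yields |y|
  -- ≥ c|t|.
  have hg1 : ∀ t ≤ t₁, Q / 2 ≤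
      inner ℝ (y t) (-(opB a (y t) (η t) (η t))) + inner ℝ (opA a (y t) (η t)) (η t) := by
    intro t ht
    rw [hcons t, inner_neg_right]
    have h1 : inner ℝ (y t) (opB a (y t) (η t) (η t)) ≤ Q / 2 := by
      refine (real_inner_le_norm _ _).trans (le_trans ?_ (ht₁ t ht))
      calc ‖y t‖ * ‖opB a (y t) (η t) (η t)‖ ≤
            bracket (y t) * (CB * e₁ ^ 2 * bracket (y t) ^ (-(μ + 1))) := by
            gcongr
            · exact (hbr0 t).le
            · exact norm_le_bracket _
            · exact hBy t
        _ = CB * e₁ ^ 2 * (bracket (y t) ^ (-(μ + 1)) * bracket (y t)) := by ring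
        _ = _ := by rw [hbr]
    linarith
  have hlin : ∀ᶠ t in atBot, Q / (4 * e₁) * |t| ≤ ‖y t‖ := by
    have hev : ∀ᶠ t in atBot, inner ℝ (y t₁) (η t₁) - Q / 2 * t₁ ≤ Q / 4 * -t :=
      (tendsto_neg_atBot_atTop.const_mul_atTop
        (show (0 : ℝ) < Q / 4 by positivity)).eventually_ge_atTop _
    filter_upwards [hev, eventually_le_atBot t₁, eventually_le_atBot 0] with t h1 h2 h3
    have h4 := sub_le_of_le_deriv hgd hg1 h2
    have h5 : -inner ℝ (y t) (η t) ≤ ‖y t‖ * e₁ :=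
      (neg_le_abs _).trans ((abs_real_inner_le_norm _ _).trans (by gcongr; exact up1 t))
    rw [abs_of_nonpos h3, div_mul_eq_mul_div, div_le_iff₀ (by positivity)]
    linarith
  refine ⟨Real.sqrt (Q / (CA + 1)), e₁, Real.sqrt_pos.2 (by positivity), fun t => ⟨?_, up1 t⟩, ?_⟩
  · refine Real.sqrt_le_iff.2 ⟨norm_nonneg _, ?_⟩
    rw [div_le_iff₀ hM0]
    have := upp t
    simp only [hη] at this ⊢
    linarith
  · intro ε hε
    -- Both terms of the derivative of y - tη are O(⟨y⟩^{-μ}), the second because |t| is bounded by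
    -- a multiple of |y|.
    have dD : ∀ t, HasDerivAt (fun t => y t - t • η t)
        ((opA a (y t) - 1) (η t) + t • opB a (y t) (η t) (η t)) t := fun t => by
      refine ((dy t).sub ((hasDerivAt_id t).smul (dη t))).congr_deriv ?_
      show opA a (y t) (η t) - (t • -(opB a (y t) (η t) (η t)) + (1 : ℝ) • η t) =
        (opA a (y t) (η t) - η t) + t • opB a (y t) (η t) (η t)
      rw [one_smul, smul_neg]; abel
    refine sublinear_of_deriv_tendsto_zero dD (fun ε hε => ?_) hε
    set c₂ := Q / (4 * e₁) with hc₂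
    have hc₂0 : 0 < c₂ := by positivity
    have h1 := hdec.const_mul (CA * e₁ + CB * e₁ ^ 2 / c₂)
    rw [mul_zero] at h1
    filter_upwards [h1.eventually_le_const hε, hlin] with t h2 h3
    refine le_trans ((norm_add_le _ _).trans ?_) h2
    have i1 : ‖(opA a (y t) - 1) (η t)‖ ≤ CA * bracket (y t) ^ (-μ) * e₁ :=
      ((opA a (y t) - 1).le_opNorm _).trans (by
        gcongr
        · exact mul_nonneg hCA0 (Real.rpow_nonneg (hbr0 t).le _)
        · exact hCA _
        · exact up1 t)
    have i2 : |t| ≤ bracket (y t) / c₂ := by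
      rw [le_div_iff₀ hc₂0, mul_comm]
      exact h3.trans (norm_le_bracket _)
    have i3 : ‖t • opB a (y t) (η t) (η t)‖ ≤
        bracket (y t) / c₂ * (CB * e₁ ^ 2 * bracket (y t) ^ (-(μ + 1))) := by
      rw [norm_smul, Real.norm_eq_abs]
      gcongr
      · exact div_nonneg (hbr0 t).le hc₂0.le
      · exact hBy t
    calc _ ≤ CA * bracket (y t) ^ (-μ) * e₁ +
          bracket (y t) / c₂ * (CB * e₁ ^ 2 * bracket (y t) ^ (-(μ + 1))) := add_le_add i1 i3
      _ = CA * e₁ * bracket (y t) ^ (-μ) +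
          CB * e₁ ^ 2 / c₂ * (bracket (y t) ^ (-(μ + 1)) * bracket (y t)) := by ring
      _ = _ := by rw [hbr]; ring

end LongRangeFlow

end

noncomputable section

namespace LongRangeFlow

open BoundedContinuousFunction
open scoped NNReal

/-! ### Initial data relative to the reference family -/

section ParametricInverse

variable {E : Type} [NormedAddCommGroup E] [NormedSpace ℝ E] [FiniteDimensional ℝ E]

theorem exists_equiv_prod (L : ℝ × E →L[ℝ] E) (e : E ≃L[ℝ] E) (h : ∀ v, L (0, v) = e v) :
    ∃ e' : (ℝ × E) ≃L[ℝ] (ℝ × E), (e' : ℝ × E →L[ℝ] ℝ × E) =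
      (ContinuousLinearMap.fst ℝ ℝ E).prod L := by
  set D := (ContinuousLinearMap.fst ℝ ℝ E).prod L with hD
  have hinj : Function.Injective (D : ℝ × E →ₗ[ℝ] ℝ × E) := by
    rw [injective_iff_map_eq_zero]
    rintro ⟨c, v⟩ hv
    have h1 : (c, L (c, v)) = (0 : ℝ × E) := hv
    rw [Prod.mk_eq_zero] at h1
    obtain ⟨rfl, h2⟩ := h1
    rw [h, ContinuousLinearEquiv.map_eq_zero_iff] at h2
    rw [h2, Prod.mk_zero_zero]
  exact ⟨(LinearEquiv.ofInjectiveEndo (D : ℝ × E →ₗ[ℝ] ℝ × E) hinj).toContinuousLinearEquiv,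
    by ext v <;> rfl⟩

/-- The inverse function theorem with a parameter. -/
theorem exists_parametric_inverse {G : ℝ × E → E} {c₀ : ℝ} {x₀ : E}
    (hG : ∀ᶠ p in 𝓝 (c₀, x₀), ContDiffAt ℝ ∞ G p) {e : E ≃L[ℝ] E}
    (he : HasFDerivAt (fun x => G (c₀, x)) (e : E →L[ℝ] E) x₀) :
    ∃ Ξ : ℝ × E → E, (∀ᶠ w in 𝓝 (c₀, G (c₀, x₀)), ContDiffAt ℝ ∞ Ξ w) ∧
      Ξ (c₀, G (c₀, x₀)) = x₀ ∧ ∀ᶠ w in 𝓝 (c₀, G (c₀, x₀)), G (w.1, Ξ w) = w.2 := by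
  set f : ℝ × E → ℝ × E := fun p => (p.1, G p) with hf
  have hfe : ∀ᶠ p in 𝓝 (c₀, x₀), ContDiffAt ℝ ∞ f p := by
    filter_upwards [hG] with p hp
    exact contDiffAt_fst.prodMk hp
  have hfs : ContDiffAt ℝ ∞ f (c₀, x₀) := hfe.self_of_nhds
  have hd := (hG.self_of_nhds.differentiableAt (by simp)).hasFDerivAt
  obtain ⟨e', he'⟩ := exists_equiv_prod (fderiv ℝ G (c₀, x₀)) e (fun v => by
    have h1 := HasFDerivAt.comp x₀ (f := fun x => (c₀, x)) hd (hasFDerivAt_prodMk_right c₀ x₀)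
    exact congrArg (fun D => D v) (h1.unique he))
  have hfd : HasFDerivAt f (e' : ℝ × E →L[ℝ] ℝ × E) (c₀, x₀) := by
    rw [he']; exact hasFDerivAt_fst.prodMk hd
  set Φ := hfs.toOpenPartialHomeomorph f hfd (by simp) with hΦ
  have htgt : f (c₀, x₀) ∈ Φ.target := hfs.image_mem_toOpenPartialHomeomorph_target hfd (by simp)
  have hsrc : (c₀, x₀) ∈ Φ.source := hfs.mem_toOpenPartialHomeomorph_source hfd (by simp)
  have hequiv : ∀ᶠ p in 𝓝 (c₀, x₀), fderiv ℝ f p ∈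
      range ((↑) : ((ℝ × E) ≃L[ℝ] (ℝ × E)) → (ℝ × E →L[ℝ] ℝ × E)) := by
    have hcont : ContinuousAt (fderiv ℝ f) (c₀, x₀) :=
      (hfs.fderiv_right (m := 0) (by simp)).continuousAt
    refine hcont.eventually_mem (ContinuousLinearEquiv.isOpen.mem_nhds ?_)
    rw [hfd.fderiv]
    exact ⟨e', rfl⟩
  have hback : Tendsto Φ.symm (𝓝 (f (c₀, x₀))) (𝓝 (c₀, x₀)) := by
    have h1 := (Φ.continuousAt_symm htgt).tendsto
    rwa [show Φ.symm (f (c₀, x₀)) = (c₀, x₀) from Φ.left_inv hsrc] at h1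
  refine ⟨fun w => (Φ.symm w).2, ?_, ?_, ?_⟩
  · filter_upwards [Φ.open_target.mem_nhds htgt, hback.eventually (hequiv.and hfe)] with w hw h2
    obtain ⟨⟨e'', h3⟩, h4⟩ := h2
    refine contDiffAt_snd.comp w (Φ.contDiffAt_symm hw (f₀' := e'') ?_ h4)
    rw [h3]
    exact (h4.differentiableAt (by simp)).hasFDerivAt
  · exact congrArg Prod.snd (Φ.left_inv hsrc)
  · filter_upwards [Φ.open_target.mem_nhds htgt] with w hw
    have h1 : f (Φ.symm w) = w := Φ.right_inv hw
    have h2 : (f (Φ.symm w)).1 = w.1 := by rw [h1]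
    have h3 : (f (Φ.symm w)).2 = w.2 := by rw [h1]
    change (Φ.symm w).1 = w.1 at h2
    change G (Φ.symm w) = w.2 at h3
    rw [← h3, ← h2]

end ParametricInverse

variable {n : ℕ} {K : ℝ} {S : LRSys n}

theorem LRSys.contDiff_φ (S : LRSys n) (t : ℝ) :
    ContDiff ℝ ∞ (fun p : ℝ × (Eucl n × Eucl n) => S.φ p.1 t p.2) :=
  S.φ_smooth.comp (f := fun p : ℝ × (Eucl n × Eucl n) => (p.1, t, p.2)) (by fun_prop)

theorem LRSys.φ_neg (S : LRSys n) (κ t : ℝ) (q : Eucl n × Eucl n) :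
    S.φ κ (-t) (S.φ κ t q) = q := by
  rw [← S.φ_add, add_neg_cancel, S.φ_zero]

/-- The phase point with relative data `p`, at the time when the data are prescribed. -/
def LRSys.place (S : LRSys n) (R τ m c : ℝ) (dir : Eucl n)
    (w : ℝ × (Eucl n × Eucl n)) : Eucl n × Eucl n :=
  S.φ w.1 τ (incoming R (m • (dir + w.2.2)), m • (dir + w.2.2)) + (c • w.2.1, 0)

theorem LRSys.contDiffAt_place (S : LRSys n) {R τ m c : ℝ} {dir : Eucl n}
    {w : ℝ × (Eucl n × Eucl n)} (hne : m • (dir + w.2.2) ≠ 0) :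
    ContDiffAt ℝ ∞ (S.place R τ m c dir) w := by
  have h1 := (S.contDiffAt_incoming_flow R w.1 τ hne).comp w
    (f := fun w : ℝ × (Eucl n × Eucl n) => (w.1, τ, m • (dir + w.2.2))) (by fun_prop)
  exact h1.add (ContDiffAt.prodMk (by fun_prop) contDiffAt_const)

/-- Relative data depending smoothly on the initial point and the coupling constant. -/
theorem LRSys.exists_initialData (S : LRSys n) {R τ m c : ℝ} {dir : Eucl n} {q₀ : Eucl n × Eucl n}
    (hc : c ≠ 0) (hm : m ≠ 0) (hne : m • dir ≠ 0)
    (hθ : S.mom R 0 τ (m • dir) = (S.φ 0 τ q₀).2)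
    {e : Eucl n ≃L[ℝ] Eucl n}
    (he : HasStrictFDerivAt (S.mom R 0 τ) (e : Eucl n →L[ℝ] Eucl n) (m • dir)) :
    ∃ P : ℝ × (Eucl n × Eucl n) → Eucl n × Eucl n,
      (∀ᶠ w in 𝓝 ((0 : ℝ), q₀), ContDiffAt ℝ ∞ P w) ∧
      P (0, q₀) = (c⁻¹ • ((S.φ 0 τ q₀).1 - (S.φ 0 τ (incoming R (m • dir), m • dir)).1), 0) ∧
      ∀ᶠ w in 𝓝 ((0 : ℝ), q₀), S.φ w.1 τ w.2 = S.place R τ m c dir (w.1, P w) := by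
  have hGs : ∀ᶠ p : ℝ × Eucl n in 𝓝 (0, m • dir),
      ContDiffAt ℝ ∞ (fun p : ℝ × Eucl n => S.mom R p.1 τ p.2) p := by
    have : ∀ᶠ p : ℝ × Eucl n in 𝓝 (0, m • dir), p.2 ≠ 0 :=
      continuous_snd.continuousAt.eventually_ne hne
    filter_upwards [this] with p hp
    exact contDiffAt_snd.comp _ ((S.contDiffAt_incoming_flow R p.1 τ hp).comp p
      (f := fun p : ℝ × Eucl n => (p.1, τ, p.2)) (by fun_prop))
  obtain ⟨Ξ, hΞs, hΞ0, hΞ⟩ := exists_parametric_inverse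
    (G := fun p : ℝ × Eucl n => S.mom R p.1 τ p.2) (c₀ := 0) (x₀ := m • dir) hGs he.hasFDerivAt
  simp only [hθ] at hΞs hΞ0 hΞ
  set θ : ℝ × (Eucl n × Eucl n) → Eucl n := fun w => Ξ (w.1, (S.φ w.1 τ w.2).2) with hθdef
  have hφ := S.contDiff_φ τ
  have hin : ContDiff ℝ ∞ (fun w : ℝ × (Eucl n × Eucl n) => (w.1, (S.φ w.1 τ w.2).2)) := by
    fun_prop
  have h2 : Tendsto (fun w : ℝ × (Eucl n × Eucl n) => (w.1, (S.φ w.1 τ w.2).2)) (𝓝 (0, q₀))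
      (𝓝 (0, (S.φ 0 τ q₀).2)) := hin.continuous.tendsto (0, q₀)
  have hθs : ∀ᶠ w in 𝓝 ((0 : ℝ), q₀), ContDiffAt ℝ ∞ θ w := by
    filter_upwards [h2.eventually hΞs] with w hw
    exact ContDiffAt.comp w (g := Ξ)
      (f := fun w : ℝ × (Eucl n × Eucl n) => (w.1, (S.φ w.1 τ w.2).2)) hw hin.contDiffAt
  have hθ0 : θ (0, q₀) = m • dir := hΞ0
  have hθne : ∀ᶠ w in 𝓝 ((0 : ℝ), q₀), θ w ≠ 0 :=
    hθs.self_of_nhds.continuousAt.eventually_ne (by rw [hθ0]; exact hne)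
  refine ⟨fun w => (c⁻¹ • ((S.φ w.1 τ w.2).1 - (S.φ w.1 τ (incoming R (θ w), θ w)).1),
    m⁻¹ • θ w - dir), ?_, ?_, ?_⟩
  · filter_upwards [hθs, hθne] with w hw hw0
    have hpos : ContDiffAt ℝ ∞ (fun w : ℝ × (Eucl n × Eucl n) =>
        (S.φ w.1 τ (incoming R (θ w), θ w)).1) w :=
      contDiffAt_fst.comp _ (ContDiffAt.comp w
        (g := fun p : ℝ × ℝ × Eucl n => S.φ p.1 p.2.1 (incoming R p.2.2, p.2.2))
        (f := fun w : ℝ × (Eucl n × Eucl n) => (w.1, τ, θ w))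
        (S.contDiffAt_incoming_flow R w.1 τ hw0)
        (contDiffAt_fst.prodMk (contDiffAt_const.prodMk hw)))
    have h1 : ContDiffAt ℝ ∞ (fun w : ℝ × (Eucl n × Eucl n) => (S.φ w.1 τ w.2).1) w :=
      contDiffAt_fst.comp _ hφ.contDiffAt
    exact ((h1.sub hpos).const_smul c⁻¹).prodMk ((hw.const_smul m⁻¹).sub contDiffAt_const)
  · simp only [hθ0]
    rw [inv_smul_smul₀ hm, sub_self]
  · filter_upwards [h2.eventually hΞ] with w hw
    have e1 : m • (dir + (m⁻¹ • θ w - dir)) = θ w := by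
      rw [add_sub_cancel, smul_inv_smul₀ hm]
    simp only [LRSys.place, e1]
    refine Prod.ext ?_ ?_
    · simp only [Prod.fst_add, smul_inv_smul₀ hc]
      abel
    · simp only [Prod.snd_add, add_zero]
      exact hw.symm

/-- Points are controlled by their relative data. -/
theorem LRSys.exists_lower_bound (S : LRSys n) {R τ m c : ℝ} {dir : Eucl n} {q₀ : Eucl n × Eucl n}
    {P : ℝ × (Eucl n × Eucl n) → Eucl n × Eucl n} (hP : ContDiffAt ℝ ∞ P (0, q₀))
    (hP2 : (P (0, q₀)).2 = 0) (hne : m • dir ≠ 0)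
    (h : ∀ᶠ w in 𝓝 ((0 : ℝ), q₀), S.φ w.1 τ w.2 = S.place R τ m c dir (w.1, P w)) :
    ∃ k : ℝ, 0 < k ∧ ∃ N ∈ 𝓝 ((0 : ℝ), q₀), ∀ κ q q', (κ, q) ∈ N → (κ, q') ∈ N →
      k * ‖q - q'‖ ≤ ‖P (κ, q) - P (κ, q')‖ := by
  -- The initial point is recovered from its relative data by placing it and flowing back; this
  -- inverse is C¹, hence locally Lipschitz.
  set Q : ℝ × (Eucl n × Eucl n) → Eucl n × Eucl n := fun w =>
    S.φ w.1 (-τ) (S.place R τ m c dir w) with hQ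
  have hpl : ContDiffAt ℝ ∞ (S.place R τ m c dir) (0, P (0, q₀)) :=
    S.contDiffAt_place (by simp only [hP2, add_zero]; exact hne)
  have hQs : ContDiffAt ℝ 1 Q (0, P (0, q₀)) :=
    (ContDiffAt.comp (0, P (0, q₀)) (f := fun w : ℝ × (Eucl n × Eucl n) =>
      (w.1, S.place R τ m c dir w)) (S.contDiff_φ (-τ)).contDiffAt
      (contDiffAt_fst.prodMk hpl)).of_le (by simp)
  obtain ⟨k, t, ht, hk⟩ := hQs.exists_lipschitzOnWith
  have hcont : Tendsto (fun w : ℝ × (Eucl n × Eucl n) => (w.1, P w)) (𝓝 (0, q₀))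
      (𝓝 (0, P (0, q₀))) := (continuousAt_fst.prodMk hP.continuousAt)
  refine ⟨((k : ℝ) + 1)⁻¹, by positivity, _, (hcont.eventually_mem ht).and h, ?_⟩
  rintro κ q q' ⟨h1, h2⟩ ⟨h3, h4⟩
  have e : ∀ q, S.φ κ τ q = S.place R τ m c dir (κ, P (κ, q)) → Q (κ, P (κ, q)) = q := by
    intro q hq
    simp only [hQ, ← hq, S.φ_neg]
  have h5 := hk.dist_le_mul _ h1 _ h3
  simp only [e q h2, e q' h4] at h5
  have h6 : dist (κ, P (κ, q)) (κ, P (κ, q')) = ‖P (κ, q) - P (κ, q')‖ := by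
    rw [Prod.dist_eq, dist_self, dist_eq_norm]
    exact max_eq_right (norm_nonneg _)
  rw [h6, dist_eq_norm] at h5
  rw [inv_mul_le_iff₀ (by positivity)]
  have := norm_nonneg (P (κ, q) - P (κ, q'))
  linarith

namespace DeepFam

variable {F : RefFam S K} (D : DeepFam F)

/-- Displacement and momentum along the trajectory with given relative data. -/
def out (p : Eucl n × Eucl n) : BE n K × BE n K := ((D.V p).1, RefFam.along F.H (D.V p).2)

theorem mem_snd {p : Eucl n × Eucl n} (hp : p ∈ Metric.ball (0 : Eucl n × Eucl n) D.ρ) :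
    (D.V p).2 ∈ Metric.ball (0 : BE n K) F.r := (mem_of_mem_ball F (D.mem p hp)).1

theorem contDiffOn_out : ContDiffOn ℝ ∞ D.out (Metric.ball (0 : Eucl n × Eucl n) D.ρ) :=
  (contDiff_fst.comp_contDiffOn D.smooth).prodMk
    ((F.contDiffOn_along F.smooth_H).comp (contDiff_snd.comp_contDiffOn D.smooth)
      fun _ hp => D.mem_snd hp)

theorem out_snd {p : Eucl n × Eucl n} (hp : p ∈ Metric.ball (0 : Eucl n × Eucl n) D.ρ)
    (t : IT n K) : (D.out p).2 t = F.H ((D.V p).2 t) t :=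
  F.along_apply F.smooth_H (D.mem_snd hp) t

theorem norm_V_sub_apply_le {p p' : Eucl n × Eucl n}
    (hp : p ∈ Metric.ball (0 : Eucl n × Eucl n) D.ρ)
    (hp' : p' ∈ Metric.ball (0 : Eucl n × Eucl n) D.ρ) (t : IT n K) :
    ‖(D.V p).1 t - (D.V p').1 t - (p.1 - p'.1)‖ ≤ 1 / 8 * ‖p - p'‖ ∧
    ‖(D.V p).2 t - (D.V p').2 t - (p.2 - p'.2)‖ ≤ 1 / 8 * ‖p - p'‖ := by
  have h := D.lip p hp p' hp'
  set v : BE n K × BE n K := D.V p - D.V p' - constPair (p - p') with hv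
  exact ⟨(v.1.norm_coe_le_norm t).trans ((norm_fst_le v).trans h),
    (v.2.norm_coe_le_norm t).trans ((norm_snd_le v).trans h)⟩

/-- The passage from data to parameter and displacement, and from parameter to momentum, are each
within 1/8 of the identity in Lipschitz norm; together they lose less than half. The constant does
not depend on the index or the time, so the bound survives the limit. -/
theorem norm_out_sub_ge {p p' : Eucl n × Eucl n}
    (hp : p ∈ Metric.ball (0 : Eucl n × Eucl n) D.ρ)
    (hp' : p' ∈ Metric.ball (0 : Eucl n × Eucl n) D.ρ) (t : IT n K) :
    1 / 2 * ‖p - p'‖ ≤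
      ‖((D.out p).1 t - (D.out p').1 t, (D.out p).2 t - (D.out p').2 t)‖ := by
  obtain ⟨h1, h2⟩ := D.norm_V_sub_apply_le hp hp' t
  have h3 := F.lip_H_apply (F.along_mem' (D.mem_snd hp) t) (F.along_mem' (D.mem_snd hp') t) t
  rw [← D.out_snd hp, ← D.out_snd hp'] at h3
  have h4 : ‖p.2 - p'.2‖ ≤ ‖p - p'‖ := norm_snd_le (p - p')
  set Δ := ‖p - p'‖ with hΔ
  set z := (D.out p).1 t - (D.out p').1 t with hz
  set x := (D.out p).2 t - (D.out p').2 t with hx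
  set θ := (D.V p).2 t - (D.V p').2 t with hθ
  change ‖z - (p.1 - p'.1)‖ ≤ 1 / 8 * Δ at h1
  have h5 : ‖θ‖ ≤ 9 / 8 * Δ := by
    have := norm_add_le (θ - (p.2 - p'.2)) (p.2 - p'.2)
    rw [sub_add_cancel] at this
    linarith
  have h6 : ‖p.1 - p'.1‖ ≤ ‖(z, x)‖ + 1 / 8 * Δ := by
    have a1 := norm_sub_le z (z - (p.1 - p'.1))
    rw [sub_sub_cancel] at a1
    have a2 : ‖z‖ ≤ ‖(z, x)‖ := norm_fst_le (z, x)
    linarith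
  have h7 : ‖p.2 - p'.2‖ ≤ ‖(z, x)‖ + 1 / 2 * Δ := by
    have a1 : p.2 - p'.2 = x - (x - θ) - (θ - (p.2 - p'.2)) := by abel
    have a2 := norm_sub_le (x - (x - θ)) (θ - (p.2 - p'.2))
    have a3 := norm_sub_le x (x - θ)
    have a4 : ‖x‖ ≤ ‖(z, x)‖ := norm_snd_le (z, x)
    rw [← a1] at a2
    have a5 := norm_nonneg (p - p')
    linarith
  have h8 : Δ ≤ ‖(z, x)‖ + 1 / 2 * Δ := by
    have : Δ = max ‖p.1 - p'.1‖ ‖p.2 - p'.2‖ := rfl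
    rw [this] at h6 h7 ⊢
    refine max_le (h6.trans ?_) h7
    have := norm_nonneg (p.1 - p'.1)
    have := le_max_left ‖p.1 - p'.1‖ ‖p.2 - p'.2‖
    linarith
  linarith

/-- The change of momentum splits into the drift of the parameter at a fixed time and the evolution
of one fixed reference trajectory; both have integrable tails. -/
theorem exists_cauchy : ∃ C : ℝ, ∀ p ∈ Metric.ball (0 : Eucl n × Eucl n) D.ρ,
    ∀ (i : Idx n K) (s s' : ℝ), i.σ ≤ s' → s' ≤ s → s ≤ -i.L →
    ‖(D.out p).1 (i, s') - (D.out p).1 (i, s)‖ ≤ C * (1 - s) ^ (-S.μ) ∧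
    ‖(D.out p).2 (i, s') - (D.out p).2 (i, s)‖ ≤ C * (1 - s) ^ (-S.μ) := by
  refine ⟨max D.C (9 / 8 * D.C + F.C'), fun p hp i s s' h1 h2 h3 => ?_⟩
  have hs0 : s ≤ 0 := h3.trans (by linarith [i.one_le_L])
  have hpow : 0 ≤ (1 - s) ^ (-S.μ) := Real.rpow_nonneg (by linarith) _
  obtain ⟨a1, a2⟩ := D.cauchy p hp i s s' h1 h2 h3
  refine ⟨a1.trans (by gcongr; exact le_max_left _ _), ?_⟩
  rw [D.out_snd hp, D.out_snd hp]
  set θ := (D.V p).2 (i, s)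
  set θ' := (D.V p).2 (i, s')
  have hθ : θ ∈ Metric.ball (0 : Eucl n) (2 * F.r) := F.along_mem' (D.mem_snd hp) _
  have hθ' : θ' ∈ Metric.ball (0 : Eucl n) (2 * F.r) := F.along_mem' (D.mem_snd hp) _
  have b1 := F.lip_H_apply hθ' hθ (i, s')
  have b2 := F.cauchy_H θ hθ i s s' h1 h2 hs0
  have b3 : ‖F.H θ' (i, s') - F.H θ (i, s')‖ ≤ 9 / 8 * ‖θ' - θ‖ := by
    have := norm_add_le (F.H θ' (i, s') - F.H θ (i, s') - (θ' - θ)) (θ' - θ)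
    rw [sub_add_cancel] at this
    linarith
  have b4 := norm_add_le (F.H θ' (i, s') - F.H θ (i, s')) (F.H θ (i, s') - F.H θ (i, s))
  rw [sub_add_sub_cancel] at b4
  calc _ ≤ 9 / 8 * (D.C * (1 - s) ^ (-S.μ)) + F.C' * (1 - s) ^ (-S.μ) := by linarith
    _ = (9 / 8 * D.C + F.C') * (1 - s) ^ (-S.μ) := by ring
    _ ≤ _ := by gcongr; exact le_max_right _ _

/-- The trajectory with given relative data, in unscaled form. -/
theorem flow_place {i : Idx n K} (hi : F.R₀ ≤ i.R) (hiL : D.L₀ ≤ i.L) {m κ : ℝ} (hm : 0 < m)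
    (hκ : κ = m ^ 2 * i.κ) {p : Eucl n × Eucl n} (hp : p ∈ Metric.ball (0 : Eucl n × Eucl n) D.ρ)
    {q : Eucl n × Eucl n}
    (hq : S.φ κ (m⁻¹ * (i.R * -i.L)) q =
      S.place i.R (m⁻¹ * (i.R * -i.L)) m (i.R * i.L) i.dir (κ, p)) {s : ℝ}
    (hs : s ∈ Icc i.σ (-i.L)) :
    S.φ κ (m⁻¹ * (i.R * s)) q =
      ((S.φ κ (m⁻¹ * (i.R * s)) (incoming i.R (m • (i.dir + (D.V p).2 (i, s))),
          m • (i.dir + (D.V p).2 (i, s)))).1 + (i.R * i.L) • (D.out p).1 (i, s),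
        m • (D.out p).2 (i, s)) ∧
    S.mom i.R κ (m⁻¹ * (i.R * s)) (m • (i.dir + (D.V p).2 (i, s))) = m • (D.out p).2 (i, s) := by
  have hL := i.one_le_L
  have href : ∀ s ∈ Icc i.σ 0, ∀ ϑ ∈ Metric.ball (0 : Eucl n) (2 * F.r),
      S.φ κ (m⁻¹ * (i.R * s)) (incoming i.R (m • (i.dir + ϑ)), m • (i.dir + ϑ)) =
        ((i.R * (1 - s)) • F.Y ϑ (i, s), m • F.H ϑ (i, s)) := fun s hs ϑ hϑ => by
    rw [incoming_smul hm, hκ, S.φ_scale hm.ne', F.flow_eq i hi s hs ϑ hϑ]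
  have hp2 : p.2 ∈ Metric.ball (0 : Eucl n) (2 * F.r) := by
    rw [mem_ball_zero_iff] at hp ⊢
    have := D.ρ_le
    have := F.r_pos
    linarith [norm_snd_le p]
  have hθ : (D.V p).2 (i, s) ∈ Metric.ball (0 : Eucl n) (2 * F.r) := F.along_mem' (D.mem_snd hp) _
  have h1 := href (-i.L) ⟨i.σ_le, by linarith⟩ p.2 hp2
  have h2 := href s ⟨hs.1, by linarith [hs.2]⟩ _ hθ
  rw [LRSys.mom, h2, D.out_snd hp]
  refine ⟨?_, rfl⟩
  simp only [LRSys.place, h1] at hq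
  rw [Prod.mk_add_mk, add_zero, sub_neg_eq_add] at hq
  have e : m⁻¹ * (i.R * s) = m⁻¹ * (i.R * -i.L) + m⁻¹ * (i.R * (s + i.L)) := by ring
  rw [e, S.φ_add, hq, hκ, S.φ_scale hm.ne', D.flow_eq p hp i hi hiL s hs]
  rfl

end DeepFam

end LongRangeFlow

end

/-! ### Far back, nontrapped geodesics have small relative data. -/

noncomputable section

namespace LongRangeFlow

open BoundedContinuousFunction

variable {n : ℕ} {K : ℝ} {a : Eucl n → Matrix (Fin n) (Fin n) ℝ} {V : Eucl n → ℝ} {μ : ℝ}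

/-- Sufficiently far back, a nontrapped geodesic is close to the reference geodesic with the same
momentum. -/
theorem BackwardNontrapping.exists_depth (h : IsLongRange a V μ) {F : RefFam (sysOf h) K}
    (D : DeepFam F) (hK : 1 ≤ K) {R : ℝ} (hR : F.R₀ ≤ R) {q : Eucl n × Eucl n}
    (hq : BackwardNontrapping a q) :
    ∃ (m L : ℝ) (dir : Eucl n), 0 < m ∧ 1 ≤ L ∧ D.L₀ ≤ L ∧ ‖dir‖ = 1 ∧
      (sysOf h).mom R 0 (m⁻¹ * (R * -L)) (m • dir) = ((sysOf h).φ 0 (m⁻¹ * (R * -L)) q).2 ∧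
      (∃ e : Eucl n ≃L[ℝ] Eucl n, HasStrictFDerivAt ((sysOf h).mom R 0 (m⁻¹ * (R * -L)))
        (e : Eucl n →L[ℝ] Eucl n) (m • dir)) ∧
      ‖(R * L)⁻¹ • (((sysOf h).φ 0 (m⁻¹ * (R * -L)) q).1 -
        ((sysOf h).φ 0 (m⁻¹ * (R * -L)) (incoming R (m • dir), m • dir)).1)‖ < D.ρ := by
  obtain ⟨e₀, e₁, he₀, hη, has⟩ := hq.asymptotics h
  have hR1 : 1 ≤ R := F.one_le_R₀.trans hR
  have hR0 : 0 < R := by linarith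
  have hρ := D.ρ_pos
  have hCev : ∀ᶠ L : ℝ in atTop, 2 * |F.C| * (1 + L) ^ (-(sysOf h).μ) ≤ D.ρ / 3 := by
    have h1 := ((tendsto_rpow_neg_atTop (sysOf h).μ_pos).comp
      (tendsto_atTop_add_const_left atTop (1 : ℝ) tendsto_id)).const_mul (2 * |F.C|)
    rw [mul_zero] at h1
    exact h1.eventually_le_const (by positivity)
  obtain ⟨L₁, hL₁⟩ := eventually_atTop.1 hCev
  -- The reference momentum will satisfy `3 / 4 * e₀ ≤ m`, since it is within a quarter of the
  -- geodesic's momentum; so this forces the depth `L = m * -τ / R` above all thresholds.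
  have hτev : ∀ᶠ τ : ℝ in atBot, max 1 (max D.L₀ L₁) ≤ 3 / 4 * e₀ / R * -τ :=
    (tendsto_neg_atBot_atTop.const_mul_atTop
      (show (0 : ℝ) < 3 / 4 * e₀ / R by positivity)).eventually_ge_atTop _
  obtain ⟨τ, h1, h2, h3⟩ := (hτev.and ((has (e₀ * D.ρ / 4) (by positivity)).and
    (eventually_lt_atBot 0))).exists
  set η := ((sysOf h).φ 0 τ q).2 with hηdef
  have hη0 : 0 < ‖η‖ := lt_of_lt_of_le he₀ (hη τ).1
  obtain ⟨ζ, hζ, hmom, hclose⟩ := F.exists_mom_eq hR le_rfl h3.le (t := τ)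
    (by rw [zero_mul, zero_add]; exact hK) (norm_pos_iff.1 hη0) (ξ := η)
    (by rw [zero_mul, mul_zero]; positivity)
  set m := ‖ζ‖ with hm
  have hm0 : 0 < m := norm_pos_iff.2 hζ.1
  have hme : 3 / 4 * e₀ ≤ m := by
    have := norm_le_norm_add_norm_sub' η ζ
    rw [norm_sub_rev] at this
    linarith [(hη τ).1]
  set L := m * -τ / R with hL
  have hLbig : max 1 (max D.L₀ L₁) ≤ L := h1.trans (by
    rw [hL, div_mul_eq_mul_div]
    have : 0 ≤ -τ := by linarith
    gcongr)
  have hL1 : 1 ≤ L := (le_max_left _ _).trans hLbig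
  have hL2 : D.L₀ ≤ L := ((le_max_left _ _).trans (le_max_right _ _)).trans hLbig
  have hL3 : L₁ ≤ L := ((le_max_right _ _).trans (le_max_right _ _)).trans hLbig
  have hτ : m⁻¹ * (R * -L) = τ := by rw [hL]; field_simp
  have hdir : ‖m⁻¹ • ζ‖ = 1 := by
    rw [norm_smul, norm_inv, Real.norm_eq_abs, abs_of_pos hm0, inv_mul_cancel₀ hm0.ne']
  have hmd : m • m⁻¹ • ζ = ζ := smul_inv_smul₀ hm0.ne' ζ
  refine ⟨m, L, m⁻¹ • ζ, hm0, hL1, hL2, hdir, ?_, ?_, ?_⟩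
  · rw [hτ, hmd, hmom]
  · rw [hτ, hmd]
    exact F.hasStrictFDerivAt_mom hR le_rfl hζ h3.le (by rw [zero_mul, zero_add]; exact hK)
  · set i : Idx n K :=
      { R := R, κ := 0, σ := -L, L := L, dir := m⁻¹ • ζ, one_le_R := hR1, κ_nonneg := le_rfl
        κR := by rw [zero_mul]; exact zero_le_one
        κRσ := by rw [zero_mul, zero_mul]; linarith
        one_le_L := hL1, σ_le := le_rfl, norm_dir := hdir } with hi
    have hs : -L ∈ Icc i.σ 0 := ⟨le_rfl, by linarith⟩
    have hf := F.flow_eq i hR (-L) hs 0 (Metric.mem_ball_self (by linarith [F.r_pos]))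
    rw [add_zero, sub_neg_eq_add] at hf
    have hsc := (sysOf h).φ_scale hm0.ne' 0 (R * -L) (incoming R (m⁻¹ • ζ)) (m⁻¹ • ζ)
    rw [mul_zero] at hsc
    have hf' : (sysOf h).φ 0 (R * -L) (incoming R (m⁻¹ • ζ), m⁻¹ • ζ) =
      ((R * (1 + L)) • F.Y 0 (i, -L), F.H 0 (i, -L)) := hf
    rw [hf', ← incoming_smul hm0 (m⁻¹ • ζ), hmd, hτ] at hsc
    rw [hmd, hτ]
    have hη' : m • F.H 0 (i, -L) = η := by
      rw [← hmom, LRSys.mom, hsc]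
    have hw : wt (i, -L) = 1 + L := by rw [wt_eq hs, sub_neg_eq_add]
    have hdec := F.decay (i, -L)
    rw [hw, BoundedContinuousFunction.sub_apply, bcfMul_apply, cw_apply, hw, cl_eq hs] at hdec
    have hL0 : 0 < 1 + L := by linarith
    have e1 : ((sysOf h).φ 0 τ (incoming R ζ, ζ)).1 - τ • η =
        (R * (1 + L)) • (F.Y 0 (i, -L) - (-L / (1 + L)) • F.H 0 (i, -L)) := by
      rw [hsc, ← hη', smul_sub, smul_smul, smul_smul, ← hτ]
      congr 2
      field_simp
    have hpow : 0 ≤ (1 + L) ^ (-(sysOf h).μ) := Real.rpow_nonneg hL0.le _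
    have e2 : ‖((sysOf h).φ 0 τ (incoming R ζ, ζ)).1 - τ • η‖ ≤
        R * L * (2 * |F.C| * (1 + L) ^ (-(sysOf h).μ)) := by
      rw [e1, norm_smul, Real.norm_eq_abs, abs_of_pos (by positivity)]
      calc _ ≤ R * (1 + L) * (F.C * (1 + L) ^ (-(sysOf h).μ)) := by gcongr
        _ ≤ R * (1 + L) * (|F.C| * (1 + L) ^ (-(sysOf h).μ)) := by
          gcongr; exact le_abs_self _
        _ ≤ R * (2 * L) * (|F.C| * (1 + L) ^ (-(sysOf h).μ)) := by
          gcongr 2; linarith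
        _ = _ := by ring
    -- The two positions are compared through the common point `τ • η`: the geodesic is sublinearly
    -- close to it by `BackwardNontrapping.asymptotics`, the reference trajectory by `RefFam.decay`.
    -- Each error costs at most a third of `D.ρ` after division by `R * L`.
    have e3 : ‖((sysOf h).φ 0 τ q).1 - ((sysOf h).φ 0 τ (incoming R ζ, ζ)).1‖ ≤
        e₀ * D.ρ / 4 * |τ| + R * L * (D.ρ / 3) := by
      have b1 := norm_sub_le (((sysOf h).φ 0 τ q).1 - τ • η)
        (((sysOf h).φ 0 τ (incoming R ζ, ζ)).1 - τ • η)
      rw [sub_sub_sub_cancel_right] at b1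
      have b2 : R * L * (2 * |F.C| * (1 + L) ^ (-(sysOf h).μ)) ≤ R * L * (D.ρ / 3) := by
        gcongr; exact hL₁ L hL3
      linarith
    have hRL : 0 < R * L := by positivity
    rw [norm_smul, norm_inv, Real.norm_eq_abs, abs_of_pos hRL, inv_mul_lt_iff₀ hRL]
    refine lt_of_le_of_lt e3 ?_
    have hRLτ : R * L = m * |τ| := by rw [hL, abs_of_neg h3]; field_simp
    have e4 : e₀ * D.ρ / 4 * |τ| ≤ R * L * (D.ρ / 3) := by
      rw [hRLτ]
      have : 3 / 4 * e₀ * (D.ρ / 3 * |τ|) ≤ m * (D.ρ / 3 * |τ|) := by gcongr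
      linarith
    nlinarith [mul_pos hRL hρ]

end LongRangeFlow

end

/-! ### Derivative bounds with a parameter, interchange of limits, and local diffeomorphisms. -/

noncomputable section

namespace LongRangeFlow

section PartialDerivatives

variable {E : Type} [NormedAddCommGroup E] [NormedSpace ℝ E]

/-- The derivatives in the second variable of a smooth function are bounded on compact sets. -/
theorem exists_bound_partial_iteratedFDeriv {N Q : Set (ℝ × E)} (hN : IsOpen N) (hQ : IsCompact Q)
    (hQN : Q ⊆ N) (m : ℕ) :
    ∀ {B : Type} [NormedAddCommGroup B] [NormedSpace ℝ B] {g : ℝ × E → B}, ContDiffOn ℝ ∞ g N →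
      ∃ C, ∀ w ∈ Q, ‖iteratedFDeriv ℝ m (fun q => g (w.1, q)) w.2‖ ≤ C := by
  induction m with
  | zero =>
    intro B _ _ g hg
    obtain ⟨C, hC⟩ := hQ.exists_bound_of_continuousOn (hg.continuousOn.mono hQN)
    exact ⟨C, fun w hw => by rw [norm_iteratedFDeriv_zero]; exact hC w hw⟩
  | succ m ih =>
    intro B _ _ g hg
    obtain ⟨C, hC⟩ := ih (B := E →L[ℝ] B)
      (g := fun w => (fderiv ℝ g w).comp (ContinuousLinearMap.inr ℝ ℝ E))
      ((hg.fderiv_of_isOpen (m := ∞) hN (by simp)).clm_comp contDiffOn_const)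
    refine ⟨C, fun w hw => ?_⟩
    rw [← norm_iteratedFDeriv_fderiv]
    have he : fderiv ℝ (fun q => g (w.1, q)) =ᶠ[𝓝 w.2]
        fun q => (fderiv ℝ g (w.1, q)).comp (ContinuousLinearMap.inr ℝ ℝ E) := by
      have hc : Tendsto (fun q : E => (w.1, q)) (𝓝 w.2) (𝓝 w) :=
        (Continuous.prodMk_right w.1).tendsto w.2
      filter_upwards [hc.eventually_mem (hN.mem_nhds (hQN hw))] with q hq
      exact (HasFDerivAt.comp q (f := fun q => (w.1, q))
        ((hg.contDiffAt (hN.mem_nhds hq)).differentiableAt (by simp)).hasFDerivAt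
        (hasFDerivAt_prodMk_right w.1 q)).fderiv
    rw [(he.iteratedFDeriv ℝ m).eq_of_nhds]
    exact hC w hw

end PartialDerivatives

/-- Interchange of limits. -/
theorem exists_limit_of_interchange {E : Type} [NormedAddCommGroup E] [CompleteSpace E]
    {f : ℝ → E} {g : ℝ → ℝ → E} {g₀ : ℝ → E} {b : ℝ → ℝ} (hb : Tendsto b atBot (𝓝 0))
    (hfg : ∀ᶠ s in atBot, ∀ᶠ i in atTop, ‖f i - g s i‖ ≤ b s)
    (hg : ∀ᶠ s in atBot, Tendsto (g s) atTop (𝓝 (g₀ s))) :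
    ∃ l, Tendsto f atTop (𝓝 l) ∧ Tendsto g₀ atBot (𝓝 l) := by
  have hc : Cauchy (map f atTop) := by
    rw [Metric.cauchy_iff]
    refine ⟨inferInstance, fun ε hε => ?_⟩
    obtain ⟨s, h1, h2, h3⟩ := (hfg.and (hg.and (hb.eventually_lt_const
      (show (0 : ℝ) < ε / 4 by positivity)))).exists
    have h4 := h2.eventually_mem (Metric.ball_mem_nhds (g₀ s) (show 0 < ε / 4 by positivity))
    refine ⟨f '' {i | ‖f i - g s i‖ ≤ b s ∧ g s i ∈ Metric.ball (g₀ s) (ε / 4)},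
      image_mem_map (h1.and h4), ?_⟩
    rintro _ ⟨i, ⟨a1, a2⟩, rfl⟩ _ ⟨j, ⟨b1, b2⟩, rfl⟩
    rw [mem_ball_iff_norm] at a2 b2
    rw [dist_eq_norm]
    have e : f i - f j = (f i - g s i) + (g s i - g₀ s) - (g s j - g₀ s) - (f j - g s j) := by abel
    rw [e]
    have n1 := norm_sub_le ((f i - g s i) + (g s i - g₀ s) - (g s j - g₀ s)) (f j - g s j)
    have n2 := norm_sub_le ((f i - g s i) + (g s i - g₀ s)) (g s j - g₀ s)
    have n3 := norm_add_le (f i - g s i) (g s i - g₀ s)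
    linarith
  obtain ⟨l, hl⟩ := cauchy_map_iff_exists_tendsto.1 hc
  refine ⟨l, hl, ?_⟩
  rw [tendsto_iff_norm_sub_tendsto_zero]
  refine squeeze_zero' (Eventually.of_forall fun _ => norm_nonneg _) ?_ hb
  filter_upwards [hfg, hg] with s h1 h2
  rw [norm_sub_rev]
  exact le_of_tendsto (hl.sub h2).norm h1

section LocalDiffeo

variable {E : Type} [NormedAddCommGroup E] [NormedSpace ℝ E]

theorem norm_fderiv_ge_of_lower_bound {f : E → E} {D : E →L[ℝ] E} {x : E}
    (hf : HasFDerivAt f D x) {U : Set E} (hU : U ∈ 𝓝 x) {k : ℝ}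
    (h : ∀ y ∈ U, k * ‖y - x‖ ≤ ‖f y - f x‖) (v : E) : k * ‖v‖ ≤ ‖D v‖ := by
  have hd : HasDerivAt (fun t : ℝ => x + t • v) v 0 := by
    simpa using ((hasDerivAt_id (0 : ℝ)).smul_const v).const_add x
  have h0 : x + (0 : ℝ) • v = x := by simp
  have h1 : HasDerivAt (fun t : ℝ => f (x + t • v)) (D v) 0 :=
    HasFDerivAt.comp_hasDerivAt (f := fun t : ℝ => x + t • v) 0 (by rw [h0]; exact hf) hd
  have h2 := (hasDerivAt_iff_tendsto_slope.1 h1).norm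
  have h3 : Tendsto (fun t : ℝ => x + t • v) (𝓝[≠] 0) (𝓝 x) := by
    have := hd.continuousAt.tendsto
    rw [h0] at this
    exact this.mono_left nhdsWithin_le_nhds
  refine ge_of_tendsto h2 ?_
  filter_upwards [h3.eventually_mem hU, self_mem_nhdsWithin] with t ht ht0
  have ht0' : t ≠ 0 := ht0
  have h4 := h _ ht
  rw [add_sub_cancel_left, norm_smul, Real.norm_eq_abs] at h4
  have htp : 0 < |t| := abs_pos.2 ht0'
  rw [slope_def_module, norm_smul, norm_inv, sub_zero, Real.norm_eq_abs, h0,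
    le_inv_mul_iff₀ htp]
  linarith

variable [FiniteDimensional ℝ E]

theorem exists_equiv_of_lower_bound {D : E →L[ℝ] E} {k : ℝ} (hk : 0 < k)
    (h : ∀ v, k * ‖v‖ ≤ ‖D v‖) : ∃ e : E ≃L[ℝ] E, (e : E →L[ℝ] E) = D := by
  have hinj : Function.Injective (D : E →ₗ[ℝ] E) := by
    rw [injective_iff_map_eq_zero]
    intro v hv
    have hv' : D v = 0 := hv
    have h1 := h v
    rw [hv', norm_zero] at h1
    have : ‖v‖ ≤ 0 := by
      by_contra hc
      push Not at hc
      linarith [mul_pos hk hc]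
    exact norm_le_zero_iff.1 this
  exact ⟨(LinearEquiv.ofInjectiveEndo (D : E →ₗ[ℝ] E) hinj).toContinuousLinearEquiv,
    by ext v; rfl⟩

/-- A smooth map that does not contract distances by more than a constant factor is a local
diffeomorphism. -/
theorem isLocalDiffeomorphOn_of_lower_bound {f : E → E} {U : Set E} (hU : IsOpen U)
    (hf : ContDiffOn ℝ ∞ f U) {k : ℝ} (hk : 0 < k)
    (h : ∀ x ∈ U, ∀ y ∈ U, k * ‖x - y‖ ≤ ‖f x - f y‖) :
    IsLocalDiffeomorphOn 𝓘(ℝ, E) 𝓘(ℝ, E) ∞ f U := by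
  -- The lower Lipschitz bound passes to difference quotients, so the derivative is injective, hence
  -- invertible in finite dimension.
  have hder : ∀ x ∈ U, ∃ e : E ≃L[ℝ] E, HasFDerivAt f (e : E →L[ℝ] E) x := fun x hx => by
    have h1 := ((hf.contDiffAt (hU.mem_nhds hx)).differentiableAt (by simp)).hasFDerivAt
    obtain ⟨e, he⟩ := exists_equiv_of_lower_bound hk
      (norm_fderiv_ge_of_lower_bound h1 (hU.mem_nhds hx) fun y hy => h y hy x hx)
    exact ⟨e, he ▸ h1⟩
  rintro ⟨x, hx⟩
  obtain ⟨e, he⟩ := hder x hx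
  have hfx := hf.contDiffAt (hU.mem_nhds hx)
  set Φ := (hfx.toOpenPartialHomeomorph f he (by simp)).restrOpen U hU with hΦ
  have hsrc : Φ.source ⊆ U := inter_subset_right
  refine ⟨{ toPartialEquiv := Φ.toPartialEquiv
            open_source := Φ.open_source
            open_target := Φ.open_target
            contMDiffOn_toFun := ?_
            contMDiffOn_invFun := ?_ }, ?_, fun _ _ => rfl⟩
  · exact contMDiffOn_iff_contDiffOn.2 (hf.mono hsrc)
  · refine contMDiffOn_iff_contDiffOn.2 fun y hy => ContDiffAt.contDiffWithinAt ?_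
    have hy' : Φ.symm y ∈ U := hsrc (Φ.map_target hy)
    obtain ⟨e', he'⟩ := hder _ hy'
    exact Φ.contDiffAt_symm hy he' (hf.contDiffAt (hU.mem_nhds hy'))
  · exact ⟨hfx.mem_toOpenPartialHomeomorph_source he (by simp), hx⟩

end LocalDiffeo

end LongRangeFlow

end

/-! ### Relative data on a neighborhood of a nontrapped point. -/

noncomputable section

namespace LongRangeFlow

open BoundedContinuousFunction

variable {n : ℕ} {K : ℝ} {S : LRSys n}

/-- A neighborhood of a nontrapped point, for small coupling constants, with the data of its points
relative to the reference family. -/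
structure Chart {F : RefFam S K} (D : DeepFam F) (R : ℝ) (q₀ : Eucl n × Eucl n) where
  m : ℝ
  L : ℝ
  dir : Eucl n
  r : ℝ
  P : ℝ × (Eucl n × Eucl n) → Eucl n × Eucl n
  k : ℝ
  m_pos : 0 < m
  one_le_L : 1 ≤ L
  L₀_le : D.L₀ ≤ L
  norm_dir : ‖dir‖ = 1
  r_pos : 0 < r
  k_pos : 0 < k
  smooth : ContDiffOn ℝ ∞ P (Metric.ball (0, q₀) r)
  mem : ∀ w ∈ Metric.ball ((0 : ℝ), q₀) r, P w ∈ Metric.ball (0 : Eucl n × Eucl n) D.ρ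
  place : ∀ w ∈ Metric.ball ((0 : ℝ), q₀) r, S.φ w.1 (m⁻¹ * (R * -L)) w.2 =
    S.place R (m⁻¹ * (R * -L)) m (R * L) dir (w.1, P w)
  lower : ∀ κ q q', (κ, q) ∈ Metric.ball ((0 : ℝ), q₀) r → (κ, q') ∈ Metric.ball ((0 : ℝ), q₀) r →
    k * ‖q - q'‖ ≤ ‖P (κ, q) - P (κ, q')‖

theorem BackwardNontrapping.exists_chart {a : Eucl n → Matrix (Fin n) (Fin n) ℝ} {V : Eucl n → ℝ}
    {μ : ℝ} (h : IsLongRange a V μ) {F : RefFam (sysOf h) K}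
    (D : DeepFam F) (hK : 1 ≤ K) {R : ℝ} (hR : F.R₀ ≤ R) {q₀ : Eucl n × Eucl n}
    (hq : BackwardNontrapping a q₀) : Nonempty (Chart D R q₀) := by
  obtain ⟨m, L, dir, hm, hL1, hL₀, hdir, hmom, ⟨e, he⟩, hsmall⟩ := hq.exists_depth h D hK hR
  have hR0 : 0 < R := by linarith [F.one_le_R₀]
  have hne : m • dir ≠ 0 := by
    rw [smul_ne_zero_iff]
    refine ⟨hm.ne', fun h0 => ?_⟩
    rw [h0, norm_zero] at hdir
    norm_num at hdir
  have hc : R * L ≠ 0 := by positivity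
  obtain ⟨P, hPs, hP0, hPp⟩ := (sysOf h).exists_initialData hc hm.ne' hne hmom he
  have hPc := hPs.self_of_nhds
  obtain ⟨k, hk, N, hN, hlow⟩ := (sysOf h).exists_lower_bound hPc (by rw [hP0]) hne hPp
  have hmem : P (0, q₀) ∈ Metric.ball (0 : Eucl n × Eucl n) D.ρ := by
    rw [hP0, mem_ball_zero_iff, Prod.norm_mk, norm_zero]
    exact max_lt hsmall D.ρ_pos
  have hev := hPc.continuousAt.eventually_mem (Metric.isOpen_ball.mem_nhds hmem)
  obtain ⟨r, hr, hball⟩ := Metric.eventually_nhds_iff_ball.1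
    (hPs.and (hev.and (hPp.and (eventually_mem_set.2 hN))))
  exact ⟨{
    m := m, L := L, dir := dir, r := r, P := P, k := k, m_pos := hm, one_le_L := hL1
    L₀_le := hL₀, norm_dir := hdir, r_pos := hr, k_pos := hk
    smooth := fun w hw => (hball w hw).1.contDiffWithinAt
    mem := fun w hw => (hball w hw).2.1
    place := fun w hw => (hball w hw).2.2.1
    lower := fun κ q q' h1 h2 => hlow κ q q' (hball _ h1).2.2.2 (hball _ h2).2.2.2 }⟩

end LongRangeFlow

end

/-! ### Estimates in a chart, uniform in coupling and time. -/

noncomputable section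

namespace LongRangeFlow

open BoundedContinuousFunction

variable {n : ℕ} {K : ℝ} {S : LRSys n}

/-- The initial momentum of the reference trajectory with momentum `η` at time `t`. -/
def LRSys.zeta (S : LRSys n) (R κ t : ℝ) (η : Eucl n) : Eucl n :=
  Function.invFunOn (S.mom R κ t) (admissible κ R) η

/-- The position relative to the reference trajectory with the same momentum. -/
def LRSys.rel (S : LRSys n) (R κ t : ℝ) (q : Eucl n × Eucl n) : Eucl n :=
  (S.φ κ t q).1 - (S.φ κ t (incoming R (S.zeta R κ t (S.φ κ t q).2),
    S.zeta R κ t (S.φ κ t q).2)).1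

namespace Chart

variable {F : RefFam S K} {D : DeepFam F} {R : ℝ} {q₀ : Eucl n × Eucl n} (c : Chart D R q₀)

/-- The couplings and scaled times at which the chart is used. -/
structure Valid (κ σ : ℝ) : Prop where
  nonneg : 0 ≤ κ
  -- The factor 4 leaves room for momenta of norm at least 7/8 of `c.m` to be admissible.
  le_sq : 4 * (κ * R ^ 2) ≤ c.m ^ 2
  le_time : κ * R ^ 2 * σ ^ 2 ≤ (K - 1) * c.m ^ 2
  le_depth : σ ≤ -c.L

variable {c}

theorem Valid.mono {κ σ s : ℝ} (hv : c.Valid κ σ) (h1 : σ ≤ s) (h2 : s ≤ -c.L) : c.Valid κ s where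
  nonneg := hv.nonneg
  le_sq := hv.le_sq
  le_time := by
    refine le_trans ?_ hv.le_time
    have := hv.nonneg
    have h3 : s ^ 2 ≤ σ ^ 2 := by nlinarith [c.one_le_L]
    gcongr
  le_depth := h2

/-- The index of a coupling and a scaled time. -/
def idx (hR : 1 ≤ R) {κ σ : ℝ} (hv : c.Valid κ σ) : Idx n K where
  R := R
  κ := κ / c.m ^ 2
  σ := σ
  L := c.L
  dir := c.dir
  one_le_R := hR
  κ_nonneg := div_nonneg hv.nonneg (sq_nonneg _)
  κR := by
    have hm := c.m_pos
    rw [div_mul_eq_mul_div, div_le_one (by positivity)]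
    have := hv.le_sq
    have h0 : 0 ≤ κ * R ^ 2 := mul_nonneg hv.nonneg (sq_nonneg _)
    linarith
  κRσ := by
    have hm := c.m_pos
    rw [div_mul_eq_mul_div, div_mul_eq_mul_div, div_le_iff₀ (by positivity)]
    have := hv.le_time
    nlinarith [sq_nonneg c.m]
  one_le_L := c.one_le_L
  σ_le := hv.le_depth
  norm_dir := c.norm_dir

theorem Valid.time_le {κ s : ℝ} (hv : c.Valid κ s) : κ * (c.m⁻¹ * (R * s)) ^ 2 + 1 ≤ K := by
  have hm := c.m_pos
  have h1 := hv.le_time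
  have h2 : κ * (c.m⁻¹ * (R * s)) ^ 2 = κ * R ^ 2 * s ^ 2 / c.m ^ 2 := by
    field_simp
  rw [h2]
  have h3 : κ * R ^ 2 * s ^ 2 / c.m ^ 2 ≤ K - 1 := by
    rw [div_le_iff₀ (by positivity)]; exact h1
  linarith

theorem Valid.dir_mem {κ s : ℝ} (hv : c.Valid κ s) : c.m • c.dir ∈ admissible κ R := by
  have hm := c.m_pos
  have hn : ‖c.m • c.dir‖ = c.m := by
    rw [norm_smul, c.norm_dir, Real.norm_eq_abs, abs_of_pos hm, mul_one]
  refine ⟨norm_pos_iff.1 (by rw [hn]; exact hm), ?_⟩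
  rw [hn]
  have := hv.le_sq
  have h0 : 0 ≤ κ * R ^ 2 := mul_nonneg hv.nonneg (sq_nonneg _)
  linarith

theorem norm_ge_of_close {ζ : Eucl n} (h : ‖ζ - c.m • c.dir‖ < F.r * c.m) :
    7 / 8 * c.m ≤ ‖ζ‖ := by
  have hm := c.m_pos
  have hn : ‖c.m • c.dir‖ = c.m := by
    rw [norm_smul, c.norm_dir, Real.norm_eq_abs, abs_of_pos hm, mul_one]
  have h1 := norm_le_norm_add_norm_sub' (c.m • c.dir) ζ
  rw [norm_sub_rev] at h1
  have h2 : F.r * c.m ≤ 1 / 8 * c.m := by gcongr; exact F.r_le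
  linarith

theorem Valid.mem_of_close {κ s : ℝ} (hv : c.Valid κ s) {ζ : Eucl n}
    (h : ‖ζ - c.m • c.dir‖ < F.r * c.m) : ζ ∈ admissible κ R := by
  have hm := c.m_pos
  have h1 := norm_ge_of_close h
  have h0 : 0 ≤ κ * R ^ 2 := mul_nonneg hv.nonneg (sq_nonneg _)
  refine ⟨norm_pos_iff.1 (lt_of_lt_of_le (by positivity) h1), ?_⟩
  have := hv.le_sq
  nlinarith

theorem time_nonpos (hR : 1 ≤ R) {s : ℝ} (hs : s ≤ -c.L) : c.m⁻¹ * (R * s) ≤ 0 := by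
  have hm := c.m_pos
  have : s ≤ 0 := hs.trans (by linarith [c.one_le_L])
  exact mul_nonpos_of_nonneg_of_nonpos (by positivity)
    (mul_nonpos_of_nonneg_of_nonpos (by linarith) this)

/-- Injectivity of the momentum map identifies the chosen `S.zeta` with the drifting parameter of
the ansatz. The relative position is then exactly the displacement, a component of the smooth map
`D.out`. -/
theorem Valid.flow_eq (hR : F.R₀ ≤ R) {κ σ s : ℝ} (hv : c.Valid κ σ) (hσ : σ ≤ s) (hs : s ≤ -c.L)
    {q : Eucl n × Eucl n} (hq : (κ, q) ∈ Metric.ball ((0 : ℝ), q₀) c.r) :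
    (S.φ κ (c.m⁻¹ * (R * s)) q).2 =
      c.m • (D.out (c.P (κ, q))).2 (idx (F.one_le_R₀.trans hR) hv, s) ∧
    S.rel R κ (c.m⁻¹ * (R * s)) q =
      (R * c.L) • (D.out (c.P (κ, q))).1 (idx (F.one_le_R₀.trans hR) hv, s) ∧
    ‖S.zeta R κ (c.m⁻¹ * (R * s)) (S.φ κ (c.m⁻¹ * (R * s)) q).2 - c.m • c.dir‖ < F.r * c.m ∧
    S.mom R κ (c.m⁻¹ * (R * s)) (S.zeta R κ (c.m⁻¹ * (R * s)) (S.φ κ (c.m⁻¹ * (R * s)) q).2) =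
      (S.φ κ (c.m⁻¹ * (R * s)) q).2 := by
  have hm := c.m_pos
  have hR1 := F.one_le_R₀.trans hR
  set i := idx hR1 hv with hi
  have hp := c.mem _ hq
  obtain ⟨h1, h2⟩ := D.flow_place (i := i) hR c.L₀_le hm (κ := κ)
    (by show κ = c.m ^ 2 * (κ / c.m ^ 2); field_simp) hp (q := q) (c.place _ hq) (s := s) ⟨hσ, hs⟩
  change S.φ κ (c.m⁻¹ * (R * s)) q = _ at h1
  change S.mom R κ (c.m⁻¹ * (R * s)) (c.m • (c.dir + _)) = _ at h2
  set ζ := c.m • (c.dir + (D.V (c.P (κ, q))).2 (i, s)) with hζ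
  have hclose : ‖ζ - c.m • c.dir‖ < F.r * c.m := by
    rw [hζ, smul_add, add_sub_cancel_left, norm_smul, Real.norm_eq_abs, abs_of_pos hm, mul_comm]
    gcongr
    exact F.along_mem (D.mem_snd hp) (i, s)
  have hvs := hv.mono hσ hs
  have hη : (S.φ κ (c.m⁻¹ * (R * s)) q).2 =
      c.m • (D.out (c.P (κ, q))).2 (i, s) := by rw [h1]
  have hmom : S.mom R κ (c.m⁻¹ * (R * s)) ζ = (S.φ κ (c.m⁻¹ * (R * s)) q).2 := by rw [hη, h2]
  have hζm : ζ ∈ admissible κ R := hvs.mem_of_close hclose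
  have hz : S.zeta R κ (c.m⁻¹ * (R * s)) (S.φ κ (c.m⁻¹ * (R * s)) q).2 = ζ := by
    have hex : ∃ x ∈ admissible κ R, S.mom R κ (c.m⁻¹ * (R * s)) x =
      (S.φ κ (c.m⁻¹ * (R * s)) q).2 := ⟨ζ, hζm, hmom⟩
    exact F.mom_injOn hR hv.nonneg (time_nonpos hR1 hs) hvs.time_le
      (Function.invFunOn_mem hex) hζm ((Function.invFunOn_eq hex).trans hmom.symm)
  refine ⟨hη, ?_, by rw [hz]; exact hclose, by rw [hz]; exact hmom⟩
  rw [LRSys.rel, hz, h1]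
  show (S.φ κ (c.m⁻¹ * (R * s)) (incoming R ζ, ζ)).1 + (R * c.L) • (D.out (c.P (κ, q))).1 (i, s) -
    (S.φ κ (c.m⁻¹ * (R * s)) (incoming R ζ, ζ)).1 = _
  rw [add_sub_cancel_left]

variable (c)

/-- Uniform Cauchy estimates in time. -/
theorem exists_cauchy (hR : F.R₀ ≤ R) : ∃ C : ℝ, ∀ κ σ s, c.Valid κ σ → σ ≤ s → s ≤ -c.L →
    ∀ q, (κ, q) ∈ Metric.ball ((0 : ℝ), q₀) c.r →
    ‖(S.φ κ (c.m⁻¹ * (R * σ)) q).2 - (S.φ κ (c.m⁻¹ * (R * s)) q).2‖ ≤ C * (1 - s) ^ (-S.μ) ∧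
    ‖S.rel R κ (c.m⁻¹ * (R * σ)) q - S.rel R κ (c.m⁻¹ * (R * s)) q‖ ≤ C * (1 - s) ^ (-S.μ) := by
  obtain ⟨C, hC⟩ := D.exists_cauchy
  have hm := c.m_pos
  have hR1 := F.one_le_R₀.trans hR
  have hL := c.one_le_L
  refine ⟨max (c.m * C) (R * c.L * C), fun κ σ s hv hσ hs q hq => ?_⟩
  have hpow : 0 ≤ (1 - s) ^ (-S.μ) := Real.rpow_nonneg (by linarith) _
  obtain ⟨h1, h2, -⟩ := hv.flow_eq hR hσ hs hq
  obtain ⟨h3, h4, -⟩ := hv.flow_eq hR le_rfl hv.le_depth hq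
  obtain ⟨h5, h6⟩ := hC _ (c.mem _ hq) (idx hR1 hv) s σ le_rfl hσ hs
  rw [h1, h2, h3, h4, ← smul_sub, ← smul_sub, norm_smul, norm_smul, Real.norm_eq_abs,
    Real.norm_eq_abs, abs_of_pos hm, abs_of_pos (show 0 < R * c.L by positivity)]
  constructor
  · calc _ ≤ c.m * (C * (1 - s) ^ (-S.μ)) := by gcongr
      _ = c.m * C * (1 - s) ^ (-S.μ) := by ring
      _ ≤ _ := by gcongr; exact le_max_left _ _
  · calc _ ≤ R * c.L * (C * (1 - s) ^ (-S.μ)) := by gcongr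
      _ = R * c.L * C * (1 - s) ^ (-S.μ) := by ring
      _ ≤ _ := by gcongr; exact le_max_right _ _

/-- Uniform lower bounds. -/
theorem exists_lower (hR : F.R₀ ≤ R) : ∃ k : ℝ, 0 < k ∧ ∀ κ σ, c.Valid κ σ →
    ∀ q q', (κ, q) ∈ Metric.ball ((0 : ℝ), q₀) c.r → (κ, q') ∈ Metric.ball ((0 : ℝ), q₀) c.r →
    k * ‖q - q'‖ ≤ ‖(S.rel R κ (c.m⁻¹ * (R * σ)) q, (S.φ κ (c.m⁻¹ * (R * σ)) q).2) -
      (S.rel R κ (c.m⁻¹ * (R * σ)) q', (S.φ κ (c.m⁻¹ * (R * σ)) q').2)‖ := by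
  have hm := c.m_pos
  have hk := c.k_pos
  have hR1 := F.one_le_R₀.trans hR
  have hL := c.one_le_L
  have hRL : 0 < R * c.L := by positivity
  set b := min (R * c.L) c.m with hb
  have hb0 : 0 < b := lt_min hRL hm
  refine ⟨b * (1 / 2 * c.k), by positivity, fun κ σ hv q q' hq hq' => ?_⟩
  obtain ⟨h1, h2, -⟩ := hv.flow_eq hR le_rfl hv.le_depth hq
  obtain ⟨h3, h4, -⟩ := hv.flow_eq hR le_rfl hv.le_depth hq'
  have h5 := D.norm_out_sub_ge (c.mem _ hq) (c.mem _ hq') (idx hR1 hv, σ)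
  have h6 := c.lower κ q q' hq hq'
  have e : ∀ (α β : ℝ) (u v u' v' : Eucl n), ((α • u, β • v) : Eucl n × Eucl n) - (α • u', β • v') =
      (α • (u - u'), β • (v - v')) := fun α β u v u' v' => by rw [smul_sub, smul_sub]; rfl
  rw [h1, h2, h3, h4, e]
  set z := (D.out (c.P (κ, q))).1 (idx hR1 hv, σ) - (D.out (c.P (κ, q'))).1 (idx hR1 hv, σ)
  set x := (D.out (c.P (κ, q))).2 (idx hR1 hv, σ) - (D.out (c.P (κ, q'))).2 (idx hR1 hv, σ)
  have h7 : b * ‖(z, x)‖ ≤ ‖((R * c.L) • z, c.m • x)‖ := by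
    rw [Prod.norm_mk, Prod.norm_mk, norm_smul, norm_smul, Real.norm_eq_abs, Real.norm_eq_abs,
      abs_of_pos hm, abs_of_pos hRL, mul_max_of_nonneg _ _ hb0.le]
    exact max_le_max (by gcongr; exact min_le_left _ _) (by gcongr; exact min_le_right _ _)
  refine le_trans ?_ h7
  rw [mul_assoc]
  gcongr
  linarith

theorem mem_ball_prod {κ ρ : ℝ} {q : Eucl n × Eucl n} :
    (κ, q) ∈ Metric.ball ((0 : ℝ), q₀) ρ ↔ |κ| < ρ ∧ q ∈ Metric.ball q₀ ρ := by
  rw [← ball_prod_same, mem_prod, mem_ball_zero_iff, Real.norm_eq_abs]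

/-- The maps for different times and couplings are compositions of bounded linear functionals with
one smooth map into a space of bounded functions. Its derivatives are bounded on a compact set, so
those of all the compositions are bounded by the norms of the functionals. -/
theorem exists_bound_comp (j : ℕ) : ∃ C : ℝ, ∀ (T : BE n K × BE n K →L[ℝ] Eucl n) (κ : ℝ),
    |κ| ≤ c.r / 2 → ContDiffOn ℝ ∞ (fun q => T (D.out (c.P (κ, q)))) (Metric.ball q₀ c.r) ∧
    ∀ q ∈ Metric.ball q₀ (c.r / 2),
      ‖iteratedFDeriv ℝ j (fun q => T (D.out (c.P (κ, q)))) q‖ ≤ ‖T‖ * C := by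
  have hr := c.r_pos
  have hM : ContDiffOn ℝ ∞ (fun w => D.out (c.P w)) (Metric.ball ((0 : ℝ), q₀) c.r) :=
    D.contDiffOn_out.comp c.smooth c.mem
  have hQ : IsCompact (Metric.closedBall (0 : ℝ) (c.r / 2) ×ˢ Metric.closedBall q₀ (c.r / 2)) :=
    (isCompact_closedBall _ _).prod (isCompact_closedBall _ _)
  have hQN : Metric.closedBall (0 : ℝ) (c.r / 2) ×ˢ Metric.closedBall q₀ (c.r / 2) ⊆
      Metric.ball ((0 : ℝ), q₀) c.r := by
    rw [← ball_prod_same]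
    exact prod_mono (Metric.closedBall_subset_ball (by linarith))
      (Metric.closedBall_subset_ball (by linarith))
  obtain ⟨C, hC⟩ := exists_bound_partial_iteratedFDeriv Metric.isOpen_ball hQ hQN j hM
  refine ⟨C, fun T κ hκ => ?_⟩
  have hs : ContDiffOn ℝ ∞ (fun q => D.out (c.P (κ, q))) (Metric.ball q₀ c.r) :=
    hM.comp (f := fun q => (κ, q)) (by fun_prop) fun q hq =>
      mem_ball_prod.2 ⟨by linarith, hq⟩
  refine ⟨T.contDiff.comp_contDiffOn hs, fun q hq => ?_⟩
  have hat : ContDiffAt ℝ ∞ (fun q => D.out (c.P (κ, q))) q :=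
    hs.contDiffAt (Metric.isOpen_ball.mem_nhds (Metric.ball_subset_ball (by linarith) hq))
  have h1 : ‖iteratedFDeriv ℝ j (T ∘ fun q => D.out (c.P (κ, q))) q‖ ≤
      ‖T‖ * ‖iteratedFDeriv ℝ j (fun q => D.out (c.P (κ, q))) q‖ := by
    rw [T.iteratedFDeriv_comp_left hat (i := j) (by exact_mod_cast le_top)]
    exact T.norm_compContinuousMultilinearMap_le _
  refine h1.trans ?_
  gcongr
  exact hC (κ, q) ⟨by rw [mem_closedBall_zero_iff]; exact hκ, Metric.ball_subset_closedBall hq⟩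

/-- Multiples of the evaluation at a point, as continuous linear maps. -/
theorem exists_evalCLM (t : IT n K) {α : ℝ} (hα : 0 ≤ α) : ∃ T₁ T₂ : BE n K × BE n K →L[ℝ] Eucl n,
    ‖T₁‖ ≤ α ∧ ‖T₂‖ ≤ α ∧ ∀ v, T₁ v = α • v.1 t ∧ T₂ v = α • v.2 t := by
  refine ⟨α • (evalCLM ℝ t).comp (ContinuousLinearMap.fst ℝ _ _),
    α • (evalCLM ℝ t).comp (ContinuousLinearMap.snd ℝ _ _), ?_, ?_, fun v => ⟨rfl, rfl⟩⟩
  · refine ContinuousLinearMap.opNorm_le_bound _ hα fun v => ?_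
    show ‖α • v.1 t‖ ≤ _
    rw [norm_smul, Real.norm_eq_abs, abs_of_nonneg hα]
    gcongr
    exact (v.1.norm_coe_le_norm t).trans (norm_fst_le v)
  · refine ContinuousLinearMap.opNorm_le_bound _ hα fun v => ?_
    show ‖α • v.2 t‖ ≤ _
    rw [norm_smul, Real.norm_eq_abs, abs_of_nonneg hα]
    gcongr
    exact (v.2.norm_coe_le_norm t).trans (norm_snd_le v)

/-- Smoothness, and uniform bounds of the derivatives. -/
theorem exists_deriv_bound (hR : F.R₀ ≤ R) (j : ℕ) : ∃ C : ℝ, ∀ κ σ, c.Valid κ σ → |κ| ≤ c.r / 2 →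
    (ContDiffOn ℝ ∞ (fun q => (S.φ κ (c.m⁻¹ * (R * σ)) q).2) (Metric.ball q₀ (c.r / 2)) ∧
      ContDiffOn ℝ ∞ (S.rel R κ (c.m⁻¹ * (R * σ))) (Metric.ball q₀ (c.r / 2))) ∧
    ∀ q ∈ Metric.ball q₀ (c.r / 2),
      ‖iteratedFDeriv ℝ j (fun q => (S.φ κ (c.m⁻¹ * (R * σ)) q).2) q‖ ≤ C ∧
      ‖iteratedFDeriv ℝ j (S.rel R κ (c.m⁻¹ * (R * σ))) q‖ ≤ C := by
  have hr := c.r_pos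
  have hm := c.m_pos
  have hR1 := F.one_le_R₀.trans hR
  have hL := c.one_le_L
  have hRL : 0 < R * c.L := by positivity
  obtain ⟨C, hC⟩ := c.exists_bound_comp j
  refine ⟨max (c.m * |C|) (R * c.L * |C|), fun κ σ hv hκ => ?_⟩
  obtain ⟨T₁, _, hT₁, -, hT₁'⟩ := exists_evalCLM (idx hR1 hv, σ) hRL.le
  obtain ⟨_, T₂, -, hT₂, hT₂'⟩ := exists_evalCLM (idx hR1 hv, σ) hm.le
  obtain ⟨s1, b1⟩ := hC T₁ κ hκ
  obtain ⟨s2, b2⟩ := hC T₂ κ hκ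
  have hsub : Metric.ball q₀ (c.r / 2) ⊆ Metric.ball q₀ c.r := Metric.ball_subset_ball (by linarith)
  have e1 : EqOn (S.rel R κ (c.m⁻¹ * (R * σ)))
      (fun q => T₁ (D.out (c.P (κ, q)))) (Metric.ball q₀ (c.r / 2)) := fun q hq => by
    obtain ⟨-, h2, -⟩ := hv.flow_eq hR le_rfl hv.le_depth
      (mem_ball_prod.2 ⟨by linarith, hsub hq⟩)
    exact h2.trans (hT₁' _).1.symm
  have e2 : EqOn (fun q => (S.φ κ (c.m⁻¹ * (R * σ)) q).2)
      (fun q => T₂ (D.out (c.P (κ, q)))) (Metric.ball q₀ (c.r / 2)) := fun q hq => by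
    obtain ⟨h1, -⟩ := hv.flow_eq hR le_rfl hv.le_depth
      (mem_ball_prod.2 ⟨by linarith, hsub hq⟩)
    exact h1.trans (hT₂' _).2.symm
  refine ⟨⟨(s2.mono hsub).congr e2, (s1.mono hsub).congr e1⟩, fun q hq => ⟨?_, ?_⟩⟩
  · have he : (fun q => (S.φ κ (c.m⁻¹ * (R * σ)) q).2) =ᶠ[𝓝 q] fun q => T₂ (D.out (c.P (κ, q))) :=
      e2.eventuallyEq_of_mem (Metric.isOpen_ball.mem_nhds hq)
    rw [(he.iteratedFDeriv ℝ j).eq_of_nhds]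
    refine (b2 q hq).trans (le_trans ?_ (le_max_left _ _))
    calc _ ≤ ‖T₂‖ * |C| := by gcongr; exact le_abs_self _
      _ ≤ c.m * |C| := by gcongr
  · have he : S.rel R κ (c.m⁻¹ * (R * σ)) =ᶠ[𝓝 q] fun q => T₁ (D.out (c.P (κ, q))) :=
      e1.eventuallyEq_of_mem (Metric.isOpen_ball.mem_nhds hq)
    rw [(he.iteratedFDeriv ℝ j).eq_of_nhds]
    refine (b1 q hq).trans (le_trans ?_ (le_max_right _ _))
    calc _ ≤ ‖T₁‖ * |C| := by gcongr; exact le_abs_self _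
      _ ≤ R * c.L * |C| := by gcongr

theorem eventually_valid (hK : 1 < K) {s : ℝ} (hs : s ≤ -c.L) : ∀ᶠ κ in 𝓝[≥] 0, c.Valid κ s := by
  have hm := c.m_pos
  have h1 : ∀ᶠ κ : ℝ in 𝓝[≥] 0, 4 * (κ * R ^ 2) ≤ c.m ^ 2 := by
    have : Tendsto (fun κ : ℝ => 4 * (κ * R ^ 2)) (𝓝 0) (𝓝 (4 * (0 * R ^ 2))) :=
      Continuous.tendsto (by fun_prop) 0
    rw [zero_mul, mul_zero] at this
    exact (this.mono_left nhdsWithin_le_nhds).eventually_le_const (by positivity)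
  have h2 : ∀ᶠ κ : ℝ in 𝓝[≥] 0, κ * R ^ 2 * s ^ 2 ≤ (K - 1) * c.m ^ 2 := by
    have : Tendsto (fun κ : ℝ => κ * R ^ 2 * s ^ 2) (𝓝 0) (𝓝 (0 * R ^ 2 * s ^ 2)) :=
      Continuous.tendsto (by fun_prop) 0
    rw [zero_mul, zero_mul] at this
    exact (this.mono_left nhdsWithin_le_nhds).eventually_le_const
      (mul_pos (by linarith) (by positivity))
  filter_upwards [h1, h2, self_mem_nhdsWithin] with κ a1 a2 a3
  exact ⟨a3, a1, a2, hs⟩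

/-- Continuity in the coupling constant, at a fixed time. -/
theorem tendsto_rel (hR : F.R₀ ≤ R) (hK : 1 < K) {s : ℝ} (hs : s ≤ -c.L) {q : Eucl n × Eucl n}
    (hq : q ∈ Metric.ball q₀ c.r) :
    Tendsto (fun κ => S.rel R κ (c.m⁻¹ * (R * s)) q) (𝓝[≥] 0)
      (𝓝 (S.rel R 0 (c.m⁻¹ * (R * s)) q)) := by
  have hm := c.m_pos
  have hR1 := F.one_le_R₀.trans hR
  set t := c.m⁻¹ * (R * s) with ht
  have hv := c.eventually_valid hK hs
  have hball : ∀ᶠ κ : ℝ in 𝓝[≥] 0, (κ, q) ∈ Metric.ball ((0 : ℝ), q₀) c.r := by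
    filter_upwards [nhdsWithin_le_nhds (Metric.ball_mem_nhds (0 : ℝ) c.r_pos)] with κ hκ
    exact mem_ball_prod.2 ⟨by simpa using hκ, hq⟩
  have hφ : Tendsto (fun κ => S.φ κ t q) (𝓝[≥] 0) (𝓝 (S.φ 0 t q)) :=
    (((S.contDiff_φ t).continuous.comp (Continuous.prodMk_left q)).tendsto 0).mono_left
      nhdsWithin_le_nhds
  have hη : Tendsto (fun κ => (S.φ κ t q).2) (𝓝[≥] 0) (𝓝 (S.φ 0 t q).2) :=
    (continuous_snd.tendsto _).comp hφ
  set ζ : ℝ → Eucl n := fun κ => S.zeta R κ t (S.φ κ t q).2 with hζ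
  have h0 : (0 : ℝ) ∈ Ici (0 : ℝ) := mem_Ici.2 le_rfl
  obtain ⟨-, -, c0, m0⟩ := (hv.self_of_nhdsWithin h0).flow_eq hR le_rfl hs
    (hball.self_of_nhdsWithin h0)
  change ‖ζ 0 - c.m • c.dir‖ < F.r * c.m at c0
  change S.mom R 0 t (ζ 0) = (S.φ 0 t q).2 at m0
  have hζ0 : ζ 0 ≠ 0 := ((hv.self_of_nhdsWithin h0).mem_of_close c0).1
  have hmom : Tendsto (fun κ => S.mom R κ t (ζ 0)) (𝓝[≥] 0) (𝓝 (S.mom R 0 t (ζ 0))) := by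
    have := ((S.contDiff_φ t).continuous.comp
      (Continuous.prodMk_left (incoming R (ζ 0), ζ 0))).tendsto 0
    exact ((continuous_snd.tendsto _).comp this).mono_left nhdsWithin_le_nhds
  have hnd : ‖c.m • c.dir‖ = c.m := by
    rw [norm_smul, c.norm_dir, Real.norm_eq_abs, abs_of_pos hm, mul_one]
  -- The momentum map at coupling `κ` is close to the identity, so the distance from `ζ κ` to `ζ 0`
  -- is at most twice that of their images, and both images tend to the same momentum.
  have hζt : Tendsto ζ (𝓝[≥] 0) (𝓝 (ζ 0)) := by
    rw [tendsto_iff_norm_sub_tendsto_zero]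
    have hz := ((hη.sub hmom).norm).const_mul 2
    rw [m0, sub_self, norm_zero, mul_zero] at hz
    refine squeeze_zero' (Eventually.of_forall fun _ => norm_nonneg _) ?_ hz
    filter_upwards [hv, hball] with κ a1 a2
    obtain ⟨-, -, c1, m1⟩ := a1.flow_eq hR le_rfl hs a2
    change ‖ζ κ - c.m • c.dir‖ < F.r * c.m at c1
    change S.mom R κ t (ζ κ) = (S.φ κ t q).2 at m1
    have hr2 : F.r * c.m < 2 * F.r * ‖c.m • c.dir‖ := by
      rw [hnd]; nlinarith [mul_pos F.r_pos hm]
    have h1 := F.mom_sub hR a1.nonneg a1.dir_mem (time_nonpos hR1 hs) a1.time_le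
      (c1.trans hr2) (c0.trans hr2)
    rw [← ht, m1] at h1
    have h2 := norm_sub_norm_le (ζ κ - ζ 0) ((S.φ κ t q).2 - S.mom R κ t (ζ 0))
    rw [norm_sub_rev (ζ κ - ζ 0)] at h2
    have := norm_nonneg (ζ κ - ζ 0)
    linarith
  have hlast : Tendsto (fun κ => S.φ κ t (incoming R (ζ κ), ζ κ)) (𝓝[≥] 0)
      (𝓝 (S.φ 0 t (incoming R (ζ 0), ζ 0))) := by
    have h1 := (S.contDiffAt_incoming_flow R 0 t hζ0).continuousAt.tendsto
    exact h1.comp (f := fun κ : ℝ => (κ, t, ζ κ))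
      ((tendsto_id.mono_left nhdsWithin_le_nhds).prodMk_nhds
        (tendsto_const_nhds.prodMk_nhds hζt))
  exact ((continuous_fst.tendsto _).comp hφ).sub ((continuous_fst.tendsto _).comp hlast)

end Chart

end LongRangeFlow

end

noncomputable section

namespace LongRangeFlow

variable {n : ℕ} {a : Eucl n → Matrix (Fin n) (Fin n) ℝ} {V : Eucl n → ℝ} {μ K : ℝ}

/-! ### Rescaling and the limits -/

/-- Turns the large momentum into a small coupling `lam⁻¹ ^ 2` and a long time `lam * t₀`; coupling
times the square of time stays equal to `t₀ ^ 2`. -/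
theorem flow_energy_smul (h : IsLongRange a V μ) {lam : ℝ} (hl : lam ≠ 0) (t₀ : ℝ) (x ξ : Eucl n) :
    flow (energy a V) t₀ (x, lam • ξ) =
      (((sysOf h).φ (lam⁻¹ ^ 2) (lam * t₀) (x, ξ)).1,
        lam • ((sysOf h).φ (lam⁻¹ ^ 2) (lam * t₀) (x, ξ)).2) := by
  rw [← (sysOf h).φ_scale hl, ← sysOf_φ_one h]
  congr 1
  · rw [← mul_pow, mul_inv_cancel₀ hl, one_pow]
  · rw [inv_mul_cancel_left₀ hl]

theorem etaScaled_eq (h : IsLongRange a V μ) {lam : ℝ} (hl : lam ≠ 0) (t₀ : ℝ) (q : Eucl n × Eucl n) :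
    etaScaled a V t₀ lam q = ((sysOf h).φ (lam⁻¹ ^ 2) (lam * t₀) q).2 := by
  rw [etaScaled, etaFlow, flow_energy_smul h hl, inv_smul_smul₀ hl]

theorem mom_smul (h : IsLongRange a V μ) {lam : ℝ} (hl : 0 < lam) (R t₀ : ℝ) (ζ : Eucl n) :
    (sysOf h).mom R 1 t₀ (lam • ζ) = lam • (sysOf h).mom R (lam⁻¹ ^ 2) (lam * t₀) ζ := by
  rw [LRSys.mom, LRSys.mom, incoming_smul hl, sysOf_φ_one, flow_energy_smul h hl.ne']

/-- For large `lam` the momentum lies beyond the cutoff, so the gradient of the phase is the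
position of the reference trajectory with the same final momentum. Uniqueness of its initial
momentum and scaling turn the modified position into `LRSys.rel`. -/
theorem Chart.zScaled_eq (h : IsLongRange a V μ) {F : RefFam (sysOf h) K} {D : DeepFam F} {R : ℝ}
    {q₀ : Eucl n × Eucl n} (c : Chart D R q₀) (hR : F.R₀ ≤ R) {χ : Eucl n → ℝ}
    (hχ : IsCutoff (2 * R) χ) {lam t₀ σ : ℝ} (hl : 0 < lam) (ht : t₀ ≤ 0) (htK : t₀ ^ 2 + 1 ≤ K)
    (hσ : c.m⁻¹ * (R * σ) = lam * t₀) (hv : c.Valid (lam⁻¹ ^ 2) σ)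
    (hlarge : 2 * R + 1 < lam * (3 / 4 * c.m)) {q : Eucl n × Eucl n}
    (hq : (lam⁻¹ ^ 2, q) ∈ Metric.ball ((0 : ℝ), q₀) c.r) :
    zScaled a V 1 R χ t₀ lam q = (sysOf h).rel R (lam⁻¹ ^ 2) (lam * t₀) q := by
  have hm := c.m_pos
  obtain ⟨-, -, h3, h4⟩ := hv.flow_eq hR le_rfl hv.le_depth hq
  have htime := hv.time_le
  rw [hσ] at h3 h4 htime
  rw [zScaled, yFlow, etaFlow, flow_energy_smul h hl.ne', LRSys.rel]
  set η := ((sysOf h).φ (lam⁻¹ ^ 2) (lam * t₀) q).2 with hη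
  set ζ := (sysOf h).zeta R (lam⁻¹ ^ 2) (lam * t₀) η with hζ
  have hadm := hv.mem_of_close h3
  have hmom : (sysOf h).mom R 1 t₀ (lam • ζ) = lam • η := by rw [mom_smul h hl, h4]
  have hadm1 : lam • ζ ∈ admissible 1 R := by
    refine ⟨smul_ne_zero hl.ne' hadm.1, ?_⟩
    rw [norm_smul, Real.norm_eq_abs, abs_of_pos hl, mul_pow, one_mul]
    calc R ^ 2 = lam ^ 2 * (lam⁻¹ ^ 2 * R ^ 2) := by field_simp
      _ ≤ _ := by gcongr; exact hadm.2
  have hηn : 3 / 4 * c.m ≤ ‖η‖ := by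
    have h5 := F.norm_mom_sub_self_le hR hv.nonneg hadm
      (mul_nonpos_of_nonneg_of_nonpos hl.le ht) htime
    rw [h4] at h5
    have h6 := Chart.norm_ge_of_close h3
    have h7 := norm_le_norm_add_norm_sub' ζ η
    rw [norm_sub_rev] at h7
    have h8 : F.r / 8 * ‖ζ‖ ≤ 1 / 8 / 8 * ‖ζ‖ := by gcongr; exact F.r_le
    linarith
  have hbig : 2 * R + 1 < ‖lam • η‖ := by
    rw [norm_smul, Real.norm_eq_abs, abs_of_pos hl]
    exact hlarge.trans_le (by gcongr)
  have hz : zetaInv a V 1 R t₀ (lam • η) = lam • ζ := by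
    rw [← hmom]
    exact zetaInv_unique h F hR ht htK hadm1 (by rw [hmom]; linarith)
  rw [gradient_W h F hR ht htK hχ hbig, hz, incoming_smul hl, sysOf_φ_one, flow_energy_smul h hl.ne']

/-- The scaled time along the high-energy limit is eventually admissible. -/
theorem Chart.eventually_valid_scaled {S : LRSys n} {F : RefFam S K} {D : DeepFam F} {R : ℝ}
    {q₀ : Eucl n × Eucl n} (c : Chart D R q₀) (hR : F.R₀ ≤ R) {t₀ : ℝ} (ht : t₀ < 0)
    (htK : t₀ ^ 2 + 1 ≤ K) : ∀ᶠ lam : ℝ in atTop, 0 < lam ∧ lam⁻¹ ^ 2 < c.r / 2 ∧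
      c.Valid (lam⁻¹ ^ 2) (c.m * (lam * t₀) / R) ∧ 2 * R + 1 < lam * (3 / 4 * c.m) := by
  have hm := c.m_pos
  have hr := c.r_pos
  have hR0 : 0 < R := by linarith [F.one_le_R₀]
  have hε : Tendsto (fun lam : ℝ => lam⁻¹ ^ 2) atTop (𝓝 0) := by
    simpa using (tendsto_inv_atTop_zero (𝕜 := ℝ)).pow 2
  have h1 : ∀ᶠ lam : ℝ in atTop, 4 * (lam⁻¹ ^ 2 * R ^ 2) ≤ c.m ^ 2 := by
    have : Tendsto (fun lam : ℝ => 4 * (lam⁻¹ ^ 2 * R ^ 2)) atTop (𝓝 0) := by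
      simpa using (hε.mul_const (R ^ 2)).const_mul 4
    exact this.eventually_le_const (by positivity)
  have h2 : ∀ᶠ lam : ℝ in atTop, c.m * (lam * t₀) / R ≤ -c.L := by
    have : Tendsto (fun lam : ℝ => c.m * (lam * t₀) / R) atTop atBot :=
      ((tendsto_id.atTop_mul_const_of_neg ht).const_mul_atBot hm).atBot_div_const hR0
    exact this.eventually_le_atBot _
  have h3 : ∀ᶠ lam : ℝ in atTop, 2 * R + 1 < lam * (3 / 4 * c.m) :=
    (tendsto_id.atTop_mul_const (show (0 : ℝ) < 3 / 4 * c.m by positivity)).eventually_gt_atTop _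
  filter_upwards [h1, h2, h3, eventually_gt_atTop 0, hε.eventually_lt_const (by linarith : (0 : ℝ) < c.r / 2)]
    with lam a1 a2 a3 a4 a5
  refine ⟨a4, a5, ⟨by positivity, a1, ?_, a2⟩, a3⟩
  -- The quantity controlling the potential force is independent of `lam`; this is why a finite `K`
  -- covers the whole limit.
  have : lam⁻¹ ^ 2 * R ^ 2 * (c.m * (lam * t₀) / R) ^ 2 = t₀ ^ 2 * c.m ^ 2 := by
    field_simp
  rw [this]
  gcongr
  linarith

/-- The asymptotic momentum. -/
def LRSys.asympMomentum (S : LRSys n) (q : Eucl n × Eucl n) : Eucl n :=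
  limUnder atBot fun t => (S.φ 0 t q).2

/-- The asymptotic relative position. -/
def LRSys.asympPosition (S : LRSys n) (R : ℝ) (q : Eucl n × Eucl n) : Eucl n :=
  limUnder atBot fun t => S.rel R 0 t q

section

variable {S : LRSys n} {F : RefFam S K} {D : DeepFam F} {R : ℝ} {q₀ : Eucl n × Eucl n}

theorem Chart.time_eq (c : Chart D R q₀) (hR : F.R₀ ≤ R) (t : ℝ) :
    c.m⁻¹ * (R * (c.m * t / R)) = t := by
  have hm := c.m_pos
  have hR0 : 0 < R := by linarith [F.one_le_R₀]
  field_simp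

/-- The Cauchy estimate compares time `lam * t₀` with a fixed earlier-reached time `t`, uniformly in
`lam`; at the fixed time the coupling can be sent to 0. The limit is thereby the one along the
geodesic flow, in whose definition neither `t₀` nor `K` occurs. -/
theorem Chart.tendsto_asymp (c : Chart D R q₀) (hR : F.R₀ ≤ R) (hK : 1 < K) {t₀ : ℝ} (ht : t₀ < 0)
    (htK : t₀ ^ 2 + 1 ≤ K) {q : Eucl n × Eucl n} (hq : q ∈ Metric.ball q₀ (c.r / 2)) :
    (Tendsto (fun lam : ℝ => (S.φ (lam⁻¹ ^ 2) (lam * t₀) q).2) atTop (𝓝 (S.asympMomentum q)) ∧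
      Tendsto (fun t => (S.φ 0 t q).2) atBot (𝓝 (S.asympMomentum q))) ∧
    Tendsto (fun lam : ℝ => S.rel R (lam⁻¹ ^ 2) (lam * t₀) q) atTop (𝓝 (S.asympPosition R q)) := by
  have hm := c.m_pos
  have hr := c.r_pos
  have hR0 : 0 < R := by linarith [F.one_le_R₀]
  obtain ⟨C, hC⟩ := c.exists_cauchy hR
  have hqr : q ∈ Metric.ball q₀ c.r := Metric.ball_subset_ball (by linarith) hq
  have hσ : Tendsto (fun t : ℝ => c.m * t / R) atBot atBot :=
    (tendsto_id.const_mul_atBot hm).atBot_div_const hR0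
  have hb : Tendsto (fun t : ℝ => C * (1 - c.m * t / R) ^ (-S.μ)) atBot (𝓝 0) := by
    have h1 : Tendsto (fun t : ℝ => 1 - c.m * t / R) atBot atTop := by
      have := tendsto_atTop_add_const_left atBot (1 : ℝ) (tendsto_neg_atBot_atTop.comp hσ)
      exact this.congr fun t => by simp [sub_eq_add_neg]
    simpa using ((tendsto_rpow_neg_atTop S.μ_pos).comp h1).const_mul C
  have hε : Tendsto (fun lam : ℝ => lam⁻¹ ^ 2) atTop (𝓝[≥] 0) := by
    refine tendsto_nhdsWithin_iff.2 ⟨?_, Eventually.of_forall fun lam => sq_nonneg lam⁻¹⟩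
    simpa using (tendsto_inv_atTop_zero (𝕜 := ℝ)).pow 2
  have hest : ∀ᶠ t : ℝ in atBot, ∀ᶠ lam : ℝ in atTop,
      ‖(S.φ (lam⁻¹ ^ 2) (lam * t₀) q).2 - (S.φ (lam⁻¹ ^ 2) t q).2‖ ≤
        C * (1 - c.m * t / R) ^ (-S.μ) ∧
      ‖S.rel R (lam⁻¹ ^ 2) (lam * t₀) q - S.rel R (lam⁻¹ ^ 2) t q‖ ≤
        C * (1 - c.m * t / R) ^ (-S.μ) := by
    filter_upwards [hσ.eventually_le_atBot (-c.L)] with t h1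
    have h2 : ∀ᶠ lam : ℝ in atTop, lam * t₀ ≤ t :=
      (tendsto_id.atTop_mul_const_of_neg ht).eventually_le_atBot t
    filter_upwards [h2, c.eventually_valid_scaled hR ht htK] with lam a1 ⟨_, a2, a3, _⟩
    have h3 := hC _ _ (c.m * t / R) a3 (by gcongr) h1 q
      (Chart.mem_ball_prod.2 ⟨by rw [abs_of_nonneg (sq_nonneg _)]; linarith, hqr⟩)
    rwa [c.time_eq hR, c.time_eq hR] at h3
  have hg1 : ∀ᶠ t : ℝ in atBot, Tendsto (fun lam : ℝ => (S.φ (lam⁻¹ ^ 2) t q).2) atTop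
      (𝓝 (S.φ 0 t q).2) := Eventually.of_forall fun t => by
    have h1 : Tendsto (fun κ => (S.φ κ t q).2) (𝓝 0) (𝓝 (S.φ 0 t q).2) :=
      (continuous_snd.comp ((S.contDiff_φ t).continuous.comp (Continuous.prodMk_left q))).tendsto 0
    exact h1.comp (hε.mono_right nhdsWithin_le_nhds)
  have hg2 : ∀ᶠ t : ℝ in atBot, Tendsto (fun lam : ℝ => S.rel R (lam⁻¹ ^ 2) t q) atTop
      (𝓝 (S.rel R 0 t q)) := by
    filter_upwards [hσ.eventually_le_atBot (-c.L)] with t h1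
    have h2 := c.tendsto_rel hR hK h1 hqr
    rw [c.time_eq hR] at h2
    exact h2.comp hε
  obtain ⟨l, h1, h2⟩ := exists_limit_of_interchange hb
    (hest.mono fun _ h => h.mono fun _ h => h.1) hg1
  obtain ⟨l', h3, h4⟩ := exists_limit_of_interchange hb
    (hest.mono fun _ h => h.mono fun _ h => h.2) hg2
  have e1 : S.asympMomentum q = l := h2.limUnder_eq
  have e2 : S.asympPosition R q = l' := h4.limUnder_eq
  rw [e1, e2]
  exact ⟨⟨h1, h2⟩, h3⟩

/-- The limits hold with bounds for all derivatives. -/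
theorem Chart.bddConv_asymp (c : Chart D R q₀) (hR : F.R₀ ≤ R) (hK : 1 < K) {t₀ : ℝ} (ht : t₀ < 0)
    (htK : t₀ ^ 2 + 1 ≤ K) {f g : ℝ → Eucl n × Eucl n → Eucl n}
    (hf : ∀ᶠ lam : ℝ in atTop, EqOn (f lam) (fun q => (S.φ (lam⁻¹ ^ 2) (lam * t₀) q).2)
      (Metric.ball q₀ (c.r / 2)))
    (hg : ∀ᶠ lam : ℝ in atTop, EqOn (g lam) (S.rel R (lam⁻¹ ^ 2) (lam * t₀))
      (Metric.ball q₀ (c.r / 2))) :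
    BddConv f S.asympMomentum (Metric.ball q₀ (c.r / 2)) ∧
      BddConv g (S.asympPosition R) (Metric.ball q₀ (c.r / 2)) := by
  have hv := c.eventually_valid_scaled hR ht htK
  have hb : ∀ j, ∃ C : ℝ, ∀ᶠ lam : ℝ in atTop,
      (ContDiffOn ℝ ∞ (f lam) (Metric.ball q₀ (c.r / 2)) ∧
        ContDiffOn ℝ ∞ (g lam) (Metric.ball q₀ (c.r / 2))) ∧
      ∀ q ∈ Metric.ball q₀ (c.r / 2), ‖iteratedFDeriv ℝ j (f lam) q‖ ≤ C ∧
        ‖iteratedFDeriv ℝ j (g lam) q‖ ≤ C := fun j => by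
    obtain ⟨C, hC⟩ := c.exists_deriv_bound hR j
    refine ⟨C, ?_⟩
    filter_upwards [hv, hf, hg] with lam ⟨_, a2, a3, _⟩ b1 b2
    obtain ⟨⟨h1, h2⟩, h3⟩ := hC _ _ a3 (by rw [abs_of_nonneg (sq_nonneg _)]; exact a2.le)
    rw [c.time_eq hR] at h1 h2 h3
    refine ⟨⟨h1.congr b1, h2.congr b2⟩, fun q hq => ?_⟩
    have e1 : f lam =ᶠ[𝓝 q] fun q => (S.φ (lam⁻¹ ^ 2) (lam * t₀) q).2 :=
      b1.eventuallyEq_of_mem (Metric.isOpen_ball.mem_nhds hq)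
    have e2 : g lam =ᶠ[𝓝 q] S.rel R (lam⁻¹ ^ 2) (lam * t₀) :=
      b2.eventuallyEq_of_mem (Metric.isOpen_ball.mem_nhds hq)
    rw [(e1.iteratedFDeriv ℝ j).eq_of_nhds, (e2.iteratedFDeriv ℝ j).eq_of_nhds]
    exact h3 q hq
  obtain ⟨_, hb0⟩ := hb 0
  refine ⟨⟨hb0.mono fun _ h => h.1.1, fun j => ?_, fun q hq => ?_⟩,
    ⟨hb0.mono fun _ h => h.1.2, fun j => ?_, fun q hq => ?_⟩⟩
  · obtain ⟨C, hC⟩ := hb j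
    exact ⟨C, hC.mono fun _ h q hq => (h.2 q hq).1⟩
  · refine (c.tendsto_asymp hR hK ht htK hq).1.1.congr' ?_
    filter_upwards [hf] with lam h using (h hq).symm
  · obtain ⟨C, hC⟩ := hb j
    exact ⟨C, hC.mono fun _ h q hq => (h.2 q hq).2⟩
  · refine (c.tendsto_asymp hR hK ht htK hq).2.congr' ?_
    filter_upwards [hg] with lam h using (h hq).symm

theorem Chart.exists_lower_asymp (c : Chart D R q₀) (hR : F.R₀ ≤ R) (hK : 1 < K) {t₀ : ℝ}
    (ht : t₀ < 0) (htK : t₀ ^ 2 + 1 ≤ K) : ∃ k : ℝ, 0 < k ∧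
    ∀ q ∈ Metric.ball q₀ (c.r / 2), ∀ q' ∈ Metric.ball q₀ (c.r / 2),
      k * ‖q - q'‖ ≤ ‖(S.asympPosition R q, S.asympMomentum q) -
        (S.asympPosition R q', S.asympMomentum q')‖ := by
  have hr := c.r_pos
  obtain ⟨k, hk, h⟩ := c.exists_lower hR
  refine ⟨k, hk, fun q hq q' hq' => ?_⟩
  obtain ⟨⟨h1, -⟩, h2⟩ := c.tendsto_asymp hR hK ht htK hq
  obtain ⟨⟨h3, -⟩, h4⟩ := c.tendsto_asymp hR hK ht htK hq'
  refine ge_of_tendsto ((h2.prodMk_nhds h1).sub (h4.prodMk_nhds h3)).norm ?_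
  filter_upwards [c.eventually_valid_scaled hR ht htK] with lam ⟨_, a2, a3, _⟩
  have hlt : |lam⁻¹ ^ 2| < c.r := by rw [abs_of_nonneg (sq_nonneg _)]; linarith
  have hsub : Metric.ball q₀ (c.r / 2) ⊆ Metric.ball q₀ c.r := Metric.ball_subset_ball (by linarith)
  have := h _ _ a3 q q' (Chart.mem_ball_prod.2 ⟨hlt, hsub hq⟩)
    (Chart.mem_ball_prod.2 ⟨hlt, hsub hq'⟩)
  rwa [c.time_eq hR] at this

end

end LongRangeFlow

end

theorem proposition2p12 {n : ℕ} (a : LongRangeFlow.Eucl n → Matrix (Fin n) (Fin n) ℝ)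
    (V : LongRangeFlow.Eucl n → ℝ) (μ : ℝ) (hA : LongRangeFlow.IsLongRange a V μ) :
    ∃ (ξm : LongRangeFlow.Eucl n × LongRangeFlow.Eucl n → LongRangeFlow.Eucl n)
      (zm : ℝ → LongRangeFlow.Eucl n × LongRangeFlow.Eucl n → LongRangeFlow.Eucl n),
      ∀ T : ℝ, 0 < T →
        ∃ R₀ c₀ c₄ : ℝ, 0 < R₀ ∧ 0 < c₀ ∧ 0 < c₄ ∧ ∀ R : ℝ, R₀ ≤ R →
          -- the inverse `ζ(t, ·)` entering the phase `W` is well defined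
          (∀ t ∈ Icc (-T) 0,
            InjOn (LongRangeFlow.Lam a V R t) {ζ | c₀ * R ≤ ‖ζ‖} ∧
            {ξ | c₄ * R ≤ ‖ξ‖} ⊆ LongRangeFlow.Lam a V R t '' {ζ | c₀ * R ≤ ‖ζ‖}) ∧
          ∀ χ : LongRangeFlow.Eucl n → ℝ, LongRangeFlow.IsCutoff (c₄ * R) χ →
            ∀ q₀ : LongRangeFlow.Eucl n × LongRangeFlow.Eucl n,
              LongRangeFlow.BackwardNontrapping a q₀ →
              ∃ U : Set (LongRangeFlow.Eucl n × LongRangeFlow.Eucl n), IsOpen U ∧ q₀ ∈ U ∧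
                (∀ t₀ ∈ Ico (-T) 0,
                  (∀ q ∈ U,
                    Tendsto (fun lam => LongRangeFlow.etaScaled a V t₀ lam q)
                      atTop (𝓝 (ξm q)) ∧
                    Tendsto (fun lam => LongRangeFlow.zScaled a V c₀ R χ t₀ lam q)
                      atTop (𝓝 (zm R q))) ∧
                  LongRangeFlow.TendstoWithDerivs (LongRangeFlow.etaScaled a V t₀) ξm U ∧
                  LongRangeFlow.TendstoWithDerivs
                    (LongRangeFlow.zScaled a V c₀ R χ t₀) (zm R) U) ∧
                -- `ξ₋` is the asymptotic momentum of the geodesic flow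
                (∀ q ∈ U, Tendsto
                  (fun t => (LongRangeFlow.flow (LongRangeFlow.kinetic a) t q).2)
                  atBot (𝓝 (ξm q))) ∧
                IsLocalDiffeomorphOn
                  𝓘(ℝ, LongRangeFlow.Eucl n × LongRangeFlow.Eucl n)
                  𝓘(ℝ, LongRangeFlow.Eucl n × LongRangeFlow.Eucl n) ∞
                  (fun q => (zm R q, ξm q)) U := by
  refine ⟨(LongRangeFlow.sysOf hA).asympMomentum, fun R => (LongRangeFlow.sysOf hA).asympPosition R,
    fun T hT => ?_⟩
  have hK : 1 < T ^ 2 + 1 := by linarith [pow_pos hT 2]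
  have htime : ∀ t ∈ Icc (-T) 0, t ^ 2 + 1 ≤ T ^ 2 + 1 := fun t ht => by
    nlinarith [ht.1, ht.2]
  obtain ⟨F⟩ := LongRangeFlow.exists_refFam (LongRangeFlow.sysOf hA) (T ^ 2 + 1)
  obtain ⟨D⟩ := LongRangeFlow.exists_deepFam F
  -- Only the reference and relative families, built with `K = T ^ 2 + 1`, depend on `T`. The
  -- constants `c₀ = 1` and `c₄ = 2` are those for which admissibility and `exists_mom_eq` apply at
  -- coupling 1.
  refine ⟨F.R₀, 1, 2, by linarith [F.one_le_R₀], one_pos, two_pos, fun R hR => ⟨fun t ht => ?_,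
    fun χ hχ q₀ hq₀ => ?_⟩⟩
  · have hR0 : 0 < R := by linarith [F.one_le_R₀]
    rw [LongRangeFlow.Lam_eq_mom hA, LongRangeFlow.setOf_le_norm_eq hR0]
    have ht1 : 1 * t ^ 2 + 1 ≤ T ^ 2 + 1 := by linarith [htime t ht]
    refine ⟨F.mom_injOn hR zero_le_one ht.2 ht1, fun ξ hξ => ?_⟩
    have hξ' : 2 * R ≤ ‖ξ‖ := hξ
    obtain ⟨ζ, h1, h2, -⟩ := F.exists_mom_eq hR zero_le_one ht.2 ht1 (ξ := ξ)
      (norm_pos_iff.1 (by linarith)) (by nlinarith)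
    exact ⟨ζ, h1, h2⟩
  · obtain ⟨c⟩ := hq₀.exists_chart hA D hK.le hR
    have hr := c.r_pos
    have hball : Convex ℝ (Metric.ball q₀ (c.r / 2)) := convex_ball _ _
    have hconv : ∀ t₀ ∈ Ico (-T) 0,
        LongRangeFlow.BddConv (LongRangeFlow.etaScaled a V t₀)
          (LongRangeFlow.sysOf hA).asympMomentum (Metric.ball q₀ (c.r / 2)) ∧
        LongRangeFlow.BddConv (LongRangeFlow.zScaled a V 1 R χ t₀)
          ((LongRangeFlow.sysOf hA).asympPosition R) (Metric.ball q₀ (c.r / 2)) := fun t₀ ht => by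
      have htK := htime t₀ ⟨ht.1, ht.2.le⟩
      have hv := c.eventually_valid_scaled hR ht.2 htK
      refine c.bddConv_asymp hR hK ht.2 htK ?_ ?_
      · filter_upwards [hv] with lam h q _
        exact LongRangeFlow.etaScaled_eq hA h.1.ne' t₀ q
      · filter_upwards [hv] with lam h q hq
        refine c.zScaled_eq hA hR hχ h.1 ht.2.le htK (c.time_eq hR _) h.2.2.1 h.2.2.2
          (LongRangeFlow.Chart.mem_ball_prod.2
            ⟨by rw [abs_of_nonneg (sq_nonneg _)]; linarith [h.2.1], ?_⟩)
        exact Metric.ball_subset_ball (by linarith) hq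
    -- The claims that do not involve `t₀` are deduced from the single time `-T`.
    have hT' : -T ∈ Ico (-T) 0 := ⟨le_rfl, by linarith⟩
    have htK := htime (-T) ⟨le_rfl, by linarith⟩
    have hder : ∀ t₀ ∈ Ico (-T) 0, _ ∧ _ := fun t₀ ht =>
      ⟨(hconv t₀ ht).1.tendstoWithDerivs Metric.isOpen_ball hball Metric.isBounded_ball,
        (hconv t₀ ht).2.tendstoWithDerivs Metric.isOpen_ball hball Metric.isBounded_ball⟩
    refine ⟨Metric.ball q₀ (c.r / 2), Metric.isOpen_ball, Metric.mem_ball_self (by positivity),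
      fun t₀ ht => ⟨fun q hq => ⟨(hconv t₀ ht).1.tendsto q hq, (hconv t₀ ht).2.tendsto q hq⟩,
        hder t₀ ht⟩, fun q hq => ?_, ?_⟩
    · have h1 := (c.tendsto_asymp hR hK hT'.2 htK hq).1.2
      exact h1.congr fun t => by rw [LongRangeFlow.sysOf_φ_zero hA]
    · obtain ⟨k, hk, hlow⟩ := c.exists_lower_asymp hR hK hT'.2 htK
      exact LongRangeFlow.isLocalDiffeomorphOn_of_lower_bound Metric.isOpen_ball
        ((hder (-T) hT').2.1.prodMk (hder (-T) hT').1.1) hk hlow
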